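/- Let $N\ge 1$, $s\in(0,\frac2N)$, $\tilde s\ge 0$ with $\tilde s<\frac{2}{N-2}$ if $N\ge 3$, and let $\lambda\in L^\infty(\mathbb R^N,\mathbb R)$. Let $\eta\in L^2(\mathbb R^N)\cap C^2(\mathbb R^N)$ be positive, spherically symmetric, with $-\Delta\eta+\eta-\eta^{2s+1}=0$, and put $m=\frac12\int\eta^2\,dx$. For $\sigma=(a,v,\gamma,\mu)\in\mathbb R^N\times\mathbb R^N\times\mathbb R\times\mathbb R^+$ let $$(T_\sigma u)(x)=e^{i(\frac12 v\cdot(x-a)+\gamma)}\mu^{\frac1{2s}}u(\sqrt\mu(x-a)),\qquad \eta_\sigma=T_\sigma\eta,$$ and let $\mathcal T_{\eta_\sigma}$ be the real span of $-\partial_{x_j}\eta_\sigma$, $ix_j\eta_\sigma$ $(1\le j\le N)$, $i\eta_\sigma$ and $(\frac1{2s}+\frac12x\cdot\partial_x)\eta_\sigma$. Let $\omega(u,z)=\mathrm{Im}\int u\bar z\,dx$. Let $I\subset\mathbb R^+$ be bounded with closure contained in $\mathbb R^+=(0,\infty)$, let $I_0\subset I\setminus\partial I$, and for $\delta>0$ let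 $$U_\delta=\{\psi\in H^1(\mathbb R^N,\mathbb C):\ \inf\{\|\psi-\eta_\sigma\|_{H^1}:\ \sigma\in\mathbb R^N\times\mathbb R^N\times[0,2\pi)\times I_0\}\le\delta\}.$$ For $\epsilon\ge0$, $\mu>0$ and $b\in\mathbb R^N$ let $$V_{eff,\mu}(b)=\frac{\epsilon\mu^{\tilde s/s}}{(2+2\tilde s)\,m}\int\lambda\Big(\frac{b+x}{\sqrt\mu}\Big)\eta^{2\tilde s+2}(x)\,dx,\qquad B_{eff,\mu}(b)=\frac{\epsilon\mu^{\tilde s/s}}{(2+2\tilde s)\,m}\nabla_b\cdot\int\lambda\Big(\frac{b+x}{\sqrt\mu}\Big)\eta^{2\tilde s+2}(x)\,x\,dx .$$ Then $V_{eff,\mu}$ and the vector field $b\mapsto\int\lambda(\frac{b+x}{\sqrt\mu})\eta^{2\tilde s+2}(x)\,x\,dx$ are differentiable on $\mathbb R^N$, and there are constants $c\in(0,1)$ and $C>0$, depending only on $N,s,\tilde s,\lambda,\eta,I,I_0$, such that the following holds for all $\epsilon\in[0,1)$, $T>0$ and $\delta>0$. Let $\psi\in C([0,T],H^1)$ solve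 $i\partial_t\psi=-\Delta\psi-|\psi|^{2s}\psi+\epsilon\lambda(x)|\psi|^{2\tilde s}\psi$ in $H^{-1}$ on $[0,T]$, with $\psi(t)\in U_\delta$ for all $t\in[0,T]$. Let $\sigma(t)=(a(t),v(t),\gamma(t),\mu(t))$, $t\in[0,T]$, be a differentiable path in $\mathbb R^N\times\mathbb R^N\times\mathbb R\times I$ and let $w(t)\in H^1$ be such that, for all $t\in[0,T]$, $$\psi(t)=T_{\sigma(t)}(\eta+w(t)),\qquad \omega(\psi(t)-\eta_{\sigma(t)},z)=0\quad\text{for all }z\in\mathcal T_{\eta_{\sigma(t)}}.$$ Then at every $t\in[0,T]$ with $\|w(t)\|_{H^1}<c$, $$\begin{aligned}\partial_ta&=v+R_1,\\ \partial_tv&=-2\sqrt\mu\,(\nabla V_{eff,\mu})(\sqrt\mu\,a)+R_2,\\ \partial_t\gamma&=\mu+\tfrac12\,\partial_ta\cdot v-\tfrac14|v|^2-\tfrac{2-Ns+2\tilde s}{2-Ns}V_{eff,\mu}(\sqrt\mu\,a)+\tfrac{s}{2-Ns}B_{eff,\mu}(\sqrt\mu\,a)+R_3,\\ \partial_t\mu&=R_4,\end{aligned}$$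 where $|R_j|\le C\,(\epsilon\|w(t)\|_{H^1}+\|w(t)\|_{H^1}^2)$ for $j=1,2,3,4$. -/

import Mathlib

open MeasureTheory Set Laplacian
open scoped ContDiff ENNReal ComplexConjugate

noncomputable section

/-- Configuration space `ℝ^N`. -/
abbrev Space (N : ℕ) : Type := EuclideanSpace ℝ (Fin N)

/-- The `i`-th standard basis vector of `ℝ^N`. -/
def stdVec {N : ℕ} (i : Fin N) : Space N := EuclideanSpace.single i 1

/-- The classical partial derivative `∂_{x_i} u (x)`. -/
def partialDeriv {N : ℕ} {F : Type*} [NormedAddCommGroup F] [NormedSpace ℝ F]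
    (i : Fin N) (u : Space N → F) (x : Space N) : F :=
  fderiv ℝ u x (stdVec i)

/-- `G` is the weak (distributional) partial derivative `∂_{x_i} u`, tested against all real
smooth compactly supported functions. -/
def IsWeakPartial {N : ℕ} (i : Fin N) (u G : Space N → ℂ) : Prop :=
  ∀ φ : Space N → ℝ, ContDiff ℝ ∞ φ → HasCompactSupport φ →
    ∫ x, ((partialDeriv i φ x : ℝ) : ℂ) * u x = -∫ x, ((φ x : ℝ) : ℂ) * G x

/-- Elements of `L²(ℝ^N, ℂ)^{N+1}`, with the Hilbert norm. -/
abbrev L2Tuple (N : ℕ) : Type :=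
  PiLp 2 (fun _ : Fin (N + 1) => Lp ℂ 2 (volume : Measure (Space N)))

lemma integrable_real_mul_L2 {N : ℕ} (φ : Space N → ℝ) (hφ : Continuous φ)
    (hc : HasCompactSupport φ) (f : Lp ℂ 2 (volume : Measure (Space N))) :
    Integrable (fun x => ((φ x : ℝ) : ℂ) * f x) volume := by
  have h1 : MemLp (fun x => ((φ x : ℝ) : ℂ)) 2 (volume : Measure (Space N)) :=
    (Complex.continuous_ofReal.comp hφ).memLp_of_hasCompactSupport
      (hc.comp_left (g := fun r : ℝ => (r : ℂ)) Complex.ofReal_zero)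
  exact h1.integrable_mul (Lp.memLp f)

lemma continuous_partialDeriv {N : ℕ} (i : Fin N) (φ : Space N → ℝ) (hφ : ContDiff ℝ ∞ φ) :
    Continuous (partialDeriv i φ) :=
  (hφ.continuous_fderiv (by simp)).clm_apply continuous_const

lemma hasCompactSupport_partialDeriv {N : ℕ} (i : Fin N) (φ : Space N → ℝ)
    (hc : HasCompactSupport φ) : HasCompactSupport (partialDeriv i φ) :=
  hc.fderiv_apply ℝ (stdVec i)

/-- The Sobolev space `H¹(ℝ^N, ℂ)`: an element is the tuple `(u, ∂₁u, …, ∂_N u)` of `u ∈ L²` and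
its weak partial derivatives in `L²` (which `u` determines). The norm is the inherited one,
`‖u‖²_{H¹} = ‖u‖²_{L²} + ∑ᵢ ‖∂ᵢu‖²_{L²}`. -/
def H1 (N : ℕ) : Submodule ℂ (L2Tuple N) where
  carrier := {f | ∀ i : Fin N, IsWeakPartial i (f 0) (f i.succ)}
  zero_mem' := by
    intro i φ hφ hc
    have h : ∀ j : Fin (N + 1), ((0 : L2Tuple N) j : Space N → ℂ) =ᵐ[volume] 0 := fun j =>
      Lp.coeFn_zero ℂ 2 volume
    have key : ∀ (j : Fin (N + 1)) (k : Space N → ℂ),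
        ∫ x, k x * (0 : L2Tuple N) j x = 0 := fun j k =>
      integral_eq_zero_of_ae (by filter_upwards [h j] with x hx; rw [hx]; simp)
    rw [key, key, neg_zero]
  add_mem' := by
    intro f g hf hg i φ hφ hc
    have h : ∀ j : Fin (N + 1), ((f + g) j : Space N → ℂ) =ᵐ[volume] fun x => f j x + g j x :=
      fun j => Lp.coeFn_add (f j) (g j)
    have key : ∀ (j : Fin (N + 1)) (k : Space N → ℝ), Continuous k → HasCompactSupport k →
        ∫ x, ((k x : ℝ) : ℂ) * (f + g) j x
          = (∫ x, ((k x : ℝ) : ℂ) * f j x) + ∫ x, ((k x : ℝ) : ℂ) * g j x := by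
      intro j k hk hkc
      rw [← integral_add (integrable_real_mul_L2 k hk hkc _) (integrable_real_mul_L2 k hk hkc _)]
      exact integral_congr_ae (by filter_upwards [h j] with x hx; rw [hx]; ring)
    rw [key 0 _ (continuous_partialDeriv i φ hφ) (hasCompactSupport_partialDeriv i φ hc),
      key i.succ _ hφ.continuous hc, hf i φ hφ hc, hg i φ hφ hc]
    ring
  smul_mem' := by
    intro c f hf i φ hφ hc
    have h : ∀ j : Fin (N + 1), ((c • f) j : Space N → ℂ) =ᵐ[volume] fun x => c * f j x :=
      fun j => Lp.coeFn_smul c (f j)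
    have key : ∀ (j : Fin (N + 1)) (k : Space N → ℝ),
        ∫ x, ((k x : ℝ) : ℂ) * (c • f) j x = c * ∫ x, ((k x : ℝ) : ℂ) * f j x := by
      intro j k
      rw [← integral_const_mul]
      exact integral_congr_ae (by filter_upwards [h j] with x hx; rw [hx]; ring)
    rw [key, key, hf i φ hφ hc]
    ring

/-- The function underlying an element of `H¹`. -/
def h1Fn {N : ℕ} (u : H1 N) : Space N → ℂ := (u : L2Tuple N) 0

/-- The weak partial derivative `∂ᵢu` of an element `u` of `H¹`. -/
def h1Grad {N : ℕ} (u : H1 N) (i : Fin N) : Space N → ℂ := (u : L2Tuple N) i.succ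

/-- The power nonlinearity `|z|^{2p} z`. -/
def powNL (p : ℝ) (z : ℂ) : ℂ := ((‖z‖ ^ (2 * p) : ℝ) : ℂ) * z

/-- `ψ` is a solution on `[0,T]` of
`i ∂_t ψ = -Δψ - |ψ|^{2s} ψ + ε λ(x) |ψ|^{2s'} ψ`:
`ψ` is continuous into `H¹` and the equation holds in `H⁻¹`, the dual of `H¹`, that is, after
pairing with an arbitrary `φ ∈ H¹`. -/
def IsNLSSolution {N : ℕ} (s s' ε : ℝ) (lam : Space N → ℝ) (T : ℝ) (ψ : ℝ → H1 N) : Prop :=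
  ContinuousOn ψ (Icc 0 T) ∧
  ∀ φ : H1 N, ∀ t ∈ Icc 0 T,
    HasDerivWithinAt (fun τ => ∫ x, h1Fn (ψ τ) x * conj (h1Fn φ x))
      (-Complex.I * ((∑ i, ∫ x, h1Grad (ψ t) i x * conj (h1Grad φ i x))
        - (∫ x, powNL s (h1Fn (ψ t) x) * conj (h1Fn φ x))
        + (ε : ℂ) * ∫ x, ((lam x : ℝ) : ℂ) * powNL s' (h1Fn (ψ t) x) * conj (h1Fn φ x)))
      (Icc 0 T) t

/-- `η ∈ L² ∩ C²` is positive, spherically symmetric, and solves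
`(-Δ + 1) η - η^{2s+1} = 0`. -/
structure IsSolitonProfile {N : ℕ} (s : ℝ) (η : Space N → ℝ) : Prop where
  contDiff : ContDiff ℝ 2 η
  memLp : MemLp η 2 volume
  pos : ∀ x, 0 < η x
  radial : ∀ x y, ‖x‖ = ‖y‖ → η x = η y
  equation : ∀ x, -(Δ η x) + η x - η x ^ (2 * s + 1) = 0

/-- The modulation parameters `σ = (a, v, γ, μ)`: position, velocity, phase, scale. -/
structure Param (N : ℕ) where
  a : Space N
  v : Space N
  γ : ℝ
  μ : ℝ

/-- The combined transformation
`(T_σ u)(x) = e^{i(v·(x-a)/2 + γ)} μ^{1/(2s)} u(√μ (x-a))`. -/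
def transf {N : ℕ} (s : ℝ) (σ : Param N) (u : Space N → ℂ) : Space N → ℂ := fun x =>
  Complex.exp (Complex.I * (((1 / 2) * inner ℝ σ.v (x - σ.a) + σ.γ : ℝ) : ℂ))
    * ((σ.μ ^ (1 / (2 * s)) : ℝ) : ℂ) * u (Real.sqrt σ.μ • (x - σ.a))

/-- The soliton `η_σ = T_σ η`. -/
def soliton {N : ℕ} (s : ℝ) (η : Space N → ℝ) (σ : Param N) : Space N → ℂ :=
  transf s σ (fun x => ((η x : ℝ) : ℂ))

/-- The part of the soliton manifold with `γ ∈ [0, 2π)` and `μ ∈ I₀`, as a subset of `H¹`. -/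
def solitonManifold {N : ℕ} (s : ℝ) (η : Space N → ℝ) (I₀ : Set ℝ) : Set (H1 N) :=
  {z | ∃ σ : Param N, σ.γ ∈ Ico 0 (2 * Real.pi) ∧ σ.μ ∈ I₀ ∧ h1Fn z =ᵐ[volume] soliton s η σ}

/-- The tubular neighbourhood `U_δ = {ψ ∈ H¹ : inf_σ ‖ψ - η_σ‖_{H¹} ≤ δ}`. -/
def tube {N : ℕ} (s : ℝ) (η : Space N → ℝ) (I₀ : Set ℝ) (δ : ℝ) : Set (H1 N) :=
  {ψ | Metric.infEDist ψ (solitonManifold s η I₀) ≤ ENNReal.ofReal δ}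

/-- Labels of the `2N+2` generators of translations, boosts, gauge changes and dilations. -/
inductive Gen (N : ℕ) : Type
  | translation (i : Fin N)
  | boost (i : Fin N)
  | gauge
  | scaling

/-- The generators `-∂_{x_i}`, `i x_i`, `i` and `1/(2s) + (1/2) x·∂_x`. -/
def Gen.act {N : ℕ} (s : ℝ) : Gen N → (Space N → ℂ) → Space N → ℂ
  | .translation i, u => fun x => -partialDeriv i u x
  | .boost i, u => fun x => Complex.I * ((x i : ℝ) : ℂ) * u x
  | .gauge, u => fun x => Complex.I * u x
  | .scaling, u => fun x => ((1 / (2 * s) : ℝ) : ℂ) * u x + (1 / 2 : ℂ) * fderiv ℝ u x x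

/-- The tangent space to the soliton manifold at `η_σ`, the real span of the generators applied
to `η_σ`. -/
def tangentSpaceAt {N : ℕ} (s : ℝ) (η : Space N → ℝ) (σ : Param N) :
    Submodule ℝ (Space N → ℂ) :=
  Submodule.span ℝ (Set.range fun e : Gen N => e.act s (soliton s η σ))

/-- The symplectic form `ω(u, v) = Im ∫ u v̄`. -/
def symp {N : ℕ} (u v : Space N → ℂ) : ℝ := (∫ x, u x * conj (v x)).im

/-- The decomposition `ψ = T_σ (η + w)` with `w' = ψ - η_σ` skew-orthogonal to the tangent space
of the soliton manifold at `η_σ`. -/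
def IsSkewDecomp {N : ℕ} (s : ℝ) (η : Space N → ℝ) (ψ : H1 N) (σ : Param N) (w : H1 N) : Prop :=
  h1Fn ψ =ᵐ[volume] transf s σ (fun x => ((η x : ℝ) : ℂ) + h1Fn w x) ∧
  ∀ z ∈ tangentSpaceAt s η σ, symp (fun x => h1Fn ψ x - soliton s η σ x) z = 0

/-- The mass `m = (1/2) ∫ η²`. -/
def profileMass {N : ℕ} (η : Space N → ℝ) : ℝ := (1 / 2) * ∫ x, η x ^ 2

/-- The prefactor `ε μ^{s'/s} / ((2 + 2s') m)`. -/
def effPrefactor {N : ℕ} (s s' ε : ℝ) (η : Space N → ℝ) (μ : ℝ) : ℝ :=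
  ε * μ ^ (s' / s) / ((2 + 2 * s') * profileMass η)

/-- The effective potential
`V_{eff,μ}(b) = ε μ^{s'/s} / ((2 + 2s') m) ∫ λ((b + x)/√μ) η^{2s'+2}(x) dx`. -/
def Veff {N : ℕ} (s s' ε : ℝ) (lam η : Space N → ℝ) (μ : ℝ) (b : Space N) : ℝ :=
  effPrefactor s s' ε η μ *
    ∫ x, lam ((Real.sqrt μ)⁻¹ • (b + x)) * η x ^ (2 * s' + 2)

/-- The vector field `b ↦ ∫ λ((b + x)/√μ) η^{2s'+2}(x) x dx`. -/
def effField {N : ℕ} (s' : ℝ) (lam η : Space N → ℝ) (μ : ℝ) (b : Space N) : Space N :=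
  ∫ x, (lam ((Real.sqrt μ)⁻¹ • (b + x)) * η x ^ (2 * s' + 2)) • x

/-- The divergence `∑ᵢ ∂_{b_i} Fᵢ`. -/
def divergenceAt {N : ℕ} (F : Space N → Space N) (b : Space N) : ℝ :=
  ∑ i, (partialDeriv i F b) i

/-- `B_{eff,μ}(b) = ε μ^{s'/s} / ((2 + 2s') m) ∇_b · ∫ λ((b + x)/√μ) η^{2s'+2}(x) x dx`. -/
def Beff {N : ℕ} (s s' ε : ℝ) (lam η : Space N → ℝ) (μ : ℝ) (b : Space N) : ℝ :=
  effPrefactor s s' ε η μ * divergenceAt (effField s' lam η μ) b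

end

/-! Let `Z` be one of the generators applied to `η`. Skew-orthogonality gives `ω(ψ, T_σ Z) = ω(η_σ,
T_σ Z) = μ^(1/s - N/2) ω(η, Z)` (`IsSkewDecomp.symp_eq`), an explicit function of `μ` alone. Its
time derivative is also computable from the equation: `Z` and its first derivatives decay
exponentially, so the pairing is differentiable although the equation for `ψ` holds only in `H⁻¹`
(`hasDerivWithinAt_integral_mul_conj`). In the moving frame (`hasDerivWithinAt_pairing`) the
derivative consists of the energy gradient at `η + w` tested on `Z`, the force of the potential, and
the pairing of `η + w` with `modGen`. The parameters `A`, `B`, `Γ`, `M` of `modGen` are rescaled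
differences between the velocities of `a`, `v`, `γ`, `μ` and those of a free soliton.

In the energy term the profile equation removes the part independent of `w`. The part linear in `w`
pairs `w` with the Hessian of the energy at `Z`. The Hessian sends each generator mode to zero or to
`i` times another generator mode, so skew-orthogonality annihilates it and only a quadratic
remainder survives (`SolitonMode.energy_identity`). In the force term, replacing `η + w` by `η`
costs `O(ε‖w‖)`, and what is left is expressed through `Veff` and `Beff`
(`DecayProfile.translation_force`, `DecayProfile.scaling_force`). In the third term the `w` part is
bounded by the size `X` of the velocities times `‖w‖`. The `η` part is the matrix of `ω` on the
tangent space, which couples translations with boosts (entry `m`) and gauge with scaling (entry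
`(1/s - N/2) m`). It is invertible because `s < 2/N`.

The outcome is a linear system for the velocities with error `D = X‖w‖ + ‖w‖² + ε‖w‖`. The system
bounds `X` itself by a multiple of `D + ε`, so for small `‖w‖` the term `X‖w‖` can be absorbed and
`D` is `O(ε‖w‖ + ‖w‖²)` (`le_of_absorption`, `modulation_bounds`).

Two analytic inputs support this. The profile is only assumed to lie in `L² ∩ C²`; its radial
equation yields exponential decay and the domination of its first and second derivatives by `η`
itself (`IsSolitonProfile.estimates`). The nonlinear terms in `w` always appear against
exponentially decaying weights, so a weighted subcritical Sobolev embedding is enough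
(`exists_weighted_sobolev`). -/

open Filter Topology

/-! ### Calculus of exponentially decaying functions. -/

/-- `f` decays exponentially at infinity. -/
def ExpDecay {N : ℕ} {F : Type*} [NormedAddCommGroup F] (f : Space N → F) : Prop :=
  ∃ C κ : ℝ, 0 ≤ C ∧ 0 < κ ∧ ∀ x, ‖f x‖ ≤ C * Real.exp (-κ * ‖x‖)

/-- Continuously differentiable functions which decay exponentially with their derivative. -/
structure DecayC1 {N : ℕ} {F : Type*} [NormedAddCommGroup F] [NormedSpace ℝ F]
    (f : Space N → F) : Prop where
  contDiff : ContDiff ℝ 1 f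
  decay : ExpDecay f
  decay_fderiv : ExpDecay (fderiv ℝ f)

section Decay

variable {N : ℕ} {F G : Type*} [NormedAddCommGroup F] [NormedAddCommGroup G]

/-- One term of the exponential series at `κ (1 + t)` already dominates the power; this explains the
factorial and the factor `exp κ`. -/
lemma one_add_pow_mul_exp_le (n : ℕ) {κ : ℝ} (hκ : 0 < κ) {t : ℝ} (ht : 0 ≤ t) :
    (1 + t) ^ n * Real.exp (-κ * t) ≤ n.factorial * Real.exp κ / κ ^ n := by
  have h := Real.pow_div_factorial_le_exp (x := κ * (1 + t)) (by positivity) n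
  have hf : (0 : ℝ) < n.factorial := by exact_mod_cast n.factorial_pos
  rw [div_le_iff₀ hf, mul_pow] at h
  have e : Real.exp (κ * (1 + t)) = Real.exp κ * Real.exp (κ * t) := by
    rw [← Real.exp_add]; ring_nf
  rw [neg_mul, Real.exp_neg, le_div_iff₀ (by positivity), mul_assoc, mul_comm _ (κ ^ n),
    mul_left_comm, ← mul_assoc]
  rw [e] at h
  rw [← div_eq_mul_inv, div_le_iff₀ (Real.exp_pos _)]
  nlinarith

lemma ExpDecay.mono {f : Space N → F} {g : Space N → G} (hg : ExpDecay g) (K : ℝ)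
    (h : ∀ x, ‖f x‖ ≤ K * ‖g x‖) : ExpDecay f := by
  obtain ⟨C, κ, hC, hκ, hb⟩ := hg
  refine ⟨|K| * C, κ, by positivity, hκ, fun x => (h x).trans ?_⟩
  calc K * ‖g x‖ ≤ |K| * ‖g x‖ := by gcongr; exact le_abs_self K
    _ ≤ |K| * (C * Real.exp (-κ * ‖x‖)) := by gcongr; exact hb x
    _ = _ := by ring

lemma ExpDecay.poly {f : Space N → F} {g : Space N → G} (hg : ExpDecay g) (K : ℝ) (n : ℕ)
    (h : ∀ x, ‖f x‖ ≤ K * (1 + ‖x‖) ^ n * ‖g x‖) : ExpDecay f := by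
  obtain ⟨C, κ, hC, hκ, hb⟩ := hg
  -- Half of the decay rate pays for the polynomial, the other half is kept as the new rate.
  refine ⟨|K| * C * (n.factorial * Real.exp (κ / 2) / (κ / 2) ^ n), κ / 2, by positivity,
    by positivity, fun x => (h x).trans ?_⟩
  have h1 := one_add_pow_mul_exp_le n (half_pos hκ) (norm_nonneg x)
  calc K * (1 + ‖x‖) ^ n * ‖g x‖ ≤ |K| * (1 + ‖x‖) ^ n * (C * Real.exp (-κ * ‖x‖)) := by
        gcongr
        · exact le_abs_self K
        · exact hb x
    _ = |K| * C * ((1 + ‖x‖) ^ n * Real.exp (-(κ / 2) * ‖x‖)) * Real.exp (-(κ / 2) * ‖x‖) := by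
        have : Real.exp (-κ * ‖x‖) = Real.exp (-(κ / 2) * ‖x‖) * Real.exp (-(κ / 2) * ‖x‖) := by
          rw [← Real.exp_add]; ring_nf
        rw [this]; ring
    _ ≤ _ := by gcongr

lemma ExpDecay.norm {f : Space N → F} (hf : ExpDecay f) : ExpDecay (fun x => ‖f x‖) :=
  hf.mono 1 (fun x => by simp)

lemma ExpDecay.add {f g : Space N → F} (hf : ExpDecay f) (hg : ExpDecay g) :
    ExpDecay (fun x => f x + g x) := by
  obtain ⟨C, κ, hC, hκ, hb⟩ := hf
  obtain ⟨C', κ', hC', hκ', hb'⟩ := hg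
  refine ⟨C + C', min κ κ', by positivity, lt_min hκ hκ', fun x => (norm_add_le _ _).trans ?_⟩
  rw [add_mul]
  gcongr
  · refine (hb x).trans ?_
    gcongr
    exact min_le_left _ _
  · refine (hb' x).trans ?_
    gcongr
    exact min_le_right _ _

lemma ExpDecay.neg {f : Space N → F} (hf : ExpDecay f) : ExpDecay (fun x => -f x) :=
  hf.mono 1 (fun x => by simp)

lemma ExpDecay.sum {ι : Type*} (S : Finset ι) {f : ι → Space N → F}
    (hf : ∀ i ∈ S, ExpDecay (f i)) : ExpDecay (fun x => ∑ i ∈ S, f i x) := by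
  classical
  induction S using Finset.induction_on with
  | empty => exact ⟨0, 1, le_rfl, one_pos, fun x => by simp⟩
  | insert a S ha ih =>
    simp only [Finset.sum_insert ha]
    exact (hf a (by simp)).add (ih fun i hi => hf i (by simp [hi]))

lemma ExpDecay.bounded {f : Space N → F} (hf : ExpDecay f) : ∃ C, 0 ≤ C ∧ ∀ x, ‖f x‖ ≤ C := by
  obtain ⟨C, κ, hC, hκ, hb⟩ := hf
  refine ⟨C, hC, fun x => (hb x).trans ?_⟩
  have : Real.exp (-κ * ‖x‖) ≤ 1 := Real.exp_le_one_iff.2 (by nlinarith [norm_nonneg x])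
  nlinarith

lemma ExpDecay.rpow {f : Space N → ℝ} (hf : ExpDecay f) (h0 : ∀ x, 0 ≤ f x) {p : ℝ}
    (hp : 0 < p) : ExpDecay (fun x => f x ^ p) := by
  obtain ⟨C, κ, hC, hκ, hb⟩ := hf
  refine ⟨C ^ p, κ * p, by positivity, by positivity, fun x => ?_⟩
  rw [Real.norm_of_nonneg (Real.rpow_nonneg (h0 x) _)]
  have hx := hb x
  rw [Real.norm_of_nonneg (h0 x)] at hx
  calc f x ^ p ≤ (C * Real.exp (-κ * ‖x‖)) ^ p := Real.rpow_le_rpow (h0 x) hx hp.le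
    _ = _ := by
      rw [Real.mul_rpow hC (Real.exp_pos _).le, ← Real.exp_mul]; ring_nf

lemma expDecay_exp {κ : ℝ} (hκ : 0 < κ) :
    ExpDecay (fun x : Space N => Real.exp (-κ * ‖x‖)) :=
  ⟨1, κ, zero_le_one, hκ, fun x => by simp⟩

lemma integrable_exp_neg_norm {κ : ℝ} (hκ : 0 < κ) :
    Integrable (fun x : Space N => Real.exp (-κ * ‖x‖)) := by
  have h := integrable_one_add_norm (E := Space N) (μ := volume) (r := ((N + 1 : ℕ) : ℝ))
    (by simp)
  refine (h.const_mul ((N + 1).factorial * Real.exp κ / κ ^ (N + 1))).mono'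
    (by fun_prop) (Eventually.of_forall fun x => ?_)
  have h1 := one_add_pow_mul_exp_le (N + 1) hκ (norm_nonneg x)
  rw [Real.norm_of_nonneg (Real.exp_pos _).le, Real.rpow_neg (by positivity), Real.rpow_natCast,
    ← div_eq_mul_inv, le_div_iff₀ (by positivity), mul_comm]
  exact h1

lemma ExpDecay.integrable {f : Space N → F} (hf : ExpDecay f)
    (hm : AEStronglyMeasurable f volume) : Integrable f := by
  obtain ⟨C, κ, hC, hκ, hb⟩ := hf
  exact ((integrable_exp_neg_norm hκ).const_mul C).mono' hm (Eventually.of_forall hb)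

lemma ExpDecay.memLp_two {f : Space N → F} (hf : ExpDecay f)
    (hm : AEStronglyMeasurable f volume) : MemLp f 2 volume := by
  rw [memLp_two_iff_integrable_sq_norm hm]
  obtain ⟨C, hC, hb⟩ := hf.bounded
  exact (hf.mono C (fun x => by
    rw [Real.norm_of_nonneg (sq_nonneg _), sq]
    exact mul_le_mul_of_nonneg_right (hb x) (norm_nonneg _))).integrable (hm.norm.pow 2)

/-- Exponential decay is invariant under affine changes of variable. -/
lemma ExpDecay.comp_affine {f : Space N → F} (hf : ExpDecay f) {c : ℝ} (hc : 0 < c)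
    (a : Space N) : ExpDecay (fun x => f (c • (x - a))) := by
  obtain ⟨C, κ, hC, hκ, hb⟩ := hf
  refine ⟨C * Real.exp (κ * c * ‖a‖), κ * c, by positivity, by positivity,
    fun x => (hb _).trans ?_⟩
  rw [mul_assoc, ← Real.exp_add]
  gcongr
  rw [norm_smul, Real.norm_of_nonneg hc.le]
  have : ‖x‖ - ‖a‖ ≤ ‖x - a‖ := norm_sub_norm_le _ _
  have h2 : κ * c * (‖x‖ - ‖a‖) ≤ κ * c * ‖x - a‖ := by gcongr
  nlinarith

variable [NormedSpace ℝ F] [NormedSpace ℝ G]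

lemma DecayC1.continuous {f : Space N → F} (hf : DecayC1 f) : Continuous f :=
  hf.contDiff.continuous

lemma DecayC1.differentiable {f : Space N → F} (hf : DecayC1 f) : Differentiable ℝ f :=
  hf.contDiff.differentiable (by simp)

lemma DecayC1.continuous_fderiv {f : Space N → F} (hf : DecayC1 f) : Continuous (fderiv ℝ f) :=
  hf.contDiff.continuous_fderiv (by simp)

lemma norm_stdVec (i : Fin N) : ‖(stdVec i : Space N)‖ = 1 := by simp [stdVec]

lemma norm_partialDeriv_le (f : Space N → F) (i : Fin N) (x : Space N) :
    ‖partialDeriv i f x‖ ≤ ‖fderiv ℝ f x‖ := by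
  have := (fderiv ℝ f x).le_opNorm (stdVec i)
  rwa [norm_stdVec, mul_one] at this

lemma DecayC1.decay_partialDeriv {f : Space N → F} (hf : DecayC1 f) (i : Fin N) :
    ExpDecay (partialDeriv i f) :=
  hf.decay_fderiv.mono 1 fun x => by simpa using norm_partialDeriv_le f i x

lemma DecayC1.continuous_partialDeriv {f : Space N → F} (hf : DecayC1 f) (i : Fin N) :
    Continuous (partialDeriv i f) :=
  hf.continuous_fderiv.clm_apply continuous_const

lemma ContDiff.decayC1 {f : Space N → F} (hf : ContDiff ℝ 1 f) (hc : HasCompactSupport f) :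
    DecayC1 f := by
  have key : ∀ {H : Type _} [NormedAddCommGroup H] (g : Space N → H), Continuous g →
      HasCompactSupport g → ExpDecay g := by
    intro H _ g hg hgc
    obtain ⟨C, hC⟩ := hg.bounded_above_of_compact_support hgc
    obtain ⟨R, hR⟩ := hgc.isBounded.subset_closedBall 0
    refine ⟨|C| * Real.exp R, 1, by positivity, one_pos, fun x => ?_⟩
    by_cases hx : x ∈ tsupport g
    · have : ‖x‖ ≤ R := by simpa using hR hx
      rw [mul_assoc, ← Real.exp_add]
      have h1 : 1 ≤ Real.exp (R + -1 * ‖x‖) := Real.one_le_exp (by linarith)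
      calc ‖g x‖ ≤ |C| * 1 := by simpa using (hC x).trans (le_abs_self C)
        _ ≤ _ := by gcongr
    · rw [image_eq_zero_of_notMem_tsupport hx, norm_zero]; positivity
  exact ⟨hf, key f hf.continuous hc, key _ (hf.continuous_fderiv (by simp)) (hc.fderiv ℝ)⟩

lemma DecayC1.add {f g : Space N → F} (hf : DecayC1 f) (hg : DecayC1 g) :
    DecayC1 (fun x => f x + g x) :=
  ⟨hf.contDiff.add hg.contDiff, hf.decay.add hg.decay,
    (hf.decay_fderiv.add hg.decay_fderiv).mono 1 fun x => by
      rw [fderiv_fun_add (hf.differentiable x) (hg.differentiable x), one_mul]⟩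

lemma DecayC1.clm_comp {f : Space N → F} (hf : DecayC1 f) (L : F →L[ℝ] G) :
    DecayC1 (fun x => L (f x)) :=
  ⟨L.contDiff.comp hf.contDiff, hf.decay.mono ‖L‖ fun x => L.le_opNorm _,
    hf.decay_fderiv.mono ‖L‖ fun x => by
      have : fderiv ℝ (fun x => L (f x)) x = L.comp (fderiv ℝ f x) :=
        (L.hasFDerivAt.comp x (hf.differentiable x).hasFDerivAt).fderiv
      rw [this]
      exact L.opNorm_comp_le _⟩

/-- Products with functions of polynomial growth. -/
lemma DecayC1.poly_smul {f : Space N → F} (hf : DecayC1 f) {p : Space N → ℝ}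
    (hp : ContDiff ℝ 1 p) (K : ℝ) (n : ℕ) (h0 : ∀ x, ‖p x‖ ≤ K * (1 + ‖x‖) ^ n)
    (h1 : ∀ x, ‖fderiv ℝ p x‖ ≤ K * (1 + ‖x‖) ^ n) : DecayC1 (fun x => p x • f x) := by
  refine ⟨hp.smul hf.contDiff, hf.decay.poly K n fun x => ?_, ?_⟩
  · rw [norm_smul]; gcongr; exact h0 x
  · refine (ExpDecay.add (f := fun x => (1 + ‖x‖) ^ n * ‖fderiv ℝ f x‖)
      (g := fun x => (1 + ‖x‖) ^ n * ‖f x‖)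
      (hf.decay_fderiv.poly 1 n fun x => ?_) (hf.decay.poly 1 n fun x => ?_)).mono |K| fun x => ?_
    · rw [Real.norm_of_nonneg (by positivity), one_mul]
    · rw [Real.norm_of_nonneg (by positivity), one_mul]
    · rw [fderiv_fun_smul (hp.differentiable (by simp) x) (hf.differentiable x),
        Real.norm_of_nonneg (by positivity)]
      refine (norm_add_le _ _).trans ?_
      rw [norm_smul, mul_add]
      have a0 := (h0 x).trans (mul_le_mul_of_nonneg_right (le_abs_self K)
        (by positivity : 0 ≤ (1 + ‖x‖) ^ n))
      have a1 := (h1 x).trans (mul_le_mul_of_nonneg_right (le_abs_self K)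
        (by positivity : 0 ≤ (1 + ‖x‖) ^ n))
      refine add_le_add ?_ ?_
      · rw [← mul_assoc]; exact mul_le_mul_of_nonneg_right a0 (norm_nonneg _)
      · rw [ContinuousLinearMap.norm_smulRight_apply, ← mul_assoc]
        exact mul_le_mul_of_nonneg_right a1 (norm_nonneg _)

lemma DecayC1.const_smul {f : Space N → F} (hf : DecayC1 f) (c : ℝ) :
    DecayC1 (fun x => c • f x) :=
  hf.clm_comp (c • ContinuousLinearMap.id ℝ F)

lemma DecayC1.coord_smul {f : Space N → F} (hf : DecayC1 f) (i : Fin N) :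
    DecayC1 (fun x => x i • f x) := by
  have e : (fun x : Space N => x i) = fun x => EuclideanSpace.proj (𝕜 := ℝ) i x := rfl
  have hn : ‖(EuclideanSpace.proj (𝕜 := ℝ) i : Space N →L[ℝ] ℝ)‖ ≤ 1 :=
    ContinuousLinearMap.opNorm_le_bound _ zero_le_one fun x => by
      simpa using PiLp.norm_apply_le x i
  refine hf.poly_smul (p := fun x => x i) (by rw [e]; exact ContinuousLinearMap.contDiff _) 1 1
    (fun x => ?_) (fun x => ?_)
  · have := PiLp.norm_apply_le x i
    linarith
  · rw [e, ContinuousLinearMap.fderiv]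
    have := norm_nonneg x
    linarith

end Decay

/-! ### Dominated approximation by mollification and cutoff. -/

section Approximation

variable {N : ℕ} {F : Type*} [NormedAddCommGroup F] [NormedSpace ℝ F]

/-- A sequence of functions converging pointwise with their first derivatives, dominated by an
exponentially decaying function. -/
structure DominatedApprox (G : ℕ → Space N → ℝ) (g : Space N → ℝ) : Prop where
  tendsto : ∀ x, Tendsto (fun n => G n x) atTop (𝓝 (g x))
  tendsto_deriv : ∀ i x, Tendsto (fun n => partialDeriv i (G n) x) atTop (𝓝 (partialDeriv i g x))
  dominated : ∃ C κ : ℝ, 0 < κ ∧ ∀ n x, ‖G n x‖ ≤ C * Real.exp (-κ * ‖x‖) ∧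
    ∀ i, ‖partialDeriv i (G n) x‖ ≤ C * Real.exp (-κ * ‖x‖)

lemma integrable_mul_L2 {g : Space N → ℂ} (hg : ExpDecay g) (hm : AEStronglyMeasurable g volume)
    {f : Space N → ℂ} (hf : MemLp f 2 volume) : Integrable (fun x => g x * f x) :=
  (hg.memLp_two hm).integrable_mul hf

lemma integrable_ofReal_mul_L2 {g : Space N → ℝ} (hg : ExpDecay g)
    (hm : AEStronglyMeasurable g volume)
    {f : Space N → ℂ} (hf : MemLp f 2 volume) : Integrable (fun x => (g x : ℂ) * f x) :=
  integrable_mul_L2 (g := fun x => (g x : ℂ)) (hg.mono 1 fun x => by simp)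
    (Complex.continuous_ofReal.comp_aestronglyMeasurable hm) hf

lemma tendsto_integral_mul_L2 {G : ℕ → Space N → ℝ} {g : Space N → ℝ} {C κ : ℝ} (hκ : 0 < κ)
    (hG : ∀ n, Continuous (G n)) (hb : ∀ n x, ‖G n x‖ ≤ C * Real.exp (-κ * ‖x‖))
    (ht : ∀ x, Tendsto (fun n => G n x) atTop (𝓝 (g x)))
    {f : Space N → ℂ} (hf : MemLp f 2 volume) :
    Tendsto (fun n => ∫ x, (G n x : ℂ) * f x) atTop (𝓝 (∫ x, (g x : ℂ) * f x)) := by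
  refine tendsto_integral_of_dominated_convergence
    (fun x => C * Real.exp (-κ * ‖x‖) * ‖f x‖) (fun n => ?_) ?_ (fun n => ?_) ?_
  · exact (Complex.continuous_ofReal.comp (hG n)).aestronglyMeasurable.mul hf.1
  · have h := (((expDecay_exp hκ).mono (f := fun x : Space N => C * Real.exp (-κ * ‖x‖)) |C|
      fun x => by simp).memLp_two (by fun_prop)).integrable_mul hf.norm
    exact h
  · refine Eventually.of_forall fun x => ?_
    rw [norm_mul, Complex.norm_real]
    exact mul_le_mul_of_nonneg_right (hb n x) (norm_nonneg _)
  · refine Eventually.of_forall fun x => ?_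
    exact ((Complex.continuous_ofReal.tendsto _).comp (ht x)).mul_const _

/-- A standard mollifier of radius at most one. -/
noncomputable def mollifier (N : ℕ) (n : ℕ) : ContDiffBump (0 : Space N) where
  rIn := 1 / (n + 2)
  rOut := 2 / (n + 2)
  rIn_pos := by positivity
  rIn_lt_rOut := by gcongr; norm_num

lemma tendsto_mollifier_rOut : Tendsto (fun n => (mollifier N n).rOut) atTop (𝓝 0) := by
  have h := tendsto_const_div_atTop_nhds_zero_nat (2 : ℝ)
  have h2 := h.comp (tendsto_add_atTop_nat 2)
  refine h2.congr fun n => ?_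
  simp [mollifier]

lemma mollifier_norm_le (n : ℕ) {y : Space N} (hy : (mollifier N n).normed volume y ≠ 0) :
    ‖y‖ ≤ 1 := by
  have : y ∈ Function.support ((mollifier N n).normed volume) := hy
  rw [ContDiffBump.support_normed_eq, mem_ball_zero_iff] at this
  refine this.le.trans ?_
  simp only [mollifier]
  rw [div_le_one (by positivity)]
  linarith [(Nat.cast_nonneg n : (0 : ℝ) ≤ n)]

/-- Mollification. -/
noncomputable def mollify (n : ℕ) (f : Space N → F) (x : Space N) : F :=
  ∫ y, (mollifier N n).normed volume y • f (x - y)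

lemma mollify_eq (n : ℕ) (f : Space N → F) :
    mollify n f = convolution ((mollifier N n).normed volume) f
      (ContinuousLinearMap.lsmul ℝ ℝ) volume := rfl

/-- The mollifiers are supported in the unit ball, so averaging moves the argument by at most one
and loses only the factor `exp κ`. The bound is uniform in `n`, as dominated convergence requires.
-/
lemma norm_mollify_le (n : ℕ) {f : Space N → F} {C κ : ℝ} (hκ : 0 ≤ κ) (hC : 0 ≤ C)
    (hf : ∀ x, ‖f x‖ ≤ C * Real.exp (-κ * ‖x‖)) (x : Space N) :
    ‖mollify n f x‖ ≤ C * Real.exp κ * Real.exp (-κ * ‖x‖) := by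
  have hρ := (mollifier N n).integrable_normed (μ := volume)
  calc ‖mollify n f x‖
      ≤ ∫ y, (mollifier N n).normed volume y * (C * Real.exp κ * Real.exp (-κ * ‖x‖)) := by
        refine norm_integral_le_of_norm_le (hρ.mul_const _) (Eventually.of_forall fun y => ?_)
        have h0 := (mollifier N n).nonneg_normed (μ := volume) y
        rw [norm_smul, Real.norm_of_nonneg h0]
        by_cases hy : (mollifier N n).normed volume y = 0
        · simp [hy]
        refine mul_le_mul_of_nonneg_left ((hf _).trans ?_) h0
        rw [mul_assoc, ← Real.exp_add]
        have h1 := mollifier_norm_le n hy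
        have h2 : ‖x‖ ≤ ‖x - y‖ + ‖y‖ := by simpa using norm_add_le (x - y) y
        gcongr
        nlinarith
    _ = _ := by rw [integral_mul_const, ContDiffBump.integral_normed, one_mul]

lemma contDiff_mollify (n : ℕ) {f : Space N → F} [CompleteSpace F] (hf : LocallyIntegrable f volume) :
    ContDiff ℝ ∞ (mollify n f) := by
  rw [mollify_eq]
  exact ((mollifier N n).hasCompactSupport_normed).contDiff_convolution_left _
    ((mollifier N n).contDiff_normed (n := ⊤)) hf

lemma tendsto_mollify {f : Space N → F} [CompleteSpace F] (hf : Continuous f) (x : Space N) :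
    Tendsto (fun n => mollify n f x) atTop (𝓝 (f x)) :=
  ContDiffBump.convolution_tendsto_right_of_continuous tendsto_mollifier_rOut hf x

lemma partialDeriv_mollify (n : ℕ) {f : Space N → F} [CompleteSpace F] (hf : ContDiff ℝ 1 f)
    (hc : HasCompactSupport f) (i : Fin N) (x : Space N) :
    partialDeriv i (mollify n f) x = mollify n (partialDeriv i f) x := by
  have h := hc.hasFDerivAt_convolution_right (ContinuousLinearMap.lsmul ℝ ℝ)
    ((mollifier N n).integrable_normed (μ := volume)).locallyIntegrable hf x
  rw [partialDeriv, mollify_eq, h.fderiv, convolution_precompR_apply _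
    ((mollifier N n).integrable_normed (μ := volume)).locallyIntegrable (hc.fderiv ℝ)
    (hf.continuous_fderiv one_ne_zero)]
  rfl

lemma dominatedApprox_mollify {g : Space N → ℝ} (hg : ContDiff ℝ 1 g) (hc : HasCompactSupport g) :
    DominatedApprox (fun n => mollify n g) g := by
  have hd := hg.decayC1 hc
  obtain ⟨C, κ, hC, hκ, hb⟩ := hd.decay
  obtain ⟨C', κ', hC', hκ', hb'⟩ := hd.decay_fderiv
  refine ⟨tendsto_mollify hg.continuous, fun i x => ?_, ?_⟩
  · simp only [partialDeriv_mollify _ hg hc]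
    exact tendsto_mollify (hd.continuous_partialDeriv i) x
  · have e1 : ∀ x, ‖g x‖ ≤ (C + C') * Real.exp (-(min κ κ') * ‖x‖) := fun x =>
      (hb x).trans (by gcongr <;> [linarith; exact min_le_left _ _])
    have e2 : ∀ i x, ‖partialDeriv i g x‖ ≤ (C + C') * Real.exp (-(min κ κ') * ‖x‖) := fun i x =>
      ((norm_partialDeriv_le g i x).trans (hb' x)).trans
        (by gcongr <;> [linarith; exact min_le_right _ _])
    have hm := lt_min hκ hκ'
    refine ⟨(C + C') * Real.exp (min κ κ'), min κ κ', hm, fun n x => ⟨?_, fun i => ?_⟩⟩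
    · exact norm_mollify_le n hm.le (by positivity) e1 x
    · rw [partialDeriv_mollify _ hg hc]
      exact norm_mollify_le n hm.le (by positivity) (e2 i) x

lemma hasCompactSupport_mollify (n : ℕ) {g : Space N → F} (hc : HasCompactSupport g) :
    HasCompactSupport (mollify n g) := by
  rw [mollify_eq]
  exact HasCompactSupport.convolution _ (mollifier N n).hasCompactSupport_normed hc

/-- A fixed smooth cutoff, equal to one on the unit ball. -/
noncomputable def cutoffBump (N : ℕ) : ContDiffBump (0 : Space N) where
  rIn := 1
  rOut := 2
  rIn_pos := one_pos
  rIn_lt_rOut := one_lt_two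

/-- Smooth cutoffs of the ball of radius `n + 1`. -/
noncomputable def cutoff (n : ℕ) (x : Space N) : ℝ := cutoffBump N ((1 / (n + 1 : ℝ)) • x)

lemma contDiff_cutoff (n : ℕ) : ContDiff ℝ ∞ (cutoff n : Space N → ℝ) :=
  (cutoffBump N).contDiff.comp (contDiff_const_smul _)

lemma hasCompactSupport_cutoff (n : ℕ) : HasCompactSupport (cutoff n : Space N → ℝ) :=
  (cutoffBump N).hasCompactSupport.comp_smul (by positivity)

/-- Equality on a neighbourhood, and not only at `x`, also makes the derivative of the cutoff vanish
at `x`. -/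
lemma cutoff_eventually_eq_one (x : Space N) :
    ∀ᶠ n : ℕ in atTop, cutoff n =ᶠ[𝓝 x] (fun _ : Space N => (1 : ℝ)) := by
  obtain ⟨m, hm⟩ := exists_nat_gt ‖x‖
  filter_upwards [eventually_ge_atTop m] with n hn
  have hx : ‖x‖ < n + 1 := hm.trans_le (by exact_mod_cast Nat.le_succ_of_le hn)
  filter_upwards [(continuous_norm.tendsto x).eventually (Iio_mem_nhds hx)] with y hy
  refine (cutoffBump N).one_of_mem_closedBall ?_
  rw [mem_closedBall_zero_iff, norm_smul, Real.norm_of_nonneg (by positivity), one_div,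
    inv_mul_le_iff₀ (by positivity)]
  simpa [cutoffBump] using hy.le

lemma cutoff_nonneg (n : ℕ) (x : Space N) : 0 ≤ cutoff n x := (cutoffBump N).nonneg

lemma cutoff_le_one (n : ℕ) (x : Space N) : cutoff n x ≤ 1 := (cutoffBump N).le_one

lemma norm_fderiv_cutoff_le : ∃ K, 0 ≤ K ∧ ∀ n, ∀ x : Space N, ‖fderiv ℝ (cutoff n) x‖ ≤ K := by
  obtain ⟨C, hC⟩ := ((cutoffBump N).contDiff (n := 1).continuous_fderiv
    one_ne_zero).bounded_above_of_compact_support ((cutoffBump N).hasCompactSupport.fderiv ℝ)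
  refine ⟨C, (norm_nonneg _).trans (hC 0), fun n x => ?_⟩
  have h : HasFDerivAt (cutoff n : Space N → ℝ)
      ((fderiv ℝ (cutoffBump N) ((1 / (n + 1 : ℝ)) • x)).comp
        ((1 / (n + 1 : ℝ)) • ContinuousLinearMap.id ℝ (Space N))) x :=
    (((cutoffBump N).contDiff (n := 1)).differentiable one_ne_zero _).hasFDerivAt.comp x
      ((1 / (n + 1 : ℝ)) • ContinuousLinearMap.id ℝ (Space N)).hasFDerivAt
  rw [h.fderiv]
  refine (ContinuousLinearMap.opNorm_comp_le _ _).trans ?_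
  have h2 : ‖(1 / (n + 1 : ℝ)) • ContinuousLinearMap.id ℝ (Space N)‖ ≤ 1 := by
    rw [norm_smul, Real.norm_of_nonneg (by positivity)]
    have h3 : 1 / (n + 1 : ℝ) ≤ 1 := by
      rw [div_le_one (by positivity)]; linarith [(Nat.cast_nonneg n : (0 : ℝ) ≤ n)]
    exact mul_le_one₀ h3 (norm_nonneg _) ContinuousLinearMap.norm_id_le
  calc _ ≤ C * 1 := mul_le_mul (hC _) h2 (norm_nonneg _) ((norm_nonneg _).trans (hC 0))
    _ = C := mul_one C

lemma partialDeriv_mul {f g : Space N → ℝ} (i : Fin N) {x : Space N}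
    (hf : DifferentiableAt ℝ f x) (hg : DifferentiableAt ℝ g x) :
    partialDeriv i (fun x => f x * g x) x = f x * partialDeriv i g x + partialDeriv i f x * g x := by
  simp only [partialDeriv]
  rw [fderiv_fun_mul hf hg]
  simp [mul_comm]

lemma dominatedApprox_cutoff {g : Space N → ℝ} (hg : DecayC1 g) :
    DominatedApprox (fun n x => cutoff n x * g x) g := by
  obtain ⟨K, hK0, hK⟩ := norm_fderiv_cutoff_le (N := N)
  obtain ⟨C, κ, hC, hκ, hb⟩ := hg.decay
  obtain ⟨C', κ', hC', hκ', hb'⟩ := hg.decay_fderiv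
  have hpd : ∀ n i x, partialDeriv i (fun x => cutoff n x * g x) x
      = cutoff n x * partialDeriv i g x + partialDeriv i (cutoff n) x * g x := fun n i x =>
    partialDeriv_mul i ((contDiff_cutoff n).differentiable (by simp) x) (hg.differentiable x)
  refine ⟨fun x => ?_, fun i x => ?_, ?_⟩
  · refine tendsto_const_nhds.congr' ?_
    filter_upwards [cutoff_eventually_eq_one x] with n hn
    rw [hn.eq_of_nhds, one_mul]
  · refine tendsto_const_nhds.congr' ?_
    filter_upwards [cutoff_eventually_eq_one x] with n hn
    have h1 : partialDeriv i (cutoff n) x = 0 := by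
      rw [partialDeriv, hn.fderiv_eq]; simp
    rw [hpd, hn.eq_of_nhds, h1]; simp
  · have e1 : ∀ x, ‖g x‖ ≤ (C + C') * Real.exp (-(min κ κ') * ‖x‖) := fun x =>
      (hb x).trans (by gcongr <;> [linarith; exact min_le_left _ _])
    have e2 : ∀ i x, ‖partialDeriv i g x‖ ≤ (C + C') * Real.exp (-(min κ κ') * ‖x‖) := fun i x =>
      ((norm_partialDeriv_le g i x).trans (hb' x)).trans
        (by gcongr <;> [linarith; exact min_le_right _ _])
    refine ⟨(C + C') * (1 + K), min κ κ', lt_min hκ hκ', fun n x => ⟨?_, fun i => ?_⟩⟩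
    · have := e1 x
      rw [norm_mul, Real.norm_of_nonneg (cutoff_nonneg n x)]
      have h3 := mul_le_mul (cutoff_le_one n x) this (norm_nonneg _) zero_le_one
      have h4 : 0 ≤ (C + C') * K * Real.exp (-(min κ κ') * ‖x‖) := by positivity
      nlinarith
    · rw [hpd]
      refine (norm_add_le _ _).trans ?_
      rw [norm_mul, norm_mul, Real.norm_of_nonneg (cutoff_nonneg n x)]
      have h3 := mul_le_mul (cutoff_le_one n x) (e2 i x) (norm_nonneg _) zero_le_one
      have h4 := mul_le_mul ((norm_partialDeriv_le (cutoff n) i x).trans (hK n x)) (e1 x)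
        (norm_nonneg _) hK0
      nlinarith

end Approximation

/-! ### Weak derivatives tested against decaying `C¹` functions. -/

section WeakDerivatives

variable {N : ℕ}

lemma memLp_h1Fn (w : H1 N) : MemLp (h1Fn w) 2 volume := Lp.memLp _

lemma memLp_h1Grad (w : H1 N) (i : Fin N) : MemLp (h1Grad w i) 2 volume := Lp.memLp _

/-- Statements which pass to dominated limits and hold for test functions hold for all `C¹`
exponentially decaying functions. -/
lemma DecayC1.induction_of_test {P : (Space N → ℝ) → Prop}
    (htest : ∀ φ : Space N → ℝ, ContDiff ℝ ∞ φ → HasCompactSupport φ → P φ)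
    (hlim : ∀ (G : ℕ → Space N → ℝ) (g : Space N → ℝ), (∀ n, ContDiff ℝ 1 (G n)) →
      DominatedApprox G g → (∀ n, P (G n)) → P g)
    {g : Space N → ℝ} (hg : DecayC1 g) : P g := by
  -- Two limits: mollification passes from smooth to `C¹` functions of compact support, then cutoffs
  -- pass to decaying `C¹` functions.
  have h1 : ∀ φ : Space N → ℝ, ContDiff ℝ 1 φ → HasCompactSupport φ → P φ := fun φ hφ hc => by
    have hs : ∀ n, ContDiff ℝ ∞ (mollify n φ) := fun n =>
      contDiff_mollify n hφ.continuous.locallyIntegrable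
    exact hlim _ φ (fun n => (hs n).of_le (by simp)) (dominatedApprox_mollify hφ hc)
      fun n => htest _ (hs n) (hasCompactSupport_mollify n hc)
  have hs : ∀ n, ContDiff ℝ 1 (fun x => cutoff n x * g x) := fun n =>
    ((contDiff_cutoff n).of_le (by simp)).mul hg.contDiff
  exact hlim _ g hs (dominatedApprox_cutoff hg) fun n => h1 _ (hs n)
    ((hasCompactSupport_cutoff n).mul_right)

lemma integral_partialDeriv_mul_ofReal (w : H1 N) (i : Fin N) {g : Space N → ℝ} (hg : DecayC1 g) :
    ∫ x, ((partialDeriv i g x : ℝ) : ℂ) * h1Fn w x = -∫ x, (g x : ℂ) * h1Grad w i x := by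
  refine DecayC1.induction_of_test (P := fun g => ∫ x, ((partialDeriv i g x : ℝ) : ℂ) * h1Fn w x
    = -∫ x, (g x : ℂ) * h1Grad w i x) (fun φ h1 h2 => w.2 i φ h1 h2) ?_ hg
  intro G g hG ha hP
  obtain ⟨C, κ, hκ, hb⟩ := ha.dominated
  have h1 := tendsto_integral_mul_L2 hκ
    (fun n => ((hG n).continuous_fderiv one_ne_zero).clm_apply continuous_const)
    (fun n x => (hb n x).2 i) (ha.tendsto_deriv i) (memLp_h1Fn w)
  have h2 := tendsto_integral_mul_L2 hκ (fun n => (hG n).continuous)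
    (fun n x => (hb n x).1) ha.tendsto (memLp_h1Grad w i)
  exact tendsto_nhds_unique (h1.congr hP) h2.neg

lemma partialDeriv_comm {g : Space N → ℝ} (hg : ContDiff ℝ 2 g) (i j : Fin N) (x : Space N) :
    partialDeriv i (partialDeriv j g) x = partialDeriv j (partialDeriv i g) x := by
  have hd : DifferentiableAt ℝ (fderiv ℝ g) x :=
    (hg.fderiv_right (m := 1) (by norm_num)).differentiable one_ne_zero x
  have h := (hg.contDiffAt (x := x)).isSymmSndFDerivAt (by simp)
  have key : ∀ k l : Fin N, partialDeriv k (partialDeriv l g) x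
      = fderiv ℝ (fderiv ℝ g) x (stdVec k) (stdVec l) := fun k l => by
    have : HasFDerivAt (partialDeriv l g) ((ContinuousLinearMap.apply ℝ ℝ (stdVec l)).comp
        (fderiv ℝ (fderiv ℝ g) x)) x :=
      (ContinuousLinearMap.apply ℝ ℝ (stdVec l)).hasFDerivAt.comp x hd.hasFDerivAt
    rw [partialDeriv, this.fderiv]; rfl
  rw [key, key]
  exact h _ _

/-- Gradients are weakly curl free. -/
lemma integral_partialDeriv_mul_h1Grad_comm (w : H1 N) (i j : Fin N) {g : Space N → ℝ}
    (hg : DecayC1 g) :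
    ∫ x, ((partialDeriv j g x : ℝ) : ℂ) * h1Grad w i x
      = ∫ x, ((partialDeriv i g x : ℝ) : ℂ) * h1Grad w j x := by
  refine DecayC1.induction_of_test (P := fun g => ∫ x, ((partialDeriv j g x : ℝ) : ℂ) * h1Grad w i x
      = ∫ x, ((partialDeriv i g x : ℝ) : ℂ) * h1Grad w j x) (fun φ h1 h2 => ?_) ?_ hg
  · have hs : ∀ k, ContDiff ℝ ∞ (partialDeriv k φ) := fun k =>
      (h1.fderiv_right (m := ∞) (by simp)).clm_apply contDiff_const
    -- For test functions both sides equal minus the pairing of `w` with the mixed second derivative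
    -- of `φ`.
    have e1 := w.2 i _ (hs j) (hasCompactSupport_partialDeriv j φ h2)
    have e2 := w.2 j _ (hs i) (hasCompactSupport_partialDeriv i φ h2)
    have e3 : ∀ x, partialDeriv i (partialDeriv j φ) x = partialDeriv j (partialDeriv i φ) x :=
      partialDeriv_comm (contDiff_infty.1 h1 2) i j
    simp only [e3] at e1
    exact neg_injective (e1.symm.trans e2)
  · intro G g hG ha hP
    obtain ⟨C, κ, hκ, hb⟩ := ha.dominated
    have h : ∀ k l, _ := fun k l => tendsto_integral_mul_L2 hκ
      (fun n => ((hG n).continuous_fderiv one_ne_zero).clm_apply continuous_const)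
      (fun n x => (hb n x).2 k) (ha.tendsto_deriv k) (memLp_h1Grad w l)
    exact tendsto_nhds_unique ((h j i).congr hP) (h i j)

lemma partialDeriv_ofReal {g : Space N → ℝ} {x : Space N} (hg : DifferentiableAt ℝ g x)
    (i : Fin N) : partialDeriv i (fun x => (g x : ℂ)) x = ((partialDeriv i g x : ℝ) : ℂ) := by
  have : HasFDerivAt (fun x => (g x : ℂ)) (Complex.ofRealCLM.comp (fderiv ℝ g x)) x :=
    Complex.ofRealCLM.hasFDerivAt.comp x hg.hasFDerivAt
  rw [partialDeriv, this.fderiv]; rfl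

lemma partialDeriv_clm {g : Space N → ℂ} {x : Space N} (hg : DifferentiableAt ℝ g x)
    (L : ℂ →L[ℝ] ℝ) (i : Fin N) : partialDeriv i (fun x => L (g x)) x = L (partialDeriv i g x) := by
  have : HasFDerivAt (fun x => L (g x)) (L.comp (fderiv ℝ g x)) x :=
    L.hasFDerivAt.comp x hg.hasFDerivAt
  rw [partialDeriv, this.fderiv]; rfl

/-- Integration by parts against `C¹` exponentially decaying functions. -/
lemma integral_partialDeriv_mul (w : H1 N) (i : Fin N) {g : Space N → ℂ} (hg : DecayC1 g) :
    ∫ x, partialDeriv i g x * h1Fn w x = -∫ x, g x * h1Grad w i x := by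
  have hre : DecayC1 (fun x => Complex.reCLM (g x)) := hg.clm_comp _
  have him : DecayC1 (fun x => Complex.imCLM (g x)) := hg.clm_comp _
  have e1 := integral_partialDeriv_mul_ofReal w i hre
  have e2 := integral_partialDeriv_mul_ofReal w i him
  have d1 : ∀ {f : Space N → ℂ}, MemLp f 2 volume → ∫ x, g x * f x
      = (∫ x, (Complex.reCLM (g x) : ℂ) * f x) + Complex.I * ∫ x, (Complex.imCLM (g x) : ℂ) * f x := by
    intro f hf
    rw [← integral_const_mul, ← integral_add
      (integrable_ofReal_mul_L2 hre.decay hre.continuous.aestronglyMeasurable hf)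
      ((integrable_ofReal_mul_L2 him.decay him.continuous.aestronglyMeasurable hf).const_mul _)]
    refine integral_congr_ae (Eventually.of_forall fun x => ?_)
    simp only [Complex.reCLM_apply, Complex.imCLM_apply]
    conv_lhs => rw [← Complex.re_add_im (g x)]
    ring
  have d2 : ∫ x, partialDeriv i g x * h1Fn w x
      = (∫ x, ((partialDeriv i (fun x => Complex.reCLM (g x)) x : ℝ) : ℂ) * h1Fn w x)
        + Complex.I * ∫ x, ((partialDeriv i (fun x => Complex.imCLM (g x)) x : ℝ) : ℂ) * h1Fn w x := by
    rw [← integral_const_mul, ← integral_add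
      (integrable_ofReal_mul_L2 (hre.decay_partialDeriv i)
        (hre.continuous_partialDeriv i).aestronglyMeasurable (memLp_h1Fn w))
      ((integrable_ofReal_mul_L2 (him.decay_partialDeriv i)
        (him.continuous_partialDeriv i).aestronglyMeasurable (memLp_h1Fn w)).const_mul _)]
    refine integral_congr_ae (Eventually.of_forall fun x => ?_)
    have r1 := partialDeriv_clm (hg.differentiable x) Complex.reCLM i
    have r2 := partialDeriv_clm (hg.differentiable x) Complex.imCLM i
    beta_reduce
    rw [r1, r2, Complex.reCLM_apply, Complex.imCLM_apply]
    conv_lhs => rw [← Complex.re_add_im (partialDeriv i g x)]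
    ring
  rw [d1 (memLp_h1Grad w i), d2, e1, e2]
  ring

/-- `C¹` exponentially decaying functions belong to `H¹`. -/
lemma DecayC1.exists_h1 {g : Space N → ℂ} (hg : DecayC1 g) :
    ∃ z : H1 N, h1Fn z =ᵐ[volume] g ∧ ∀ i, h1Grad z i =ᵐ[volume] partialDeriv i g := by
  have h0 : MemLp g 2 volume := hg.decay.memLp_two hg.continuous.aestronglyMeasurable
  have hi : ∀ i, MemLp (partialDeriv i g) 2 volume := fun i =>
    (hg.decay_partialDeriv i).memLp_two (hg.continuous_partialDeriv i).aestronglyMeasurable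
  let t : L2Tuple N := WithLp.toLp 2
    (Fin.cons (h0.toLp g) (fun i => (hi i).toLp (partialDeriv i g)))
  have t0 : (t 0 : Space N → ℂ) =ᵐ[volume] g := h0.coeFn_toLp
  have ti : ∀ i : Fin N, (t i.succ : Space N → ℂ) =ᵐ[volume] partialDeriv i g := fun i =>
    (hi i).coeFn_toLp
  refine ⟨⟨t, fun i φ hφ hc => ?_⟩, t0, ti⟩
  have hφ1 : ContDiff ℝ 1 (fun x => (φ x : ℂ)) :=
    Complex.ofRealCLM.contDiff.comp (hφ.of_le (by simp))
  have hφc : HasCompactSupport (fun x => (φ x : ℂ)) :=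
    hc.comp_left (g := fun r : ℝ => (r : ℂ)) Complex.ofReal_zero
  have hd := hφ1.decayC1 hφc
  have l1 : ∫ x, ((partialDeriv i φ x : ℝ) : ℂ) * t 0 x
      = ∫ x, fderiv ℝ (fun x => (φ x : ℂ)) x (stdVec i) * g x := by
    refine integral_congr_ae ?_
    filter_upwards [t0] with x hx
    rw [hx, ← partialDeriv_ofReal (hφ.differentiable (by simp) x)]
    rfl
  have l2 : ∫ x, (φ x : ℂ) * t i.succ x = ∫ x, (φ x : ℂ) * fderiv ℝ g x (stdVec i) := by
    refine integral_congr_ae ?_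
    filter_upwards [ti i] with x hx
    rw [hx]; rfl
  rw [l1, l2, integral_mul_fderiv_eq_neg_fderiv_mul_of_integrable, neg_neg]
  · exact integrable_mul_L2 (hd.decay_partialDeriv i)
      (hd.continuous_partialDeriv i).aestronglyMeasurable h0
  · exact integrable_mul_L2 hd.decay hd.continuous.aestronglyMeasurable (hi i)
  · exact integrable_mul_L2 hd.decay hd.continuous.aestronglyMeasurable h0
  · exact fun x _ => hd.differentiable x
  · exact fun x _ => hg.differentiable x

end WeakDerivatives

/-! ### Sobolev embedding of `H¹` with an exponential weight. -/

section Sobolev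

variable {N : ℕ}

lemma ExpDecay.memLp {F : Type*} [NormedAddCommGroup F] {f : Space N → F} (hf : ExpDecay f)
    (hm : AEStronglyMeasurable f volume) (p : ℝ≥0∞) : MemLp f p volume := by
  rcases eq_or_ne p 0 with rfl | h0
  · simpa using hm
  rcases eq_or_ne p ⊤ with rfl | ht
  · obtain ⟨C, -, hC⟩ := hf.bounded
    exact memLp_top_of_bound hm C (Eventually.of_forall hC)
  · rw [← integrable_norm_rpow_iff hm h0 ht]
    exact (hf.norm.rpow (fun x => norm_nonneg _) (ENNReal.toReal_pos h0 ht)).integrable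
      (hm.norm.aemeasurable.pow_const _).aestronglyMeasurable

/-- Mollification contracts the `L²` norm. -/
lemma eLpNorm_mollify_le (n : ℕ) {f : Space N → ℂ} (hf : StronglyMeasurable f) :
    eLpNorm (mollify n f) 2 volume ≤ eLpNorm f 2 volume := by
  set ρ : Space N → ℝ := (mollifier N n).normed volume with hρ
  have hρc : Continuous ρ := (mollifier N n).continuous_normed
  have hρ0 : ∀ y, 0 ≤ ρ y := (mollifier N n).nonneg_normed
  have hρ1 : ∫⁻ y, ENNReal.ofReal (ρ y) = 1 := by
    rw [← ofReal_integral_eq_lintegral_ofReal ((mollifier N n).integrable_normed)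
      (Eventually.of_forall hρ0), ContDiffBump.integral_normed, ENNReal.ofReal_one]
  have hρm : Measurable fun y => ENNReal.ofReal (ρ y) := hρc.measurable.ennreal_ofReal
  have hfm : Measurable f := hf.measurable
  have key : ∀ x, ‖mollify n f x‖ₑ ^ (2 : ℝ)
      ≤ ∫⁻ y, ENNReal.ofReal (ρ y) * ‖f (x - y)‖ₑ ^ (2 : ℝ) := by
    intro x
    -- The probability density `ρ` is split into two square roots, so that Cauchy–Schwarz gives
    -- Jensen's inequality; Tonelli and translation invariance then finish.
    have h1 : ‖mollify n f x‖ₑ ≤ ∫⁻ y, ((fun y => ENNReal.ofReal (ρ y) ^ (1 / 2 : ℝ)) *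
        fun y => ENNReal.ofReal (ρ y) ^ (1 / 2 : ℝ) * ‖f (x - y)‖ₑ) y := by
      refine (enorm_integral_le_lintegral_enorm _).trans (lintegral_mono fun y => le_of_eq ?_)
      rw [Pi.mul_apply, ← mul_assoc, ← ENNReal.rpow_add_of_nonneg _ _ (by norm_num) (by norm_num),
        enorm_smul, Real.enorm_of_nonneg (hρ0 y)]
      norm_num [hρ]
    have h2 := ENNReal.lintegral_mul_le_Lp_mul_Lq volume Real.HolderConjugate.two_two
      (f := fun y => ENNReal.ofReal (ρ y) ^ (1 / 2 : ℝ))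
      (g := fun y => ENNReal.ofReal (ρ y) ^ (1 / 2 : ℝ) * ‖f (x - y)‖ₑ)
      (hρm.pow_const _).aemeasurable
      ((hρm.pow_const _).mul (hfm.comp (measurable_const.sub measurable_id)).enorm).aemeasurable
    have e1 : ∀ y, (ENNReal.ofReal (ρ y) ^ (1 / 2 : ℝ)) ^ (2 : ℝ) = ENNReal.ofReal (ρ y) := fun y => by
      rw [← ENNReal.rpow_mul]; norm_num
    have e2 : ∀ y, (ENNReal.ofReal (ρ y) ^ (1 / 2 : ℝ) * ‖f (x - y)‖ₑ) ^ (2 : ℝ)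
        = ENNReal.ofReal (ρ y) * ‖f (x - y)‖ₑ ^ (2 : ℝ) := fun y => by
      rw [ENNReal.mul_rpow_of_nonneg _ _ (by norm_num), e1]
    simp only [e1, e2, hρ1, ENNReal.one_rpow, one_mul] at h2
    calc ‖mollify n f x‖ₑ ^ (2 : ℝ)
        ≤ ((∫⁻ y, ENNReal.ofReal (ρ y) * ‖f (x - y)‖ₑ ^ (2 : ℝ)) ^ (1 / 2 : ℝ)) ^ (2 : ℝ) :=
          ENNReal.rpow_le_rpow (h1.trans h2) (by norm_num)
      _ = _ := by rw [← ENNReal.rpow_mul]; norm_num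
  have hint : ∫⁻ x, ‖mollify n f x‖ₑ ^ (2 : ℝ) ≤ ∫⁻ x, ‖f x‖ₑ ^ (2 : ℝ) := by
    calc ∫⁻ x, ‖mollify n f x‖ₑ ^ (2 : ℝ)
        ≤ ∫⁻ x, ∫⁻ y, ENNReal.ofReal (ρ y) * ‖f (x - y)‖ₑ ^ (2 : ℝ) := lintegral_mono key
      _ = ∫⁻ y, ∫⁻ x, ENNReal.ofReal (ρ y) * ‖f (x - y)‖ₑ ^ (2 : ℝ) := by
          refine lintegral_lintegral_swap (Measurable.aemeasurable ?_)
          exact (hρm.comp measurable_snd).mul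
            ((hfm.comp (measurable_fst.sub measurable_snd)).enorm.pow_const _)
      _ = ∫⁻ y, ENNReal.ofReal (ρ y) * ∫⁻ x, ‖f x‖ₑ ^ (2 : ℝ) := by
          refine lintegral_congr fun y => ?_
          have hm : Measurable fun x => ‖f (x - y)‖ₑ ^ (2 : ℝ) :=
            (hfm.comp (measurable_id.sub_const y)).enorm.pow_const _
          rw [lintegral_const_mul _ hm, lintegral_sub_right_eq_self (fun x => ‖f x‖ₑ ^ (2 : ℝ)) y]
      _ = _ := by rw [lintegral_mul_const _ hρm, hρ1, one_mul]
  rw [eLpNorm_eq_lintegral_rpow_enorm_toReal (by norm_num) (by norm_num),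
    eLpNorm_eq_lintegral_rpow_enorm_toReal (by norm_num) (by norm_num)]
  simp only [ENNReal.toReal_ofNat]
  exact ENNReal.rpow_le_rpow hint (by norm_num)

lemma locallyIntegrable_h1Fn (w : H1 N) : LocallyIntegrable (h1Fn w) volume :=
  (memLp_h1Fn w).locallyIntegrable (by norm_num)

/-- The derivative of the convolution falls on the mollifier, and the weak derivative of `w` is then
used with the reflected and translated mollifier as test function. -/
lemma partialDeriv_mollify_h1 (n : ℕ) (w : H1 N) (i : Fin N) (x : Space N) :
    partialDeriv i (mollify n (h1Fn w)) x = mollify n (h1Grad w i) x := by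
  set ρ : Space N → ℝ := (mollifier N n).normed volume with hρ
  have hρs : ContDiff ℝ ∞ ρ := (mollifier N n).contDiff_normed (n := ⊤)
  have hρc : HasCompactSupport ρ := (mollifier N n).hasCompactSupport_normed
  have hex := (hρc.fderiv ℝ).convolutionExists_left
    ((ContinuousLinearMap.lsmul ℝ ℝ : ℝ →L[ℝ] ℂ →L[ℝ] ℂ).precompL (Space N))
    (hρs.continuous_fderiv (by simp)) (locallyIntegrable_h1Fn w) x
  have h := hρc.hasFDerivAt_convolution_left (μ := volume)
    (ContinuousLinearMap.lsmul ℝ ℝ : ℝ →L[ℝ] ℂ →L[ℝ] ℂ) (hρs.of_le (by simp))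
    (locallyIntegrable_h1Fn w) x
  rw [partialDeriv, mollify_eq, h.fderiv, convolution_def,
    ContinuousLinearMap.integral_apply hex]
  have e1 : ∀ y, ((ContinuousLinearMap.lsmul ℝ ℝ : ℝ →L[ℝ] ℂ →L[ℝ] ℂ).precompL (Space N)
      (fderiv ℝ ρ y) (h1Fn w (x - y))) (stdVec i)
      = ((partialDeriv i ρ y : ℝ) : ℂ) * h1Fn w (x - y) := fun y => by
    rw [← Complex.real_smul]; rfl
  simp only [e1]
  let φ : Space N → ℝ := fun y => ρ (x - y)
  have hφs : ContDiff ℝ ∞ φ := hρs.comp (contDiff_const.sub contDiff_id)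
  have hφc : HasCompactSupport φ := hρc.comp_homeomorph (Homeomorph.subLeft x)
  have hpd : ∀ y, partialDeriv i φ y = -partialDeriv i ρ (x - y) := fun y => by
    have : HasFDerivAt φ ((fderiv ℝ ρ (x - y)).comp (-ContinuousLinearMap.id ℝ (Space N))) y :=
      (hρs.differentiable (by simp) (x - y)).hasFDerivAt.comp y
        ((hasFDerivAt_id y).const_sub x)
    rw [partialDeriv, this.fderiv]
    simp [partialDeriv]
  have hw := w.2 i φ hφs hφc
  have s1 : ∫ y, ((partialDeriv i ρ y : ℝ) : ℂ) * h1Fn w (x - y)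
      = ∫ y, ((partialDeriv i ρ (x - y) : ℝ) : ℂ) * h1Fn w y := by
    rw [← integral_sub_left_eq_self _ volume x]
    simp
  have s2 : mollify n (h1Grad w i) x = ∫ y, ((φ y : ℝ) : ℂ) * h1Grad w i y := by
    rw [mollify, ← integral_sub_left_eq_self _ volume x]
    simp [φ, hρ]
  rw [s1, s2]
  simp only [hpd, Complex.ofReal_neg, neg_mul, integral_neg] at hw
  exact neg_injective hw

/-- A smooth exponential weight. -/
noncomputable def expWeight (κ : ℝ) (x : Space N) : ℝ := Real.exp (-κ * Real.sqrt (1 + ‖x‖ ^ 2))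

lemma expWeight_pos (κ : ℝ) (x : Space N) : 0 < expWeight κ x := Real.exp_pos _

lemma hasFDerivAt_expWeight (κ : ℝ) (x : Space N) :
    HasFDerivAt (expWeight κ : Space N → ℝ)
      (expWeight κ x • (-κ) • (1 / (2 * Real.sqrt (1 + ‖x‖ ^ 2))) • (2 : ℕ) • innerSL ℝ x) x := by
  have h0 : (1 + ‖x‖ ^ 2) ≠ 0 := by positivity
  have h1 : HasFDerivAt (fun x : Space N => 1 + ‖x‖ ^ 2) ((2 : ℕ) • innerSL ℝ x) x :=
    (hasStrictFDerivAt_norm_sq x).hasFDerivAt.const_add 1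
  exact ((h1.sqrt h0).const_mul (-κ)).exp

lemma contDiff_expWeight (κ : ℝ) : ContDiff ℝ 1 (expWeight κ : Space N → ℝ) :=
  (contDiff_const.mul ((contDiff_const.add (contDiff_norm_sq ℝ)).sqrt
    fun x => by positivity)).exp

lemma norm_fderiv_expWeight_le {κ : ℝ} (hκ : 0 < κ) (x : Space N) :
    ‖fderiv ℝ (expWeight κ) x‖ ≤ κ * expWeight κ x := by
  rw [(hasFDerivAt_expWeight κ x).fderiv, norm_smul, norm_smul, norm_smul, ← Nat.cast_smul_eq_nsmul ℝ,
    norm_smul, innerSL_apply_norm, Real.norm_of_nonneg (expWeight_pos κ x).le, norm_neg,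
    Real.norm_of_nonneg hκ.le, Real.norm_of_nonneg (by positivity),
    Real.norm_of_nonneg (by positivity)]
  have h1 : ‖x‖ ≤ Real.sqrt (1 + ‖x‖ ^ 2) := Real.le_sqrt_of_sq_le (by linarith)
  have h2 : 1 / (2 * Real.sqrt (1 + ‖x‖ ^ 2)) * (((2 : ℕ) : ℝ) * ‖x‖) ≤ 1 := by
    rw [one_div, inv_mul_le_iff₀ (by positivity)]
    push_cast
    linarith
  have h3 := expWeight_pos κ x
  calc _ ≤ expWeight κ x * (κ * 1) := by gcongr
    _ = _ := by ring

lemma expWeight_le (κ : ℝ) (hκ : 0 < κ) (x : Space N) :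
    expWeight κ x ≤ Real.exp (-κ * ‖x‖) := by
  refine Real.exp_le_exp.2 ?_
  have h1 : ‖x‖ ≤ Real.sqrt (1 + ‖x‖ ^ 2) := Real.le_sqrt_of_sq_le (by linarith)
  nlinarith

lemma le_expWeight (κ : ℝ) (hκ : 0 < κ) (x : Space N) :
    Real.exp (-κ) * Real.exp (-κ * ‖x‖) ≤ expWeight κ x := by
  rw [← Real.exp_add]
  refine Real.exp_le_exp.2 ?_
  have h1 : Real.sqrt (1 + ‖x‖ ^ 2) ≤ 1 + ‖x‖ := by
    rw [Real.sqrt_le_iff]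
    constructor
    · positivity
    · nlinarith [norm_nonneg x]
  nlinarith

lemma expDecay_expWeight {κ : ℝ} (hκ : 0 < κ) : ExpDecay (expWeight κ : Space N → ℝ) :=
  (expDecay_exp hκ).mono 1 fun x => by
    rw [Real.norm_of_nonneg (expWeight_pos κ x).le, Real.norm_of_nonneg (Real.exp_pos _).le,
      one_mul]
    exact expWeight_le κ hκ x

/-- In dimension one this is the fundamental theorem of calculus, carried from `ℝ` to `Space 1` by
the measure-preserving isometry `L`. -/
lemma enorm_le_lintegral_fderiv {u : Space 1 → ℂ} (hu : ContDiff ℝ 1 u)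
    (hc : HasCompactSupport u) (x : Space 1) : ‖u x‖ₑ ≤ ∫⁻ y, ‖fderiv ℝ u y‖ₑ := by
  let L : ℝ →L[ℝ] Space 1 := (ContinuousLinearMap.id ℝ ℝ).smulRight (stdVec 0)
  have hL : ∀ t, L t = WithLp.toLp 2 ((MeasurableEquiv.funUnique (Fin 1) ℝ).symm t) := fun t => by
    ext i
    fin_cases i
    simp [L, stdVec]
  have hmp : MeasurePreserving (fun t => L t) volume volume := by
    have := (PiLp.volume_preserving_toLp (Fin 1)).comp
      ((volume_preserving_funUnique (Fin 1) ℝ).symm)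
    rwa [show (fun t => L t) = _ from funext hL]
  have hx : x = L (x 0) := by
    ext i
    fin_cases i
    simp [L, stdVec]
  have hLs : ContDiff ℝ 1 (fun t => u (L t)) := hu.comp L.contDiff
  have hLi : Isometry L := AddMonoidHomClass.isometry_of_norm L fun t => by
    simp [L, norm_smul, norm_stdVec]
  have hLc : HasCompactSupport (fun t => u (L t)) :=
    hc.comp_isClosedEmbedding hLi.isClosedEmbedding
  have h := hLc.enorm_le_lintegral_Ici_deriv hLs (x 0)
  rw [← hx] at h
  refine h.trans ((setLIntegral_le_lintegral _ _).trans ?_)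
  rw [← hmp.lintegral_comp (hu.continuous_fderiv one_ne_zero).enorm.measurable]
  refine lintegral_mono fun t => ?_
  have hd : HasDerivAt (fun t => u (L t)) (fderiv ℝ u (L t) (stdVec 0)) t := by
    have := ((hu.differentiable one_ne_zero (L t)).hasFDerivAt.comp t L.hasFDerivAt).hasDerivAt
    simpa [L, Function.comp_def] using this
  rw [hd.deriv]
  have h3 := (fderiv ℝ u (L t)).le_opNorm (stdVec 0)
  rw [norm_stdVec, mul_one] at h3
  exact enorm_le_iff_norm_le.2 h3

/-- The Sobolev inequality for test functions, in the form used for weighted estimates. -/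
lemma exists_sobolev_exponents (hN : 1 ≤ N) {q : ℝ} (hq : 2 ≤ q)
    (hq' : 3 ≤ N → q * ((N : ℝ) - 2) < 2 * N) :
    ∃ p p' r r' : ℝ≥0∞, ENNReal.HolderTriple r 2 p ∧ ENNReal.HolderTriple r' p' (ENNReal.ofReal q) ∧
      ∃ C : ℝ≥0∞, C ≠ ⊤ ∧ ∀ u : Space N → ℂ, ContDiff ℝ 1 u → HasCompactSupport u →
        eLpNorm u p' volume ≤ C * eLpNorm (fderiv ℝ u) p volume := by
  rcases hN.eq_or_lt with rfl | hN2
  -- In one dimension the gradient in `L¹` bounds the supremum; Hölder with a weight in `L²` reaches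
  -- `L¹` from `L²`, and a weight in `L^q` reaches `L^q` from `L^∞`.
  · refine ⟨1, ⊤, 2, ENNReal.ofReal q, ⟨?_⟩, ⟨by simp⟩, 1, by simp, fun u hu hc => ?_⟩
    · rw [ENNReal.inv_two_add_inv_two, inv_one]
    · rw [one_mul, eLpNorm_one_eq_lintegral_enorm, eLpNorm_exponent_top]
      exact eLpNormEssSup_le_of_ae_enorm_bound
        (Eventually.of_forall fun x => enorm_le_lintegral_fderiv hu hc x)
  · have hN0 : (2 : ℝ) ≤ N := by exact_mod_cast hN2
    have hlt : q * ((N : ℝ) - 2) < 2 * N := by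
      rcases (show 2 ≤ N from hN2).eq_or_lt with h | h
      · rw [← h]; norm_num
      · exact hq' h
    have hq0 : 0 < q := by linarith
    -- This choice makes `q` the Sobolev conjugate of `p`. Strict subcriticality of `q` amounts to
    -- `p < 2`, which leaves room for a Hölder weight of exponent `r` with `1/r = 1/p - 1/2`.
    let p : ℝ := q * N / (N + q)
    have hp : 0 < p := by positivity
    have hpinv : p⁻¹ = q⁻¹ + (N : ℝ)⁻¹ := by
      simp only [p]; field_simp
    have hp1 : 1 ≤ p := by
      simp only [p]
      rw [le_div_iff₀ (by positivity)]
      nlinarith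
    have hr : 0 < p⁻¹ - 2⁻¹ := by
      rw [hpinv]
      have : 2 * ((N : ℝ) + q) - q * N > 0 := by nlinarith
      have e : q⁻¹ + (N : ℝ)⁻¹ - 2⁻¹ = (2 * ((N : ℝ) + q) - q * N) / (2 * q * N) := by
        field_simp
      rw [e]; positivity
    refine ⟨ENNReal.ofReal p, ENNReal.ofReal q, (ENNReal.ofReal (p⁻¹ - 2⁻¹))⁻¹, ⊤, ⟨?_⟩,
      ⟨by simp⟩, SNormLESNormFDerivOfEqConst ℂ (volume : Measure (Space N)) p.toNNReal,
      ENNReal.coe_ne_top, fun u hu hc => ?_⟩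
    · rw [inv_inv, ← ENNReal.ofReal_inv_of_pos hp,
        show (2 : ℝ≥0∞)⁻¹ = ENNReal.ofReal 2⁻¹ by
          rw [ENNReal.ofReal_inv_of_pos two_pos]; norm_num,
        ← ENNReal.ofReal_add hr.le (by norm_num)]
      ring_nf
    · refine eLpNorm_le_eLpNorm_fderiv_of_eq volume (p := p.toNNReal) (p' := q.toNNReal) hu hc ?_ ?_ ?_
      · rwa [Real.one_le_toNNReal]
      · simp; omega
      · rw [NNReal.coe_inv, Real.coe_toNNReal _ hp.le, Real.coe_toNNReal _ hq0.le, hpinv]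
        simp

lemma eLpNorm_h1Fn_le (w : H1 N) : eLpNorm (h1Fn w) 2 volume ≤ ENNReal.ofReal ‖w‖ := by
  have h : ‖(w : L2Tuple N) 0‖ ≤ ‖w‖ := PiLp.norm_apply_le (w : L2Tuple N) 0
  rw [Lp.norm_def] at h
  exact (ENNReal.le_ofReal_iff_toReal_le (memLp_h1Fn w).2.ne (norm_nonneg _)).2 h

lemma eLpNorm_h1Grad_le (w : H1 N) (i : Fin N) :
    eLpNorm (h1Grad w i) 2 volume ≤ ENNReal.ofReal ‖w‖ := by
  have h : ‖(w : L2Tuple N) i.succ‖ ≤ ‖w‖ := PiLp.norm_apply_le (w : L2Tuple N) i.succ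
  rw [Lp.norm_def] at h
  exact (ENNReal.le_ofReal_iff_toReal_le (memLp_h1Grad w i).2.ne (norm_nonneg _)).2 h

lemma norm_fderiv_le_sum {F : Type*} [NormedAddCommGroup F] [NormedSpace ℝ F]
    (f : Space N → F) (x : Space N) : ‖fderiv ℝ f x‖ ≤ ∑ i, ‖partialDeriv i f x‖ := by
  refine ContinuousLinearMap.opNorm_le_bound _ (Finset.sum_nonneg fun _ _ => norm_nonneg _)
    fun y => ?_
  have hy : y = ∑ i, y i • stdVec i := by
    ext j
    simp [stdVec, Finset.sum_apply, Pi.single_apply]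
  conv_lhs => rw [hy, map_sum]
  refine (norm_sum_le _ _).trans ?_
  rw [Finset.sum_mul]
  refine Finset.sum_le_sum fun i _ => ?_
  rw [map_smul, norm_smul, mul_comm]
  exact mul_le_mul_of_nonneg_left (PiLp.norm_apply_le y i) (norm_nonneg _)

/-- The Sobolev inequality is applied to cutoff times weight times mollified `w`. Hölder puts the
weight in `L^r`, which lowers the gradient exponent from `2` to `p`, and Fatou's lemma removes the
approximation. -/
lemma eLpNorm_expWeight_smul_h1Fn_le {κ : ℝ} (hκ : 0 < κ) {p p' r : ℝ≥0∞}
    [ENNReal.HolderTriple r 2 p] {C : ℝ≥0∞} (hC : C ≠ ⊤)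
    (hS : ∀ u : Space N → ℂ, ContDiff ℝ 1 u → HasCompactSupport u →
        eLpNorm u p' volume ≤ C * eLpNorm (fderiv ℝ u) p volume) :
    ∃ C' : ℝ≥0∞, C' ≠ ⊤ ∧ ∀ w : H1 N,
      eLpNorm (fun x => expWeight κ x • h1Fn w x) p' volume ≤ C' * ENNReal.ofReal ‖w‖ := by
  obtain ⟨K, hK0, hK⟩ := norm_fderiv_cutoff_le (N := N)
  have hcw : Continuous (expWeight κ : Space N → ℝ) := (contDiff_expWeight κ).continuous
  refine ⟨C * (ENNReal.ofReal (K + 1 + κ) * (eLpNorm (expWeight κ : Space N → ℝ) r volume *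
    ((N : ℝ≥0∞) + 1))), ?_, fun w => ?_⟩
  · have := ((expDecay_expWeight (N := N) hκ).memLp hcw.aestronglyMeasurable r).2.ne
    have hN : (N : ℝ≥0∞) ≠ ⊤ := ENNReal.natCast_ne_top N
    finiteness
  have hsm : ∀ n, ContDiff ℝ ∞ (mollify n (h1Fn w)) := fun n =>
    contDiff_mollify n (locallyIntegrable_h1Fn w)
  have hsm' : ∀ n i, ContDiff ℝ ∞ (mollify n (h1Grad w i)) := fun n i =>
    contDiff_mollify n ((memLp_h1Grad w i).locallyIntegrable (by norm_num))
  let u : ℕ → Space N → ℂ := fun n x =>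
    (cutoff n x * expWeight κ x) • mollify n (h1Fn w) x
  let S : ℕ → Space N → ℝ := fun n x =>
    (∑ i, ‖mollify n (h1Grad w i) x‖) + ‖mollify n (h1Fn w) x‖
  have hprod : ∀ n, ContDiff ℝ 1 (fun x : Space N => cutoff n x * expWeight κ x) := fun n =>
    ((contDiff_cutoff n).of_le (by simp)).mul (contDiff_expWeight κ)
  have hu : ∀ n, ContDiff ℝ 1 (u n) := fun n => (hprod n).smul ((hsm n).of_le (by simp))
  have huc : ∀ n, HasCompactSupport (u n) := fun n =>
    ((hasCompactSupport_cutoff n).mul_right).smul_right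
  have hSc : ∀ n, Continuous (S n) := fun n =>
    (continuous_finsetSum _ fun i _ => (hsm' n i).continuous.norm).add (hsm n).continuous.norm
  have hS0 : ∀ n x, 0 ≤ S n x := fun n x => by positivity
  -- The gradient of the weight is at most `κ` times the weight, so the weight factors out of every
  -- term of the product rule.
  have hfd : ∀ n x, ‖fderiv ℝ (u n) x‖ ≤ (K + 1 + κ) * ‖((expWeight κ : Space N → ℝ) • S n) x‖ := by
    intro n x
    have hw0 := expWeight_pos κ x
    have hd1 : DifferentiableAt ℝ (cutoff n) x := (contDiff_cutoff n).differentiable (by simp) x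
    have hd2 : DifferentiableAt ℝ (expWeight κ) x :=
      (contDiff_expWeight κ).differentiable one_ne_zero x
    have hd3 := (hsm n).differentiable (by simp) x
    have e1 : ‖fderiv ℝ (fun x => cutoff n x * expWeight κ x) x‖ ≤ (K + κ) * expWeight κ x := by
      rw [fderiv_fun_mul hd1 hd2]
      refine (norm_add_le _ _).trans ?_
      rw [norm_smul, norm_smul, Real.norm_of_nonneg (cutoff_nonneg n x),
        Real.norm_of_nonneg hw0.le]
      have h1 := mul_le_mul (cutoff_le_one n x) (norm_fderiv_expWeight_le hκ x) (norm_nonneg _)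
        zero_le_one
      have h2 := mul_le_mul_of_nonneg_left (hK n x) hw0.le
      nlinarith
    have e2 : ‖fderiv ℝ (mollify n (h1Fn w)) x‖ ≤ ∑ i, ‖mollify n (h1Grad w i) x‖ := by
      refine (norm_fderiv_le_sum _ x).trans (le_of_eq ?_)
      simp only [partialDeriv_mollify_h1]
    have e3 : ‖cutoff n x * expWeight κ x‖ ≤ expWeight κ x := by
      rw [Real.norm_of_nonneg (mul_nonneg (cutoff_nonneg n x) hw0.le)]
      exact mul_le_of_le_one_left hw0.le (cutoff_le_one n x)
    have e4 : ‖fderiv ℝ (u n) x‖ ≤ expWeight κ x * (∑ i, ‖mollify n (h1Grad w i) x‖)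
        + (K + κ) * expWeight κ x * ‖mollify n (h1Fn w) x‖ := by
      simp only [u]
      rw [fderiv_fun_smul ((hprod n).differentiable one_ne_zero x) hd3]
      refine (norm_add_le _ _).trans ?_
      rw [norm_smul, ContinuousLinearMap.norm_smulRight_apply]
      exact add_le_add (mul_le_mul e3 e2 (norm_nonneg _) hw0.le)
        (mul_le_mul_of_nonneg_right e1 (norm_nonneg _))
    refine e4.trans ?_
    rw [Pi.smul_apply', smul_eq_mul, Real.norm_of_nonneg (mul_nonneg hw0.le (hS0 n x))]
    have p1 : 0 ≤ expWeight κ x * ∑ i, ‖mollify n (h1Grad w i) x‖ := by positivity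
    have p2 : 0 ≤ expWeight κ x * ‖mollify n (h1Fn w) x‖ := by positivity
    simp only [S]
    nlinarith
  have hSn : ∀ n, eLpNorm (S n) 2 volume ≤ ((N : ℝ≥0∞) + 1) * ENNReal.ofReal ‖w‖ := by
    intro n
    have e0 : eLpNorm (fun x => ‖mollify n (h1Fn w) x‖) 2 volume ≤ ENNReal.ofReal ‖w‖ := by
      rw [eLpNorm_norm]
      exact (eLpNorm_mollify_le n (Lp.stronglyMeasurable _)).trans (eLpNorm_h1Fn_le w)
    have e1 : ∀ i, eLpNorm (fun x => ‖mollify n (h1Grad w i) x‖) 2 volume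
        ≤ ENNReal.ofReal ‖w‖ := fun i => by
      rw [eLpNorm_norm]
      exact (eLpNorm_mollify_le n (Lp.stronglyMeasurable _)).trans (eLpNorm_h1Grad_le w i)
    have e2 : eLpNorm (∑ i, fun x => ‖mollify n (h1Grad w i) x‖) 2 volume
        ≤ N * ENNReal.ofReal ‖w‖ := by
      refine (eLpNorm_sum_le (fun i _ => (hsm' n i).continuous.norm.aestronglyMeasurable)
        (by norm_num)).trans ?_
      refine (Finset.sum_le_sum fun i _ => e1 i).trans ?_
      simp
    have e3 : S n = (∑ i, fun x => ‖mollify n (h1Grad w i) x‖)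
        + fun x => ‖mollify n (h1Fn w) x‖ := by
      ext x; simp [S]
    rw [e3, add_mul, one_mul]
    refine (eLpNorm_add_le ?_ (hsm n).continuous.norm.aestronglyMeasurable (by norm_num)).trans
      (add_le_add e2 e0)
    exact Finset.aestronglyMeasurable_sum _
      fun i _ => (hsm' n i).continuous.norm.aestronglyMeasurable
  have hbound : ∀ n, eLpNorm (u n) p' volume ≤ C * (ENNReal.ofReal (K + 1 + κ) *
      (eLpNorm (expWeight κ : Space N → ℝ) r volume * ((N : ℝ≥0∞) + 1))) *
      ENNReal.ofReal ‖w‖ := by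
    intro n
    calc eLpNorm (u n) p' volume ≤ C * eLpNorm (fderiv ℝ (u n)) p volume := hS _ (hu n) (huc n)
      _ ≤ C * (ENNReal.ofReal (K + 1 + κ) * eLpNorm ((expWeight κ : Space N → ℝ) • S n) p volume) := by
          gcongr
          exact eLpNorm_le_mul_eLpNorm_of_ae_le_mul (Eventually.of_forall (hfd n)) p
      _ ≤ C * (ENNReal.ofReal (K + 1 + κ) * (eLpNorm (expWeight κ : Space N → ℝ) r volume *
            (((N : ℝ≥0∞) + 1) * ENNReal.ofReal ‖w‖))) := by
          have hh : eLpNorm ((expWeight κ : Space N → ℝ) • S n) p volume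
              ≤ eLpNorm (expWeight κ : Space N → ℝ) r volume *
                (((N : ℝ≥0∞) + 1) * ENNReal.ofReal ‖w‖) :=
            (eLpNorm_smul_le_mul_eLpNorm (q := 2) (hSc n).aestronglyMeasurable
              hcw.aestronglyMeasurable).trans (mul_le_mul_right (hSn n) _)
          exact mul_le_mul_right (mul_le_mul_right hh _) _
      _ = _ := by ring
  have hlim : ∀ᵐ x, Tendsto (fun n => u n x) atTop (𝓝 (expWeight κ x • h1Fn w x)) := by
    -- Without continuity of `w` the convergence holds only almost everywhere, by Lebesgue
    -- differentiation, for which the ratio of the two radii of the bump must stay bounded.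
    have hK2 : ∀ n, (mollifier N n).rOut ≤ 2 * (mollifier N n).rIn := fun n => by
      simp only [mollifier]; rw [mul_one_div]
    filter_upwards [ContDiffBump.ae_convolution_tendsto_right_of_locallyIntegrable
      tendsto_mollifier_rOut (Eventually.of_forall hK2) (locallyIntegrable_h1Fn w)] with x hx
    have h1 : Tendsto (fun n => cutoff n x) atTop (𝓝 1) := by
      refine tendsto_const_nhds.congr' ?_
      filter_upwards [cutoff_eventually_eq_one x] with n hn
      exact hn.eq_of_nhds.symm
    have := (h1.mul_const (expWeight κ x)).smul hx
    rw [one_mul] at this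
    exact this
  refine (Lp.eLpNorm_lim_le_liminf_eLpNorm (fun n => (hu n).continuous.aestronglyMeasurable) _
    hlim).trans ?_
  exact (liminf_le_liminf (Eventually.of_forall hbound)).trans (liminf_const _).le

/-- The Sobolev embedding of `H¹` with an exponential weight. -/
theorem exists_weighted_sobolev (hN : 1 ≤ N) {q : ℝ} (hq : 2 ≤ q)
    (hq' : 3 ≤ N → q * ((N : ℝ) - 2) < 2 * N) {κ : ℝ} (hκ : 0 < κ) :
    ∃ C : ℝ, 0 ≤ C ∧ ∀ w : H1 N,
      Integrable (fun x => ‖h1Fn w x‖ ^ q * Real.exp (-κ * ‖x‖)) ∧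
      ∫ x, ‖h1Fn w x‖ ^ q * Real.exp (-κ * ‖x‖) ≤ C * ‖w‖ ^ q := by
  obtain ⟨p, p', r, r', h1, h2, C, hC, hS⟩ := exists_sobolev_exponents hN hq hq'
  have hq0 : 0 < q := by linarith
  -- Two weights of this rate are used, one for the Sobolev step and one for the Hölder step from
  -- `p'` to `q`; the `q`-th power of their product has rate `κ`.
  have hκ' : 0 < κ / (2 * q) := by positivity
  obtain ⟨C', hC', hw⟩ := eLpNorm_expWeight_smul_h1Fn_le (r := r) hκ' hC hS
  have hcw : Continuous (expWeight (κ / (2 * q)) : Space N → ℝ) :=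
    (contDiff_expWeight _).continuous
  set D : ℝ≥0∞ := eLpNorm (expWeight (κ / (2 * q)) : Space N → ℝ) r' volume * C' with hD
  have hDt : D ≠ ⊤ := ENNReal.mul_ne_top
    ((expDecay_expWeight (N := N) hκ').memLp hcw.aestronglyMeasurable r').2.ne hC'
  refine ⟨Real.exp κ * D.toReal ^ q, by positivity, fun w => ?_⟩
  let f : Space N → ℂ := (expWeight (κ / (2 * q)) : Space N → ℝ) • fun x => expWeight (κ / (2 * q)) x • h1Fn w x
  have hfm : AEStronglyMeasurable f volume :=
    hcw.aestronglyMeasurable.smul (hcw.aestronglyMeasurable.smul (memLp_h1Fn w).1)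
  have hf : eLpNorm f (ENNReal.ofReal q) volume ≤ D * ENNReal.ofReal ‖w‖ := by
    refine (eLpNorm_smul_le_mul_eLpNorm (p := r') (q := p')
      (hcw.aestronglyMeasurable.smul (memLp_h1Fn w).1) hcw.aestronglyMeasurable).trans ?_
    rw [hD, mul_assoc]
    gcongr
    exact hw w
  have hfL : MemLp f (ENNReal.ofReal q) volume :=
    ⟨hfm, hf.trans_lt (ENNReal.mul_lt_top hDt.lt_top ENNReal.ofReal_lt_top)⟩
  have hint := hfL.integrable_norm_rpow (by simpa using hq0) ENNReal.ofReal_ne_top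
  have hfx : ∀ x, ‖f x‖ ^ (ENNReal.ofReal q).toReal = ‖h1Fn w x‖ ^ q * expWeight κ x := by
    intro x
    have h0 := (expWeight_pos (κ / (2 * q)) x).le
    rw [ENNReal.toReal_ofReal hq0.le]
    simp only [f, Pi.smul_apply']
    rw [norm_smul, norm_smul, Real.norm_of_nonneg h0, ← mul_assoc,
      Real.mul_rpow (mul_nonneg h0 h0) (norm_nonneg _), mul_comm]
    congr 1
    rw [expWeight, expWeight, ← Real.exp_add, ← Real.exp_mul]
    congr 1
    field_simp
    ring
  simp only [hfx] at hint
  have hle : ∀ x, ‖h1Fn w x‖ ^ q * Real.exp (-κ * ‖x‖)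
      ≤ Real.exp κ * (‖h1Fn w x‖ ^ q * expWeight κ x) := fun x => by
    have h3 := le_expWeight κ hκ x
    rw [Real.exp_neg, inv_mul_le_iff₀ (Real.exp_pos _)] at h3
    have h4 : 0 ≤ ‖h1Fn w x‖ ^ q := by positivity
    nlinarith [mul_le_mul_of_nonneg_left h3 h4]
  have hint2 : Integrable (fun x => ‖h1Fn w x‖ ^ q * Real.exp (-κ * ‖x‖)) := by
    refine (hint.const_mul (Real.exp κ)).mono' ?_ (Eventually.of_forall fun x => ?_)
    · exact ((memLp_h1Fn w).1.norm.aemeasurable.pow_const _).aestronglyMeasurable.mul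
        (by fun_prop)
    · rw [Real.norm_of_nonneg (by positivity)]
      exact hle x
  refine ⟨hint2, ?_⟩
  have hval := hfL.eLpNorm_eq_integral_rpow_norm (by simpa using hq0) ENNReal.ofReal_ne_top
  rw [integral_congr_ae (Eventually.of_forall hfx), ENNReal.toReal_ofReal hq0.le] at hval
  rw [hval] at hf
  have hI0 : 0 ≤ ∫ x, ‖h1Fn w x‖ ^ q * expWeight κ x :=
    integral_nonneg fun x => mul_nonneg (by positivity) (expWeight_pos _ _).le
  have hI : ∫ x, ‖h1Fn w x‖ ^ q * expWeight κ x ≤ (D.toReal * ‖w‖) ^ q := by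
    rw [← ENNReal.ofReal_toReal hDt, ← ENNReal.ofReal_mul ENNReal.toReal_nonneg,
      ENNReal.ofReal_le_ofReal_iff (by positivity)] at hf
    calc _ = ((∫ x, ‖h1Fn w x‖ ^ q * expWeight κ x) ^ q⁻¹) ^ q := by
          rw [← Real.rpow_mul hI0, inv_mul_cancel₀ hq0.ne', Real.rpow_one]
      _ ≤ _ := Real.rpow_le_rpow (by positivity) hf hq0.le
  calc ∫ x, ‖h1Fn w x‖ ^ q * Real.exp (-κ * ‖x‖)
      ≤ ∫ x, Real.exp κ * (‖h1Fn w x‖ ^ q * expWeight κ x) :=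
        integral_mono hint2 (hint.const_mul _) hle
    _ ≤ Real.exp κ * (D.toReal * ‖w‖) ^ q := by
        rw [integral_const_mul]
        gcongr
    _ = _ := by rw [Real.mul_rpow ENNReal.toReal_nonneg (norm_nonneg _)]; ring

end Sobolev

/-! ### Decay of positive solutions of the radial equation. -/

section RadialODE

lemma antitoneOn_Ici_of_hasDerivAt {g g' : ℝ → ℝ} {a : ℝ} (h : ∀ r, a ≤ r → HasDerivAt g (g' r) r)
    (h0 : ∀ r, a ≤ r → g' r ≤ 0) : AntitoneOn g (Ici a) := by
  refine antitoneOn_of_deriv_nonpos (convex_Ici a)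
    (fun r hr => (h r hr).continuousAt.continuousWithinAt)
    (fun r hr => (h r (interior_subset hr)).differentiableAt.differentiableWithinAt) fun r hr => ?_
  rw [(h r (interior_subset hr)).deriv]
  exact h0 r (interior_subset hr)

lemma monotoneOn_Ici_of_hasDerivAt {g g' : ℝ → ℝ} {a : ℝ} (h : ∀ r, a ≤ r → HasDerivAt g (g' r) r)
    (h0 : ∀ r, a ≤ r → 0 ≤ g' r) : MonotoneOn g (Ici a) := by
  have := antitoneOn_Ici_of_hasDerivAt (g := fun r => -g r) (fun r hr => (h r hr).neg)
    fun r hr => neg_nonpos.2 (h0 r hr)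
  exact fun x hx y hy hxy => neg_le_neg_iff.1 (this hx hy hxy)

/-- The radial profile equation on `[1, ∞)`. -/
structure RadialODE (s k : ℝ) (f f' f'' : ℝ → ℝ) : Prop where
  deriv : ∀ r, 1 ≤ r → HasDerivAt f (f' r) r
  deriv2 : ∀ r, 1 ≤ r → HasDerivAt f' (f'' r) r
  pos : ∀ r, 1 ≤ r → 0 < f r
  eq : ∀ r, 1 ≤ r → f'' r + k / r * f' r = f r - f r ^ (2 * s + 1)

variable {s k : ℝ} {f f' f'' : ℝ → ℝ}

/-- Bernoulli's inequality for the power `s + 1` of `y²`. It bounds the potential part of the radial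
energy from below. -/
lemma half_sq_le_rpow {s : ℝ} (hs : 0 < s) {y : ℝ} (hy : 0 < y) :
    y ^ 2 / 2 ≤ 1 / 2 + y ^ (2 * s + 2) / (2 * s + 2) := by
  have h := one_add_mul_self_le_rpow_one_add (s := y ^ 2 - 1) (by nlinarith [sq_nonneg y])
    (p := s + 1) (by linarith)
  have e : (1 + (y ^ 2 - 1)) ^ (s + 1) = y ^ (2 * s + 2) := by
    rw [add_sub_cancel, ← Real.rpow_natCast, ← Real.rpow_mul hy.le]
    congr 1; push_cast; ring
  rw [e] at h
  have h2 : y ^ 2 / 2 - 1 / 2 ≤ y ^ (2 * s + 2) / (2 * s + 2) := by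
    rw [le_div_iff₀ (by linarith)]
    linarith
  linarith

/-- The mechanical energy `E` is dissipated by the friction term `k/r`, and its potential part is
bounded below, so the kinetic part stays bounded. -/
lemma RadialODE.deriv_bounded (h : RadialODE s k f f' f'') (hs : 0 < s) (hk : 0 ≤ k) :
    ∃ K, ∀ r, 1 ≤ r → |f' r| ≤ K := by
  let E : ℝ → ℝ := fun r => f' r ^ 2 / 2 - f r ^ 2 / 2 + f r ^ (2 * s + 2) / (2 * s + 2)
  have hE : ∀ r, 1 ≤ r → HasDerivAt E (-(k / r) * f' r ^ 2) r := by
    intro r hr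
    have h1 := h.deriv r hr
    have h2 := h.deriv2 r hr
    have h3 := h1.rpow_const (p := 2 * s + 2) (Or.inl (h.pos r hr).ne')
    have h4 := (((h2.pow 2).div_const 2).sub ((h1.pow 2).div_const 2)).add (h3.div_const (2 * s + 2))
    refine h4.congr_deriv ?_
    have h5 := h.eq r hr
    have h6 : f'' r = f r - f r ^ (2 * s + 1) - k / r * f' r := by linarith
    rw [h6, show 2 * s + 2 - 1 = 2 * s + 1 by ring]
    have : (2 * s + 2) ≠ 0 := by linarith
    push_cast
    field_simp
    ring
  have hanti := antitoneOn_Ici_of_hasDerivAt hE fun r hr => by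
    have : 0 ≤ k / r := div_nonneg hk (by linarith)
    nlinarith [sq_nonneg (f' r)]
  refine ⟨Real.sqrt (2 * E 1 + 1), fun r hr => Real.abs_le_sqrt ?_⟩
  have h1 : E r ≤ E 1 := hanti (mem_Ici.2 le_rfl) hr hr
  have h2 := half_sq_le_rpow hs (h.pos r hr)
  simp only [E] at h1 ⊢
  linarith

/-- Where `f ^ (2s) ≤ 1/2` the equation behaves like a linear one: `f` must decrease, then `f'' ≥
f/2`, and comparison of `f'²` with `f²/2` gives `f' ≤ -f/2`, hence exponential decay. The reverse
bounds of `f'` and `f''` by `f` make the derivatives decay exactly as `f` does. -/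
lemma RadialODE.decay (h : RadialODE s k f f' f'') (hs : 0 < s) (hk : 0 ≤ k)
    (hlim : Tendsto f atTop (𝓝 0)) :
    ∃ R C K : ℝ, 1 ≤ R ∧ 0 ≤ C ∧ 0 ≤ K ∧ ∀ r, R ≤ r →
      f r ≤ C * Real.exp (-(1 / 2) * r) ∧ |f' r| ≤ K * f r ∧ |f'' r| ≤ K * f r := by
  obtain ⟨R, hR1, hR⟩ : ∃ R : ℝ, 1 ≤ R ∧ ∀ r, R ≤ r → f r ^ (2 * s) ≤ 1 / 2 := by
    have h1 : Tendsto (fun r => f r ^ (2 * s)) atTop (𝓝 0) := by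
      have := hlim.rpow_const (p := 2 * s) (Or.inr (by linarith))
      rwa [Real.zero_rpow (by linarith)] at this
    have h2 := h1.eventually (Iic_mem_nhds (show (0 : ℝ) < 1 / 2 by norm_num))
    obtain ⟨R, hR⟩ := eventually_atTop.1 h2
    exact ⟨max R 1, le_max_right _ _, fun r hr => hR r ((le_max_left _ _).trans hr)⟩
  have hpos : ∀ r, R ≤ r → 0 < f r := fun r hr => h.pos r (hR1.trans hr)
  have hd1 : ∀ r, R ≤ r → HasDerivAt f (f' r) r := fun r hr => h.deriv r (hR1.trans hr)
  have hd2 : ∀ r, R ≤ r → HasDerivAt f' (f'' r) r := fun r hr => h.deriv2 r (hR1.trans hr)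
  have heq : ∀ r, R ≤ r → f'' r = f r * (1 - f r ^ (2 * s)) - k / r * f' r := fun r hr => by
    have h1 := h.eq r (hR1.trans hr)
    have h2 : f r ^ (2 * s + 1) = f r ^ (2 * s) * f r := by
      rw [Real.rpow_add (hpos r hr), Real.rpow_one]
    rw [h2] at h1
    linarith
  have hpw : ∀ r, R ≤ r → 0 ≤ f r ^ (2 * s) := fun r hr => Real.rpow_nonneg (hpos r hr).le _
  -- the derivative is negative
  have hneg : ∀ r, R ≤ r → f' r ≤ 0 := by
    by_contra! hcon
    obtain ⟨a, ha, hfa⟩ := hcon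
    -- With the integrating factor `r ^ k` a positive slope would persist forever, so `f` could not
    -- tend to zero.
    have hP : ∀ r, R ≤ r → HasDerivAt (fun r => r ^ k * f' r) (r ^ k * (f r * (1 - f r ^ (2 * s)))) r := by
      intro r hr
      have hr0 : 0 < r := by linarith
      have h1 := (Real.hasDerivAt_rpow_const (p := k) (Or.inl hr0.ne')).mul (hd2 r hr)
      refine h1.congr_deriv ?_
      rw [heq r hr, Real.rpow_sub_one hr0.ne']
      field_simp
      ring
    have hmono := monotoneOn_Ici_of_hasDerivAt hP fun r hr => by
      have := hR r hr
      have h3 := hpos r hr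
      have h4 : 0 ≤ 1 - f r ^ (2 * s) := by linarith
      have hr0 : 0 < r := by linarith
      positivity
    have hpos' : ∀ r, a ≤ r → 0 ≤ f' r := by
      intro r hr
      have h1 : a ^ k * f' a ≤ r ^ k * f' r := hmono ha (ha.trans hr) hr
      have ha0 : 0 < a := by linarith
      have hr0 : 0 < r := by linarith
      have h2 : 0 < r ^ k * f' r := lt_of_lt_of_le (by positivity) h1
      exact (pos_of_mul_pos_right h2 (Real.rpow_nonneg hr0.le k)).le
    have hm := monotoneOn_Ici_of_hasDerivAt (fun r hr => hd1 r (ha.trans hr)) hpos'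
    have h1 : f a ≤ 0 := ge_of_tendsto hlim (by
      filter_upwards [eventually_ge_atTop a] with r hr
      exact hm (mem_Ici.2 le_rfl) hr hr)
    linarith [hpos a ha]
  have hconv : ∀ r, R ≤ r → f r / 2 ≤ f'' r := fun r hr => by
    have h1 := hneg r hr
    have h2 := hR r hr
    have h3 := hpos r hr
    have h4 : 0 ≤ k / r := div_nonneg hk (by linarith)
    rw [heq r hr]
    nlinarith
  -- The difference `f'² - f²/2` is antitone and is bounded below by `-f²/2`, which tends to zero;
  -- no limit of `f'` is needed.
  have hD : ∀ r, R ≤ r → f r ^ 2 / 2 ≤ f' r ^ 2 := by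
    intro r hr
    have hDd : ∀ r, R ≤ r → HasDerivAt (fun r => f' r ^ 2 - f r ^ 2 / 2)
        (2 * f' r * (f'' r - f r / 2)) r := fun r hr => by
      refine (((hd2 r hr).pow 2).sub (((hd1 r hr).pow 2).div_const 2)).congr_deriv ?_
      push_cast
      ring
    have hanti := antitoneOn_Ici_of_hasDerivAt hDd fun r hr => by
      nlinarith [hneg r hr, hconv r hr]
    have hl : Tendsto (fun r => -(f r ^ 2 / 2)) atTop (𝓝 0) := by
      simpa using ((hlim.pow 2).div_const 2).neg
    have := le_of_tendsto hl (b := f' r ^ 2 - f r ^ 2 / 2) ?_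
    · linarith
    · filter_upwards [eventually_ge_atTop r] with t ht
      have := hanti hr (hr.trans ht) ht
      simp only at this
      nlinarith [sq_nonneg (f' t)]
  have hle : ∀ r, R ≤ r → f' r ≤ -(1 / 2) * f r := fun r hr => by
    have h1 := hD r hr
    have h2 := hneg r hr
    have h3 := hpos r hr
    have : (1 / 2 * f r) ^ 2 ≤ (-f' r) ^ 2 := by nlinarith
    have := (abs_le_of_sq_le_sq' this (by linarith)).2
    linarith
  have hexp : ∀ r, R ≤ r → f r ≤ f R * Real.exp (1 / 2 * R) * Real.exp (-(1 / 2) * r) := by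
    have hGd : ∀ r, R ≤ r → HasDerivAt (fun r => f r * Real.exp (1 / 2 * r))
        ((f' r + 1 / 2 * f r) * Real.exp (1 / 2 * r)) r := fun r hr => by
      have h1 : HasDerivAt (fun r : ℝ => 1 / 2 * r) (1 / 2) r := by
        simpa using (hasDerivAt_id r).const_mul (1 / 2 : ℝ)
      refine ((hd1 r hr).mul h1.exp).congr_deriv ?_
      ring
    have hanti := antitoneOn_Ici_of_hasDerivAt hGd fun r hr =>
      mul_nonpos_of_nonpos_of_nonneg (by linarith [hle r hr]) (Real.exp_pos _).le
    intro r hr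
    have h1 := hanti (mem_Ici.2 le_rfl) hr hr
    simp only at h1
    have h2 : Real.exp (1 / 2 * r) * Real.exp (-(1 / 2) * r) = 1 := by
      rw [← Real.exp_add]; simp
    calc f r = f r * Real.exp (1 / 2 * r) * Real.exp (-(1 / 2) * r) := by rw [mul_assoc, h2, mul_one]
      _ ≤ _ := by gcongr
  have hkr : ∀ r, R ≤ r → k / r * (-f' r) ≤ k * (-f' r) := fun r hr => by
    have : k / r ≤ k := div_le_self hk (hR1.trans hr)
    exact mul_le_mul_of_nonneg_right this (by linarith [hneg r hr])
  have hup : ∀ r, R ≤ r → f'' r ≤ f r + k * (-f' r) := fun r hr => by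
    rw [heq r hr]
    have h1 := hkr r hr
    have h2 := mul_nonneg (hpos r hr).le (hpw r hr)
    nlinarith
  have hanti_f := antitoneOn_Ici_of_hasDerivAt hd1 hneg
  -- A lower bound for `f'` at some `c` in `(r, r + 1)` comes from the mean value theorem and `f >
  -- 0`. The antitone quantity `f' + k f - f(r) t` carries it back from `c` to `r`.
  have hder : ∀ r, R ≤ r → -f' r ≤ (k + 2) * f r := by
    intro r hr
    have h1 : ∀ t, r ≤ t → f' t + k * f t - f r * t ≤ f' r + k * f r - f r * r := by
      have := antitoneOn_Ici_of_hasDerivAt (a := r) (g := fun t => f' t + k * f t - f r * t)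
        (g' := fun t => f'' t + k * f' t - f r)
        (fun t ht => by
          have hm := (((hd2 t (hr.trans ht)).add ((hd1 t (hr.trans ht)).const_mul k)).sub
            ((hasDerivAt_id t).const_mul (f r)))
          exact hm.congr_deriv (by simp))
        (fun t ht => by
          have a1 := hup t (hr.trans ht)
          have a2 : f t ≤ f r := hanti_f hr (hr.trans ht) ht
          linarith)
      exact fun t ht => this (mem_Ici.2 le_rfl) ht ht
    obtain ⟨c, hc, hc2⟩ := exists_hasDerivAt_eq_slope f f' (show r < r + 1 by linarith)
      (fun t ht => (hd1 t (hr.trans ht.1)).continuousAt.continuousWithinAt)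
      (fun t ht => hd1 t (hr.trans ht.1.le))
    have h2 := h1 c hc.1.le
    have h3 := hpos (r + 1) (by linarith)
    have h4 := hpos c (by linarith [hc.1])
    have h5 := hpos r hr
    rw [add_sub_cancel_left, div_one] at hc2
    have h6 : f r * (c - r) ≤ f r * 1 := by gcongr; linarith [hc.2]
    have h7 : 0 ≤ k * f c := by positivity
    nlinarith
  refine ⟨R, f R * Real.exp (1 / 2 * R), (1 + k) * (k + 2), hR1,
    mul_nonneg (hpos R le_rfl).le (Real.exp_pos _).le, by positivity, fun r hr =>
      ⟨hexp r hr, ?_, ?_⟩⟩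
  · rw [abs_of_nonpos (hneg r hr)]
    have h1 := hder r hr
    have h2 := mul_nonneg hk (mul_nonneg (by linarith : 0 ≤ k + 2) (hpos r hr).le)
    nlinarith
  · rw [abs_of_nonneg (by linarith [hconv r hr, hpos r hr])]
    have h1 := hder r hr
    have h2 := hup r hr
    have h3 := hpos r hr
    have h4 := mul_le_mul_of_nonneg_left h1 hk
    nlinarith

end RadialODE

/-! ### Exponential decay of the soliton profile and its derivatives. -/

section Profile

variable {N : ℕ}

lemma hasFDerivAt_norm_of_ne_zero {x : Space N} (hx : x ≠ 0) :
    HasFDerivAt (fun y : Space N => ‖y‖) (‖x‖⁻¹ • innerSL ℝ x) x := by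
  have hx0 : 0 < ‖x‖ := norm_pos_iff.2 hx
  have h := (hasStrictFDerivAt_norm_sq x).hasFDerivAt.sqrt (by positivity)
  simp only [Real.sqrt_sq (norm_nonneg _)] at h
  refine h.congr_fderiv ?_
  ext y
  simp only [_root_.smul_apply, smul_eq_mul, nsmul_eq_mul]
  push_cast
  field_simp

/-- Lipschitz functions in `L²` vanish at infinity. -/
lemma exists_forall_lt_of_lipschitz_of_memLp {η : Space N → ℝ} {K : ℝ} (hK : 0 ≤ K)
    (hlip : ∀ x y, |η x - η y| ≤ K * ‖x - y‖) (h2 : MemLp η 2 volume) {δ : ℝ} (hδ : 0 < δ) :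
    ∃ R : ℝ, ∀ x, R ≤ ‖x‖ → η x < δ := by
  by_contra! hcon
  have hint : Integrable (fun x => η x ^ 2) := h2.integrable_sq
  -- On a ball of this radius around a point with `η ≥ δ` the Lipschitz bound keeps `η ≥ δ/2`. Each
  -- such ball carries the fixed amount `c` of `∫ η²`, which is impossible in the tails.
  set ρ : ℝ := δ / (2 * (K + 1)) with hρ
  have hρ0 : 0 < ρ := by positivity
  set c : ℝ := (δ / 2) ^ 2 * (volume : Measure (Space N)).real (Metric.ball 0 ρ) with hc
  have hvol : 0 < (volume : Measure (Space N)).real (Metric.ball 0 ρ) :=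
    ENNReal.toReal_pos (Metric.measure_ball_pos _ _ hρ0).ne' measure_ball_lt_top.ne
  have hc0 : 0 < c := by positivity
  have htail : Tendsto (fun n : ℕ => ∫ x in {x : Space N | (n : ℝ) ≤ ‖x‖}, η x ^ 2) atTop (𝓝 0) := by
    have := tendsto_setIntegral_of_antitone (μ := volume) (f := fun x => η x ^ 2)
      (s := fun n : ℕ => {x : Space N | (n : ℝ) ≤ ‖x‖})
      (fun n => measurableSet_le measurable_const measurable_norm)
      (fun m n hmn x hx => by
        have h3 : (m : ℝ) ≤ n := by exact_mod_cast hmn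
        exact h3.trans hx) ⟨0, hint.integrableOn⟩
    have he : (⋂ n : ℕ, {x : Space N | (n : ℝ) ≤ ‖x‖}) = ∅ := by
      ext x
      simp only [mem_iInter, mem_ofPred_eq, mem_empty_iff_false, iff_false, not_forall, not_le]
      exact exists_nat_gt ‖x‖
    rwa [he, setIntegral_empty] at this
  obtain ⟨n, hn⟩ := (htail.eventually (Iio_mem_nhds hc0)).exists
  obtain ⟨x, hx, hηx⟩ := hcon (n + ρ)
  have hsub : Metric.ball x ρ ⊆ {x : Space N | (n : ℝ) ≤ ‖x‖} := fun y hy => by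
    rw [mem_ball_iff_norm'] at hy
    have := norm_sub_norm_le x y
    simp only [mem_ofPred_eq]
    linarith
  have hlow : ∀ y ∈ Metric.ball x ρ, (δ / 2) ^ 2 ≤ η y ^ 2 := fun y hy => by
    rw [mem_ball_iff_norm'] at hy
    have h1 := (le_abs_self _).trans (hlip x y)
    have h3 : K * ‖x - y‖ ≤ K * ρ := by gcongr
    have h4 : K * ρ ≤ δ / 2 := by
      rw [hρ, mul_div_assoc', div_le_div_iff₀ (by positivity) (by norm_num)]
      nlinarith
    have h5 : δ / 2 ≤ η y := by linarith
    gcongr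
  have h1 : c ≤ ∫ y in Metric.ball x ρ, η y ^ 2 := by
    have := setIntegral_ge_of_const_le_real (μ := volume) measurableSet_ball measure_ball_lt_top.ne hlow
      hint.integrableOn
    rw [hc]
    convert this using 2
    simp only [Measure.real]
    rw [Measure.addHaar_ball_center volume x]
  have h3 : ∫ y in Metric.ball x ρ, η y ^ 2 ≤ ∫ x in {x : Space N | (n : ℝ) ≤ ‖x‖}, η x ^ 2 :=
    setIntegral_mono_set hint.integrableOn (Eventually.of_forall fun x => sq_nonneg _)
      hsub.eventuallyLE
  have h4 : ∫ x in {x : Space N | (n : ℝ) ≤ ‖x‖}, η x ^ 2 < c := hn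
  linarith

lemma laplacian_eq_sum {η : Space N → ℝ} (hη : ContDiff ℝ 2 η) (x : Space N) :
    Δ η x = ∑ i, partialDeriv i (partialDeriv i η) x := by
  rw [InnerProductSpace.laplacian_eq_iteratedFDeriv_orthonormalBasis η
    (EuclideanSpace.basisFun (Fin N) ℝ)]
  refine Finset.sum_congr rfl fun i _ => ?_
  have hd : DifferentiableAt ℝ (fderiv ℝ η) x :=
    (hη.fderiv_right (m := 1) (by norm_num)).differentiable one_ne_zero x
  have : HasFDerivAt (partialDeriv i η) ((ContinuousLinearMap.apply ℝ ℝ (stdVec i)).comp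
      (fderiv ℝ (fderiv ℝ η) x)) x :=
    (ContinuousLinearMap.apply ℝ ℝ (stdVec i)).hasFDerivAt.comp x hd.hasFDerivAt
  rw [iteratedFDeriv_two_apply, partialDeriv, this.fderiv]
  simp [stdVec]

lemma contDiff_partialDeriv {η : Space N → ℝ} (hη : ContDiff ℝ 2 η) (i : Fin N) :
    ContDiff ℝ 1 (partialDeriv i η) :=
  (hη.fderiv_right (m := 1) (by norm_num)).clm_apply contDiff_const

/-- The restriction of a radial function to a ray. -/
noncomputable def radialPart (η : Space N → ℝ) (i₀ : Fin N) (r : ℝ) : ℝ := η (r • stdVec i₀)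

section

variable {s : ℝ} {η : Space N → ℝ} (hη : IsSolitonProfile s η) (i₀ : Fin N)

include hη

lemma contDiff_radialPart : ContDiff ℝ 2 (radialPart η i₀) :=
  hη.contDiff.comp (contDiff_id.smul contDiff_const)

lemma radialPart_norm (x : Space N) : radialPart η i₀ ‖x‖ = η x :=
  hη.radial _ _ (by simp [norm_smul, norm_stdVec])

lemma hasDerivAt_radialPart (r : ℝ) :
    HasDerivAt (radialPart η i₀) (deriv (radialPart η i₀) r) r :=
  ((contDiff_radialPart hη i₀).differentiable (by simp) r).hasDerivAt

lemma hasDerivAt_deriv_radialPart (r : ℝ) :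
    HasDerivAt (deriv (radialPart η i₀)) (deriv (deriv (radialPart η i₀)) r) r := by
  have h : ContDiff ℝ 1 (deriv (radialPart η i₀)) :=
    ((contDiff_succ_iff_deriv (n := 1)).1 (contDiff_radialPart hη i₀)).2.2
  exact (h.differentiable one_ne_zero r).hasDerivAt

lemma fderiv_eq_radialPart {x : Space N} (hx : x ≠ 0) :
    fderiv ℝ η x = (deriv (radialPart η i₀) ‖x‖ * ‖x‖⁻¹) • innerSL ℝ x := by
  have h := (hasDerivAt_radialPart hη i₀ ‖x‖).comp_hasFDerivAt x (hasFDerivAt_norm_of_ne_zero hx)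
  have e : (radialPart η i₀ ∘ fun y => ‖y‖) = η := funext fun y => radialPart_norm hη i₀ y
  rw [e] at h
  rw [h.fderiv, smul_smul]

lemma partialDeriv_eq_radialPart {x : Space N} (hx : x ≠ 0) (j : Fin N) :
    partialDeriv j η x = deriv (radialPart η i₀) ‖x‖ * ‖x‖⁻¹ * x j := by
  rw [partialDeriv, fderiv_eq_radialPart hη i₀ hx]
  simp [stdVec, EuclideanSpace.inner_single_right]

lemma norm_fderiv_eq_radialPart {x : Space N} (hx : x ≠ 0) :
    ‖fderiv ℝ η x‖ = |deriv (radialPart η i₀) ‖x‖| := by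
  have : 0 < ‖x‖ := norm_pos_iff.2 hx
  rw [fderiv_eq_radialPart hη i₀ hx, norm_smul, innerSL_apply_norm, norm_mul, norm_inv, norm_norm,
    mul_assoc, inv_mul_cancel₀ this.ne', mul_one, Real.norm_eq_abs]

lemma fderiv_partialDeriv_eq_radialPart {x : Space N} (hx : x ≠ 0) (j : Fin N) :
    fderiv ℝ (partialDeriv j η) x =
      (deriv (radialPart η i₀) ‖x‖ * ‖x‖⁻¹) • (EuclideanSpace.proj (𝕜 := ℝ) j : Space N →L[ℝ] ℝ)
      + (x j * ((deriv (deriv (radialPart η i₀)) ‖x‖ * ‖x‖⁻¹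
          - deriv (radialPart η i₀) ‖x‖ * (‖x‖ ^ 2)⁻¹) * ‖x‖⁻¹)) • innerSL ℝ x := by
  have hx0 : 0 < ‖x‖ := norm_pos_iff.2 hx
  have h1 : HasDerivAt (fun r => deriv (radialPart η i₀) r * r⁻¹)
      (deriv (deriv (radialPart η i₀)) ‖x‖ * ‖x‖⁻¹
        + deriv (radialPart η i₀) ‖x‖ * (-(‖x‖ ^ 2)⁻¹)) ‖x‖ :=
    (hasDerivAt_deriv_radialPart hη i₀ ‖x‖).mul (hasDerivAt_inv hx0.ne')
  have h2 := h1.comp_hasFDerivAt x (hasFDerivAt_norm_of_ne_zero hx)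
  have h3 : HasFDerivAt (fun y : Space N => y j) (EuclideanSpace.proj (𝕜 := ℝ) j) x :=
    (EuclideanSpace.proj (𝕜 := ℝ) j : Space N →L[ℝ] ℝ).hasFDerivAt
  have h4 := h2.mul h3
  have e : partialDeriv j η =ᶠ[𝓝 x] fun y =>
      ((fun r => deriv (radialPart η i₀) r * r⁻¹) ∘ fun y => ‖y‖) y * y j := by
    filter_upwards [isOpen_ne.mem_nhds hx] with y hy
    exact partialDeriv_eq_radialPart hη i₀ hy j
  rw [e.fderiv_eq]
  refine h4.fderiv.trans ?_
  simp only [smul_smul, Function.comp]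
  congr 2
  ring

/-- The trace of the Hessian at a point of the ray: the diagonal part gives `N f'/r`, the rank-one
part gives `f'' - f'/r`. -/
lemma radialODE_radialPart :
    RadialODE s (N - 1) (radialPart η i₀) (deriv (radialPart η i₀))
      (deriv (deriv (radialPart η i₀))) where
  deriv r _ := hasDerivAt_radialPart hη i₀ r
  deriv2 r _ := hasDerivAt_deriv_radialPart hη i₀ r
  pos r _ := hη.pos _
  eq r hr := by
    have hr0 : 0 < r := by linarith
    set x : Space N := r • stdVec i₀ with hx
    have hnx : ‖x‖ = r := by rw [hx, norm_smul, norm_stdVec, mul_one, Real.norm_of_nonneg hr0.le]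
    have hx0 : x ≠ 0 := norm_pos_iff.1 (by rw [hnx]; exact hr0)
    have h := hη.equation x
    rw [laplacian_eq_sum hη.contDiff] at h
    have hi : ∀ i, partialDeriv i (partialDeriv i η) x = deriv (radialPart η i₀) r * r⁻¹
        + (deriv (deriv (radialPart η i₀)) r * r⁻¹ - deriv (radialPart η i₀) r * (r ^ 2)⁻¹) * r⁻¹
          * (x i) ^ 2 := fun i => by
      rw [partialDeriv, fderiv_partialDeriv_eq_radialPart hη i₀ hx0, hnx]
      simp [stdVec, EuclideanSpace.inner_single_right]
      ring
    have hs2 : ∑ i, (x i) ^ 2 = r ^ 2 := by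
      rw [← hnx, EuclideanSpace.norm_sq_eq]
      simp
    simp only [hi, Finset.sum_add_distrib, ← Finset.mul_sum, hs2] at h
    simp only [Finset.sum_const, Finset.card_univ, Fintype.card_fin, nsmul_eq_mul] at h
    have h5 : radialPart η i₀ r = η x := rfl
    have e : (deriv (deriv (radialPart η i₀)) r * r⁻¹ - deriv (radialPart η i₀) r * (r ^ 2)⁻¹) * r⁻¹
        * r ^ 2 = deriv (deriv (radialPart η i₀)) r - deriv (radialPart η i₀) r * r⁻¹ := by
      field_simp
    rw [e] at h
    rw [h5, div_eq_mul_inv]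
    linarith

end

/-- A bound for a ratio near infinity and continuity give a global bound. -/
lemma exists_le_mul_of_continuous {η g : Space N → ℝ} (hη : Continuous η) (hpos : ∀ x, 0 < η x)
    (hg : Continuous g) {R K : ℝ} (h : ∀ x, R ≤ ‖x‖ → g x ≤ K * η x) :
    ∃ K', 0 ≤ K' ∧ ∀ x, g x ≤ K' * η x := by
  obtain ⟨C, hC⟩ := (isCompact_closedBall (0 : Space N) R).exists_bound_of_continuousOn
    (f := fun x => g x / η x) (hg.div hη fun x => (hpos x).ne').continuousOn
  refine ⟨max (max C K) 0, le_max_right _ _, fun x => ?_⟩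
  rcases le_total R ‖x‖ with hx | hx
  · refine (h x hx).trans (mul_le_mul_of_nonneg_right ?_ (hpos x).le)
    exact (le_max_right _ _).trans (le_max_left _ _)
  · have h1 := (le_abs_self _).trans (hC x (by simpa using hx))
    rw [div_le_iff₀ (hpos x)] at h1
    refine h1.trans (mul_le_mul_of_nonneg_right ?_ (hpos x).le)
    exact (le_max_left _ _).trans (le_max_left _ _)

/-- Decay of the soliton profile and of its derivatives up to order two. -/
theorem IsSolitonProfile.estimates {s : ℝ} {η : Space N → ℝ} (hη : IsSolitonProfile s η)
    (hN : 1 ≤ N) (hs : 0 < s) :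
    ExpDecay η ∧ (∃ K, 0 ≤ K ∧ ∀ x, ‖fderiv ℝ η x‖ ≤ K * η x) ∧
      ∀ j, ∃ K, 0 ≤ K ∧ ∀ x, ‖fderiv ℝ (partialDeriv j η) x‖ ≤ K * η x := by
  let i₀ : Fin N := ⟨0, hN⟩
  have hk : (0 : ℝ) ≤ N - 1 := by
    have : (1 : ℝ) ≤ N := by exact_mod_cast hN
    linarith
  have hode := radialODE_radialPart hη i₀
  have hcf : Continuous (fderiv ℝ η) := hη.contDiff.continuous_fderiv (by simp)
  have hne : ∀ {x : Space N} {R : ℝ}, 1 ≤ R → R ≤ ‖x‖ → x ≠ 0 := fun h1 h2 =>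
    norm_pos_iff.1 (by linarith)
  -- The bound on `f'` outside the unit ball and continuity inside give a global Lipschitz constant;
  -- with square integrability this forces `η` to vanish at infinity.
  have hlip : ∃ K, 0 ≤ K ∧ ∀ x y, |η x - η y| ≤ K * ‖x - y‖ := by
    obtain ⟨K, hK⟩ := hode.deriv_bounded hs hk
    obtain ⟨K', hK0, hK'⟩ := exists_le_mul_of_continuous (η := fun _ : Space N => (1 : ℝ))
      (g := fun x => ‖fderiv ℝ η x‖) continuous_const (fun _ => one_pos) hcf.norm (R := 1) (K := K)
      fun x hx => by
        rw [norm_fderiv_eq_radialPart hη i₀ (hne le_rfl hx), mul_one]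
        exact hK _ hx
    refine ⟨K', hK0, fun x y => ?_⟩
    exact convex_univ.norm_image_sub_le_of_norm_fderiv_le (𝕜 := ℝ)
      (fun x _ => hη.contDiff.differentiable (by simp) x)
      (fun x _ => by simpa using hK' x) (mem_univ y) (mem_univ x)
  obtain ⟨K, hK0, hK⟩ := hlip
  have hlim : Tendsto (radialPart η i₀) atTop (𝓝 0) := by
    rw [Metric.tendsto_atTop]
    intro ε hε
    obtain ⟨R, hR⟩ := exists_forall_lt_of_lipschitz_of_memLp hK0 hK hη.memLp hε
    refine ⟨max R 0, fun r hr => ?_⟩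
    rw [Real.dist_0_eq_abs, abs_of_pos (show 0 < radialPart η i₀ r from hη.pos _)]
    refine hR _ ?_
    rw [norm_smul, norm_stdVec, mul_one, Real.norm_of_nonneg ((le_max_right _ _).trans hr)]
    exact (le_max_left _ _).trans hr
  obtain ⟨R, C, K₁, hR1, hC, hK₁, hb⟩ := hode.decay hs hk hlim
  refine ⟨?_, ?_, fun j => ?_⟩
  · obtain ⟨C', hC'0, hC'⟩ := exists_le_mul_of_continuous
      (η := fun x : Space N => Real.exp (-(1 / 2) * ‖x‖)) (g := η) (by fun_prop)
      (fun x => Real.exp_pos _) hη.contDiff.continuous (R := R) (K := C) fun x hx => by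
        rw [← radialPart_norm hη i₀]
        exact (hb _ hx).1
    refine ⟨C', 1 / 2, hC'0, by norm_num, fun x => ?_⟩
    rw [Real.norm_of_nonneg (hη.pos x).le]
    exact hC' x
  · refine exists_le_mul_of_continuous hη.contDiff.continuous hη.pos hcf.norm (R := R) (K := K₁)
      fun x hx => ?_
    rw [norm_fderiv_eq_radialPart hη i₀ (hne hR1 hx), ← radialPart_norm hη i₀]
    exact (hb _ hx).2.1
  -- In the Hessian of a radial function `f'/r` occurs twice and `f''` once, and each is at most `K₁
  -- η` for `r ≥ 1`; hence the factor three.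
  · refine exists_le_mul_of_continuous hη.contDiff.continuous hη.pos
      ((contDiff_partialDeriv hη.contDiff j).continuous_fderiv one_ne_zero).norm (R := R)
      (K := 3 * K₁) fun x hx => ?_
    obtain ⟨-, h1, h2⟩ := hb _ hx
    have hr1 : 1 ≤ ‖x‖ := hR1.trans hx
    have hr0 : 0 < ‖x‖ := by linarith
    have hinv : ‖x‖⁻¹ ≤ 1 := inv_le_one_of_one_le₀ hr1
    rw [fderiv_partialDeriv_eq_radialPart hη i₀ (hne hR1 hx), ← radialPart_norm hη i₀ x]
    set d1 := deriv (radialPart η i₀) ‖x‖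
    set d2 := deriv (deriv (radialPart η i₀)) ‖x‖
    have hproj : ‖(EuclideanSpace.proj (𝕜 := ℝ) j : Space N →L[ℝ] ℝ)‖ ≤ 1 :=
      ContinuousLinearMap.opNorm_le_bound _ zero_le_one fun y => by
        simpa using PiLp.norm_apply_le y j
    refine (norm_add_le _ _).trans ?_
    rw [norm_smul, norm_smul, innerSL_apply_norm, norm_mul, norm_mul, norm_mul, norm_inv, norm_norm,
      Real.norm_eq_abs d1]
    have e1 : |d1| * ‖x‖⁻¹ * ‖(EuclideanSpace.proj (𝕜 := ℝ) j : Space N →L[ℝ] ℝ)‖ ≤ |d1| * 1 * 1 := by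
      gcongr
    have e2 : ‖d2 * ‖x‖⁻¹ - d1 * (‖x‖ ^ 2)⁻¹‖ ≤ (|d2| + |d1|) * ‖x‖⁻¹ := by
      refine (norm_sub_le _ _).trans ?_
      rw [norm_mul, norm_mul, norm_inv, norm_norm, norm_inv, norm_pow, norm_norm, sq, mul_inv, add_mul,
        Real.norm_eq_abs, Real.norm_eq_abs]
      gcongr
      exact mul_le_of_le_one_left (by positivity) hinv
    have e3 : ‖x j‖ * (‖d2 * ‖x‖⁻¹ - d1 * (‖x‖ ^ 2)⁻¹‖ * ‖x‖⁻¹) * ‖x‖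
        ≤ ‖x‖ * ((|d2| + |d1|) * ‖x‖⁻¹ * ‖x‖⁻¹) * ‖x‖ := by
      gcongr
      exact PiLp.norm_apply_le x j
    have e4 : ‖x‖ * ((|d2| + |d1|) * ‖x‖⁻¹ * ‖x‖⁻¹) * ‖x‖ = |d2| + |d1| := by
      field_simp
    linarith

end Profile

/-! ### The modulation `T_σ`: derivatives, integrals and weak gradients. -/

section Transf

variable {N : ℕ} {s : ℝ}

/-- The derivative of a modulated function along a path of parameters and base points. -/
lemma hasDerivWithinAt_transf {Z : Space N → ℂ} (hZ : Differentiable ℝ Z) {S : Set ℝ} {t : ℝ}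
    {σ : ℝ → Param N} {x : ℝ → Space N} {a' v' x' : Space N} {γ' μ' : ℝ}
    (ha : HasDerivWithinAt (fun τ => (σ τ).a) a' S t)
    (hv : HasDerivWithinAt (fun τ => (σ τ).v) v' S t)
    (hγ : HasDerivWithinAt (fun τ => (σ τ).γ) γ' S t)
    (hμ : HasDerivWithinAt (fun τ => (σ τ).μ) μ' S t)
    (hx : HasDerivWithinAt x x' S t) (hμ0 : 0 < (σ t).μ) :
    HasDerivWithinAt (fun τ => transf s (σ τ) Z (x τ))
      (transf s (σ t) (fun y =>
        Complex.I * ((1 / 2 * (inner ℝ v' (x t - (σ t).a) + inner ℝ (σ t).v (x' - a')) + γ' : ℝ) : ℂ)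
          * Z y + ((μ' / (σ t).μ * (1 / (2 * s)) : ℝ) : ℂ) * Z y
        + fderiv ℝ Z y ((μ' / (σ t).μ / 2) • y + Real.sqrt (σ t).μ • (x' - a'))) (x t)) S t := by
  have hxa := hx.sub ha
  have hθ : HasDerivWithinAt (fun τ => (1 / 2) * inner ℝ (σ τ).v (x τ - (σ τ).a) + (σ τ).γ)
      (1 / 2 * (inner ℝ v' (x t - (σ t).a) + inner ℝ (σ t).v (x' - a')) + γ') S t := by
    have h1 := ((hv.inner ℝ hxa).const_mul (1 / 2)).add hγ
    refine h1.congr_deriv ?_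
    simp only [Pi.sub_apply]
    ring
  have hexp : HasDerivWithinAt (fun τ => Complex.exp (Complex.I *
      (((1 / 2) * inner ℝ (σ τ).v (x τ - (σ τ).a) + (σ τ).γ : ℝ) : ℂ)))
      (Complex.exp (Complex.I *
        (((1 / 2) * inner ℝ (σ t).v (x t - (σ t).a) + (σ t).γ : ℝ) : ℂ)) * (Complex.I *
        ((1 / 2 * (inner ℝ v' (x t - (σ t).a) + inner ℝ (σ t).v (x' - a')) + γ' : ℝ) : ℂ))) S t :=
    (hθ.ofReal_comp.const_mul Complex.I).cexp
  have hpow : HasDerivWithinAt (fun τ => (((σ τ).μ ^ (1 / (2 * s)) : ℝ) : ℂ))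
      ((((σ t).μ ^ (1 / (2 * s)) * (μ' / (σ t).μ * (1 / (2 * s))) : ℝ)) : ℂ) S t := by
    have h1 := hμ.rpow_const (p := 1 / (2 * s)) (Or.inl hμ0.ne')
    refine (h1.congr_deriv ?_).ofReal_comp
    rw [Real.rpow_sub_one hμ0.ne']
    field_simp
  have hsq : HasDerivWithinAt (fun τ => Real.sqrt (σ τ).μ)
      (Real.sqrt (σ t).μ * (μ' / (σ t).μ / 2)) S t := by
    refine (hμ.sqrt hμ0.ne').congr_deriv ?_
    have h2 : Real.sqrt (σ t).μ ≠ 0 := (Real.sqrt_pos.2 hμ0).ne'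
    have h3 := Real.sq_sqrt hμ0.le
    field_simp
    rw [h3]
  have harg : HasDerivWithinAt (fun τ => Real.sqrt (σ τ).μ • (x τ - (σ τ).a))
      ((μ' / (σ t).μ / 2) • (Real.sqrt (σ t).μ • (x t - (σ t).a))
        + Real.sqrt (σ t).μ • (x' - a')) S t := by
    refine (hsq.smul hxa).congr_deriv ?_
    simp only [Pi.sub_apply]
    rw [add_comm, mul_comm, mul_smul]
  have hZc := (hZ (Real.sqrt (σ t).μ • (x t - (σ t).a))).hasFDerivAt.comp_hasDerivWithinAt t harg
  refine ((hexp.mul hpow).mul hZc).congr_deriv ?_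
  simp only [transf, Function.comp, Pi.mul_apply]
  push_cast
  ring

lemma contDiff_transf (σ : Param N) {Z : Space N → ℂ} {n : ℕ∞} (hZ : ContDiff ℝ n Z) :
    ContDiff ℝ n (transf s σ Z) := by
  have h1 : ContDiff ℝ n (fun x : Space N => x - σ.a) := contDiff_id.sub contDiff_const
  have h2 : ContDiff ℝ n (fun x : Space N =>
      (((1 / 2) * inner ℝ σ.v (x - σ.a) + σ.γ : ℝ) : ℂ)) :=
    Complex.ofRealCLM.contDiff.comp
      ((contDiff_const.mul (contDiff_const.inner ℝ h1)).add contDiff_const)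
  exact ((contDiff_const.mul h2).cexp.mul contDiff_const).mul (hZ.comp (h1.const_smul _))

lemma partialDeriv_eq_of_hasDerivAt {F : Type*} [NormedAddCommGroup F] [NormedSpace ℝ F]
    {f : Space N → F} {x : Space N} (hf : DifferentiableAt ℝ f x) {y : Space N} {d : F}
    (h : HasDerivWithinAt (fun τ : ℝ => f (x + τ • y)) d univ 0) : fderiv ℝ f x y = d := by
  have h1 : HasDerivAt (fun τ : ℝ => x + τ • y) y 0 := by
    simpa using ((hasDerivAt_id (0 : ℝ)).smul_const y).const_add x
  have h2 : HasFDerivAt f (fderiv ℝ f x) (x + (0 : ℝ) • y) := by simpa using hf.hasFDerivAt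
  exact (h2.comp_hasDerivAt 0 h1).unique (hasDerivWithinAt_univ.1 h)

/-- The path derivative with frozen parameters and a base point moving along `e`. The first term
comes from the phase. -/
lemma fderiv_transf (σ : Param N) (hμ : 0 < σ.μ) {Z : Space N → ℂ} (hZ : ContDiff ℝ 1 Z)
    (x e : Space N) :
    fderiv ℝ (transf s σ Z) x e = transf s σ (fun y =>
      Complex.I * ((inner ℝ σ.v e / 2 : ℝ) : ℂ) * Z y + Real.sqrt σ.μ * fderiv ℝ Z y e) x := by
  refine partialDeriv_eq_of_hasDerivAt ((contDiff_transf σ hZ).differentiable one_ne_zero x) ?_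
  have h1 : HasDerivWithinAt (fun τ : ℝ => x + τ • e) e univ 0 := by
    have := (((hasDerivAt_id (0 : ℝ)).smul_const e).const_add x).hasDerivWithinAt (s := univ)
    rw [one_smul] at this
    exact this
  have h := hasDerivWithinAt_transf (s := s) (hZ.differentiable one_ne_zero) (S := univ) (t := 0)
    (σ := fun _ => σ) (hasDerivWithinAt_const _ _ _) (hasDerivWithinAt_const _ _ _)
    (hasDerivWithinAt_const _ _ _) (hasDerivWithinAt_const _ _ _) h1 hμ
  refine h.congr_deriv ?_
  simp only [transf, zero_smul, add_zero, inner_zero_left, zero_add, sub_zero, zero_div, map_smul,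
    Complex.real_smul]
  push_cast
  ring

lemma partialDeriv_transf (σ : Param N) (hμ : 0 < σ.μ) {Z : Space N → ℂ} (hZ : ContDiff ℝ 1 Z)
    (i : Fin N) (x : Space N) :
    partialDeriv i (transf s σ Z) x = transf s σ (fun y =>
      Complex.I * ((σ.v i / 2 : ℝ) : ℂ) * Z y + Real.sqrt σ.μ * partialDeriv i Z y) x := by
  rw [partialDeriv, fderiv_transf σ hμ hZ]
  simp [stdVec, EuclideanSpace.inner_single_right, partialDeriv]

lemma norm_transf (σ : Param N) (hμ : 0 < σ.μ) (Z : Space N → ℂ) (x : Space N) :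
    ‖transf s σ Z x‖ = σ.μ ^ (1 / (2 * s)) * ‖Z (Real.sqrt σ.μ • (x - σ.a))‖ := by
  rw [transf, norm_mul, norm_mul, mul_comm Complex.I, Complex.norm_exp_ofReal_mul_I, one_mul,
    Complex.norm_real, Real.norm_of_nonneg (Real.rpow_nonneg hμ.le _)]

lemma ExpDecay.transf (σ : Param N) (hμ : 0 < σ.μ) {Z : Space N → ℂ} (hZ : ExpDecay Z) :
    ExpDecay (transf s σ Z) :=
  (hZ.comp_affine (Real.sqrt_pos.2 hμ) σ.a).mono (σ.μ ^ (1 / (2 * s)))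
    fun x => (norm_transf σ hμ Z x).le

lemma DecayC1.transf (σ : Param N) (hμ : 0 < σ.μ) {Z : Space N → ℂ} (hZ : DecayC1 Z) :
    DecayC1 (transf s σ Z) := by
  refine ⟨contDiff_transf σ hZ.contDiff, hZ.decay.transf σ hμ, ?_⟩
  have h : ∀ i, ExpDecay (fun x => ‖partialDeriv i (_root_.transf s σ Z) x‖) := fun i => by
    have h1 : ExpDecay (fun y => Complex.I * ((σ.v i / 2 : ℝ) : ℂ) * Z y
        + Real.sqrt σ.μ * partialDeriv i Z y) :=
      (hZ.decay.mono ‖Complex.I * ((σ.v i / 2 : ℝ) : ℂ)‖ fun x => (norm_mul _ _).le).add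
        ((hZ.decay_partialDeriv i).mono ‖(Real.sqrt σ.μ : ℂ)‖ fun x => (norm_mul _ _).le)
    refine ((h1.transf (s := s) σ hμ).norm).mono 1 fun x => ?_
    rw [partialDeriv_transf σ hμ hZ.contDiff, one_mul]
  refine (ExpDecay.sum Finset.univ fun i _ => h i).mono 1 fun x => ?_
  rw [one_mul, Real.norm_of_nonneg (Finset.sum_nonneg fun _ _ => norm_nonneg _)]
  exact norm_fderiv_le_sum _ x

lemma quasiMeasurePreserving_affine {c : ℝ} (hc : c ≠ 0) (a : Space N) :
    Measure.QuasiMeasurePreserving (fun x : Space N => c • (x - a)) volume volume := by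
  have h1 : Measure.QuasiMeasurePreserving (fun x : Space N => c • x) volume volume :=
    ⟨measurable_const_smul c, by
      rw [Measure.map_addHaar_smul volume hc]
      exact Measure.smul_absolutelyContinuous⟩
  exact h1.comp (measurePreserving_sub_right volume a).quasiMeasurePreserving

lemma integral_comp_affine {F : Type*} [NormedAddCommGroup F] [NormedSpace ℝ F] (f : Space N → F)
    {c : ℝ} (hc : 0 < c) (a : Space N) :
    ∫ x, f (c • (x - a)) = (c ^ N)⁻¹ • ∫ x, f x := by
  rw [integral_sub_right_eq_self (fun x => f (c • x)) a, Measure.integral_comp_smul_of_nonneg _ _ _ (hR := hc.le)]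
  simp

lemma transf_ae_eq (σ : Param N) (hμ : 0 < σ.μ) {f g : Space N → ℂ} (h : f =ᵐ[volume] g) :
    transf s σ f =ᵐ[volume] transf s σ g := by
  have := (quasiMeasurePreserving_affine (Real.sqrt_pos.2 hμ).ne' σ.a).ae_eq_comp h
  filter_upwards [this] with x hx
  simp only [Function.comp] at hx
  rw [transf, transf, hx]

lemma aestronglyMeasurable_transf (σ : Param N) (hμ : 0 < σ.μ) {f : Space N → ℂ}
    (hf : AEStronglyMeasurable f volume) : AEStronglyMeasurable (transf s σ f) volume := by
  have h1 := hf.comp_quasiMeasurePreserving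
    (quasiMeasurePreserving_affine (Real.sqrt_pos.2 hμ).ne' σ.a)
  refine AEStronglyMeasurable.mul (Continuous.aestronglyMeasurable ?_) h1
  exact ((continuous_const.mul (Complex.continuous_ofReal.comp ((continuous_const.mul
    (continuous_const.inner (continuous_id.sub continuous_const))).add
    continuous_const))).cexp).mul continuous_const

lemma memLp_transf (σ : Param N) (hμ : 0 < σ.μ) {f : Space N → ℂ} (hf : MemLp f 2 volume) :
    MemLp (transf s σ f) 2 volume := by
  rw [memLp_two_iff_integrable_sq_norm (aestronglyMeasurable_transf σ hμ hf.1)]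
  have h1 := ((memLp_two_iff_integrable_sq_norm hf.1).1 hf).comp_smul (Real.sqrt_pos.2 hμ).ne'
  have h2 := (h1.comp_sub_right σ.a).const_mul ((σ.μ ^ (1 / (2 * s))) ^ 2)
  refine h2.congr (Eventually.of_forall fun x => ?_)
  simp only [norm_transf σ hμ, mul_pow]

/-- The scaling factor of the pairing of two modulated functions. -/
lemma integral_transf_mul_conj (σ : Param N) (hμ : 0 < σ.μ) (l u v : Space N → ℂ) :
    ∫ x, l x * transf s σ u x * conj (transf s σ v x)
      = ((σ.μ ^ (1 / s - N / 2) : ℝ) : ℂ) *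
        ∫ y, l (σ.a + (Real.sqrt σ.μ)⁻¹ • y) * u y * conj (v y) := by
  have hq : 0 < Real.sqrt σ.μ := Real.sqrt_pos.2 hμ
  have h1 := integral_comp_affine
    (fun y => ((σ.μ ^ (1 / s) : ℝ) : ℂ) * (l (σ.a + (Real.sqrt σ.μ)⁻¹ • y) * u y * conj (v y))) hq σ.a
  have h2 : ∀ x, l x * transf s σ u x * conj (transf s σ v x) = ((σ.μ ^ (1 / s) : ℝ) : ℂ) *
      (l (σ.a + (Real.sqrt σ.μ)⁻¹ • (Real.sqrt σ.μ • (x - σ.a))) * u (Real.sqrt σ.μ • (x - σ.a))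
        * conj (v (Real.sqrt σ.μ • (x - σ.a)))) := fun x => by
    rw [smul_smul, inv_mul_cancel₀ hq.ne', one_smul, add_sub_cancel]
    simp only [transf, map_mul, Complex.conj_ofReal]
    have e1 : ∀ θ : ℝ, Complex.exp (Complex.I * (θ : ℂ)) * conj (Complex.exp (Complex.I * (θ : ℂ))) = 1 := by
      intro θ
      rw [Complex.mul_conj, Complex.normSq_eq_norm_sq, mul_comm Complex.I,
        Complex.norm_exp_ofReal_mul_I]
      simp
    have e2 : ((σ.μ ^ (1 / s) : ℝ) : ℂ) = ((σ.μ ^ (1 / (2 * s)) : ℝ) : ℂ) * ((σ.μ ^ (1 / (2 * s)) : ℝ) : ℂ) := by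
      rw [← Complex.ofReal_mul, ← Real.rpow_add hμ]
      congr 2
      rcases eq_or_ne s 0 with rfl | h0
      · simp
      · field_simp
        norm_num
    rw [e2]
    linear_combination (l x * ((σ.μ ^ (1 / (2 * s)) : ℝ) : ℂ) * ((σ.μ ^ (1 / (2 * s)) : ℝ) : ℂ)
      * u (Real.sqrt σ.μ • (x - σ.a)) * conj (v (Real.sqrt σ.μ • (x - σ.a)))) *
      e1 ((1 / 2) * inner ℝ σ.v (x - σ.a) + σ.γ)
  simp only [h2]
  rw [h1, integral_const_mul, Complex.real_smul, ← mul_assoc, ← Complex.ofReal_mul]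
  congr 2
  have h3 : Real.sqrt σ.μ ^ N = σ.μ ^ ((N : ℝ) / 2) := by
    rw [Real.sqrt_eq_rpow, ← Real.rpow_natCast, ← Real.rpow_mul hμ.le]
    congr 1; ring
  rw [h3, Real.rpow_sub hμ, div_eq_mul_inv (_ ^ _), mul_comm]

lemma integral_transf_mul_conj' (σ : Param N) (hμ : 0 < σ.μ) (u v : Space N → ℂ) :
    ∫ x, transf s σ u x * conj (transf s σ v x)
      = ((σ.μ ^ (1 / s - N / 2) : ℝ) : ℂ) * ∫ y, u y * conj (v y) := by
  have := integral_transf_mul_conj (s := s) σ hμ (fun _ => 1) u v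
  simpa using this

lemma symp_transf (σ : Param N) (hμ : 0 < σ.μ) (u v : Space N → ℂ) :
    symp (transf s σ u) (transf s σ v) = σ.μ ^ (1 / s - N / 2) * symp u v := by
  rw [symp, integral_transf_mul_conj' σ hμ, Complex.im_ofReal_mul]
  rfl

/-- The weak gradient of a modulated element of `H¹`. -/
lemma h1Grad_transf (σ : Param N) (hμ : 0 < σ.μ) {ψ u : H1 N}
    (h : h1Fn ψ =ᵐ[volume] transf s σ (h1Fn u)) (i : Fin N) :
    h1Grad ψ i =ᵐ[volume] transf s σ (fun y =>
      Complex.I * ((σ.v i / 2 : ℝ) : ℂ) * h1Fn u y + Real.sqrt σ.μ * h1Grad u i y) := by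
  have hq : 0 < Real.sqrt σ.μ := Real.sqrt_pos.2 hμ
  have hqc : (Real.sqrt σ.μ : ℂ) ≠ 0 := by exact_mod_cast hq.ne'
  have hmem : MemLp (fun y => Complex.I * ((σ.v i / 2 : ℝ) : ℂ) * h1Fn u y
      + Real.sqrt σ.μ * h1Grad u i y) 2 volume :=
    ((memLp_h1Fn u).const_mul _).add ((memLp_h1Grad u i).const_mul _)
  refine ae_eq_of_integral_contDiff_smul_eq ((memLp_h1Grad ψ i).locallyIntegrable (by norm_num))
    ((memLp_transf σ hμ hmem).locallyIntegrable (by norm_num)) fun φ hφ hc => ?_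
  -- The modulation is undone on the test function: `Φ` is `φ` times the phase, read in the frame of
  -- `u`. The chain rule is applied only to `C¹` functions, and `u` enters only through
  -- `integral_partialDeriv_mul`.
  let θ : Space N → ℂ := fun x =>
    Complex.exp (Complex.I * (((1 / 2) * inner ℝ σ.v (x - σ.a) + σ.γ : ℝ) : ℂ))
  let Ψ : Space N → ℂ := fun x => θ x * (φ x : ℂ)
  let Φ : Space N → ℂ := fun y => Ψ (σ.a + (Real.sqrt σ.μ)⁻¹ • y)
  have hθ : ContDiff ℝ 1 θ :=
    (contDiff_const.mul (Complex.ofRealCLM.contDiff.comp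
      ((contDiff_const.mul (contDiff_const.inner ℝ (contDiff_id.sub contDiff_const))).add
        contDiff_const))).cexp
  have hφ1 : ContDiff ℝ 1 (fun x => (φ x : ℂ)) :=
    Complex.ofRealCLM.contDiff.comp (hφ.of_le (by simp))
  have hΨ : ContDiff ℝ 1 Ψ := hθ.mul hφ1
  have hΦ : ContDiff ℝ 1 Φ := hΨ.comp (contDiff_const.add (contDiff_const_smul _))
  have hΨc : HasCompactSupport Ψ :=
    (hc.comp_left (g := fun r : ℝ => (r : ℂ)) Complex.ofReal_zero).mul_left
  have hΦc : HasCompactSupport Φ := by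
    have h1 : HasCompactSupport (fun y => Ψ (σ.a + y)) := hΨc.comp_homeomorph (Homeomorph.addLeft σ.a)
    exact h1.comp_smul (inv_ne_zero hq.ne')
  have hΦd := hΦ.decayC1 hΦc
  have hθd : ∀ x, partialDeriv i θ x = Complex.I * ((σ.v i / 2 : ℝ) : ℂ) * θ x := fun x => by
    have h1 : HasFDerivAt (fun x : Space N => (1 / 2) * inner ℝ σ.v (x - σ.a) + σ.γ)
        ((1 / 2 : ℝ) • innerSL ℝ σ.v) x := by
      have := ((innerSL ℝ σ.v).hasFDerivAt.comp x ((hasFDerivAt_id x).sub_const σ.a)).const_mul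
        (1 / 2 : ℝ)
      exact this.add_const _
    have h2 := ((Complex.ofRealCLM.hasFDerivAt.comp x h1).const_mul Complex.I).cexp
    have h3 : HasFDerivAt θ _ x := h2
    rw [partialDeriv, h3.fderiv]
    simp [stdVec, EuclideanSpace.inner_single_right, θ]
    ring
  have hΨd : ∀ x, partialDeriv i Ψ x = θ x * ((partialDeriv i φ x : ℝ) : ℂ)
      + Complex.I * ((σ.v i / 2 : ℝ) : ℂ) * Ψ x := fun x => by
    have h1 := partialDeriv_ofReal (hφ.differentiable (by simp) x) i
    have h2 : partialDeriv i Ψ x = θ x * partialDeriv i (fun x => (φ x : ℂ)) x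
        + partialDeriv i θ x * (φ x : ℂ) := by
      simp only [partialDeriv, Ψ]
      rw [fderiv_fun_mul (hθ.differentiable one_ne_zero x) (hφ1.differentiable one_ne_zero x)]
      simp [mul_comm]
    rw [h2, h1, hθd]
    ring
  have hΦp : ∀ y, (Real.sqrt σ.μ : ℂ) * partialDeriv i Φ y
      = partialDeriv i Ψ (σ.a + (Real.sqrt σ.μ)⁻¹ • y) := fun y => by
    have h1 : HasFDerivAt Φ ((fderiv ℝ Ψ (σ.a + (Real.sqrt σ.μ)⁻¹ • y)).comp
        ((Real.sqrt σ.μ)⁻¹ • ContinuousLinearMap.id ℝ (Space N))) y :=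
      (hΨ.differentiable one_ne_zero _).hasFDerivAt.comp y
        ((((Real.sqrt σ.μ)⁻¹ • ContinuousLinearMap.id ℝ (Space N)).hasFDerivAt).const_add σ.a)
    rw [partialDeriv, h1.fderiv]
    simp [partialDeriv]
    field_simp
  have hinv : ∀ x, σ.a + (Real.sqrt σ.μ)⁻¹ • (Real.sqrt σ.μ • (x - σ.a)) = x := fun x => by
    rw [smul_smul, inv_mul_cancel₀ hq.ne', one_smul, add_sub_cancel]
  have key : ∀ g : Space N → ℂ, ∫ x, θ x * (φ x : ℂ) * ((σ.μ ^ (1 / (2 * s)) : ℝ) : ℂ)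
      * g (Real.sqrt σ.μ • (x - σ.a)) = (Real.sqrt σ.μ ^ N)⁻¹ •
        (((σ.μ ^ (1 / (2 * s)) : ℝ) : ℂ) * ∫ y, Φ y * g y) := fun g => by
    rw [← integral_const_mul, ← integral_comp_affine _ hq σ.a]
    refine integral_congr_ae (Eventually.of_forall fun x => ?_)
    simp only [Φ, Ψ, hinv]
    ring
  have key2 : ∫ x, ((partialDeriv i φ x : ℝ) : ℂ) * transf s σ (h1Fn u) x
      = (Real.sqrt σ.μ ^ N)⁻¹ • (((σ.μ ^ (1 / (2 * s)) : ℝ) : ℂ) *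
        ((Real.sqrt σ.μ : ℂ) * (∫ y, partialDeriv i Φ y * h1Fn u y)
          - Complex.I * ((σ.v i / 2 : ℝ) : ℂ) * ∫ y, Φ y * h1Fn u y)) := by
    rw [← integral_const_mul, ← integral_const_mul, ← integral_sub, ← integral_const_mul,
      ← integral_comp_affine _ hq σ.a]
    · refine integral_congr_ae (Eventually.of_forall fun x => ?_)
      have h1 := hΦp (Real.sqrt σ.μ • (x - σ.a))
      rw [hinv, hΨd] at h1
      simp only [transf, Φ, hinv]
      simp only [θ] at h1
      linear_combination (-((σ.μ ^ (1 / (2 * s)) : ℝ) : ℂ) * h1Fn u (Real.sqrt σ.μ • (x - σ.a))) * h1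
    · exact (integrable_mul_L2 (hΦd.decay_partialDeriv i)
        (hΦd.continuous_partialDeriv i).aestronglyMeasurable (memLp_h1Fn u)).const_mul _
    · exact (integrable_mul_L2 hΦd.decay hΦd.continuous.aestronglyMeasurable
        (memLp_h1Fn u)).const_mul _
  have hw : ∫ x, ((partialDeriv i φ x : ℝ) : ℂ) * h1Fn ψ x = -∫ x, ((φ x : ℝ) : ℂ) * h1Grad ψ i x :=
    ψ.2 i φ hφ hc
  have hw2 : ∫ x, ((partialDeriv i φ x : ℝ) : ℂ) * h1Fn ψ x
      = ∫ x, ((partialDeriv i φ x : ℝ) : ℂ) * transf s σ (h1Fn u) x :=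
    integral_congr_ae (by filter_upwards [h] with x hx; rw [hx])
  have hR : ∫ x, φ x • transf s σ (fun y => Complex.I * ((σ.v i / 2 : ℝ) : ℂ) * h1Fn u y
      + Real.sqrt σ.μ * h1Grad u i y) x = (Real.sqrt σ.μ ^ N)⁻¹ •
        (((σ.μ ^ (1 / (2 * s)) : ℝ) : ℂ) * (Complex.I * ((σ.v i / 2 : ℝ) : ℂ) * (∫ y, Φ y * h1Fn u y)
          + (Real.sqrt σ.μ : ℂ) * ∫ y, Φ y * h1Grad u i y)) := by
    have h1 := key (fun y => Complex.I * ((σ.v i / 2 : ℝ) : ℂ) * h1Fn u y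
      + Real.sqrt σ.μ * h1Grad u i y)
    have h2 : ∫ y, Φ y * (Complex.I * ((σ.v i / 2 : ℝ) : ℂ) * h1Fn u y
        + Real.sqrt σ.μ * h1Grad u i y) = Complex.I * ((σ.v i / 2 : ℝ) : ℂ) * (∫ y, Φ y * h1Fn u y)
          + (Real.sqrt σ.μ : ℂ) * ∫ y, Φ y * h1Grad u i y := by
      rw [← integral_const_mul, ← integral_const_mul, ← integral_add]
      · refine integral_congr_ae (Eventually.of_forall fun x => ?_)
        ring
      · exact (integrable_mul_L2 hΦd.decay hΦd.continuous.aestronglyMeasurable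
          (memLp_h1Fn u)).const_mul _
      · exact (integrable_mul_L2 hΦd.decay hΦd.continuous.aestronglyMeasurable
          (memLp_h1Grad u i)).const_mul _
    rw [← h2, ← h1]
    refine integral_congr_ae (Eventually.of_forall fun x => ?_)
    simp only [transf, Complex.real_smul, θ]
    ring
  have hL : ∫ x, φ x • h1Grad ψ i x = ∫ x, ((φ x : ℝ) : ℂ) * h1Grad ψ i x := rfl
  rw [hR, hL, ← neg_eq_iff_eq_neg.2 hw, hw2, key2, integral_partialDeriv_mul u i hΦd, ← smul_neg]
  congr 1
  ring

end Transf

/-! ### Differentiating the pairing of a path with moving test functions. -/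

section Pairing

variable {N : ℕ}

lemma norm_integral_mul_le {f g : Space N → ℂ} (hf : MemLp f 2 volume) (hg : MemLp g 2 volume) :
    ‖∫ x, f x * g x‖ ≤ (eLpNorm f 2 volume).toReal * (eLpNorm g 2 volume).toReal := by
  rw [← ENNReal.toReal_mul, ← toReal_enorm]
  refine ENNReal.toReal_mono (ENNReal.mul_ne_top hf.2.ne hg.2.ne) ?_
  refine (enorm_integral_le_lintegral_enorm _).trans ?_
  have h := eLpNorm_smul_le_mul_eLpNorm (p := 2) (q := 2) (r := 1) hg.1 hf.1
  rwa [eLpNorm_one_eq_lintegral_enorm] at h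

lemma toReal_eLpNorm_h1Fn_le (w : H1 N) : (eLpNorm (h1Fn w) 2 volume).toReal ≤ ‖w‖ :=
  ENNReal.toReal_le_of_le_ofReal (norm_nonneg _) (eLpNorm_h1Fn_le w)

lemma h1Fn_sub (u w : H1 N) : h1Fn (u - w) =ᵐ[volume] fun x => h1Fn u x - h1Fn w x :=
  Lp.coeFn_sub _ _

lemma h1Fn_add (u w : H1 N) : h1Fn (u + w) =ᵐ[volume] fun x => h1Fn u x + h1Fn w x :=
  Lp.coeFn_add _ _

lemma h1Grad_add (u w : H1 N) (i : Fin N) :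
    h1Grad (u + w) i =ᵐ[volume] fun x => h1Grad u i x + h1Grad w i x :=
  Lp.coeFn_add _ _

lemma memLp_conj {f : Space N → ℂ} (hf : MemLp f 2 volume) :
    MemLp (fun x => conj (f x)) 2 volume :=
  hf.of_le (Complex.continuous_conj.comp_aestronglyMeasurable hf.1)
    (Eventually.of_forall fun x => by simp)

/-- Differentiation of the pairing of a weakly differentiable path in `H¹` with a path of test
functions. -/
lemma hasDerivWithinAt_integral_mul_conj {S : Set ℝ} {t : ℝ} {ψ : ℝ → H1 N}
    (hψ : Tendsto ψ (𝓝[S] t) (𝓝 (ψ t))) {z : ℝ → Space N → ℂ} {z' : Space N → ℂ} {D : ℂ}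
    (hD : HasDerivWithinAt (fun τ => ∫ x, h1Fn (ψ τ) x * conj (z t x)) D S t)
    (hz : ∀ x, HasDerivWithinAt (fun τ => z τ x) (z' x) S t) {B : Space N → ℝ}
    (hB : MemLp B 2 volume)
    (hzB : ∀ᶠ τ in 𝓝[S] t, ∀ x, ‖z τ x - z t x‖ ≤ |τ - t| * B x)
    (hzL : ∀ᶠ τ in 𝓝[S] t, MemLp (z τ) 2 volume) (hzt : MemLp (z t) 2 volume) :
    HasDerivWithinAt (fun τ => ∫ x, h1Fn (ψ τ) x * conj (z τ x))
      (D + ∫ x, h1Fn (ψ t) x * conj (z' x)) S t := by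
  -- With `ψ` frozen at time `t`, the difference quotients of `z` are dominated by `B`, and
  -- dominated convergence applies.
  have h2 : HasDerivWithinAt (fun τ => ∫ x, h1Fn (ψ t) x * conj (z τ x - z t x))
      (∫ x, h1Fn (ψ t) x * conj (z' x)) S t := by
    rw [hasDerivWithinAt_iff_tendsto_slope]
    have e : ∀ τ, slope (fun τ => ∫ x, h1Fn (ψ t) x * conj (z τ x - z t x)) t τ
        = ∫ x, h1Fn (ψ t) x * conj (slope (fun τ => z τ x) t τ) := fun τ => by
      simp only [slope, vsub_eq_sub, sub_self, map_zero, mul_zero, integral_zero, sub_zero]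
      rw [← integral_smul]
      refine integral_congr_ae (Eventually.of_forall fun x => ?_)
      have e0 : ∀ (r : ℝ) (p q : ℂ), r • (p * conj q) = p * conj (r • q) := fun r p q => by
        rw [Complex.real_smul, Complex.real_smul, map_mul, Complex.conj_ofReal]
        ring
      exact e0 _ _ _
    refine Tendsto.congr (fun τ => (e τ).symm) ?_
    have hle : 𝓝[S \ {t}] t ≤ 𝓝[S] t := nhdsWithin_mono _ sdiff_subset
    refine tendsto_integral_filter_of_dominated_convergence (fun x => ‖h1Fn (ψ t) x‖ * B x)
      ?_ ?_ ((memLp_h1Fn _).norm.integrable_mul hB) ?_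
    · filter_upwards [hle hzL] with τ hτ
      refine (memLp_h1Fn _).1.mul (Complex.continuous_conj.comp_aestronglyMeasurable ?_)
      exact (hτ.1.sub hzt.1).const_smul _
    · filter_upwards [hle hzB, self_mem_nhdsWithin] with τ hτ hne
      refine Eventually.of_forall fun x => ?_
      rw [norm_mul, RCLike.norm_conj]
      refine mul_le_mul_of_nonneg_left ?_ (norm_nonneg _)
      have h0 : 0 < |τ - t| := abs_pos.2 (sub_ne_zero.2 hne.2)
      rw [slope, vsub_eq_sub, norm_smul, norm_inv, Real.norm_eq_abs, inv_mul_le_iff₀ h0]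
      exact hτ x
    · refine Eventually.of_forall fun x => ?_
      have := (hasDerivWithinAt_iff_tendsto_slope.1 (hz x))
      exact ((Complex.continuous_conj.tendsto _).comp this).const_mul _
  -- The mixed increment is `o(|τ - t|)`: mere continuity of `ψ` in norm suffices because `z` is
  -- Lipschitz in `L²`.
  have h3 : HasDerivWithinAt (fun τ => ∫ x, h1Fn (ψ τ - ψ t) x * conj (z τ x - z t x)) 0 S t := by
    rw [hasDerivWithinAt_iff_tendsto_slope]
    have hle : 𝓝[S \ {t}] t ≤ 𝓝[S] t := nhdsWithin_mono _ sdiff_subset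
    have hlim : Tendsto (fun τ => ‖ψ τ - ψ t‖ * (eLpNorm B 2 volume).toReal) (𝓝[S \ {t}] t) (𝓝 0) := by
      have h1 : Tendsto (fun τ => ‖ψ τ - ψ t‖) (𝓝[S] t) (𝓝 0) :=
        tendsto_iff_norm_sub_tendsto_zero.1 hψ
      simpa using (h1.mono_left hle).mul_const ((eLpNorm B 2 volume).toReal)
    refine squeeze_zero_norm' ?_ hlim
    filter_upwards [hle hzB, hle hzL, self_mem_nhdsWithin] with τ hτ hL hne
    have h0 : 0 < |τ - t| := abs_pos.2 (sub_ne_zero.2 hne.2)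
    have hdiff : MemLp (fun x => z τ x - z t x) 2 volume := hL.sub hzt
    simp only [slope, vsub_eq_sub, sub_self, map_zero, mul_zero, integral_zero, sub_zero]
    rw [norm_smul, norm_inv, Real.norm_eq_abs, inv_mul_le_iff₀ h0]
    refine (norm_integral_mul_le (memLp_h1Fn _) (memLp_conj hdiff)).trans ?_
    have e1 : (eLpNorm (fun x => conj (z τ x - z t x)) 2 volume).toReal
        ≤ |τ - t| * (eLpNorm B 2 volume).toReal := by
      have h4 : eLpNorm (fun x => conj (z τ x - z t x)) 2 volume
          ≤ ENNReal.ofReal |τ - t| * eLpNorm B 2 volume := by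
        refine eLpNorm_le_mul_eLpNorm_of_ae_le_mul (Eventually.of_forall fun x => ?_) 2
        rw [RCLike.norm_conj]
        exact (hτ x).trans (mul_le_mul_of_nonneg_left (le_abs_self _) h0.le)
      have h5 := ENNReal.toReal_mono (ENNReal.mul_ne_top ENNReal.ofReal_ne_top hB.2.ne) h4
      rwa [ENNReal.toReal_mul, ENNReal.toReal_ofReal h0.le] at h5
    calc _ ≤ ‖ψ τ - ψ t‖ * (|τ - t| * (eLpNorm B 2 volume).toReal) :=
          mul_le_mul (toReal_eLpNorm_h1Fn_le _) e1 ENNReal.toReal_nonneg (norm_nonneg _)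
      _ = _ := by ring
  have hsum := (hD.add h2).add h3
  rw [add_zero] at hsum
  have heq : ∀ τ, MemLp (z τ) 2 volume → ∫ x, h1Fn (ψ τ) x * conj (z τ x)
      = (∫ x, h1Fn (ψ τ) x * conj (z t x)) + (∫ x, h1Fn (ψ t) x * conj (z τ x - z t x))
        + ∫ x, h1Fn (ψ τ - ψ t) x * conj (z τ x - z t x) := by
    intro τ hτ
    have hdiff : MemLp (fun x => z τ x - z t x) 2 volume := hτ.sub hzt
    have i1 : Integrable (fun x => h1Fn (ψ τ) x * conj (z t x)) :=
      (memLp_h1Fn _).integrable_mul (memLp_conj hzt)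
    have i2 : Integrable (fun x => h1Fn (ψ t) x * conj (z τ x - z t x)) :=
      (memLp_h1Fn _).integrable_mul (memLp_conj hdiff)
    have i3 : Integrable (fun x => h1Fn (ψ τ - ψ t) x * conj (z τ x - z t x)) :=
      (memLp_h1Fn _).integrable_mul (memLp_conj hdiff)
    have i12 : Integrable (fun x => h1Fn (ψ τ) x * conj (z t x)
      + h1Fn (ψ t) x * conj (z τ x - z t x)) := i1.add i2
    rw [← integral_add i1 i2, ← integral_add i12 i3]
    refine integral_congr_ae ?_
    filter_upwards [h1Fn_sub (ψ τ) (ψ t)] with x hx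
    rw [hx, map_sub]
    ring
  refine hsum.congr_of_eventuallyEq ?_ (heq t hzt)
  filter_upwards [hzL] with τ hτ
  exact heq τ hτ

set_option maxHeartbeats 800000 in
/-- Uniform bound for the derivative of a modulated function with respect to the parameters. -/
lemma exists_transf_deriv_bound {s : ℝ} (hs : 0 < s) {Z : Space N → ℂ} {C κ m M : ℝ} (hC : 0 ≤ C)
    (hκ : 0 < κ) (hZ : ∀ y, ‖Z y‖ ≤ C * Real.exp (-κ * ‖y‖))
    (hZ' : ∀ y, ‖fderiv ℝ Z y‖ ≤ C * Real.exp (-κ * ‖y‖)) (hm : 0 < m) (hM : 1 ≤ M) :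
    ∃ P, 0 ≤ P ∧ ∀ (σ : Param N) (a' v' : Space N) (γ' μ' d : ℝ) (x : Space N),
      m ≤ σ.μ → σ.μ ≤ M → ‖σ.a‖ ≤ M → ‖σ.v‖ ≤ M → ‖a'‖ ≤ d → ‖v'‖ ≤ d → |γ'| ≤ d → |μ'| ≤ d →
      ‖transf s σ (fun y =>
        Complex.I * ((1 / 2 * (inner ℝ v' (x - σ.a) + inner ℝ σ.v (0 - a')) + γ' : ℝ) : ℂ)
          * Z y + ((μ' / σ.μ * (1 / (2 * s)) : ℝ) : ℂ) * Z y
        + fderiv ℝ Z y ((μ' / σ.μ / 2) • y + Real.sqrt σ.μ • (0 - a'))) x‖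
        ≤ d * (P * ((1 + ‖x‖) * Real.exp (-(κ * Real.sqrt m) * ‖x‖))) := by
  have hM0 : 0 < M := by linarith
  -- The summands bound the phase, amplitude and dilation-translation contributions; the factor `exp
  -- (κ √m M)` is the cost of recentring the decay from `σ.a` to the origin.
  refine ⟨M ^ (1 / (2 * s)) * ((M + 1 + 1 / m * (1 / (2 * s)) + (1 / m * (M * M) + M)) *
    (C * Real.exp (κ * Real.sqrt m * M))), by positivity, ?_⟩
  intro σ a' v' γ' μ' d x h1 h2 ha hv ha' hv' hγ' hμ'
  have hμ0 : 0 < σ.μ := hm.trans_le h1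
  have hd : 0 ≤ d := (abs_nonneg _).trans hγ'
  rw [norm_transf σ hμ0]
  set y := Real.sqrt σ.μ • (x - σ.a) with hy
  have hx0 := norm_nonneg x
  have hxa : ‖x - σ.a‖ ≤ ‖x‖ + M := (norm_sub_le _ _).trans (by linarith)
  have hsq : Real.sqrt σ.μ ≤ M := by
    rw [Real.sqrt_le_left hM0.le]
    nlinarith
  have hyle : ‖y‖ ≤ M * (‖x‖ + M) := by
    rw [hy, norm_smul, Real.norm_of_nonneg (Real.sqrt_nonneg _)]
    gcongr
  have hyge : Real.sqrt m * (‖x‖ - M) ≤ ‖y‖ := by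
    rw [hy, norm_smul, Real.norm_of_nonneg (Real.sqrt_nonneg _)]
    have h3 : ‖x‖ - M ≤ ‖x - σ.a‖ := by
      have := norm_sub_norm_le x σ.a
      linarith
    calc Real.sqrt m * (‖x‖ - M) ≤ Real.sqrt m * ‖x - σ.a‖ := by gcongr
      _ ≤ _ := by gcongr
  set W := C * Real.exp (κ * Real.sqrt m * M) * Real.exp (-(κ * Real.sqrt m) * ‖x‖) with hW
  have hW0 : 0 ≤ W := by positivity
  have hexp : C * Real.exp (-κ * ‖y‖) ≤ W := by
    rw [hW, mul_assoc, ← Real.exp_add]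
    gcongr
    nlinarith
  have hZy := (hZ y).trans hexp
  have hZy' := (hZ' y).trans hexp
  have hpow : σ.μ ^ (1 / (2 * s)) ≤ M ^ (1 / (2 * s)) :=
    Real.rpow_le_rpow hμ0.le h2 (by positivity)
  have hμd : |μ' / σ.μ| ≤ d * (1 / m) := by
    rw [abs_div, abs_of_pos hμ0, div_eq_mul_one_div]
    gcongr
  have t1 : ‖Complex.I * ((1 / 2 * (inner ℝ v' (x - σ.a) + inner ℝ σ.v (0 - a')) + γ' : ℝ) : ℂ)
      * Z y‖ ≤ d * ((M + 1) * (1 + ‖x‖)) * W := by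
    rw [norm_mul, norm_mul, Complex.norm_I, one_mul, Complex.norm_real]
    have i1 : |inner ℝ v' (x - σ.a)| ≤ d * (‖x‖ + M) :=
      (abs_real_inner_le_norm _ _).trans (by gcongr)
    have i2 : |inner ℝ σ.v (0 - a')| ≤ M * d :=
      (abs_real_inner_le_norm _ _).trans (by rw [zero_sub, norm_neg]; gcongr)
    have i3 : ‖1 / 2 * (inner ℝ v' (x - σ.a) + inner ℝ σ.v (0 - a')) + γ'‖
        ≤ d * ((M + 1) * (1 + ‖x‖)) := by
      rw [Real.norm_eq_abs, abs_le]
      have := abs_le.1 i1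
      have := abs_le.1 i2
      have := abs_le.1 hγ'
      have h5 : 0 ≤ d * (M * ‖x‖) := by positivity
      have h6 : 0 ≤ d * ‖x‖ := by positivity
      constructor <;> nlinarith
    gcongr
  have t2 : ‖((μ' / σ.μ * (1 / (2 * s)) : ℝ) : ℂ) * Z y‖ ≤ d * (1 / m * (1 / (2 * s))) * (1 + ‖x‖) * W := by
    rw [norm_mul, Complex.norm_real, norm_mul, Real.norm_eq_abs,
      Real.norm_of_nonneg (by positivity : 0 ≤ 1 / (2 * s))]
    have i3 : |μ' / σ.μ| * (1 / (2 * s)) ≤ d * (1 / m * (1 / (2 * s))) * (1 + ‖x‖) := by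
      have h5 : 0 ≤ d * (1 / m) * (1 / (2 * s)) * ‖x‖ := by positivity
      have h6 : |μ' / σ.μ| * (1 / (2 * s)) ≤ d * (1 / m) * (1 / (2 * s)) := by gcongr
      linarith
    gcongr
  have t3 : ‖fderiv ℝ Z y ((μ' / σ.μ / 2) • y + Real.sqrt σ.μ • (0 - a'))‖
      ≤ d * (1 / m * (M * M) + M) * (1 + ‖x‖) * W := by
    refine ((fderiv ℝ Z y).le_opNorm _).trans ?_
    rw [mul_comm]
    refine mul_le_mul ?_ hZy' (norm_nonneg _) (by positivity)
    refine (norm_add_le _ _).trans ?_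
    rw [norm_smul _ y, norm_smul _ (0 - a'), zero_sub, norm_neg,
      Real.norm_of_nonneg (Real.sqrt_nonneg _), norm_div, Real.norm_eq_abs, Real.norm_ofNat]
    have j1 : |μ' / σ.μ| / 2 * ‖y‖ ≤ d * (1 / m) / 2 * (M * (‖x‖ + M)) := by gcongr
    have j2 : Real.sqrt σ.μ * ‖a'‖ ≤ M * d := by gcongr
    have j3 : M * (‖x‖ + M) ≤ 2 * (M * M * (1 + ‖x‖)) := by
      have : M * ‖x‖ ≤ M * M * ‖x‖ := by
        rw [mul_assoc]; exact mul_le_mul_of_nonneg_left (by nlinarith) hM0.le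
      have : 0 ≤ M * M := by positivity
      have : 0 ≤ M * M * ‖x‖ := by positivity
      linarith
    have j4 : d * (1 / m) / 2 * (M * (‖x‖ + M)) ≤ d * (1 / m) / 2 * (2 * (M * M * (1 + ‖x‖))) := by
      gcongr
    have j5 : 0 ≤ M * d * ‖x‖ := by positivity
    linarith
  have htot : ‖Complex.I * ((1 / 2 * (inner ℝ v' (x - σ.a) + inner ℝ σ.v (0 - a')) + γ' : ℝ) : ℂ)
      * Z y + ((μ' / σ.μ * (1 / (2 * s)) : ℝ) : ℂ) * Z y
      + fderiv ℝ Z y ((μ' / σ.μ / 2) • y + Real.sqrt σ.μ • (0 - a'))‖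
      ≤ d * (M + 1 + 1 / m * (1 / (2 * s)) + (1 / m * (M * M) + M)) * (1 + ‖x‖) * W := by
    exact norm_add₃_le.trans ((add_le_add (add_le_add t1 t2) t3).trans (le_of_eq (by ring)))
  calc _ ≤ M ^ (1 / (2 * s)) * (d * (M + 1 + 1 / m * (1 / (2 * s)) + (1 / m * (M * M) + M))
        * (1 + ‖x‖) * W) := by
        refine mul_le_mul hpow htot (norm_nonneg _) (by positivity)
    _ = _ := by rw [hW]; ring

lemma HasDerivWithinAt.eventually_norm_sub_le {E : Type*} [NormedAddCommGroup E] [NormedSpace ℝ E]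
    {f : ℝ → E} {f' : E} {S : Set ℝ} {t : ℝ} (h : HasDerivWithinAt f f' S t) {K : ℝ}
    (hK : ‖f'‖ < K) : ∀ᶠ τ in 𝓝[S] t, ‖f τ - f t‖ ≤ K * |τ - t| := by
  have h1 := h.limsup_norm_slope_le hK
  refine h1.mono fun τ hτ => ?_
  rcases eq_or_ne τ t with rfl | hne
  · simp
  · have h0 : 0 < ‖τ - t‖ := norm_pos_iff.2 (sub_ne_zero.2 hne)
    rw [inv_mul_lt_iff₀ h0] at hτ
    rw [mul_comm]
    exact hτ.le

/-- Modulated test functions are Lipschitz in time with exponentially decaying constant. -/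
lemma exists_transf_lipschitz {s : ℝ} (hs : 0 < s) {Z : Space N → ℂ} (hZ : DecayC1 Z) {S : Set ℝ}
    {t : ℝ} {σ : ℝ → Param N} {a' v' : Space N} {γ' μ' : ℝ}
    (ha : HasDerivWithinAt (fun τ => (σ τ).a) a' S t)
    (hv : HasDerivWithinAt (fun τ => (σ τ).v) v' S t)
    (hγ : HasDerivWithinAt (fun τ => (σ τ).γ) γ' S t)
    (hμ : HasDerivWithinAt (fun τ => (σ τ).μ) μ' S t) (hμ0 : 0 < (σ t).μ) :
    ∃ B : Space N → ℝ, MemLp B 2 volume ∧ ∀ᶠ τ in 𝓝[S] t, ∀ x,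
      ‖transf s (σ τ) Z x - transf s (σ t) Z x‖ ≤ |τ - t| * B x := by
  obtain ⟨C₁, κ₁, hC₁, hκ₁, hb₁⟩ := hZ.decay
  obtain ⟨C₂, κ₂, hC₂, hκ₂, hb₂⟩ := hZ.decay_fderiv
  set κ := min κ₁ κ₂
  have hκ : 0 < κ := lt_min hκ₁ hκ₂
  have e1 : ∀ y, ‖Z y‖ ≤ (C₁ + C₂) * Real.exp (-κ * ‖y‖) := fun y =>
    (hb₁ y).trans (by gcongr <;> [linarith; exact min_le_left _ _])
  have e2 : ∀ y, ‖fderiv ℝ Z y‖ ≤ (C₁ + C₂) * Real.exp (-κ * ‖y‖) := fun y =>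
    (hb₂ y).trans (by gcongr <;> [linarith; exact min_le_right _ _])
  set M := ‖(σ t).a‖ + ‖(σ t).v‖ + (σ t).μ + 1 with hM
  have hM1 : 1 ≤ M := by
    have := norm_nonneg (σ t).a
    have := norm_nonneg (σ t).v
    linarith
  obtain ⟨P, hP, hbd⟩ := exists_transf_deriv_bound hs (by positivity) hκ e1 e2 (half_pos hμ0) hM1
  set K := ‖a'‖ + ‖v'‖ + ‖γ'‖ + ‖μ'‖ + 1 with hK
  have hK0 : 0 < K := by positivity
  have n1 := norm_nonneg a'
  have n2 := norm_nonneg v'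
  have n3 := norm_nonneg γ'
  have n4 := norm_nonneg μ'
  set κ' := κ * Real.sqrt ((σ t).μ / 2)
  have hκ' : 0 < κ' := mul_pos hκ (Real.sqrt_pos.2 (half_pos hμ0))
  refine ⟨fun x => K * (P * ((1 + ‖x‖) * Real.exp (-κ' * ‖x‖))), ?_, ?_⟩
  · refine ExpDecay.memLp ((expDecay_exp hκ').poly (K * P) 1 fun x => ?_)
      (Continuous.aestronglyMeasurable (by fun_prop)) 2
    rw [Real.norm_of_nonneg (by positivity), Real.norm_of_nonneg (by positivity)]
    exact le_of_eq (by ring)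
  have hsmall : ∀ᶠ τ in 𝓝[S] t, K * |τ - t| ≤ min 1 ((σ t).μ / 2) := by
    have h1 : Tendsto (fun τ => K * |τ - t|) (𝓝 t) (𝓝 0) := by
      have : Continuous fun τ : ℝ => K * |τ - t| := by fun_prop
      simpa using this.tendsto t
    exact (h1.mono_left nhdsWithin_le_nhds).eventually
      (Iic_mem_nhds (lt_min one_pos (half_pos hμ0)))
  filter_upwards [hsmall, ha.eventually_norm_sub_le (show ‖a'‖ < K by linarith),
    hv.eventually_norm_sub_le (show ‖v'‖ < K by linarith),
    hγ.eventually_norm_sub_le (show ‖γ'‖ < K by linarith),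
    hμ.eventually_norm_sub_le (show ‖μ'‖ < K by linarith)] with τ hτ haτ hvτ hγτ hμτ x
  have hτ1 := hτ.trans (min_le_left _ _)
  have hτ2 := hτ.trans (min_le_right _ _)
  -- The path `σ` is differentiable only at `t`, so the mean value inequality is applied along the
  -- straight segment of parameters from `σ t` to `σ τ`. Closeness of `τ` to `t` keeps `μ` on the
  -- segment above half of its value at `t`.
  let ρ : ℝ → Param N := fun r =>
    ⟨(σ t).a + r • ((σ τ).a - (σ t).a), (σ t).v + r • ((σ τ).v - (σ t).v),
      (σ t).γ + r • ((σ τ).γ - (σ t).γ), (σ t).μ + r • ((σ τ).μ - (σ t).μ)⟩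
  have hρ0 : ρ 0 = σ t := by simp [ρ]
  have hρ1 : ρ 1 = σ τ := by simp [ρ]
  have hlin : ∀ {E : Type} [NormedAddCommGroup E] [NormedSpace ℝ E] (p q : E) (r : ℝ),
      HasDerivWithinAt (fun r : ℝ => p + r • q) q (Icc 0 1) r := fun p q r => by
    have := (((hasDerivAt_id r).smul_const q).const_add p).hasDerivWithinAt (s := Icc 0 1)
    rw [one_smul] at this
    exact this
  have hnear : ∀ {E : Type} [NormedAddCommGroup E] [NormedSpace ℝ E] (p q : E) {r d : ℝ},
      r ∈ Icc (0 : ℝ) 1 → ‖q‖ ≤ d → ‖r • q‖ ≤ d := fun p q r d hr hq => by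
    rw [norm_smul, Real.norm_of_nonneg hr.1]
    exact (mul_le_of_le_one_left (norm_nonneg _) hr.2).trans hq
  have hμr : ∀ r ∈ Icc (0 : ℝ) 1, (σ t).μ / 2 ≤ (ρ r).μ ∧ (ρ r).μ ≤ M := fun r hr => by
    have h1 := abs_le.1 ((hnear 0 _ hr hμτ).trans hτ2)
    have h2 := abs_le.1 ((hnear 0 _ hr hμτ).trans hτ1)
    simp only [ρ]
    have := norm_nonneg (σ t).a
    have := norm_nonneg (σ t).v
    constructor <;> linarith
  have hder : ∀ r ∈ Icc (0 : ℝ) 1, HasDerivWithinAt (fun r => transf s (ρ r) Z x) _ (Icc 0 1) r :=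
    fun r hr => hasDerivWithinAt_transf (s := s) hZ.differentiable (σ := ρ) (x := fun _ => x)
      (hlin _ _ r) (hlin _ _ r) (hlin _ _ r) (hlin _ _ r) (hasDerivWithinAt_const _ _ _)
      (lt_of_lt_of_le (half_pos hμ0) (hμr r hr).1)
  have hmv := norm_image_sub_le_of_norm_deriv_le_segment_01' hder
    (C := K * |τ - t| * (P * ((1 + ‖x‖) * Real.exp (-κ' * ‖x‖)))) fun r hr => by
      have hr' : r ∈ Icc (0 : ℝ) 1 := ⟨hr.1, hr.2.le⟩
      refine hbd (ρ r) _ _ _ _ _ x (hμr r hr').1 (hμr r hr').2 ?_ ?_ haτ hvτ hγτ hμτ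
      · refine (norm_add_le _ _).trans ?_
        have := (hnear 0 _ hr' haτ).trans hτ1
        have := norm_nonneg (σ t).v
        linarith
      · refine (norm_add_le _ _).trans ?_
        have := (hnear 0 _ hr' hvτ).trans hτ1
        have := norm_nonneg (σ t).a
        linarith
  rw [hρ0, hρ1] at hmv
  refine hmv.trans (le_of_eq ?_)
  ring

end Pairing

/-! ### The time derivative of the pairing in the moving frame. -/

section MainIdentity

variable {N : ℕ} {s : ℝ}

lemma integrable_fun_add {α F : Type*} [MeasurableSpace α] [NormedAddCommGroup F] {ν : Measure α}
    {f g : α → F} (hf : Integrable f ν) (hg : Integrable g ν) : Integrable (fun x => f x + g x) ν :=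
  hf.add hg

lemma integrable_fun_sub {α F : Type*} [MeasurableSpace α] [NormedAddCommGroup F] {ν : Measure α}
    {f g : α → F} (hf : Integrable f ν) (hg : Integrable g ν) : Integrable (fun x => f x - g x) ν :=
  hf.sub hg

/-- The infinitesimal modulation of a function `Z` with parameters `(A, B, Γ, M)`. -/
noncomputable def modGen (s : ℝ) (A B : Space N) (Γ M : ℝ) (Z : Space N → ℂ) (y : Space N) : ℂ :=
  -fderiv ℝ Z y A + Complex.I * ((inner ℝ B y + Γ : ℝ) : ℂ) * Z y
    + (M : ℂ) * (((1 / (2 * s) : ℝ) : ℂ) * Z y + (1 / 2 : ℂ) * fderiv ℝ Z y y)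

lemma fderiv_apply_eq_sum {F : Type*} [NormedAddCommGroup F] [NormedSpace ℝ F] (f : Space N → F)
    (x v : Space N) : fderiv ℝ f x v = ∑ i, v i • partialDeriv i f x := by
  conv_lhs => rw [← (EuclideanSpace.basisFun (Fin N) ℝ).sum_repr v]
  rw [map_sum]
  refine Finset.sum_congr rfl fun i _ => ?_
  rw [map_smul]
  simp [partialDeriv, stdVec]

lemma powNL_transf (hs : 0 < s) (p : ℝ) (σ : Param N) (hμ : 0 < σ.μ) (f : Space N → ℂ)
    (x : Space N) : powNL p (transf s σ f x)
      = ((σ.μ ^ (p / s) : ℝ) : ℂ) * transf s σ (fun y => powNL p (f y)) x := by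
  have h : ‖transf s σ f x‖ ^ (2 * p)
      = σ.μ ^ (p / s) * ‖f (Real.sqrt σ.μ • (x - σ.a))‖ ^ (2 * p) := by
    rw [norm_transf σ hμ, Real.mul_rpow (by positivity) (norm_nonneg _), ← Real.rpow_mul hμ.le]
    congr 2
    field_simp
  rw [powNL, h, Complex.ofReal_mul]
  simp only [transf, powNL]
  ring

lemma integrable_L2_mul_conj {f g : Space N → ℂ} (hf : MemLp f 2 volume) (hg : ExpDecay g)
    (hm : AEStronglyMeasurable g volume) : Integrable (fun x => f x * conj (g x)) :=
  hf.integrable_mul (memLp_conj (hg.memLp_two hm))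

lemma ExpDecay.fderiv_apply {Z : Space N → ℂ} (hZ : DecayC1 Z) (v : Space N) :
    ExpDecay (fun y => fderiv ℝ Z y v) :=
  hZ.decay_fderiv.mono ‖v‖ fun y => by rw [mul_comm]; exact (fderiv ℝ Z y).le_opNorm v

lemma DecayC1.continuous_fderiv_apply {Z : Space N → ℂ} (hZ : DecayC1 Z) (v : Space N) :
    Continuous (fun y => fderiv ℝ Z y v) := hZ.continuous_fderiv.clm_apply continuous_const

lemma ExpDecay.mul_growth {Z : Space N → ℂ} (hZ : ExpDecay Z) {p : Space N → ℂ} (K : ℝ)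
    (hp : ∀ y, ‖p y‖ ≤ K * (1 + ‖y‖)) : ExpDecay (fun y => p y * Z y) :=
  hZ.poly K 1 fun y => by rw [norm_mul, pow_one]; gcongr; exact hp y

lemma ExpDecay.fderiv_self {Z : Space N → ℂ} (hZ : DecayC1 Z) :
    ExpDecay (fun y => fderiv ℝ Z y y) :=
  hZ.decay_fderiv.poly 1 1 fun y => by
    refine ((fderiv ℝ Z y).le_opNorm y).trans ?_
    rw [mul_comm, pow_one, one_mul]
    gcongr
    linarith

lemma expDecay_modGen (A B : Space N) (Γ M : ℝ) {Z : Space N → ℂ} (hZ : DecayC1 Z) :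
    ExpDecay (modGen s A B Γ M Z) := by
  have h1 : ExpDecay (fun y => Complex.I * ((inner ℝ B y + Γ : ℝ) : ℂ) * Z y) := by
    refine hZ.decay.mul_growth (‖B‖ + |Γ|) fun y => ?_
    rw [norm_mul, Complex.norm_I, one_mul, Complex.norm_real, Real.norm_eq_abs]
    refine (abs_add_le _ _).trans ?_
    have h1 := abs_real_inner_le_norm B y
    have h2 : 0 ≤ |Γ| * ‖y‖ := by positivity
    have h3 := norm_nonneg B
    linarith
  have h2 : ExpDecay (fun y => ((1 / (2 * s) : ℝ) : ℂ) * Z y) :=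
    hZ.decay.mono ‖((1 / (2 * s) : ℝ) : ℂ)‖ fun y => by rw [norm_mul]
  have h3 : ExpDecay (fun y => (1 / 2 : ℂ) * fderiv ℝ Z y y) :=
    (ExpDecay.fderiv_self hZ).mono ‖(1 / 2 : ℂ)‖ fun y => by rw [norm_mul]
  have h4 : ExpDecay (fun y => (M : ℂ) *
      (((1 / (2 * s) : ℝ) : ℂ) * Z y + (1 / 2 : ℂ) * fderiv ℝ Z y y)) :=
    (h2.add h3).mono ‖(M : ℂ)‖ fun y => by rw [norm_mul]
  exact ((ExpDecay.fderiv_apply hZ A).neg.add h1).add h4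

lemma continuous_modGen (A B : Space N) (Γ M : ℝ) {Z : Space N → ℂ} (hZ : DecayC1 Z) :
    Continuous (modGen s A B Γ M Z) := by
  have h1 := hZ.continuous_fderiv_apply A
  have h2 : Continuous (fun y => fderiv ℝ Z y y) := hZ.continuous_fderiv.clm_apply continuous_id
  have h3 := hZ.continuous
  unfold modGen
  fun_prop

/-- The phases contribute `v²/4` and two cross terms; integration by parts against the regular `Z`
shows that the cross terms coincide, so they add up to a single drift term. -/
lemma integral_transf_grad (σ : Param N) (hμ : 0 < σ.μ) (u : H1 N) {Z : Space N → ℂ}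
    (hZ : DecayC1 Z) (i : Fin N) :
    ∫ x, transf s σ (fun y => Complex.I * ((σ.v i / 2 : ℝ) : ℂ) * h1Fn u y
        + Real.sqrt σ.μ * h1Grad u i y) x * conj (transf s σ (fun y =>
          Complex.I * ((σ.v i / 2 : ℝ) : ℂ) * Z y + Real.sqrt σ.μ * partialDeriv i Z y) x)
      = ((σ.μ ^ (1 / s - N / 2) : ℝ) : ℂ) * (((σ.v i ^ 2 / 4 : ℝ) : ℂ) * (∫ x, h1Fn u x * conj (Z x))
        + (σ.μ : ℂ) * (∫ x, h1Grad u i x * conj (partialDeriv i Z x))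
        + Complex.I * (Real.sqrt σ.μ : ℂ) * ((σ.v i : ℂ)
          * ∫ x, h1Fn u x * conj (partialDeriv i Z x))) := by
  rw [integral_transf_mul_conj' σ hμ]
  congr 1
  have i1 : Integrable (fun x => h1Fn u x * conj (Z x)) :=
    integrable_L2_mul_conj (memLp_h1Fn u) hZ.decay hZ.continuous.aestronglyMeasurable
  have i2 : Integrable (fun x => h1Grad u i x * conj (partialDeriv i Z x)) :=
    integrable_L2_mul_conj (memLp_h1Grad u i) (hZ.decay_partialDeriv i)
      (hZ.continuous_partialDeriv i).aestronglyMeasurable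
  have i3 : Integrable (fun x => h1Fn u x * conj (partialDeriv i Z x)) :=
    integrable_L2_mul_conj (memLp_h1Fn u) (hZ.decay_partialDeriv i)
      (hZ.continuous_partialDeriv i).aestronglyMeasurable
  have i4 : Integrable (fun x => h1Grad u i x * conj (Z x)) :=
    integrable_L2_mul_conj (memLp_h1Grad u i) hZ.decay hZ.continuous.aestronglyMeasurable
  have ibp : ∫ x, h1Grad u i x * conj (Z x) = -∫ x, h1Fn u x * conj (partialDeriv i Z x) := by
    have hc : DecayC1 (fun x => conj (Z x)) := hZ.clm_comp Complex.conjCLE.toContinuousLinearMap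
    have hp : ∀ x, partialDeriv i (fun x => conj (Z x)) x = conj (partialDeriv i Z x) := fun x => by
      have : HasFDerivAt (fun x => conj (Z x))
          (Complex.conjCLE.toContinuousLinearMap.comp (fderiv ℝ Z x)) x :=
        Complex.conjCLE.toContinuousLinearMap.hasFDerivAt.comp x
          (hZ.differentiable x).hasFDerivAt
      rw [partialDeriv, this.fderiv]; rfl
    have h := integral_partialDeriv_mul u i hc
    simp only [hp] at h
    simp only [mul_comm (h1Grad u i _), mul_comm (h1Fn u _)]
    rw [h, neg_neg]
  have e : ∀ x, (Complex.I * ((σ.v i / 2 : ℝ) : ℂ) * h1Fn u x + Real.sqrt σ.μ * h1Grad u i x)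
      * conj (Complex.I * ((σ.v i / 2 : ℝ) : ℂ) * Z x + Real.sqrt σ.μ * partialDeriv i Z x)
      = ((σ.v i ^ 2 / 4 : ℝ) : ℂ) * (h1Fn u x * conj (Z x))
        + (σ.μ : ℂ) * (h1Grad u i x * conj (partialDeriv i Z x))
        + (Complex.I * (Real.sqrt σ.μ : ℂ) * ((σ.v i / 2 : ℝ) : ℂ)
            * (h1Fn u x * conj (partialDeriv i Z x))
          - Complex.I * (Real.sqrt σ.μ : ℂ) * ((σ.v i / 2 : ℝ) : ℂ)
            * (h1Grad u i x * conj (Z x))) := fun x => by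
    have hq : (Real.sqrt σ.μ : ℂ) * (Real.sqrt σ.μ : ℂ) = (σ.μ : ℂ) := by
      rw [← Complex.ofReal_mul, Real.mul_self_sqrt hμ.le]
    simp only [map_add, map_mul, Complex.conj_I, Complex.conj_ofReal]
    rw [← hq]
    push_cast
    linear_combination (-(σ.v i : ℂ) ^ 2 / 4 * h1Fn u x * conj (Z x)) * Complex.I_mul_I
  simp only [e]
  rw [integral_add (integrable_fun_add (i1.const_mul _) (i2.const_mul _))
      (integrable_fun_sub (i3.const_mul _) (i4.const_mul _)),
    integral_add (i1.const_mul _) (i2.const_mul _), integral_sub (i3.const_mul _) (i4.const_mul _)]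
  simp only [integral_const_mul]
  rw [ibp]
  push_cast
  ring

/-- Time derivative of the pairing of a solution with a modulated test function, in the moving
frame. -/
lemma hasDerivWithinAt_pairing {s' ε T : ℝ} (hs : 0 < s) {lam : Space N → ℝ} {ψ : ℝ → H1 N}
    (hψ : IsNLSSolution s s' ε lam T ψ) {t : ℝ} (ht : t ∈ Icc 0 T) {σ : ℝ → Param N}
    {a' v' : Space N} {γ' μ' : ℝ}
    (ha : HasDerivWithinAt (fun τ => (σ τ).a) a' (Icc 0 T) t)
    (hv : HasDerivWithinAt (fun τ => (σ τ).v) v' (Icc 0 T) t)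
    (hγ : HasDerivWithinAt (fun τ => (σ τ).γ) γ' (Icc 0 T) t)
    (hμ : HasDerivWithinAt (fun τ => (σ τ).μ) μ' (Icc 0 T) t)
    (hμ0 : ∀ τ ∈ Icc 0 T, 0 < (σ τ).μ)
    {u : H1 N} (hu : h1Fn (ψ t) =ᵐ[volume] transf s (σ t) (h1Fn u)) {Z : Space N → ℂ}
    (hZ : DecayC1 Z) :
    HasDerivWithinAt (fun τ => ∫ x, h1Fn (ψ τ) x * conj (transf s (σ τ) Z x))
      ((((σ t).μ ^ (1 / s - N / 2) : ℝ) : ℂ) *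
        (-Complex.I * (((σ t).μ : ℂ) * ((∑ i, ∫ x, h1Grad u i x * conj (partialDeriv i Z x))
            + (∫ x, h1Fn u x * conj (Z x)) - ∫ x, powNL s (h1Fn u x) * conj (Z x))
          + (ε : ℂ) * (((σ t).μ ^ (s' / s) : ℝ) : ℂ) *
            ∫ x, (lam ((σ t).a + (Real.sqrt (σ t).μ)⁻¹ • x) : ℂ) * powNL s' (h1Fn u x)
              * conj (Z x))
        + ∫ x, h1Fn u x * conj (modGen s (Real.sqrt (σ t).μ • (a' - (σ t).v))
            ((1 / (2 * Real.sqrt (σ t).μ)) • v')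
            (γ' - inner ℝ (σ t).v a' / 2 + ‖(σ t).v‖ ^ 2 / 4 - (σ t).μ) (μ' / (σ t).μ) Z x)))
      (Icc 0 T) t := by
  have hm := hμ0 t ht
  have hq0 : Real.sqrt (σ t).μ ≠ 0 := (Real.sqrt_pos.2 hm).ne'
  -- The weak equation accepts only elements of `H¹` as test functions, so the modulated `Z` at the
  -- fixed time `t` is realized as one.
  obtain ⟨φ, hφ, hφ'⟩ := (hZ.transf (s := s) (σ t) hm).exists_h1
  have hD := hψ.2 φ t ht
  have hpair : ∀ f : Space N → ℂ, ∫ x, f x * conj (h1Fn φ x) = ∫ x, f x * conj (transf s (σ t) Z x) :=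
    fun f => integral_congr_ae (by filter_upwards [hφ] with x hx; rw [hx])
  simp only [hpair] at hD
  obtain ⟨B, hB, hBL⟩ := exists_transf_lipschitz hs hZ ha hv hγ hμ hm
  have key := hasDerivWithinAt_integral_mul_conj (ψ := ψ) (hψ.1 t ht)
    (z := fun τ => transf s (σ τ) Z) hD
    (fun x => hasDerivWithinAt_transf hZ.differentiable ha hv hγ hμ (hasDerivWithinAt_const t _ x) hm)
    hB hBL (by
      filter_upwards [self_mem_nhdsWithin] with τ hτ
      exact memLp_transf (σ τ) (hμ0 τ hτ) (hZ.decay.memLp_two hZ.continuous.aestronglyMeasurable))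
    (memLp_transf (σ t) hm (hZ.decay.memLp_two hZ.continuous.aestronglyMeasurable))
  convert key using 1
  clear key hD hBL hB B
  -- The parameter velocities are split into those of a free soliton and the deviation collected in
  -- `modGen`. Of the free part, the drift along `v` and the phase `‖v‖²/4` cancel against the
  -- Dirichlet form, and the phase `μ` supplies the mass term of the energy gradient.
  have eG : ∀ x, transf s (σ t) (fun y =>
        Complex.I * ((1 / 2 * (inner ℝ v' (x - (σ t).a) + inner ℝ (σ t).v (0 - a')) + γ' : ℝ) : ℂ)
          * Z y + ((μ' / (σ t).μ * (1 / (2 * s)) : ℝ) : ℂ) * Z y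
        + fderiv ℝ Z y ((μ' / (σ t).μ / 2) • y + Real.sqrt (σ t).μ • (0 - a'))) x
      = transf s (σ t) (fun y => modGen s (Real.sqrt (σ t).μ • (a' - (σ t).v))
            ((1 / (2 * Real.sqrt (σ t).μ)) • v')
            (γ' - inner ℝ (σ t).v a' / 2 + ‖(σ t).v‖ ^ 2 / 4 - (σ t).μ) (μ' / (σ t).μ) Z y
          + Complex.I * (((σ t).μ - ‖(σ t).v‖ ^ 2 / 4 : ℝ) : ℂ) * Z y
          - (Real.sqrt (σ t).μ : ℂ) * fderiv ℝ Z y (σ t).v) x := fun x => by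
    have hy : (inner ℝ v' (x - (σ t).a) : ℝ)
        = 2 * inner ℝ ((1 / (2 * Real.sqrt (σ t).μ)) • v') (Real.sqrt (σ t).μ • (x - (σ t).a)) := by
      rw [inner_smul_left, inner_smul_right]
      simp only [conj_trivial]
      field_simp
    rw [transf, transf, hy]
    congr 1
    simp only [modGen, zero_sub, inner_neg_right, map_add, map_smul, map_sub, map_neg, smul_neg,
      Complex.real_smul]
    push_cast
    ring
  simp only [eG]
  have tP : ∀ f : Space N → ℂ, ∫ x, h1Fn (ψ t) x * conj (transf s (σ t) f x)
      = (((σ t).μ ^ (1 / s - N / 2) : ℝ) : ℂ) * ∫ x, h1Fn u x * conj (f x) := fun f => by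
    rw [← integral_transf_mul_conj' (σ t) hm]
    exact integral_congr_ae (by filter_upwards [hu] with x hx; rw [hx])
  have tN : ∀ (l : Space N → ℂ) (p : ℝ), ∫ x, l x * powNL p (h1Fn (ψ t) x) * conj (transf s (σ t) Z x)
      = (((σ t).μ ^ (1 / s - N / 2) : ℝ) : ℂ) * ((((σ t).μ ^ (p / s) : ℝ) : ℂ) *
        ∫ x, l ((σ t).a + (Real.sqrt (σ t).μ)⁻¹ • x) * powNL p (h1Fn u x) * conj (Z x)) := fun l p => by
    rw [mul_left_comm, ← integral_transf_mul_conj (σ t) hm l, ← integral_const_mul]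
    refine integral_congr_ae ?_
    filter_upwards [hu] with x hx
    rw [hx, powNL_transf hs p _ hm]
    ring
  have tN1 := tN (fun _ => 1) s
  simp only [one_mul, div_self hs.ne', Real.rpow_one] at tN1
  have tN2 := tN (fun x => (lam x : ℂ)) s'
  have tG : ∀ i, ∫ x, h1Grad (ψ t) i x * conj (h1Grad φ i x)
      = (((σ t).μ ^ (1 / s - N / 2) : ℝ) : ℂ) * ((((σ t).v i ^ 2 / 4 : ℝ) : ℂ)
          * (∫ x, h1Fn u x * conj (Z x))
        + ((σ t).μ : ℂ) * (∫ x, h1Grad u i x * conj (partialDeriv i Z x))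
        + Complex.I * (Real.sqrt (σ t).μ : ℂ) * (((σ t).v i : ℂ)
          * ∫ x, h1Fn u x * conj (partialDeriv i Z x))) := fun i => by
    rw [← integral_transf_grad (s := s) (σ t) hm u hZ i]
    refine integral_congr_ae ?_
    filter_upwards [h1Grad_transf (σ t) hm hu i, hφ' i] with x hx hx'
    rw [hx, hx', partialDeriv_transf (σ t) hm hZ.contDiff]
  have i1 : Integrable (fun x => h1Fn u x * conj (Z x)) :=
    integrable_L2_mul_conj (memLp_h1Fn u) hZ.decay hZ.continuous.aestronglyMeasurable
  have i3 : ∀ i, Integrable (fun x => h1Fn u x * conj (partialDeriv i Z x)) := fun i =>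
    integrable_L2_mul_conj (memLp_h1Fn u) (hZ.decay_partialDeriv i)
      (hZ.continuous_partialDeriv i).aestronglyMeasurable
  have i4 := integrable_L2_mul_conj (memLp_h1Fn u) (expDecay_modGen (s := s)
    (Real.sqrt (σ t).μ • (a' - (σ t).v)) ((1 / (2 * Real.sqrt (σ t).μ)) • v')
    (γ' - inner ℝ (σ t).v a' / 2 + ‖(σ t).v‖ ^ 2 / 4 - (σ t).μ) (μ' / (σ t).μ) hZ)
    (continuous_modGen _ _ _ _ hZ).aestronglyMeasurable
  rw [tP, tN1, tN2, Finset.sum_congr rfl fun i _ => tG i, ← Finset.mul_sum, Finset.sum_add_distrib,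
    Finset.sum_add_distrib, ← Finset.sum_mul, ← Finset.mul_sum, ← Finset.mul_sum]
  have hsq : (∑ i, (((σ t).v i ^ 2 / 4 : ℝ) : ℂ)) = ((‖(σ t).v‖ ^ 2 / 4 : ℝ) : ℂ) := by
    rw [EuclideanSpace.real_norm_sq_eq, Finset.sum_div, Complex.ofReal_sum]
  rw [hsq]
  have hfin : ∫ x, h1Fn u x * conj (modGen s (Real.sqrt (σ t).μ • (a' - (σ t).v))
            ((1 / (2 * Real.sqrt (σ t).μ)) • v')
            (γ' - inner ℝ (σ t).v a' / 2 + ‖(σ t).v‖ ^ 2 / 4 - (σ t).μ) (μ' / (σ t).μ) Z x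
          + Complex.I * (((σ t).μ - ‖(σ t).v‖ ^ 2 / 4 : ℝ) : ℂ) * Z x
          - (Real.sqrt (σ t).μ : ℂ) * fderiv ℝ Z x (σ t).v)
      = (∫ x, h1Fn u x * conj (modGen s (Real.sqrt (σ t).μ • (a' - (σ t).v))
            ((1 / (2 * Real.sqrt (σ t).μ)) • v')
            (γ' - inner ℝ (σ t).v a' / 2 + ‖(σ t).v‖ ^ 2 / 4 - (σ t).μ) (μ' / (σ t).μ) Z x))
        - Complex.I * (((σ t).μ - ‖(σ t).v‖ ^ 2 / 4 : ℝ) : ℂ) * (∫ x, h1Fn u x * conj (Z x))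
        - (Real.sqrt (σ t).μ : ℂ) * ∑ i, ((σ t).v i : ℂ) *
          ∫ x, h1Fn u x * conj (partialDeriv i Z x) := by
    have e : ∀ x, h1Fn u x * conj (modGen s (Real.sqrt (σ t).μ • (a' - (σ t).v))
            ((1 / (2 * Real.sqrt (σ t).μ)) • v')
            (γ' - inner ℝ (σ t).v a' / 2 + ‖(σ t).v‖ ^ 2 / 4 - (σ t).μ) (μ' / (σ t).μ) Z x
          + Complex.I * (((σ t).μ - ‖(σ t).v‖ ^ 2 / 4 : ℝ) : ℂ) * Z x
          - (Real.sqrt (σ t).μ : ℂ) * fderiv ℝ Z x (σ t).v)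
        = h1Fn u x * conj (modGen s (Real.sqrt (σ t).μ • (a' - (σ t).v))
            ((1 / (2 * Real.sqrt (σ t).μ)) • v')
            (γ' - inner ℝ (σ t).v a' / 2 + ‖(σ t).v‖ ^ 2 / 4 - (σ t).μ) (μ' / (σ t).μ) Z x)
          - Complex.I * (((σ t).μ - ‖(σ t).v‖ ^ 2 / 4 : ℝ) : ℂ) * (h1Fn u x * conj (Z x))
          - (Real.sqrt (σ t).μ : ℂ) * ∑ i, ((σ t).v i : ℂ) *
            (h1Fn u x * conj (partialDeriv i Z x)) := fun x => by
      rw [fderiv_apply_eq_sum]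
      simp only [Complex.real_smul, map_sub, map_add, map_mul, map_sum, Complex.conj_ofReal,
        Complex.conj_I]
      have : ∑ i, ((σ t).v i : ℂ) * (h1Fn u x * conj (partialDeriv i Z x))
          = h1Fn u x * ∑ i, ((σ t).v i : ℂ) * conj (partialDeriv i Z x) := by
        rw [Finset.mul_sum]
        exact Finset.sum_congr rfl fun i _ => by ring
      rw [this]
      ring
    simp only [e]
    have i5 := integrable_finsetSum (μ := (volume : Measure (Space N))) Finset.univ
      fun i (_ : i ∈ Finset.univ) => (i3 i).const_mul ((σ t).v i : ℂ)
    rw [integral_sub (integrable_fun_sub i4 (i1.const_mul _)) (i5.const_mul _), integral_sub i4 (i1.const_mul _),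
      integral_const_mul, integral_const_mul,
      integral_finsetSum _ fun i (_ : i ∈ Finset.univ) => (i3 i).const_mul ((σ t).v i : ℂ)]
    simp only [integral_const_mul]
  rw [hfin]
  push_cast
  linear_combination ((((σ t).μ ^ (1 / s - N / 2) : ℝ) : ℂ) * (Real.sqrt (σ t).μ : ℂ) *
    ∑ i, ((σ t).v i : ℂ) * ∫ x, h1Fn u x * conj (partialDeriv i Z x)) * Complex.I_mul_I

end MainIdentity

/-! ### Real-weight pairings and the weak Dirichlet form. -/

section Pairings

variable {N : ℕ}

/-- Continuous functions with exponential decay. -/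
structure DecayC0 {N : ℕ} (g : Space N → ℝ) : Prop where
  decay : ExpDecay g
  continuous : Continuous g

lemma DecayC1.decayC0 {g : Space N → ℝ} (hg : DecayC1 g) : DecayC0 g := ⟨hg.decay, hg.continuous⟩

lemma DecayC1.decayC0_partialDeriv {g : Space N → ℝ} (hg : DecayC1 g) (i : Fin N) :
    DecayC0 (partialDeriv i g) := ⟨hg.decay_partialDeriv i, hg.continuous_partialDeriv i⟩

lemma DecayC0.add {f g : Space N → ℝ} (hf : DecayC0 f) (hg : DecayC0 g) :
    DecayC0 (fun x => f x + g x) := ⟨hf.decay.add hg.decay, hf.continuous.add hg.continuous⟩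

lemma DecayC0.const_mul {f : Space N → ℝ} (hf : DecayC0 f) (c : ℝ) : DecayC0 (fun x => c * f x) :=
  ⟨hf.decay.mono ‖c‖ fun x => by rw [norm_mul], continuous_const.mul hf.continuous⟩

lemma DecayC0.sum {ι : Type*} (S : Finset ι) {f : ι → Space N → ℝ} (hf : ∀ i ∈ S, DecayC0 (f i)) :
    DecayC0 (fun x => ∑ i ∈ S, f i x) :=
  ⟨ExpDecay.sum S fun i hi => (hf i hi).decay, continuous_finsetSum S fun i hi => (hf i hi).continuous⟩

lemma DecayC0.coord_mul {f : Space N → ℝ} (hf : DecayC0 f) (i : Fin N) :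
    DecayC0 (fun x => x i * f x) :=
  ⟨hf.decay.poly 1 1 fun x => by
    rw [norm_mul, pow_one, one_mul]
    have := PiLp.norm_apply_le x i
    gcongr
    linarith, by have := hf.continuous; fun_prop⟩

lemma DecayC1.sum {ι F : Type*} [NormedAddCommGroup F] [NormedSpace ℝ F] (S : Finset ι)
    {f : ι → Space N → F} (hf : ∀ i ∈ S, DecayC1 (f i)) : DecayC1 (fun x => ∑ i ∈ S, f i x) := by
  classical
  induction S using Finset.induction_on with
  | empty =>
    simp only [Finset.sum_empty]
    refine ⟨contDiff_const, ⟨0, 1, le_rfl, one_pos, by simp⟩, ⟨0, 1, le_rfl, one_pos, by simp⟩⟩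
  | insert i S hi ih =>
    simp only [Finset.sum_insert hi]
    exact (hf i (Finset.mem_insert_self i S)).add
      (ih fun j hj => hf j (Finset.mem_insert_of_mem hj))

/-- The bilinear pairing `∫ g f` of a real weight `g` with a complex function `f`. -/
noncomputable def wpair (f : Space N → ℂ) (g : Space N → ℝ) : ℂ := ∫ x, (g x : ℂ) * f x

variable {f : Space N → ℂ}

lemma DecayC0.integrable_mul {g : Space N → ℝ} (hg : DecayC0 g) (hf : MemLp f 2 volume) :
    Integrable (fun x => (g x : ℂ) * f x) :=
  integrable_ofReal_mul_L2 hg.decay hg.continuous.aestronglyMeasurable hf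

lemma wpair_add (hf : MemLp f 2 volume) {g h : Space N → ℝ} (hg : DecayC0 g) (hh : DecayC0 h) :
    wpair f (fun x => g x + h x) = wpair f g + wpair f h := by
  simp only [wpair, Complex.ofReal_add, add_mul]
  exact integral_add (hg.integrable_mul hf) (hh.integrable_mul hf)

lemma wpair_const_mul (c : ℝ) (g : Space N → ℝ) :
    wpair f (fun x => c * g x) = (c : ℂ) * wpair f g := by
  simp only [wpair, Complex.ofReal_mul, mul_assoc, integral_const_mul]

lemma wpair_sum (hf : MemLp f 2 volume) {ι : Type*} (S : Finset ι) {g : ι → Space N → ℝ}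
    (hg : ∀ i ∈ S, DecayC0 (g i)) :
    wpair f (fun x => ∑ i ∈ S, g i x) = ∑ i ∈ S, wpair f (g i) := by
  simp only [wpair, Complex.ofReal_sum, Finset.sum_mul]
  exact integral_finsetSum S fun i hi => (hg i hi).integrable_mul hf

lemma wpair_h1Fn_partialDeriv (w : H1 N) (i : Fin N) {g : Space N → ℝ} (hg : DecayC1 g) :
    wpair (h1Fn w) (partialDeriv i g) = -wpair (h1Grad w i) g :=
  integral_partialDeriv_mul_ofReal w i hg

lemma wpair_h1Grad_comm (w : H1 N) (i j : Fin N) {g : Space N → ℝ} (hg : DecayC1 g) :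
    wpair (h1Grad w i) (partialDeriv j g) = wpair (h1Grad w j) (partialDeriv i g) :=
  integral_partialDeriv_mul_h1Grad_comm w i j hg

/-- The Dirichlet form `∑ᵢ ∫ ∂ᵢg ∂ᵢw`. -/
noncomputable def dirichlet (w : H1 N) (g : Space N → ℝ) : ℂ := ∑ i, wpair (h1Grad w i) (partialDeriv i g)

lemma dirichlet_of_laplacian (w : H1 N) {g L : Space N → ℝ} (hg : ∀ i, DecayC1 (partialDeriv i g))
    (hL : ∀ x, ∑ i, partialDeriv i (partialDeriv i g) x = L x) :
    dirichlet w g = -wpair (h1Fn w) L := by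
  have e : wpair (h1Fn w) L = ∑ i, wpair (h1Fn w) (partialDeriv i (partialDeriv i g)) := by
    rw [← wpair_sum (memLp_h1Fn w) _ fun i _ => (hg i).decayC0_partialDeriv i, ← funext hL]
  rw [e, dirichlet, ← Finset.sum_neg_distrib]
  refine Finset.sum_congr rfl fun i _ => ?_
  rw [wpair_h1Fn_partialDeriv w i (hg i), neg_neg]

lemma dirichlet_add (w : H1 N) {g h : Space N → ℝ} (hg : DecayC1 g) (hh : DecayC1 h) :
    dirichlet w (fun x => g x + h x) = dirichlet w g + dirichlet w h := by
  simp only [dirichlet]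
  rw [← Finset.sum_add_distrib]
  refine Finset.sum_congr rfl fun i _ => ?_
  rw [← wpair_add (memLp_h1Grad w i) (hg.decayC0_partialDeriv i) (hh.decayC0_partialDeriv i)]
  congr 1
  funext x
  simp only [partialDeriv]
  rw [fderiv_fun_add (hg.differentiable x) (hh.differentiable x)]
  rfl

lemma dirichlet_const_mul (w : H1 N) (c : ℝ) {g : Space N → ℝ} (hg : DecayC1 g) :
    dirichlet w (fun x => c * g x) = (c : ℂ) * dirichlet w g := by
  simp only [dirichlet]
  rw [Finset.mul_sum]
  refine Finset.sum_congr rfl fun i _ => ?_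
  rw [← wpair_const_mul]
  congr 1
  funext x
  simp only [partialDeriv]
  rw [fderiv_const_mul (hg.differentiable x)]
  rfl

lemma partialDeriv_coord (i j : Fin N) (x : Space N) :
    partialDeriv i (fun x : Space N => x j) x = if i = j then 1 else 0 := by
  have e : (fun x : Space N => x j) = fun x => EuclideanSpace.proj (𝕜 := ℝ) j x := rfl
  rw [partialDeriv, e, ContinuousLinearMap.fderiv]
  simp [stdVec, eq_comm]

lemma partialDeriv_coord_mul (i j : Fin N) {g : Space N → ℝ} (hg : Differentiable ℝ g) (x : Space N) :
    partialDeriv i (fun x => x j * g x) x = x j * partialDeriv i g x + if i = j then g x else 0 := by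
  have hd : DifferentiableAt ℝ (fun x : Space N => x j) x :=
    (EuclideanSpace.proj (𝕜 := ℝ) j : Space N →L[ℝ] ℝ).differentiableAt
  rw [partialDeriv_mul i hd (hg x), partialDeriv_coord]
  simp

lemma DecayC1.coord_mul {g : Space N → ℝ} (hg : DecayC1 g) (i : Fin N) :
    DecayC1 (fun x => x i * g x) := hg.coord_smul i

lemma DecayC1.const_mul {g : Space N → ℝ} (hg : DecayC1 g) (c : ℝ) :
    DecayC1 (fun x => c * g x) := hg.const_smul c

end Pairings

/-! ### The linearized operators on the generator modes, in weak form. -/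

section ProfileTests

variable {N : ℕ} {s : ℝ} {η : Space N → ℝ}

/-- A soliton profile together with the decay estimates of its derivatives. -/
structure DecayProfile {N : ℕ} (s : ℝ) (η : Space N → ℝ) : Prop extends IsSolitonProfile s η where
  s_pos : 0 < s
  decay : ExpDecay η
  fderiv_le : ∃ K, 0 ≤ K ∧ ∀ x, ‖fderiv ℝ η x‖ ≤ K * η x
  fderiv_partialDeriv_le : ∀ j, ∃ K, 0 ≤ K ∧ ∀ x, ‖fderiv ℝ (partialDeriv j η) x‖ ≤ K * η x

lemma IsSolitonProfile.decayProfile (hη : IsSolitonProfile s η) (hN : 1 ≤ N) (hs : 0 < s) :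
    DecayProfile s η :=
  let h := hη.estimates hN hs
  ⟨hη, hs, h.1, h.2.1, h.2.2⟩

namespace DecayProfile

variable (hη : DecayProfile s η)

include hη

lemma differentiable : Differentiable ℝ η := hη.contDiff.differentiable (by simp)

lemma decayC1 : DecayC1 η := by
  obtain ⟨K, -, hK⟩ := hη.fderiv_le
  exact ⟨hη.contDiff.of_le (by norm_num), hη.decay, hη.decay.mono K fun x => by
    rw [Real.norm_of_nonneg (hη.pos x).le]; exact hK x⟩

lemma decayC1_partialDeriv (j : Fin N) : DecayC1 (partialDeriv j η) := by
  obtain ⟨K, -, hK⟩ := hη.fderiv_partialDeriv_le j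
  exact ⟨contDiff_partialDeriv hη.contDiff j, hη.decayC1.decay_partialDeriv j,
    hη.decay.mono K fun x => by rw [Real.norm_of_nonneg (hη.pos x).le]; exact hK x⟩

lemma hasFDerivAt_rpow (p : ℝ) (x : Space N) :
    HasFDerivAt (fun x => η x ^ p) ((p * η x ^ (p - 1)) • fderiv ℝ η x) x :=
  (hη.differentiable x).hasFDerivAt.rpow_const (Or.inl (hη.pos x).ne')

/-- The bound of `∇η` by `η` turns `p η^(p-1) ∇η` into a multiple of `η^p`, so the gradient decays
also when `p < 1`. -/
lemma decayC1_rpow {p : ℝ} (hp : 0 < p) : DecayC1 (fun x => η x ^ p) := by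
  obtain ⟨K, hK0, hK⟩ := hη.fderiv_le
  have hd := hη.decay.rpow (fun x => (hη.pos x).le) hp
  refine ⟨(hη.contDiff.of_le (by norm_num)).rpow_const_of_ne fun x => (hη.pos x).ne', hd,
    hd.mono (p * K) fun x => ?_⟩
  have h1 : 0 < η x ^ (p - 1) := Real.rpow_pos_of_pos (hη.pos x) _
  have h2 : η x ^ p = η x ^ (p - 1) * η x := by
    rw [← Real.rpow_add_one (hη.pos x).ne']; ring_nf
  rw [(hη.hasFDerivAt_rpow p x).fderiv, norm_smul, Real.norm_of_nonneg (by positivity),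
    Real.norm_of_nonneg (Real.rpow_nonneg (hη.pos x).le _), h2]
  calc p * η x ^ (p - 1) * ‖fderiv ℝ η x‖ ≤ p * η x ^ (p - 1) * (K * η x) := by
        gcongr; exact hK x
    _ = _ := by ring

/-- The Laplacian of the profile. -/
lemma sum_partialDeriv (x : Space N) :
    ∑ i, partialDeriv i (partialDeriv i η) x = η x - η x ^ (2 * s + 1) := by
  rw [← laplacian_eq_sum hη.contDiff]
  linarith [hη.equation x]

lemma decayC1_laplacian : DecayC1 (fun x => η x - η x ^ (2 * s + 1)) := by
  have hs := hη.s_pos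
  simpa only [sub_eq_add_neg, neg_one_mul] using
    hη.decayC1.add ((hη.decayC1_rpow (p := 2 * s + 1) (by positivity)).const_mul (-1))

lemma partialDeriv_laplacian (i : Fin N) (x : Space N) :
    partialDeriv i (fun x => η x - η x ^ (2 * s + 1)) x
      = partialDeriv i η x - (2 * s + 1) * η x ^ (2 * s) * partialDeriv i η x := by
  have h : HasFDerivAt (fun x => η x - η x ^ (2 * s + 1))
      (fderiv ℝ η x - ((2 * s + 1) * η x ^ (2 * s + 1 - 1)) • fderiv ℝ η x) x :=
    (hη.differentiable x).hasFDerivAt.sub (hη.hasFDerivAt_rpow (2 * s + 1) x)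
  rw [partialDeriv, h.fderiv, add_sub_cancel_right]
  rfl

lemma rpow_two_s_add_one (x : Space N) : η x ^ (2 * s + 1) = η x ^ (2 * s) * η x :=
  Real.rpow_add_one (hη.pos x).ne' _

lemma decayC0_rpow_mul {g : Space N → ℝ} (hg : DecayC0 g) :
    DecayC0 (fun x => η x ^ (2 * s) * g x) := by
  have hs := hη.s_pos
  have h1 := hη.decayC1_rpow (p := 2 * s) (by positivity)
  obtain ⟨C, hC, hb⟩ := h1.decay.bounded
  exact ⟨hg.decay.mono C fun x => by rw [norm_mul]; gcongr; exact hb x,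
    h1.continuous.mul hg.continuous⟩

lemma dirichlet_self (w : H1 N) :
    dirichlet w η = -wpair (h1Fn w) (fun x => η x - η x ^ (2 * s + 1)) :=
  dirichlet_of_laplacian w hη.decayC1_partialDeriv hη.sum_partialDeriv

lemma dirichlet_gauge (w : H1 N) :
    dirichlet w η + wpair (h1Fn w) η = wpair (h1Fn w) (fun x => η x ^ (2 * s) * η x) := by
  have h := wpair_add (memLp_h1Fn w) hη.decayC1_laplacian.decayC0
    (hη.decayC0_rpow_mul hη.decayC1.decayC0)
  have e : (fun x => η x - η x ^ (2 * s + 1) + η x ^ (2 * s) * η x) = η := by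
    funext x; rw [hη.rpow_two_s_add_one]; ring
  rw [e] at h
  rw [hη.dirichlet_self, h]
  ring

/-- The commutator of `-Δ` with multiplication by `x_j` is `-2 ∂_j`; the rest is `x_j` times the
profile equation. -/
lemma dirichlet_boost (w : H1 N) (j : Fin N) :
    dirichlet w (fun x => x j * η x) + wpair (h1Fn w) (fun x => x j * η x)
      = wpair (h1Fn w) (fun x => η x ^ (2 * s) * (x j * η x) + (-2) * partialDeriv j η x) := by
  have e1 : ∀ i, partialDeriv i (fun x => x j * η x)
      = fun x => x j * partialDeriv i η x + if i = j then η x else 0 := fun i =>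
    funext fun x => partialDeriv_coord_mul i j hη.differentiable x
  have hif : ∀ i, DecayC1 (fun x => if i = j then η x else 0) := fun i => by
    by_cases h : i = j
    · simpa [h] using hη.decayC1
    · simpa [h] using hη.decayC1.const_mul 0
  have e2 : ∀ x, ∑ i, partialDeriv i (partialDeriv i (fun x => x j * η x)) x
      = x j * (η x - η x ^ (2 * s + 1)) + 2 * partialDeriv j η x := fun x => by
    have e3 : ∀ i, partialDeriv i (partialDeriv i (fun x => x j * η x)) x
        = x j * partialDeriv i (partialDeriv i η) x + 2 * if i = j then partialDeriv i η x else 0 :=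
        fun i => by
      rw [e1 i, partialDeriv, fderiv_fun_add
        (((hη.decayC1_partialDeriv i).coord_mul j).differentiable x) ((hif i).differentiable x)]
      change partialDeriv i (fun x => x j * partialDeriv i η x) x
        + partialDeriv i (fun x => if i = j then η x else 0) x = _
      rw [partialDeriv_coord_mul i j (hη.decayC1_partialDeriv i).differentiable]
      by_cases h : i = j
      · simp only [h, if_true]
        ring
      · simp [h, partialDeriv]
    rw [Finset.sum_congr rfl fun i _ => e3 i, Finset.sum_add_distrib, ← Finset.mul_sum,
      ← Finset.mul_sum, hη.sum_partialDeriv]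
    simp
  rw [dirichlet_of_laplacian w (fun i => by
    rw [e1 i]; exact ((hη.decayC1_partialDeriv i).coord_mul j).add (hif i)) e2]
  have h1 : DecayC0 (fun x => x j * (η x - η x ^ (2 * s + 1)) + 2 * partialDeriv j η x) :=
    (hη.decayC1_laplacian.decayC0.coord_mul j).add
      ((hη.decayC1.decayC0_partialDeriv j).const_mul 2)
  have h2 : DecayC0 (fun x => η x ^ (2 * s) * (x j * η x) + (-2) * partialDeriv j η x) :=
    (hη.decayC0_rpow_mul (hη.decayC1.decayC0.coord_mul j)).add
      ((hη.decayC1.decayC0_partialDeriv j).const_mul (-2))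
  have h := wpair_add (memLp_h1Fn w) h1 h2
  have e : (fun x => x j * (η x - η x ^ (2 * s + 1)) + 2 * partialDeriv j η x
      + (η x ^ (2 * s) * (x j * η x) + (-2) * partialDeriv j η x)) = fun x => x j * η x := by
    funext x; rw [hη.rpow_two_s_add_one]; ring
  rw [e] at h
  rw [h]
  ring

/-- Formally this is the profile equation differentiated in `x_j`. Since `η` is only `C²`, its third
derivatives are avoided: weak curl-freeness of the gradient of `w` moves `∂_j` onto `w`, the profile
equation is used, and `∂_j` is moved back. -/
lemma dirichlet_translation (w : H1 N) (j : Fin N) :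
    dirichlet w (partialDeriv j η) + wpair (h1Fn w) (partialDeriv j η)
      = wpair (h1Fn w) (fun x => (2 * s + 1) * (η x ^ (2 * s) * partialDeriv j η x)) := by
  have e1 : dirichlet w (partialDeriv j η)
      = ∑ i, wpair (h1Grad w j) (partialDeriv i (partialDeriv i η)) := by
    refine Finset.sum_congr rfl fun i _ => ?_
    rw [← wpair_h1Grad_comm w i j (hη.decayC1_partialDeriv i)]
    congr 1
    exact funext fun x => partialDeriv_comm hη.contDiff i j x
  have hL := hη.decayC1_laplacian
  rw [e1, ← wpair_sum (memLp_h1Grad w j) _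
    fun i _ => (hη.decayC1_partialDeriv i).decayC0_partialDeriv i, funext hη.sum_partialDeriv,
    ← neg_eq_iff_eq_neg.2 (wpair_h1Fn_partialDeriv w j hL)]
  have h := wpair_add (memLp_h1Fn w) (hL.decayC0_partialDeriv j)
    ((hη.decayC0_rpow_mul (hη.decayC1.decayC0_partialDeriv j)).const_mul (2 * s + 1))
  have e : (fun x => partialDeriv j (fun x => η x - η x ^ (2 * s + 1)) x
      + (2 * s + 1) * (η x ^ (2 * s) * partialDeriv j η x)) = partialDeriv j η := by
    funext x; rw [hη.partialDeriv_laplacian]; ring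
  rw [e] at h
  rw [h]
  ring

lemma decayC1_radial : DecayC1 (fun x => fderiv ℝ η x x) := by
  simp only [fderiv_apply_eq_sum, smul_eq_mul]
  exact DecayC1.sum _ fun i _ => (hη.decayC1_partialDeriv i).coord_mul i

/-- The profile of the scaling generator. -/
lemma decayC1_scaling : DecayC1 (fun x => 1 / (2 * s) * η x + 1 / 2 * fderiv ℝ η x x) :=
  (hη.decayC1.const_mul _).add (hη.decayC1_radial.const_mul _)

/-- The commutator of `Δ` with `x·∂_x` is `2Δ`, and `Δη = η - η^(2s+1)` can itself be differentiated
once along `x`. -/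
lemma dirichlet_radial (w : H1 N) :
    dirichlet w (fun x => fderiv ℝ η x x)
      = -2 * wpair (h1Fn w) (fun x => η x - η x ^ (2 * s + 1))
        - wpair (h1Fn w) (fun x => (1 - (2 * s + 1) * η x ^ (2 * s)) * fderiv ℝ η x x) := by
  have hL := hη.decayC1_laplacian
  have hx : ∀ i k, DecayC1 (fun x => x k * partialDeriv i η x) := fun i k =>
    (hη.decayC1_partialDeriv i).coord_mul k
  -- The derivative is rewritten through the divergences `∂_k (x_k ∂_i η)`, the form in which
  -- curl-freeness of the gradient of `w` can exchange `∂_k` for `∂_i`.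
  have e1 : ∀ i, partialDeriv i (fun x => fderiv ℝ η x x)
      = fun x => (1 - N) * partialDeriv i η x
        + ∑ k, partialDeriv k (fun x => x k * partialDeriv i η x) x := fun i => by
    funext x
    have e2 : (fun x => fderiv ℝ η x x) = fun x => ∑ k, x k * partialDeriv k η x :=
      funext fun x => fderiv_apply_eq_sum η x x
    have e3 : partialDeriv i (fun x => fderiv ℝ η x x) x
        = ∑ k, partialDeriv i (fun x => x k * partialDeriv k η x) x := by
      rw [e2, partialDeriv, fderiv_fun_sum fun k _ => (hx k k).differentiable x]
      simp [partialDeriv]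
    rw [e3]
    simp only [partialDeriv_coord_mul _ _ (hη.decayC1_partialDeriv _).differentiable, if_true]
    rw [Finset.sum_add_distrib, Finset.sum_add_distrib,
      Finset.sum_congr rfl fun k _ => by rw [partialDeriv_comm hη.contDiff i k x]]
    simp
    ring
  have e4 : ∀ i, wpair (h1Grad w i) (partialDeriv i (fun x => fderiv ℝ η x x))
      = (1 - N) * wpair (h1Grad w i) (partialDeriv i η)
        + ∑ k, wpair (h1Grad w k) (partialDeriv i (fun x => x k * partialDeriv i η x)) := fun i => by
    rw [e1 i, wpair_add (memLp_h1Grad w i) ((hη.decayC1.decayC0_partialDeriv i).const_mul (1 - N))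
      (DecayC0.sum _ fun k _ => (hx i k).decayC0_partialDeriv k), wpair_const_mul,
      wpair_sum (memLp_h1Grad w i) _ fun k _ => (hx i k).decayC0_partialDeriv k]
    simp only [wpair_h1Grad_comm w i _ (hx i _)]
    push_cast
    rfl
  have e5 : ∀ k, ∑ i, wpair (h1Grad w k) (partialDeriv i (fun x => x k * partialDeriv i η x))
      = wpair (h1Grad w k) (partialDeriv k η)
        - wpair (h1Fn w) (partialDeriv k (fun x => x k * (η x - η x ^ (2 * s + 1)))) := fun k => by
    rw [wpair_h1Fn_partialDeriv w k (hL.coord_mul k), sub_neg_eq_add,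
      ← wpair_add (memLp_h1Grad w k) (hη.decayC1.decayC0_partialDeriv k) (hL.coord_mul k).decayC0,
      ← wpair_sum (memLp_h1Grad w k) _ fun i _ => (hx i k).decayC0_partialDeriv i]
    congr 1
    funext x
    simp only [partialDeriv_coord_mul _ _ (hη.decayC1_partialDeriv _).differentiable]
    rw [Finset.sum_add_distrib, ← Finset.mul_sum, hη.sum_partialDeriv]
    simp
    ring
  have e6 : ∀ k, wpair (h1Fn w) (partialDeriv k (fun x => x k * (η x - η x ^ (2 * s + 1))))
      = wpair (h1Fn w) (fun x => x k * partialDeriv k (fun x => η x - η x ^ (2 * s + 1)) x)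
        + wpair (h1Fn w) (fun x => η x - η x ^ (2 * s + 1)) := fun k => by
    rw [← wpair_add (memLp_h1Fn w) ((hL.decayC0_partialDeriv k).coord_mul k) hL.decayC0]
    congr 1
    funext x
    rw [partialDeriv_coord_mul k k hL.differentiable, if_pos rfl]
  have e7 : ∑ k, wpair (h1Fn w) (fun x => x k * partialDeriv k (fun x => η x - η x ^ (2 * s + 1)) x)
      = wpair (h1Fn w) (fun x => (1 - (2 * s + 1) * η x ^ (2 * s)) * fderiv ℝ η x x) := by
    rw [← wpair_sum (memLp_h1Fn w) _ fun k _ => (hL.decayC0_partialDeriv k).coord_mul k]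
    congr 1
    funext x
    rw [fderiv_apply_eq_sum, Finset.mul_sum]
    refine Finset.sum_congr rfl fun k _ => ?_
    rw [hη.partialDeriv_laplacian, smul_eq_mul]
    ring
  have h0 : ∑ k, wpair (h1Grad w k) (partialDeriv k η)
      = -wpair (h1Fn w) (fun x => η x - η x ^ (2 * s + 1)) := hη.dirichlet_self w
  rw [dirichlet, Finset.sum_congr rfl fun i _ => e4 i, Finset.sum_add_distrib, ← Finset.mul_sum,
    Finset.sum_comm, Finset.sum_congr rfl fun k _ => e5 k, Finset.sum_sub_distrib,
    Finset.sum_congr rfl fun k _ => e6 k, Finset.sum_add_distrib, e7, h0]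
  simp only [Finset.sum_const, Finset.card_univ, Fintype.card_fin, nsmul_eq_mul]
  ring

/-- The coefficient `1/(2s)` is the one for which the powers `η^(2s+1)` from the two summands
cancel, so the linearized operator sends the scaling profile to `-η`. -/
lemma dirichlet_scaling (w : H1 N) :
    dirichlet w (fun x => 1 / (2 * s) * η x + 1 / 2 * fderiv ℝ η x x)
        + wpair (h1Fn w) (fun x => 1 / (2 * s) * η x + 1 / 2 * fderiv ℝ η x x)
      = wpair (h1Fn w) (fun x =>
          (2 * s + 1) * (η x ^ (2 * s) * (1 / (2 * s) * η x + 1 / 2 * fderiv ℝ η x x))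
            + (-1) * η x) := by
  have hs := hη.s_pos
  have hw := memLp_h1Fn w
  have a1 := hη.decayC1.decayC0
  have a2 := hη.decayC1_radial.decayC0
  have a3 := hη.decayC0_rpow_mul a1
  have a4 := hη.decayC0_rpow_mul a2
  rw [dirichlet_add w (hη.decayC1.const_mul _) (hη.decayC1_radial.const_mul _),
    dirichlet_const_mul w _ hη.decayC1, dirichlet_const_mul w _ hη.decayC1_radial,
    hη.dirichlet_self, hη.dirichlet_radial]
  have b1 : wpair (h1Fn w) (fun x => η x - η x ^ (2 * s + 1))
      = wpair (h1Fn w) η + ((-1 : ℝ) : ℂ) * wpair (h1Fn w) (fun x => η x ^ (2 * s) * η x) := by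
    rw [← wpair_const_mul, ← wpair_add hw a1 (a3.const_mul _)]
    congr 1; funext x; rw [hη.rpow_two_s_add_one]; ring
  have b2 : wpair (h1Fn w) (fun x => (1 - (2 * s + 1) * η x ^ (2 * s)) * fderiv ℝ η x x)
      = wpair (h1Fn w) (fun x => fderiv ℝ η x x)
        + ((-(2 * s + 1) : ℝ) : ℂ) * wpair (h1Fn w) (fun x => η x ^ (2 * s) * fderiv ℝ η x x) := by
    rw [← wpair_const_mul, ← wpair_add hw a2 (a4.const_mul _)]
    congr 1; funext x; ring
  have b3 : wpair (h1Fn w) (fun x =>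
          (2 * s + 1) * (η x ^ (2 * s) * (1 / (2 * s) * η x + 1 / 2 * fderiv ℝ η x x))
            + (-1) * η x)
      = (((2 * s + 1) / (2 * s) : ℝ) : ℂ) * wpair (h1Fn w) (fun x => η x ^ (2 * s) * η x)
        + (((2 * s + 1) / 2 : ℝ) : ℂ) * wpair (h1Fn w) (fun x => η x ^ (2 * s) * fderiv ℝ η x x)
        + ((-1 : ℝ) : ℂ) * wpair (h1Fn w) η := by
    rw [← wpair_const_mul, ← wpair_const_mul, ← wpair_const_mul,
      ← wpair_add hw (a3.const_mul _) (a4.const_mul _),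
      ← wpair_add hw ((a3.const_mul _).add (a4.const_mul _)) (a1.const_mul _)]
    congr 1; funext x; ring
  rw [wpair_add hw (a1.const_mul _) (a2.const_mul _), wpair_const_mul, wpair_const_mul, b1, b2, b3]
  have hsC : (s : ℂ) ≠ 0 := by exact_mod_cast hs.ne'
  push_cast
  field_simp
  ring

end DecayProfile

end ProfileTests

/-! ### Taylor expansion of the power nonlinearity. -/

section PowerNonlinearity

/-- The interval contains all values `‖1 + ζ‖²` with `‖ζ‖ ≤ 1/2` and stays away from zero, where the
power is singular; the mean value inequality is applied twice. -/
lemma rpow_taylor (p : ℝ) : ∃ K, 0 ≤ K ∧ ∀ x ∈ Icc (1 / 4 : ℝ) (9 / 4),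
    |x ^ p - 1 - p * (x - 1)| ≤ K * (x - 1) ^ 2 := by
  have hpos : ∀ x ∈ Icc (1 / 4 : ℝ) (9 / 4), x ≠ 0 := fun x hx => by
    have := hx.1
    intro h
    rw [h] at this
    norm_num at this
  have h1 : (1 : ℝ) ∈ Icc (1 / 4 : ℝ) (9 / 4) := by constructor <;> norm_num
  obtain ⟨K₀, hK₀⟩ := isCompact_Icc.exists_bound_of_continuousOn (f := fun x : ℝ => (p - 1) * x ^ (p - 1 - 1))
    (s := Icc (1 / 4 : ℝ) (9 / 4))
    (continuousOn_const.mul (ContinuousOn.rpow_const continuousOn_id fun x hx => Or.inl (hpos x hx)))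
  have hK₀' : 0 ≤ K₀ := (norm_nonneg _).trans (hK₀ 1 h1)
  have d1 : ∀ y ∈ Icc (1 / 4 : ℝ) (9 / 4), |y ^ (p - 1) - 1| ≤ K₀ * |y - 1| := fun y hy => by
    have := (convex_Icc (1 / 4 : ℝ) (9 / 4)).norm_image_sub_le_of_norm_hasDerivWithin_le
      (f := fun x : ℝ => x ^ (p - 1)) (fun x hx =>
        (Real.hasDerivAt_rpow_const (Or.inl (hpos x hx))).hasDerivWithinAt) hK₀ h1 hy
    simpa using this
  refine ⟨|p| * K₀, by positivity, fun x hx => ?_⟩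
  have hsub : uIcc 1 x ⊆ Icc (1 / 4 : ℝ) (9 / 4) :=
    (ordConnected_Icc (a := (1 / 4 : ℝ)) (b := 9 / 4)).uIcc_subset h1 hx
  have := (convex_uIcc (1 : ℝ) x).norm_image_sub_le_of_norm_hasDerivWithin_le
    (f := fun y : ℝ => y ^ p - 1 - p * (y - 1)) (f' := fun y => p * y ^ (p - 1) - p * 1)
    (C := |p| * (K₀ * |x - 1|)) (fun y hy =>
      (((Real.hasDerivAt_rpow_const (p := p) (Or.inl (hpos y (hsub hy)))).sub_const 1).sub
        (((hasDerivAt_id y).sub_const 1).const_mul p)).hasDerivWithinAt)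
    (fun y hy => by
      rw [mul_one, ← mul_sub_one, norm_mul, Real.norm_eq_abs, Real.norm_eq_abs]
      refine mul_le_mul_of_nonneg_left ((d1 y (hsub hy)).trans ?_) (abs_nonneg _)
      exact mul_le_mul_of_nonneg_left (abs_sub_left_of_mem_uIcc hy) hK₀')
    left_mem_uIcc right_mem_uIcc
  simp only [Real.one_rpow, sub_self, mul_zero, sub_zero, Real.norm_eq_abs] at this
  refine this.trans (le_of_eq ?_)
  rw [← sq_abs (x - 1)]
  ring

/-- The linearization of the power nonlinearity at `1`. -/
noncomputable def powLin (p : ℝ) (ζ : ℂ) : ℂ :=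
  (((2 * p + 1) * ζ.re : ℝ) : ℂ) + Complex.I * ((ζ.im : ℝ) : ℂ)

lemma norm_powLin_le {p : ℝ} (hp : 0 ≤ p) (ζ : ℂ) : ‖powLin p ζ‖ ≤ (2 * p + 2) * ‖ζ‖ := by
  refine (norm_add_le _ _).trans ?_
  rw [norm_mul, Complex.norm_I, one_mul, Complex.norm_real, Complex.norm_real, norm_mul,
    Real.norm_of_nonneg (by positivity : 0 ≤ 2 * p + 1)]
  have h1 := Complex.abs_re_le_norm ζ
  have h2 := Complex.abs_im_le_norm ζ
  simp only [Real.norm_eq_abs]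
  nlinarith

lemma norm_powNL {p : ℝ} (hp : 0 ≤ p) (z : ℂ) : ‖powNL p z‖ = ‖z‖ ^ (2 * p + 1) := by
  rw [powNL, norm_mul, Complex.norm_real, Real.norm_of_nonneg (by positivity),
    Real.rpow_add_one' (norm_nonneg z) (by positivity)]

/-- The modulus enters through `x = ‖1 + ζ‖²`, with `x - 1 = 2 Re ζ + ‖ζ‖²`; expanding `x^p` to
first order leaves only terms quadratic in `ζ`. -/
lemma powNL_one_add_small (p : ℝ) : ∃ C, 0 ≤ C ∧ ∀ ζ : ℂ, ‖ζ‖ ≤ 1 / 2 →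
    ‖powNL p (1 + ζ) - 1 - powLin p ζ‖ ≤ C * ‖ζ‖ ^ 2 := by
  obtain ⟨K, hK, hb⟩ := rpow_taylor p
  refine ⟨|p| + |p| * 3 + K * 9 * 2, by positivity, fun ζ hζ => ?_⟩
  set x := ‖1 + ζ‖ ^ 2 with hx
  have hz := norm_nonneg ζ
  have hre := abs_le.1 (Complex.abs_re_le_norm ζ)
  have hx1 : x - 1 = 2 * ζ.re + ‖ζ‖ ^ 2 := by
    rw [hx, Complex.sq_norm, Complex.sq_norm, Complex.normSq_add]
    simp
    ring
  have hup : ‖1 + ζ‖ ≤ 3 / 2 := (norm_add_le _ _).trans (by rw [norm_one]; linarith)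
  have hlo : 1 / 2 ≤ ‖1 + ζ‖ := by
    have := norm_sub_norm_le (1 : ℂ) (-ζ)
    rw [norm_one, norm_neg, sub_neg_eq_add] at this
    linarith
  have hmem : x ∈ Icc (1 / 4 : ℝ) (9 / 4) := by
    constructor <;> nlinarith
  have hxle : |x - 1| ≤ 3 * ‖ζ‖ := by
    rw [hx1, abs_le]
    constructor <;> nlinarith
  have hpow : ‖1 + ζ‖ ^ (2 * p) = x ^ p := by
    rw [hx, ← Real.rpow_natCast, ← Real.rpow_mul (norm_nonneg _)]
    norm_num
  have hr := hb x hmem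
  set r := x ^ p - 1 - p * (x - 1) with hrdef
  have hr' : |r| ≤ K * 9 * ‖ζ‖ ^ 2 := by
    refine hr.trans ?_
    have : (x - 1) ^ 2 ≤ (3 * ‖ζ‖) ^ 2 := by
      rw [← sq_abs (x - 1)]
      gcongr
    nlinarith
  have e : powNL p (1 + ζ) - 1 - powLin p ζ
      = ((p * ‖ζ‖ ^ 2 : ℝ) : ℂ) + ((p * (x - 1) : ℝ) : ℂ) * ζ + (r : ℂ) * (1 + ζ) := by
    have hxp : x ^ p = r + 1 + p * (2 * ζ.re + ‖ζ‖ ^ 2) := by rw [hrdef, hx1]; ring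
    rw [powNL, hpow, powLin, hxp, hx1]
    push_cast
    linear_combination -Complex.re_add_im ζ
  rw [e]
  refine norm_add₃_le.trans ?_
  rw [norm_mul, norm_mul, Complex.norm_real, Complex.norm_real, Complex.norm_real, norm_mul,
    norm_mul]
  simp only [Real.norm_eq_abs, abs_of_nonneg (sq_nonneg ‖ζ‖)]
  have h1 : |p| * |x - 1| * ‖ζ‖ ≤ |p| * (3 * ‖ζ‖) * ‖ζ‖ := by gcongr
  have h2 : |r| * ‖1 + ζ‖ ≤ K * 9 * ‖ζ‖ ^ 2 * 2 :=
    mul_le_mul hr' (by linarith) (norm_nonneg _) (by positivity)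
  linarith

/-- No cancellation is needed away from zero: since `2‖ζ‖ ≥ 1`, every term is a multiple of a power
of `2‖ζ‖` not exceeding the `q`-th. -/
lemma norm_powNL_one_add_large {p q : ℝ} (hp : 0 ≤ p) (hq : 2 * p + 1 ≤ q) :
    ∃ C, 0 ≤ C ∧ ∀ ζ : ℂ, 1 / 2 ≤ ‖ζ‖ →
      ‖powNL p (1 + ζ)‖ + 1 + ‖powLin p ζ‖ ≤ C * ‖ζ‖ ^ q := by
  refine ⟨((3 / 2) ^ (2 * p + 1) + 1 + (2 * p + 2)) * 2 ^ q, by positivity, fun ζ hζ => ?_⟩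
  have h2 : 1 ≤ 2 * ‖ζ‖ := by linarith
  have hz : 0 ≤ ‖ζ‖ := norm_nonneg ζ
  have hX : 2 ^ q * ‖ζ‖ ^ q = (2 * ‖ζ‖) ^ q := (Real.mul_rpow two_pos.le hz).symm
  have hq1 : 1 ≤ q := by linarith
  have a1 : 1 ≤ (2 * ‖ζ‖) ^ q := Real.one_le_rpow h2 (by linarith)
  have a2 : 2 * ‖ζ‖ ≤ (2 * ‖ζ‖) ^ q := by
    simpa using Real.rpow_le_rpow_of_exponent_le h2 hq1
  have a3 : (2 * ‖ζ‖) ^ (2 * p + 1) ≤ (2 * ‖ζ‖) ^ q := Real.rpow_le_rpow_of_exponent_le h2 hq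
  have a4 : ‖powNL p (1 + ζ)‖ ≤ (3 / 2) ^ (2 * p + 1) * (2 * ‖ζ‖) ^ q := by
    rw [norm_powNL hp]
    have : ‖1 + ζ‖ ≤ 3 / 2 * (2 * ‖ζ‖) := (norm_add_le _ _).trans (by rw [norm_one]; linarith)
    calc _ ≤ (3 / 2 * (2 * ‖ζ‖)) ^ (2 * p + 1) :=
          Real.rpow_le_rpow (norm_nonneg _) this (by positivity)
      _ = (3 / 2) ^ (2 * p + 1) * (2 * ‖ζ‖) ^ (2 * p + 1) := Real.mul_rpow (by norm_num) (by linarith)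
      _ ≤ _ := by gcongr
  have a5 := norm_powLin_le hp ζ
  have a6 : (2 * p + 2) * ‖ζ‖ ≤ (2 * p + 2) * (2 * ‖ζ‖) ^ q := by gcongr; linarith
  rw [mul_assoc, hX]
  linarith

/-- The exponent `max 2 (2p+1)` covers the growth for large `ζ` and is at least two, so the
corresponding integrals of `w` remain quadratic in `‖w‖`. -/
lemma powNL_one_add_quadratic {p : ℝ} (hp : 0 ≤ p) : ∃ C, 0 ≤ C ∧ ∀ ζ : ℂ,
    ‖powNL p (1 + ζ) - 1 - powLin p ζ‖ ≤ C * (‖ζ‖ ^ 2 + ‖ζ‖ ^ max 2 (2 * p + 1)) := by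
  obtain ⟨C₁, h1, hb1⟩ := powNL_one_add_small p
  obtain ⟨C₂, h2, hb2⟩ := norm_powNL_one_add_large hp (le_max_right 2 (2 * p + 1))
  refine ⟨C₁ + C₂, by positivity, fun ζ => ?_⟩
  have p1 : 0 ≤ ‖ζ‖ ^ 2 := by positivity
  have p2 : 0 ≤ ‖ζ‖ ^ max 2 (2 * p + 1) := by positivity
  rcases le_total ‖ζ‖ (1 / 2) with h | h
  · have := hb1 ζ h
    nlinarith
  · have := hb2 ζ h
    have h3 : ‖powNL p (1 + ζ) - 1 - powLin p ζ‖ ≤ ‖powNL p (1 + ζ)‖ + 1 + ‖powLin p ζ‖ := by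
      refine (norm_sub_le _ _).trans (add_le_add_left ((norm_sub_le _ _).trans ?_) _)
      rw [norm_one]
    nlinarith

lemma powNL_one_add_linear {p : ℝ} (hp : 0 ≤ p) : ∃ C, 0 ≤ C ∧ ∀ ζ : ℂ,
    ‖powNL p (1 + ζ) - 1‖ ≤ C * (‖ζ‖ + ‖ζ‖ ^ (2 * p + 1)) := by
  obtain ⟨C₁, h1, hb1⟩ := powNL_one_add_small p
  obtain ⟨C₂, h2, hb2⟩ := norm_powNL_one_add_large hp le_rfl
  refine ⟨C₁ + (2 * p + 2) + C₂, by positivity, fun ζ => ?_⟩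
  have p1 : 0 ≤ ‖ζ‖ := norm_nonneg ζ
  have p2 : 0 ≤ ‖ζ‖ ^ (2 * p + 1) := by positivity
  have p3 : 0 ≤ C₁ * ‖ζ‖ ^ (2 * p + 1) := by positivity
  have p4 : 0 ≤ p * ‖ζ‖ ^ (2 * p + 1) := by positivity
  have p5 : 0 ≤ C₂ * ‖ζ‖ ^ (2 * p + 1) := by positivity
  have p6 : 0 ≤ C₂ * ‖ζ‖ := by positivity
  have p7 : 0 ≤ C₁ * ‖ζ‖ := by positivity
  have p8 : 0 ≤ p * ‖ζ‖ := by positivity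
  rcases le_total ‖ζ‖ (1 / 2) with h | h
  · have h3 := hb1 ζ h
    have h4 := norm_powLin_le hp ζ
    have h5 : ‖powNL p (1 + ζ) - 1‖ ≤ ‖powNL p (1 + ζ) - 1 - powLin p ζ‖ + ‖powLin p ζ‖ := by
      simpa using norm_add_le (powNL p (1 + ζ) - 1 - powLin p ζ) (powLin p ζ)
    have h6 : C₁ * ‖ζ‖ ^ 2 ≤ C₁ * ‖ζ‖ := by gcongr; nlinarith
    nlinarith
  · have := hb2 ζ h
    have h3 : ‖powNL p (1 + ζ) - 1‖ ≤ ‖powNL p (1 + ζ)‖ + 1 := by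
      refine (norm_sub_le _ _).trans ?_
      rw [norm_one]
    have h4 := norm_nonneg (powLin p ζ)
    nlinarith

/-- Homogeneity moves the base point to `1`, which makes the constants of the expansions independent
of the value of `η`. -/
lemma powNL_add_eq {p e : ℝ} (he : 0 < e) (w : ℂ) :
    powNL p (e + w) = ((e ^ (2 * p + 1) : ℝ) : ℂ) * powNL p (1 + ((e⁻¹ : ℝ) : ℂ) * w) := by
  have hC : (e : ℂ) ≠ 0 := by exact_mod_cast he.ne'
  have h : (e : ℂ) + w = (e : ℂ) * (1 + ((e⁻¹ : ℝ) : ℂ) * w) := by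
    push_cast
    field_simp
  rw [h, powNL, powNL, norm_mul, Complex.norm_real, Real.norm_of_nonneg he.le,
    Real.mul_rpow he.le (norm_nonneg _), Real.rpow_add_one he.ne']
  push_cast
  ring

lemma powLin_smul (p r : ℝ) (w : ℂ) : powLin p ((r : ℂ) * w) = (r : ℂ) * powLin p w := by
  simp only [powLin, Complex.re_ofReal_mul, Complex.im_ofReal_mul]
  push_cast
  ring

/-- First order expansion of the power nonlinearity at a positive number. -/
lemma norm_powNL_add_sub_le {p : ℝ} (hp : 0 ≤ p) : ∃ C, 0 ≤ C ∧ ∀ e : ℝ, 0 < e → ∀ w : ℂ,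
    ‖powNL p (e + w) - ((e ^ (2 * p + 1) : ℝ) : ℂ)‖
      ≤ C * (e ^ (2 * p) * ‖w‖ + ‖w‖ ^ (2 * p + 1)) := by
  obtain ⟨C, hC, hb⟩ := powNL_one_add_linear hp
  refine ⟨C, hC, fun e he w => ?_⟩
  have hp1 : 0 < e ^ (2 * p + 1) := Real.rpow_pos_of_pos he _
  rw [powNL_add_eq he, ← mul_sub_one, norm_mul, Complex.norm_real, Real.norm_of_nonneg hp1.le]
  have h := mul_le_mul_of_nonneg_left (hb (((e⁻¹ : ℝ) : ℂ) * w)) hp1.le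
  refine h.trans (le_of_eq ?_)
  rw [norm_mul, Complex.norm_real, Real.norm_of_nonneg (by positivity),
    Real.mul_rpow (by positivity) (norm_nonneg _), Real.inv_rpow he.le, Real.rpow_add_one he.ne']
  have : e ^ (2 * p) ≠ 0 := (Real.rpow_pos_of_pos he _).ne'
  field_simp

/-- Second order expansion of the power nonlinearity at a positive number. -/
lemma norm_powNL_add_sub_powLin_le {p : ℝ} (hp : 0 ≤ p) : ∃ C, 0 ≤ C ∧ ∀ e : ℝ, 0 < e → ∀ w : ℂ,
    ‖powNL p (e + w) - ((e ^ (2 * p + 1) : ℝ) : ℂ) - ((e ^ (2 * p) : ℝ) : ℂ) * powLin p w‖ * e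
      ≤ C * (e ^ (2 * p) * ‖w‖ ^ 2
        + e ^ (2 * p + 2 - max 2 (2 * p + 1)) * ‖w‖ ^ max 2 (2 * p + 1)) := by
  obtain ⟨C, hC, hb⟩ := powNL_one_add_quadratic hp
  refine ⟨C, hC, fun e he w => ?_⟩
  have hp1 : 0 < e ^ (2 * p + 1) := Real.rpow_pos_of_pos he _
  have hlin : ((e ^ (2 * p) : ℝ) : ℂ) * powLin p w
      = ((e ^ (2 * p + 1) : ℝ) : ℂ) * powLin p (((e⁻¹ : ℝ) : ℂ) * w) := by
    have hC : (e : ℂ) ≠ 0 := by exact_mod_cast he.ne'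
    rw [powLin_smul, Real.rpow_add_one he.ne']
    push_cast
    field_simp
  rw [powNL_add_eq he, hlin, ← mul_sub_one, ← mul_sub, norm_mul, Complex.norm_real,
    Real.norm_of_nonneg hp1.le, mul_right_comm]
  have h := mul_le_mul_of_nonneg_left (hb (((e⁻¹ : ℝ) : ℂ) * w)) (mul_pos hp1 he).le
  refine h.trans (le_of_eq ?_)
  set q := max 2 (2 * p + 1)
  have hq : e ^ (2 * p + 2 - q) = e ^ (2 * p + 1) * e / e ^ q := by
    rw [Real.rpow_sub he, ← Real.rpow_add_one he.ne']
    ring_nf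
  rw [hq, norm_mul, Complex.norm_real, Real.norm_of_nonneg (by positivity),
    Real.mul_rpow (by positivity) (norm_nonneg _), Real.inv_rpow he.le, Real.rpow_add_one he.ne']
  have : e ^ (2 * p) ≠ 0 := (Real.rpow_pos_of_pos he _).ne'
  have : e ^ q ≠ 0 := (Real.rpow_pos_of_pos he _).ne'
  field_simp

lemma continuous_powNL {p : ℝ} (hp : 0 ≤ p) : Continuous (powNL p) := by
  unfold powNL
  exact (Complex.continuous_ofReal.comp
    (continuous_norm.rpow_const fun _ => Or.inr (by positivity))).mul continuous_id

lemma continuous_powLin (p : ℝ) : Continuous (powLin p) := by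
  unfold powLin
  fun_prop

end PowerNonlinearity

/-! ### Integral bounds for the nonlinear terms. -/

section IntegralEstimates

variable {N : ℕ}

/-- For `q ≥ 2` this is the weighted Sobolev embedding. For `1 ≤ q ≤ 2` the pointwise bound `z^q ≤ z
+ z²` reduces it to Cauchy–Schwarz and the case `q = 2`. Higher powers of `‖w‖` are lowered using
`‖w‖ ≤ 1`. -/
lemma exists_weighted_bound_linear (hN : 1 ≤ N) {q κ : ℝ} (hq : 1 ≤ q)
    (hq' : 3 ≤ N → q * ((N : ℝ) - 2) < 2 * N) (hκ : 0 < κ) :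
    ∃ C, 0 ≤ C ∧ ∀ w : H1 N, ‖w‖ ≤ 1 →
      Integrable (fun x => ‖h1Fn w x‖ ^ q * Real.exp (-κ * ‖x‖)) ∧
      ∫ x, ‖h1Fn w x‖ ^ q * Real.exp (-κ * ‖x‖) ≤ C * ‖w‖ := by
  rcases le_total 2 q with h2 | h2
  · obtain ⟨C, hC, hb⟩ := exists_weighted_sobolev hN h2 hq' hκ
    refine ⟨C, hC, fun w hw => ⟨(hb w).1, (hb w).2.trans ?_⟩⟩
    gcongr
    simpa using Real.rpow_le_rpow_of_exponent_ge' (norm_nonneg w) hw zero_le_one hq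
  · obtain ⟨C, hC, hb⟩ := exists_weighted_sobolev hN le_rfl (fun h3 => by
      have : (3 : ℝ) ≤ N := by exact_mod_cast h3
      linarith) hκ
    have hexp : MemLp (fun x : Space N => ((Real.exp (-κ * ‖x‖) : ℝ) : ℂ)) 2 volume :=
      ((expDecay_exp hκ).mono 1 fun x => by rw [Complex.norm_real, one_mul]).memLp_two
        (Continuous.aestronglyMeasurable (by fun_prop))
    set D := (eLpNorm (fun x : Space N => ((Real.exp (-κ * ‖x‖) : ℝ) : ℂ)) 2 volume).toReal
    refine ⟨D + C, by positivity, fun w hw => ?_⟩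
    have hn : MemLp (fun x => ((‖h1Fn w x‖ : ℝ) : ℂ)) 2 volume :=
      (memLp_h1Fn w).norm.ofReal
    have i1 : Integrable (fun x => ‖h1Fn w x‖ * Real.exp (-κ * ‖x‖)) := by
      have := (hn.integrable_mul hexp).re
      refine this.congr (Eventually.of_forall fun x => ?_)
      simp [← Complex.ofReal_mul, -Complex.ofReal_exp]
    have b1 : ∫ x, ‖h1Fn w x‖ * Real.exp (-κ * ‖x‖) ≤ D * ‖w‖ := by
      have h := norm_integral_mul_le hn hexp
      simp only [← Complex.ofReal_mul] at h
      rw [integral_complex_ofReal, Complex.norm_real, Real.norm_of_nonneg (integral_nonneg fun x => by positivity)]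
        at h
      refine h.trans ?_
      rw [mul_comm]
      gcongr
      have e : eLpNorm (fun x => ((‖h1Fn w x‖ : ℝ) : ℂ)) 2 volume = eLpNorm (h1Fn w) 2 volume :=
        eLpNorm_congr_norm_ae (Eventually.of_forall fun x => by simp)
      rw [e]
      exact toReal_eLpNorm_h1Fn_le w
    obtain ⟨i2, b2⟩ := hb w
    have hpt : ∀ x, ‖h1Fn w x‖ ^ q * Real.exp (-κ * ‖x‖)
        ≤ ‖h1Fn w x‖ * Real.exp (-κ * ‖x‖) + ‖h1Fn w x‖ ^ (2 : ℝ) * Real.exp (-κ * ‖x‖) := fun x => by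
      rw [← add_mul]
      gcongr
      set z := ‖h1Fn w x‖
      have hz : 0 ≤ z := norm_nonneg _
      rcases le_total z 1 with h | h
      · have h1 : z ^ q ≤ z := by
          simpa using Real.rpow_le_rpow_of_exponent_ge' hz h zero_le_one hq
        have : 0 ≤ z ^ (2 : ℝ) := by positivity
        linarith
      · have := Real.rpow_le_rpow_of_exponent_le h h2
        linarith
    have i3 : Integrable (fun x => ‖h1Fn w x‖ ^ q * Real.exp (-κ * ‖x‖)) := by
      refine Integrable.mono' (integrable_fun_add i1 i2) ?_ (Eventually.of_forall fun x => ?_)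
      · exact ((Real.continuous_rpow_const (by linarith)).comp_aestronglyMeasurable
          (memLp_h1Fn w).1.norm).mul (Continuous.aestronglyMeasurable (by fun_prop))
      · rw [Real.norm_of_nonneg (by positivity)]
        exact hpt x
    refine ⟨i3, (integral_mono i3 (integrable_fun_add i1 i2) hpt).trans ?_⟩
    rw [integral_add i1 i2]
    have : C * ‖w‖ ^ (2 : ℝ) ≤ C * ‖w‖ := by
      gcongr
      simpa using Real.rpow_le_rpow_of_exponent_ge' (norm_nonneg w) hw zero_le_one one_le_two
    linarith

lemma exists_weighted_bound_quadratic (hN : 1 ≤ N) {q κ : ℝ} (hq : 2 ≤ q)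
    (hq' : 3 ≤ N → q * ((N : ℝ) - 2) < 2 * N) (hκ : 0 < κ) :
    ∃ C, 0 ≤ C ∧ ∀ w : H1 N, ‖w‖ ≤ 1 →
      Integrable (fun x => ‖h1Fn w x‖ ^ q * Real.exp (-κ * ‖x‖)) ∧
      ∫ x, ‖h1Fn w x‖ ^ q * Real.exp (-κ * ‖x‖) ≤ C * ‖w‖ ^ 2 := by
  obtain ⟨C, hC, hb⟩ := exists_weighted_sobolev hN hq hq' hκ
  refine ⟨C, hC, fun w hw => ⟨(hb w).1, (hb w).2.trans ?_⟩⟩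
  gcongr
  rw [← Real.rpow_natCast]
  exact Real.rpow_le_rpow_of_exponent_ge' (norm_nonneg w) hw zero_le_two (by simpa using hq)

lemma integrable_and_norm_integral_le {f : Space N → ℂ} {g : Space N → ℝ}
    (hf : AEStronglyMeasurable f volume) (hg : Integrable g) (h : ∀ᵐ x, ‖f x‖ ≤ g x) :
    Integrable f ∧ ‖∫ x, f x‖ ≤ ∫ x, g x :=
  ⟨hg.mono' hf h, norm_integral_le_of_norm_le hg h⟩

variable {s : ℝ} {η : Space N → ℝ}

lemma DecayProfile.exists_weight (hη : DecayProfile s η) {β : ℝ} (hβ : 0 < β) :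
    ∃ C κ, 0 ≤ C ∧ 0 < κ ∧ ∀ x, (1 + ‖x‖) * η x ^ β ≤ C * Real.exp (-κ * ‖x‖) := by
  have h : ExpDecay (fun x => (1 + ‖x‖) * η x ^ β) :=
    (hη.decayC1_rpow hβ).decay.poly 1 1 fun x => by
      rw [norm_mul, Real.norm_of_nonneg (by positivity : 0 ≤ 1 + ‖x‖), pow_one, one_mul]
  obtain ⟨C, κ, hC, hκ, hb⟩ := h
  exact ⟨C, κ, hC, hκ, fun x => (le_abs_self _).trans (hb x)⟩

/-- Remainder of the nonlinearity against a test function dominated by the profile. -/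
lemma DecayProfile.exists_remainder_bound (hη : DecayProfile s η) (hN : 1 ≤ N)
    (hs : 3 ≤ N → (2 * s + 1) * ((N : ℝ) - 2) < 2 * N) {Z : Space N → ℂ} (hZc : Continuous Z)
    {K : ℝ} (hK : 0 ≤ K) (hZ : ∀ x, ‖Z x‖ ≤ K * (1 + ‖x‖) * η x) :
    ∃ C, 0 ≤ C ∧ ∀ w : H1 N, ‖w‖ ≤ 1 →
      Integrable (fun x => (powNL s (η x + h1Fn w x) - ((η x ^ (2 * s + 1) : ℝ) : ℂ)
        - ((η x ^ (2 * s) : ℝ) : ℂ) * powLin s (h1Fn w x)) * conj (Z x)) ∧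
      ‖∫ x, (powNL s (η x + h1Fn w x) - ((η x ^ (2 * s + 1) : ℝ) : ℂ)
        - ((η x ^ (2 * s) : ℝ) : ℂ) * powLin s (h1Fn w x)) * conj (Z x)‖ ≤ C * ‖w‖ ^ 2 := by
  have hs0 := hη.s_pos
  -- The second order coefficient `η^(2s-1)` may grow at infinity; the factor `η` contained in the
  -- bound for `Z` compensates it, and the weights `η^(2s)` and `η^(2s+2-q)` both have positive
  -- exponents.
  set q := max 2 (2 * s + 1) with hqdef
  have hq2 : 2 ≤ q := le_max_left _ _
  have hβ : 0 < 2 * s + 2 - q := by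
    rcases max_choice 2 (2 * s + 1) with h | h <;> rw [hqdef, h] <;> linarith
  have hq3 : 3 ≤ N → q * ((N : ℝ) - 2) < 2 * N := fun h3 => by
    have h4 := hs h3
    rcases max_choice 2 (2 * s + 1) with h | h <;> rw [hqdef, h] <;> linarith
  obtain ⟨C₁, κ₁, hC₁, hκ₁, hb₁⟩ := hη.exists_weight (β := 2 * s) (by positivity)
  obtain ⟨C₂, κ₂, hC₂, hκ₂, hb₂⟩ := hη.exists_weight hβ
  obtain ⟨D₁, hD₁, hd₁⟩ := exists_weighted_bound_quadratic hN (q := 2) le_rfl (fun h3 => by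
      have : (3 : ℝ) ≤ N := by exact_mod_cast h3
      linarith) hκ₁
  obtain ⟨D₂, hD₂, hd₂⟩ := exists_weighted_bound_quadratic hN hq2 hq3 hκ₂
  obtain ⟨C₀, hC₀, hb₀⟩ := norm_powNL_add_sub_powLin_le hs0.le
  refine ⟨K * C₀ * (C₁ * D₁ + C₂ * D₂), by positivity, fun w hw => ?_⟩
  obtain ⟨i1, e1⟩ := hd₁ w hw
  obtain ⟨i2, e2⟩ := hd₂ w hw
  have hm : AEStronglyMeasurable (fun x => (powNL s (η x + h1Fn w x) - ((η x ^ (2 * s + 1) : ℝ) : ℂ)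
        - ((η x ^ (2 * s) : ℝ) : ℂ) * powLin s (h1Fn w x)) * conj (Z x)) volume := by
    have m1 : AEStronglyMeasurable (fun x => powNL s (η x + h1Fn w x)) volume :=
      (continuous_powNL hs0.le).comp_aestronglyMeasurable
        ((Complex.continuous_ofReal.comp hη.decayC1.continuous).aestronglyMeasurable.add (memLp_h1Fn w).1)
    have m2 : Continuous (fun x => ((η x ^ (2 * s + 1) : ℝ) : ℂ)) :=
      Complex.continuous_ofReal.comp (hη.decayC1_rpow (by positivity)).continuous
    have m3 : Continuous (fun x => ((η x ^ (2 * s) : ℝ) : ℂ)) :=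
      Complex.continuous_ofReal.comp (hη.decayC1_rpow (by positivity)).continuous
    exact ((m1.sub m2.aestronglyMeasurable).sub (m3.aestronglyMeasurable.mul
      ((continuous_powLin s).comp_aestronglyMeasurable (memLp_h1Fn w).1))).mul
      (Complex.continuous_conj.comp hZc).aestronglyMeasurable
  have hdom : ∀ x, ‖(powNL s (η x + h1Fn w x) - ((η x ^ (2 * s + 1) : ℝ) : ℂ)
        - ((η x ^ (2 * s) : ℝ) : ℂ) * powLin s (h1Fn w x)) * conj (Z x)‖
      ≤ K * C₀ * (C₁ * (‖h1Fn w x‖ ^ (2 : ℝ) * Real.exp (-κ₁ * ‖x‖))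
        + C₂ * (‖h1Fn w x‖ ^ q * Real.exp (-κ₂ * ‖x‖))) := fun x => by
    rw [norm_mul, RCLike.norm_conj]
    have h0 := hb₀ (η x) (hη.pos x) (h1Fn w x)
    have hx0 : 0 ≤ 1 + ‖x‖ := by positivity
    calc _ ≤ ‖powNL s (η x + h1Fn w x) - ((η x ^ (2 * s + 1) : ℝ) : ℂ)
        - ((η x ^ (2 * s) : ℝ) : ℂ) * powLin s (h1Fn w x)‖ * (K * (1 + ‖x‖) * η x) := by
          gcongr; exact hZ x
      _ = K * (1 + ‖x‖) * (‖powNL s (η x + h1Fn w x) - ((η x ^ (2 * s + 1) : ℝ) : ℂ)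
        - ((η x ^ (2 * s) : ℝ) : ℂ) * powLin s (h1Fn w x)‖ * η x) := by ring
      _ ≤ K * (1 + ‖x‖) * (C₀ * (η x ^ (2 * s) * ‖h1Fn w x‖ ^ 2
        + η x ^ (2 * s + 2 - q) * ‖h1Fn w x‖ ^ q)) := by gcongr
      _ = K * C₀ * ((1 + ‖x‖) * η x ^ (2 * s) * ‖h1Fn w x‖ ^ 2
        + (1 + ‖x‖) * η x ^ (2 * s + 2 - q) * ‖h1Fn w x‖ ^ q) := by ring
      _ ≤ K * C₀ * (C₁ * Real.exp (-κ₁ * ‖x‖) * ‖h1Fn w x‖ ^ 2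
        + C₂ * Real.exp (-κ₂ * ‖x‖) * ‖h1Fn w x‖ ^ q) := by
          have n1 := norm_nonneg (h1Fn w x)
          refine mul_le_mul_of_nonneg_left (add_le_add ?_ ?_) (by positivity)
          · exact mul_le_mul_of_nonneg_right (hb₁ x) (by positivity)
          · exact mul_le_mul_of_nonneg_right (hb₂ x) (by positivity)
      _ = _ := by rw [Real.rpow_two]; ring
  obtain ⟨h1, h2⟩ := integrable_and_norm_integral_le hm
    ((integrable_fun_add (i1.const_mul C₁) (i2.const_mul C₂)).const_mul (K * C₀))
    (Eventually.of_forall hdom)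
  refine ⟨h1, h2.trans ?_⟩
  rw [integral_const_mul, integral_add (i1.const_mul _) (i2.const_mul _), integral_const_mul,
    integral_const_mul]
  calc K * C₀ * _ ≤ K * C₀ * (C₁ * (D₁ * ‖w‖ ^ 2) + C₂ * (D₂ * ‖w‖ ^ 2)) := by gcongr
    _ = _ := by ring

/-- The force term against a test function dominated by the profile, to leading order. -/
lemma DecayProfile.exists_force_bound (hη : DecayProfile s η) (hN : 1 ≤ N) {s' : ℝ} (hs'0 : 0 ≤ s')
    (hs' : 3 ≤ N → (2 * s' + 1) * ((N : ℝ) - 2) < 2 * N) {Z : Space N → ℂ} (hZc : Continuous Z)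
    {K : ℝ} (hK : 0 ≤ K) (hZ : ∀ x, ‖Z x‖ ≤ K * (1 + ‖x‖) * η x) {L : ℝ} (hL : 0 ≤ L) :
    ∃ C, 0 ≤ C ∧ ∀ (w : H1 N) (l : Space N → ℝ), ‖w‖ ≤ 1 → AEStronglyMeasurable l volume →
      (∀ᵐ x, ‖l x‖ ≤ L) →
      ‖(∫ x, (l x : ℂ) * powNL s' (η x + h1Fn w x) * conj (Z x))
        - ∫ x, (l x : ℂ) * ((η x ^ (2 * s' + 1) : ℝ) : ℂ) * conj (Z x)‖ ≤ C * ‖w‖ ∧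
      ‖∫ x, (l x : ℂ) * ((η x ^ (2 * s' + 1) : ℝ) : ℂ) * conj (Z x)‖ ≤ C := by
  obtain ⟨C₁, κ₁, hC₁, hκ₁, hb₁⟩ := hη.exists_weight (β := 2 * s' + 1) (by positivity)
  obtain ⟨C₂, κ₂, hC₂, hκ₂, hb₂⟩ := hη.exists_weight one_pos
  obtain ⟨C₃, κ₃, hC₃, hκ₃, hb₃⟩ := hη.exists_weight (β := 2 * s' + 2) (by positivity)
  obtain ⟨D₁, hD₁, hd₁⟩ := exists_weighted_bound_linear hN (q := 1) le_rfl (fun h3 => by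
      have : (3 : ℝ) ≤ N := by exact_mod_cast h3
      linarith) hκ₁
  obtain ⟨D₂, hD₂, hd₂⟩ := exists_weighted_bound_linear hN (q := 2 * s' + 1) (by linarith) hs' hκ₂
  obtain ⟨C₀, hC₀, hb₀⟩ := norm_powNL_add_sub_le hs'0
  set J := ∫ x : Space N, Real.exp (-κ₃ * ‖x‖)
  have hJ : 0 ≤ J := integral_nonneg fun x => by positivity
  -- The constant depends on `l` only through `L`, which makes the bound uniform in the position and
  -- scale of the soliton.
  refine ⟨L * K * C₀ * (C₁ * D₁ + C₂ * D₂) + L * K * C₃ * J, by positivity,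
    fun w l hw hlm hlL => ?_⟩
  obtain ⟨i1, e1⟩ := hd₁ w hw
  obtain ⟨i2, e2⟩ := hd₂ w hw
  have ml : AEStronglyMeasurable (fun x => (l x : ℂ)) volume :=
    Complex.continuous_ofReal.comp_aestronglyMeasurable hlm
  have m1 : AEStronglyMeasurable (fun x => powNL s' (η x + h1Fn w x)) volume :=
    (continuous_powNL hs'0).comp_aestronglyMeasurable
      ((Complex.continuous_ofReal.comp hη.decayC1.continuous).aestronglyMeasurable.add (memLp_h1Fn w).1)
  have m2 : AEStronglyMeasurable (fun x => ((η x ^ (2 * s' + 1) : ℝ) : ℂ)) volume :=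
    (Complex.continuous_ofReal.comp
      (hη.decayC1_rpow (p := 2 * s' + 1) (by positivity)).continuous).aestronglyMeasurable
  have mZ : AEStronglyMeasurable (fun x => conj (Z x)) volume :=
    (Complex.continuous_conj.comp hZc).aestronglyMeasurable
  have hd1 : ∀ᵐ x, ‖(l x : ℂ) * (powNL s' (η x + h1Fn w x) - ((η x ^ (2 * s' + 1) : ℝ) : ℂ))
      * conj (Z x)‖ ≤ L * K * C₀ * (C₁ * (‖h1Fn w x‖ ^ (1 : ℝ) * Real.exp (-κ₁ * ‖x‖))
        + C₂ * (‖h1Fn w x‖ ^ (2 * s' + 1) * Real.exp (-κ₂ * ‖x‖))) := by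
    filter_upwards [hlL] with x hx
    rw [norm_mul, norm_mul, RCLike.norm_conj, Complex.norm_real]
    have h0 := hb₀ (η x) (hη.pos x) (h1Fn w x)
    have hx0 : 0 ≤ 1 + ‖x‖ := by positivity
    have hpx := hη.pos x
    calc _ ≤ L * (C₀ * (η x ^ (2 * s') * ‖h1Fn w x‖ + ‖h1Fn w x‖ ^ (2 * s' + 1)))
          * (K * (1 + ‖x‖) * η x) := by
          gcongr; exact hZ x
      _ = L * K * C₀ * ((1 + ‖x‖) * η x ^ (2 * s' + 1) * ‖h1Fn w x‖
          + (1 + ‖x‖) * η x ^ (1 : ℝ) * ‖h1Fn w x‖ ^ (2 * s' + 1)) := by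
          rw [Real.rpow_add_one hpx.ne', Real.rpow_one]; ring
      _ ≤ L * K * C₀ * (C₁ * Real.exp (-κ₁ * ‖x‖) * ‖h1Fn w x‖
          + C₂ * Real.exp (-κ₂ * ‖x‖) * ‖h1Fn w x‖ ^ (2 * s' + 1)) := by
          have n1 := norm_nonneg (h1Fn w x)
          refine mul_le_mul_of_nonneg_left (add_le_add ?_ ?_) (by positivity)
          · exact mul_le_mul_of_nonneg_right (hb₁ x) (by positivity)
          · exact mul_le_mul_of_nonneg_right (hb₂ x) (by positivity)
      _ = _ := by rw [Real.rpow_one]; ring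
  have hd2 : ∀ᵐ x, ‖(l x : ℂ) * ((η x ^ (2 * s' + 1) : ℝ) : ℂ) * conj (Z x)‖
      ≤ L * K * C₃ * Real.exp (-κ₃ * ‖x‖) := by
    filter_upwards [hlL] with x hx
    have hpx := hη.pos x
    have hq : 0 ≤ η x ^ (2 * s' + 1) := by positivity
    rw [norm_mul, norm_mul, RCLike.norm_conj, Complex.norm_real, Complex.norm_real,
      Real.norm_of_nonneg hq]
    calc _ ≤ L * η x ^ (2 * s' + 1) * (K * (1 + ‖x‖) * η x) := by
          gcongr; exact hZ x
      _ = L * K * ((1 + ‖x‖) * η x ^ (2 * s' + 2)) := by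
          have : η x ^ (2 * s' + 2) = η x ^ (2 * s' + 1) * η x := by
            rw [← Real.rpow_add_one hpx.ne']; ring_nf
          rw [this]; ring
      _ ≤ L * K * (C₃ * Real.exp (-κ₃ * ‖x‖)) :=
          mul_le_mul_of_nonneg_left (hb₃ x) (by positivity)
      _ = _ := by ring
  obtain ⟨j1, f1⟩ := integrable_and_norm_integral_le
    (f := fun x => (l x : ℂ) * (powNL s' (η x + h1Fn w x) - ((η x ^ (2 * s' + 1) : ℝ) : ℂ))
      * conj (Z x)) ((ml.mul (m1.sub m2)).mul mZ)
    ((integrable_fun_add (i1.const_mul C₁) (i2.const_mul C₂)).const_mul (L * K * C₀)) hd1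
  obtain ⟨j2, f2⟩ := integrable_and_norm_integral_le
    (f := fun x => (l x : ℂ) * ((η x ^ (2 * s' + 1) : ℝ) : ℂ) * conj (Z x)) ((ml.mul m2).mul mZ)
    ((integrable_exp_neg_norm hκ₃).const_mul (L * K * C₃)) hd2
  have hJ' : 0 ≤ L * K * C₃ * J := by positivity
  have hD' : 0 ≤ L * K * C₀ * (C₁ * D₁ + C₂ * D₂) := by positivity
  constructor
  · have e : (∫ x, (l x : ℂ) * powNL s' (η x + h1Fn w x) * conj (Z x))
        - ∫ x, (l x : ℂ) * ((η x ^ (2 * s' + 1) : ℝ) : ℂ) * conj (Z x)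
        = ∫ x, (l x : ℂ) * (powNL s' (η x + h1Fn w x) - ((η x ^ (2 * s' + 1) : ℝ) : ℂ))
          * conj (Z x) := by
      rw [sub_eq_iff_eq_add, ← integral_add j1 j2]
      exact integral_congr_ae (Eventually.of_forall fun x => by ring)
    rw [e]
    refine f1.trans ?_
    rw [integral_const_mul, integral_add (i1.const_mul _) (i2.const_mul _), integral_const_mul,
      integral_const_mul]
    calc _ ≤ L * K * C₀ * (C₁ * (D₁ * ‖w‖) + C₂ * (D₂ * ‖w‖)) := by gcongr
      _ = L * K * C₀ * (C₁ * D₁ + C₂ * D₂) * ‖w‖ := by ring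
      _ ≤ _ := by gcongr; linarith
  · refine f2.trans ?_
    rw [integral_const_mul]
    linarith

end IntegralEstimates

/-! ### Differentiability of the effective potential and of the vector field. -/

section EffectivePotential

variable {N : ℕ}

lemma aestronglyMeasurable_comp_affine {lam : Space N → ℝ} (hlam : MemLp lam ⊤ volume) {ν : ℝ}
    (hν : ν ≠ 0) (a : Space N) : AEStronglyMeasurable (fun x => lam (ν • (x - a))) volume :=
  hlam.1.comp_quasiMeasurePreserving (quasiMeasurePreserving_affine hν a)

lemma ae_norm_comp_affine_le {lam : Space N → ℝ} (hlam : MemLp lam ⊤ volume) {ν : ℝ}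
    (hν : ν ≠ 0) (a : Space N) :
    ∀ᵐ x, ‖lam (ν • (x - a))‖ ≤ (eLpNorm lam ⊤ volume).toReal := by
  refine (quasiMeasurePreserving_affine hν a).ae (p := fun y => ‖lam y‖ ≤ (eLpNorm lam ⊤ volume).toReal) ?_
  filter_upwards [ae_le_eLpNormEssSup (f := lam) (μ := volume)] with x hx
  rw [← toReal_enorm]
  refine ENNReal.toReal_mono hlam.2.ne ?_
  rwa [eLpNorm_exponent_top]

variable {E : Type*} [NormedAddCommGroup E] [NormedSpace ℝ E]

lemma integrable_comp_affine_smul {lam : Space N → ℝ} (hlam : MemLp lam ⊤ volume) {ν : ℝ}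
    (hν : ν ≠ 0) (a : Space N) {f : Space N → E} (hf : ExpDecay f)
    (hm : AEStronglyMeasurable f volume) : Integrable (fun x => lam (ν • (x - a)) • f x) := by
  refine ((hf.integrable hm).norm.const_mul (eLpNorm lam ⊤ volume).toReal).mono'
    ((aestronglyMeasurable_comp_affine hlam hν a).smul hm) ?_
  filter_upwards [ae_norm_comp_affine_le hlam hν a] with x hx
  rw [norm_smul]
  gcongr

/-- Differentiation of a correlation of a bounded function with an exponentially decaying one. -/
lemma hasFDerivAt_integral_shift {lam : Space N → ℝ} (hlam : MemLp lam ⊤ volume) {ν : ℝ}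
    (hν : ν ≠ 0) {ρ : Space N → E} (hρ : DecayC1 ρ) (b : Space N) :
    HasFDerivAt (fun b => ∫ x, lam (ν • (b + x)) • ρ x)
      (-∫ x, lam (ν • (b + x)) • fderiv ℝ ρ x) b := by
  -- The potential is merely bounded and measurable, so the shift is transferred to the regular
  -- factor `ρ` before differentiating.
  have e1 : (fun b => ∫ x, lam (ν • (b + x)) • ρ x) = fun b => ∫ y, lam (ν • y) • ρ (y - b) := by
    funext b
    rw [← integral_add_left_eq_self (fun y => lam (ν • y) • ρ (y - b)) b]
    simp
  have e2 : -∫ x, lam (ν • (b + x)) • fderiv ℝ ρ x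
      = ∫ y, lam (ν • y) • -fderiv ℝ ρ (y - b) := by
    rw [← integral_add_left_eq_self (fun y => lam (ν • y) • -fderiv ℝ ρ (y - b)) b, ← integral_neg]
    simp
  rw [e1, e2]
  obtain ⟨C, κ, hC, hκ, hb⟩ := hρ.decay_fderiv
  have hlm : AEStronglyMeasurable (fun y => lam (ν • y)) volume := by
    simpa using aestronglyMeasurable_comp_affine hlam hν 0
  have hlb : ∀ᵐ y, ‖lam (ν • y)‖ ≤ (eLpNorm lam ⊤ volume).toReal := by
    simpa using ae_norm_comp_affine_le hlam hν 0
  have hi : Integrable (fun y => lam (ν • y) • ρ (y - b)) := by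
    have := integrable_comp_affine_smul hlam hν (-b) hρ.decay hρ.continuous.aestronglyMeasurable
    simpa using this.comp_sub_right b
  refine hasFDerivAt_integral_of_dominated_of_fderiv_le (x₀ := b)
    (F := fun b y => lam (ν • y) • ρ (y - b)) (F' := fun b y => lam (ν • y) • -fderiv ℝ ρ (y - b))
    (bound := fun y => (eLpNorm lam ⊤ volume).toReal * (C * Real.exp κ * Real.exp (-κ * ‖y - b‖)))
    (Metric.ball_mem_nhds b one_pos) (Eventually.of_forall fun b' => ?_) hi ?_ ?_ ?_ ?_
  · exact hlm.smul (hρ.continuous.comp (continuous_id.sub continuous_const)).aestronglyMeasurable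
  · exact hlm.smul
      (hρ.continuous_fderiv.comp (continuous_id.sub continuous_const)).neg.aestronglyMeasurable
  · filter_upwards [hlb] with y hy b' hb'
    rw [norm_smul, norm_neg]
    refine mul_le_mul hy ((hb _).trans ?_) (norm_nonneg _) ENNReal.toReal_nonneg
    rw [mul_assoc, ← Real.exp_add]
    gcongr
    have h1 : ‖b' - b‖ < 1 := by simpa [dist_eq_norm] using hb'
    have h2 : ‖y - b‖ ≤ ‖y - b'‖ + ‖b' - b‖ := by
      simpa using norm_add_le (y - b') (b' - b)
    nlinarith
  · exact (((integrable_exp_neg_norm hκ).comp_sub_right b).const_mul _).const_mul _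
  · refine Eventually.of_forall fun y b' _ => ?_
    have h1 : HasFDerivAt (fun b' : Space N => y - b') (-ContinuousLinearMap.id ℝ (Space N)) b' :=
      (hasFDerivAt_id b').const_sub y
    have h2 := ((hρ.differentiable (y - b')).hasFDerivAt.comp b' h1).const_smul (lam (ν • y))
    rw [ContinuousLinearMap.comp_neg, ContinuousLinearMap.comp_id] at h2
    exact h2

variable {s : ℝ} {η : Space N → ℝ}

lemma DecayProfile.fderiv_rpow_apply (hη : DecayProfile s η) {s' : ℝ} (x h : Space N) :
    fderiv ℝ (fun x => η x ^ (2 * s' + 2)) x h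
      = (2 * s' + 2) * (η x ^ (2 * s' + 1) * fderiv ℝ η x h) := by
  rw [(hη.hasFDerivAt_rpow _ x).fderiv, show 2 * s' + 2 - 1 = 2 * s' + 1 by ring]
  simp only [smul_apply, smul_eq_mul]
  ring

lemma DecayProfile.hasFDerivAt_Veff (hη : DecayProfile s η) {s' : ℝ} (hs' : 0 ≤ s')
    {lam : Space N → ℝ} (hlam : MemLp lam ⊤ volume) (ε : ℝ) {μ : ℝ} (hμ : 0 < μ) (b : Space N) :
    HasFDerivAt (Veff s s' ε lam η μ) (effPrefactor s s' ε η μ •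
      -∫ x, lam ((Real.sqrt μ)⁻¹ • (b + x)) • fderiv ℝ (fun x => η x ^ (2 * s' + 2)) x) b := by
  have hν : (Real.sqrt μ)⁻¹ ≠ 0 := inv_ne_zero (Real.sqrt_pos.2 hμ).ne'
  exact (hasFDerivAt_integral_shift hlam hν
    (hη.decayC1_rpow (p := 2 * s' + 2) (by positivity)) b).const_mul _

lemma integrable_shift_smul {lam : Space N → ℝ} (hlam : MemLp lam ⊤ volume) {ν : ℝ}
    (hν : ν ≠ 0) (b : Space N) {f : Space N → E} (hf : ExpDecay f)
    (hm : AEStronglyMeasurable f volume) : Integrable (fun x => lam (ν • (b + x)) • f x) := by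
  simpa [add_comm] using integrable_comp_affine_smul hlam hν (-b) hf hm

/-- The gradient of the effective potential. -/
lemma DecayProfile.gradient_Veff (hη : DecayProfile s η) {s' : ℝ} (hs' : 0 ≤ s')
    {lam : Space N → ℝ} (hlam : MemLp lam ⊤ volume) (ε : ℝ) {μ : ℝ} (hμ : 0 < μ) (b : Space N)
    (j : Fin N) :
    gradient (Veff s s' ε lam η μ) b j = -(effPrefactor s s' ε η μ * (2 * s' + 2) *
      ∫ x, lam ((Real.sqrt μ)⁻¹ • (b + x)) * (η x ^ (2 * s' + 1) * partialDeriv j η x)) := by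
  have hν : (Real.sqrt μ)⁻¹ ≠ 0 := inv_ne_zero (Real.sqrt_pos.2 hμ).ne'
  have hρ := hη.decayC1_rpow (p := 2 * s' + 2) (by positivity)
  have h1 : gradient (Veff s s' ε lam η μ) b j
      = fderiv ℝ (Veff s s' ε lam η μ) b (stdVec j) := by
    rw [← inner_gradient_left, stdVec, EuclideanSpace.inner_single_right]
    simp
  rw [h1, (hη.hasFDerivAt_Veff hs' hlam ε hμ b).fderiv, smul_apply,
    neg_apply, ContinuousLinearMap.integral_apply
      (integrable_shift_smul hlam hν b hρ.decay_fderiv hρ.continuous_fderiv.aestronglyMeasurable)]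
  simp only [smul_apply, hη.fderiv_rpow_apply, smul_eq_mul]
  rw [mul_neg, mul_assoc, ← integral_const_mul (2 * s' + 2)]
  congr 2
  refine integral_congr_ae (Eventually.of_forall fun x => ?_)
  simp only [partialDeriv]
  ring

lemma DecayC1.smul_id {f : Space N → ℝ} (hf : DecayC1 f) : DecayC1 (fun x => f x • x) := by
  have e : (fun x => f x • x) = fun x => ∑ i : Fin N,
      (ContinuousLinearMap.smulRight (ContinuousLinearMap.id ℝ ℝ) (stdVec i : Space N))
        (x i * f x) := by
    funext x
    refine (congrArg (f x • ·) ((EuclideanSpace.basisFun (Fin N) ℝ).sum_repr x).symm).trans ?_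
    simp only [Finset.smul_sum]
    refine Finset.sum_congr rfl fun i _ => ?_
    simp [stdVec, smul_smul, mul_comm]
  rw [e]
  exact DecayC1.sum _ fun i _ => (hf.coord_mul i).clm_comp _

lemma effField_eq (s' : ℝ) (lam η : Space N → ℝ) (μ : ℝ) (b : Space N) :
    effField s' lam η μ b
      = ∫ x, lam ((Real.sqrt μ)⁻¹ • (b + x)) • (η x ^ (2 * s' + 2) • x) := by
  simp only [effField, mul_smul]

lemma DecayProfile.hasFDerivAt_effField (hη : DecayProfile s η) {s' : ℝ} (hs' : 0 ≤ s')
    {lam : Space N → ℝ} (hlam : MemLp lam ⊤ volume) {μ : ℝ} (hμ : 0 < μ) (b : Space N) :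
    HasFDerivAt (effField s' lam η μ) (-∫ x, lam ((Real.sqrt μ)⁻¹ • (b + x)) •
      fderiv ℝ (fun x => η x ^ (2 * s' + 2) • x) x) b := by
  have hν : (Real.sqrt μ)⁻¹ ≠ 0 := inv_ne_zero (Real.sqrt_pos.2 hμ).ne'
  rw [funext (effField_eq s' lam η μ)]
  exact hasFDerivAt_integral_shift hlam hν
    (hη.decayC1_rpow (p := 2 * s' + 2) (by positivity)).smul_id b

lemma DecayProfile.divergenceAt_effField (hη : DecayProfile s η) {s' : ℝ} (hs' : 0 ≤ s')
    {lam : Space N → ℝ} (hlam : MemLp lam ⊤ volume) {μ : ℝ} (hμ : 0 < μ) (b : Space N) :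
    divergenceAt (effField s' lam η μ) b = -∫ x, lam ((Real.sqrt μ)⁻¹ • (b + x)) *
      (N * η x ^ (2 * s' + 2) + (2 * s' + 2) * (η x ^ (2 * s' + 1) * fderiv ℝ η x x)) := by
  have hν : (Real.sqrt μ)⁻¹ ≠ 0 := inv_ne_zero (Real.sqrt_pos.2 hμ).ne'
  have hρ := hη.decayC1_rpow (p := 2 * s' + 2) (by positivity)
  have hρx := hρ.smul_id
  have hint := integrable_shift_smul hlam hν b hρx.decay_fderiv
    hρx.continuous_fderiv.aestronglyMeasurable
  -- The divergence is the trace of the derivative, a continuous linear functional, and therefore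
  -- passes under the integral.
  let Φ : (Space N →L[ℝ] Space N) →L[ℝ] ℝ := ∑ i : Fin N,
    (EuclideanSpace.proj (𝕜 := ℝ) i : Space N →L[ℝ] ℝ).comp
      (ContinuousLinearMap.apply ℝ (Space N) (stdVec i))
  have hΦ : ∀ A, Φ A = ∑ i, (A (stdVec i)) i := fun A => by
    simp [Φ]
  have e : divergenceAt (effField s' lam η μ) b = Φ (fderiv ℝ (effField s' lam η μ) b) := (hΦ _).symm
  rw [e, (hη.hasFDerivAt_effField hs' hlam hμ b).fderiv, map_neg, ← Φ.integral_comp_comm hint]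
  congr 1
  refine integral_congr_ae (Eventually.of_forall fun x => ?_)
  have hd : HasFDerivAt (fun x => η x ^ (2 * s' + 2) • x) _ x :=
    (hρ.differentiable x).hasFDerivAt.smul (hasFDerivAt_id x)
  simp only [map_smul, smul_eq_mul]
  congr 1
  rw [hΦ, hd.fderiv]
  simp only [add_apply, smul_apply,
    ContinuousLinearMap.smulRight_apply, ContinuousLinearMap.id_apply, PiLp.add_apply,
    PiLp.smul_apply, smul_eq_mul, hη.fderiv_rpow_apply]
  rw [Finset.sum_add_distrib, fderiv_apply_eq_sum η x x]
  congr 1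
  · simp [stdVec]
  · rw [Finset.mul_sum, Finset.mul_sum]
    refine Finset.sum_congr rfl fun i _ => ?_
    rw [partialDeriv, smul_eq_mul]
    ring

end EffectivePotential

/-! ### Tangent vectors and generator modes in the moving frame. -/

section Tangent

variable {N : ℕ} {s : ℝ} {η : Space N → ℝ}

lemma act_mem_tangentSpaceAt (σ : Param N) (e : Gen N) :
    e.act s (soliton s η σ) ∈ tangentSpaceAt s η σ := Submodule.subset_span ⟨e, rfl⟩

lemma transf_gauge_mem (σ : Param N) :
    transf s σ (fun y => Complex.I * (η y : ℂ)) ∈ tangentSpaceAt s η σ := by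
  convert act_mem_tangentSpaceAt (s := s) (η := η) σ Gen.gauge using 1
  funext x
  simp only [transf, soliton, Gen.act]
  ring

/-- The spanning vectors use the original coordinate `x_j`, whereas `y_j = √μ (x_j - a_j)`; the
recentring is a gauge vector. -/
lemma transf_boost_mem (σ : Param N) (j : Fin N) :
    transf s σ (fun y => Complex.I * ((y j * η y : ℝ) : ℂ)) ∈ tangentSpaceAt s η σ := by
  have h := Submodule.sub_mem _
    (Submodule.smul_mem _ (Real.sqrt σ.μ) (act_mem_tangentSpaceAt (s := s) (η := η) σ (Gen.boost j)))
    (Submodule.smul_mem _ (Real.sqrt σ.μ * σ.a j)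
      (act_mem_tangentSpaceAt (s := s) (η := η) σ Gen.gauge))
  convert h using 1
  funext x
  simp only [transf, soliton, Gen.act, Pi.sub_apply, Pi.smul_apply, Complex.real_smul,
    PiLp.smul_apply, PiLp.sub_apply, smul_eq_mul]
  push_cast
  ring

variable (hη : DecayProfile s η)

include hη

lemma DecayProfile.contDiff_ofReal : ContDiff ℝ 1 (fun y => (η y : ℂ)) :=
  Complex.ofRealCLM.contDiff.comp hη.decayC1.contDiff

lemma DecayProfile.fderiv_ofReal (y h : Space N) :
    fderiv ℝ (fun y => (η y : ℂ)) y h = ((fderiv ℝ η y h : ℝ) : ℂ) := by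
  have : HasFDerivAt (fun x => (η x : ℂ)) (Complex.ofRealCLM.comp (fderiv ℝ η y)) y :=
    Complex.ofRealCLM.hasFDerivAt.comp y (hη.differentiable y).hasFDerivAt
  rw [this.fderiv]
  rfl

/-- The derivative of the phase produces `i v_j / 2` times the soliton, which a gauge vector
removes. -/
lemma DecayProfile.transf_translation_mem (σ : Param N) (hμ : 0 < σ.μ) (j : Fin N) :
    transf s σ (fun y => ((partialDeriv j η y : ℝ) : ℂ)) ∈ tangentSpaceAt s η σ := by
  have h := Submodule.smul_mem _ (-(Real.sqrt σ.μ)⁻¹) (Submodule.add_mem _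
    (act_mem_tangentSpaceAt (s := s) (η := η) σ (Gen.translation j))
    (Submodule.smul_mem _ (σ.v j / 2) (act_mem_tangentSpaceAt (s := s) (η := η) σ Gen.gauge)))
  convert h using 1
  funext x
  have hq : (Real.sqrt σ.μ : ℂ) ≠ 0 := by exact_mod_cast (Real.sqrt_pos.2 hμ).ne'
  have hp := partialDeriv_transf (s := s) σ hμ hη.contDiff_ofReal j x
  simp only [Gen.act, Pi.smul_apply, Pi.add_apply, Complex.real_smul, soliton]
  rw [hp]
  simp only [transf, partialDeriv, hη.fderiv_ofReal]
  push_cast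
  field_simp
  ring

/-- The field `x·∂_x` acts on the phase, giving `i v·x / 2`, and is centred at the origin instead of
`a`. Boost vectors correct the former, translation vectors the latter. -/
lemma DecayProfile.transf_scaling_mem (σ : Param N) (hμ : 0 < σ.μ) :
    transf s σ (fun y => ((1 / (2 * s) * η y + 1 / 2 * fderiv ℝ η y y : ℝ) : ℂ))
      ∈ tangentSpaceAt s η σ := by
  have h := Submodule.sub_mem _ (Submodule.sub_mem _
    (act_mem_tangentSpaceAt (s := s) (η := η) σ Gen.scaling)
    (Submodule.sum_mem (t := Finset.univ) _ fun j _ => Submodule.smul_mem _ (σ.v j / 4)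
      (act_mem_tangentSpaceAt (s := s) (η := η) σ (Gen.boost j))))
    (Submodule.sum_mem (t := Finset.univ) _ fun j _ => Submodule.smul_mem _
      (Real.sqrt σ.μ / 2 * σ.a j) (hη.transf_translation_mem σ hμ j))
  convert h using 1
  funext x
  have hq : (Real.sqrt σ.μ : ℂ) ≠ 0 := by exact_mod_cast (Real.sqrt_pos.2 hμ).ne'
  have hp := fderiv_transf (s := s) σ hμ hη.contDiff_ofReal x x
  simp only [Gen.act, Pi.smul_apply, Pi.sub_apply, Finset.sum_apply, Complex.real_smul, soliton]
  rw [hp]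
  set y := Real.sqrt σ.μ • (x - σ.a) with hy
  have e1 : (inner ℝ σ.v x : ℝ) = ∑ j, σ.v j * x j := by
    rw [PiLp.inner_apply]
    exact Finset.sum_congr rfl fun j _ => by simp [mul_comm]
  have e2 : fderiv ℝ η y y = Real.sqrt σ.μ * fderiv ℝ η y x
      - Real.sqrt σ.μ * ∑ j, σ.a j * partialDeriv j η y := by
    conv_lhs => rw [hy, map_smul, map_sub]
    rw [fderiv_apply_eq_sum η _ σ.a]
    simp only [smul_eq_mul, mul_sub, ← hy]
  have e3 : ∀ f : Space N → ℂ, transf s σ f x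
      = Complex.exp (Complex.I * (((1 / 2) * inner ℝ σ.v (x - σ.a) + σ.γ : ℝ) : ℂ))
        * ((σ.μ ^ (1 / (2 * s)) : ℝ) : ℂ) * f y := fun f => rfl
  simp only [e3, hη.fderiv_ofReal, e1]
  set c := Complex.exp (Complex.I * (((1 / 2) * inner ℝ σ.v (x - σ.a) + σ.γ : ℝ) : ℂ))
        * ((σ.μ ^ (1 / (2 * s)) : ℝ) : ℂ)
  have e4 : ∑ j, ((σ.v j / 4 : ℝ) : ℂ) * (Complex.I * ((x j : ℝ) : ℂ) * (c * (η y : ℂ)))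
      = Complex.I / 4 * ((∑ j, σ.v j * x j : ℝ) : ℂ) * c * (η y : ℂ) := by
    push_cast
    rw [Finset.mul_sum, Finset.sum_mul, Finset.sum_mul]
    exact Finset.sum_congr rfl fun j _ => by ring
  have e5 : ∑ j, ((Real.sqrt σ.μ / 2 * σ.a j : ℝ) : ℂ) * (c * ((partialDeriv j η y : ℝ) : ℂ))
      = (Real.sqrt σ.μ : ℂ) / 2 * c * ((∑ j, σ.a j * partialDeriv j η y : ℝ) : ℂ) := by
    push_cast
    rw [Finset.mul_sum]
    exact Finset.sum_congr rfl fun j _ => by ring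
  rw [e4, e5, e2]
  push_cast
  ring

omit hη

/-- A generator mode `c g`, with `c ∈ {1, i}` and `g` real: it is tangent to the soliton manifold
and solves the linearized equation up to a multiple of another generator mode. -/
structure SolitonMode {N : ℕ} (s : ℝ) (η : Space N → ℝ) (c : ℂ) (κ : ℝ) (g Y : Space N → ℝ) : Prop where
  cases : (c = 1 ∧ κ = 2 * s + 1) ∨ (c = Complex.I ∧ κ = 1)
  decayC1 : DecayC1 g
  bound : ∃ K, 0 ≤ K ∧ ∀ x, ‖g x‖ ≤ K * (1 + ‖x‖) * η x
  decayC0 : DecayC0 Y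
  weak : ∀ w : H1 N, dirichlet w g + wpair (h1Fn w) g
    = wpair (h1Fn w) (fun x => κ * (η x ^ (2 * s) * g x) + Y x)
  tangent : ∀ σ : Param N, 0 < σ.μ → transf s σ (fun y => c * (g y : ℂ)) ∈ tangentSpaceAt s η σ
  tangent' : ∀ σ : Param N, 0 < σ.μ →
    transf s σ (fun y => c * Complex.I * (Y y : ℂ)) ∈ tangentSpaceAt s η σ

lemma transf_zero (σ : Param N) : transf s σ (fun _ => 0) = 0 := by
  funext x
  simp [transf]

lemma transf_real_mul (σ : Param N) (r : ℝ) (f : Space N → ℂ) :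
    transf s σ (fun y => (r : ℂ) * f y) = r • transf s σ f := by
  funext x
  simp only [transf, Pi.smul_apply, Complex.real_smul]
  ring

include hη

lemma DecayProfile.gaugeMode : SolitonMode s η Complex.I 1 η (fun _ => 0) where
  cases := Or.inr ⟨rfl, rfl⟩
  decayC1 := hη.decayC1
  bound := ⟨1, zero_le_one, fun x => by
    rw [Real.norm_of_nonneg (hη.pos x).le, one_mul]
    exact le_mul_of_one_le_left (hη.pos x).le (by linarith [norm_nonneg x])⟩
  decayC0 := by simpa using hη.decayC1.decayC0.const_mul 0
  weak w := by
    rw [hη.dirichlet_gauge]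
    simp
  tangent σ _ := transf_gauge_mem σ
  tangent' σ _ := by
    simp only [Complex.ofReal_zero, mul_zero, transf_zero]
    exact Submodule.zero_mem _

/-- The linearized operator for imaginary directions sends `x_j η` to `-2 ∂_j η`, a multiple of the
translation mode, which is why the pairing with `Y` will vanish. -/
lemma DecayProfile.boostMode (j : Fin N) :
    SolitonMode s η Complex.I 1 (fun x => x j * η x) (fun x => (-2) * partialDeriv j η x) where
  cases := Or.inr ⟨rfl, rfl⟩
  decayC1 := hη.decayC1.coord_mul j
  bound := ⟨1, zero_le_one, fun x => by
    rw [norm_mul, Real.norm_of_nonneg (hη.pos x).le, one_mul]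
    have := hη.pos x
    have := PiLp.norm_apply_le x j
    gcongr
    linarith⟩
  decayC0 := (hη.decayC1.decayC0_partialDeriv j).const_mul _
  weak w := by
    rw [hη.dirichlet_boost]
    simp
  tangent σ _ := transf_boost_mem σ j
  tangent' σ hμ := by
    convert Submodule.smul_mem _ (2 : ℝ) (hη.transf_translation_mem σ hμ j) using 1
    rw [← transf_real_mul]
    congr 1
    funext y
    push_cast
    linear_combination (-2 * ((partialDeriv j η y : ℝ) : ℂ)) * Complex.I_mul_I

lemma DecayProfile.translationMode (j : Fin N) :
    SolitonMode s η 1 (2 * s + 1) (partialDeriv j η) (fun _ => 0) where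
  cases := Or.inl ⟨rfl, rfl⟩
  decayC1 := hη.decayC1_partialDeriv j
  bound := by
    obtain ⟨K, hK, hb⟩ := hη.fderiv_le
    refine ⟨K, hK, fun x => (norm_partialDeriv_le η j x).trans ((hb x).trans ?_)⟩
    have := hη.pos x
    have : 0 ≤ K * η x * ‖x‖ := by positivity
    linarith
  decayC0 := by simpa using hη.decayC1.decayC0.const_mul 0
  weak w := by
    rw [hη.dirichlet_translation]
    simp
  tangent σ hμ := by simpa using hη.transf_translation_mem σ hμ j
  tangent' σ _ := by
    simp only [Complex.ofReal_zero, mul_zero, transf_zero]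
    exact Submodule.zero_mem _

/-- The linearized operator for real directions sends the scaling profile to `-η`, so here the gauge
mode closes the chain. -/
lemma DecayProfile.scalingMode : SolitonMode s η 1 (2 * s + 1)
    (fun x => 1 / (2 * s) * η x + 1 / 2 * fderiv ℝ η x x) (fun x => (-1) * η x) where
  cases := Or.inl ⟨rfl, rfl⟩
  decayC1 := hη.decayC1_scaling
  bound := by
    obtain ⟨K, hK, hb⟩ := hη.fderiv_le
    have hs := hη.s_pos
    refine ⟨1 / (2 * s) + K, by positivity, fun x => (norm_add_le _ _).trans ?_⟩
    have hp := hη.pos x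
    have h1 : ‖fderiv ℝ η x x‖ ≤ K * η x * ‖x‖ :=
      ((fderiv ℝ η x).le_opNorm x).trans (by gcongr; exact hb x)
    rw [norm_mul, norm_mul, Real.norm_of_nonneg hp.le, Real.norm_of_nonneg (by positivity : 0 ≤ 1 / (2 * s)),
      Real.norm_of_nonneg (by norm_num : (0 : ℝ) ≤ 1 / 2)]
    have h2 : 0 ≤ K * η x := by positivity
    have h3 : 0 ≤ K * η x * ‖x‖ := by positivity
    have h4 : 0 ≤ 1 / (2 * s) * η x * ‖x‖ := by positivity
    nlinarith
  decayC0 := hη.decayC1.decayC0.const_mul _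
  weak w := hη.dirichlet_scaling w
  tangent σ hμ := by simpa using hη.transf_scaling_mem σ hμ
  tangent' σ _ := by
    convert Submodule.smul_mem _ (-1 : ℝ) (transf_gauge_mem (s := s) (η := η) σ) using 1
    rw [← transf_real_mul]
    congr 1
    funext y
    push_cast
    ring

end Tangent

/-! ### Consequences of skew-orthogonality. -/

section Orthogonality

variable {N : ℕ} {s : ℝ} {η : Space N → ℝ}

lemma IsSkewDecomp.symp_eq_zero {ψ w : H1 N} {σ : Param N} (h : IsSkewDecomp s η ψ σ w)
    (hμ : 0 < σ.μ) {Z : Space N → ℂ} (hZ : transf s σ Z ∈ tangentSpaceAt s η σ) :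
    symp (h1Fn w) Z = 0 := by
  have h1 := h.2 _ hZ
  have h2 : symp (fun x => h1Fn ψ x - soliton s η σ x) (transf s σ Z)
      = symp (transf s σ (h1Fn w)) (transf s σ Z) := by
    simp only [symp]
    congr 1
    refine integral_congr_ae ?_
    filter_upwards [h.1] with x hx
    rw [hx, soliton]
    simp only [transf]
    ring
  rw [h2, symp_transf σ hμ] at h1
  exact (mul_eq_zero.1 h1).resolve_left (Real.rpow_pos_of_pos hμ _).ne'

/-- The contribution of `w` drops out, so the pairing of the solution with a modulated mode is known
along the whole path as a function of `μ`. Differentiating it produces the modulation equations. -/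
lemma IsSkewDecomp.symp_eq {ψ w : H1 N} {σ : Param N} (h : IsSkewDecomp s η ψ σ w)
    (hμ : 0 < σ.μ) (hη : MemLp (fun x => (η x : ℂ)) 2 volume) {Z : Space N → ℂ}
    (hZL : MemLp Z 2 volume) (hZ : transf s σ Z ∈ tangentSpaceAt s η σ) :
    symp (h1Fn ψ) (transf s σ Z) = σ.μ ^ (1 / s - N / 2) * symp (fun x => (η x : ℂ)) Z := by
  have h2 : symp (h1Fn ψ) (transf s σ Z)
      = symp (transf s σ (fun x => (η x : ℂ) + h1Fn w x)) (transf s σ Z) := by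
    simp only [symp]
    congr 1
    refine integral_congr_ae ?_
    filter_upwards [h.1] with x hx
    rw [hx]
  have h3 : symp (fun x => (η x : ℂ) + h1Fn w x) Z
      = symp (fun x => (η x : ℂ)) Z + symp (h1Fn w) Z := by
    have i1 : Integrable (fun x => (η x : ℂ) * conj (Z x)) := hη.integrable_mul (memLp_conj hZL)
    have i2 : Integrable (fun x => h1Fn w x * conj (Z x)) :=
      (memLp_h1Fn w).integrable_mul (memLp_conj hZL)
    simp only [symp, add_mul]
    rw [integral_add i1 i2, Complex.add_im]
  rw [h2, symp_transf σ hμ, h3, h.symp_eq_zero hμ hZ, add_zero]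

end Orthogonality

/-! ### The exact modulation equation of a generator mode. -/

section ModeIdentity

variable {N : ℕ} {s : ℝ} {η : Space N → ℝ} {c : ℂ} {κ : ℝ} {g Y : Space N → ℝ}

lemma SolitonMode.norm_c (hm : SolitonMode s η c κ g Y) : ‖c‖ = 1 := by
  rcases hm.cases with ⟨h, -⟩ | ⟨h, -⟩ <;> simp [h]

/-- The linearization of the nonlinearity is diagonal in real and imaginary parts, with factors `2s
+ 1` and `1`; each mode is purely real or purely imaginary and sees one of them. -/
lemma SolitonMode.re_powLin (hm : SolitonMode s η c κ g Y) (z : ℂ) :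
    (powLin s z * conj c).re = κ * (z * conj c).re := by
  rcases hm.cases with ⟨h, h'⟩ | ⟨h, h'⟩ <;> simp [h, h', powLin]

lemma DecayC1.ofReal_mul {g : Space N → ℝ} (hg : DecayC1 g) (c : ℂ) :
    DecayC1 (fun x => c * (g x : ℂ)) :=
  hg.clm_comp (((ContinuousLinearMap.mul ℝ ℂ) c).comp Complex.ofRealCLM)

lemma partialDeriv_ofReal_mul {g : Space N → ℝ} (hg : Differentiable ℝ g) (c : ℂ) (i : Fin N)
    (x : Space N) :
    partialDeriv i (fun x => c * (g x : ℂ)) x = c * ((partialDeriv i g x : ℝ) : ℂ) := by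
  have : HasFDerivAt (fun x => c * (g x : ℂ))
      ((((ContinuousLinearMap.mul ℝ ℂ) c).comp Complex.ofRealCLM).comp (fderiv ℝ g x)) x :=
    (((ContinuousLinearMap.mul ℝ ℂ) c).comp Complex.ofRealCLM).hasFDerivAt.comp x
      (hg x).hasFDerivAt
  rw [partialDeriv, this.fderiv]
  rfl

lemma integral_mul_conj_ofReal (f : Space N → ℂ) (g : Space N → ℝ) (c : ℂ) :
    ∫ x, f x * conj (c * (g x : ℂ)) = conj c * wpair f g := by
  rw [wpair, ← integral_const_mul]
  refine integral_congr_ae (Eventually.of_forall fun x => ?_)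
  simp only [map_mul, Complex.conj_ofReal]
  ring

/-- The linear part of the energy identity vanishes on modes orthogonal to the tangent space. -/
lemma SolitonMode.energy_identity (hm : SolitonMode s η c κ g Y) (hη : DecayProfile s η)
    {ηH w u : H1 N} (hηH : h1Fn ηH =ᵐ[volume] fun x => (η x : ℂ))
    (hηG : ∀ i, h1Grad ηH i =ᵐ[volume] fun x => ((partialDeriv i η x : ℝ) : ℂ))
    (hu : u = ηH + w) (hY : symp (h1Fn w) (fun x => c * Complex.I * (Y x : ℂ)) = 0)
    (hR : Integrable (fun x => (powNL s (η x + h1Fn w x) - ((η x ^ (2 * s + 1) : ℝ) : ℂ)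
        - ((η x ^ (2 * s) : ℝ) : ℂ) * powLin s (h1Fn w x)) * conj (c * (g x : ℂ)))) :
    ((∑ i, ∫ x, h1Grad u i x * conj (partialDeriv i (fun x => c * (g x : ℂ)) x))
        + (∫ x, h1Fn u x * conj (c * (g x : ℂ)))
        - ∫ x, powNL s (h1Fn u x) * conj (c * (g x : ℂ))).re
      = -(∫ x, (powNL s (η x + h1Fn w x) - ((η x ^ (2 * s + 1) : ℝ) : ℂ)
        - ((η x ^ (2 * s) : ℝ) : ℂ) * powLin s (h1Fn w x)) * conj (c * (g x : ℂ))).re := by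
  have hs := hη.s_pos
  have hu1 : h1Fn u =ᵐ[volume] fun x => (η x : ℂ) + h1Fn w x := by
    rw [hu]
    filter_upwards [h1Fn_add ηH w, hηH] with x h1 h2
    rw [h1, h2]
  have hu2 : ∀ i, h1Grad u i =ᵐ[volume] fun x => h1Grad ηH i x + h1Grad w i x := fun i => by
    rw [hu]
    exact h1Grad_add ηH w i
  have wadd : ∀ {f f₁ f₂ : Space N → ℂ} {k : Space N → ℝ}, f =ᵐ[volume] (fun x => f₁ x + f₂ x) →
      MemLp f₁ 2 volume → MemLp f₂ 2 volume → DecayC0 k → wpair f k = wpair f₁ k + wpair f₂ k := by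
    intro f f₁ f₂ k h h₁ h₂ hk
    rw [wpair, wpair, wpair, ← integral_add (hk.integrable_mul h₁) (hk.integrable_mul h₂)]
    refine integral_congr_ae ?_
    filter_upwards [h] with x hx
    rw [hx, mul_add]
  have hη2 : MemLp (h1Fn ηH) 2 volume := memLp_h1Fn ηH
  have hg0 := hm.decayC1.decayC0
  -- the weak equation of the profile
  have hprof : dirichlet ηH g + wpair (h1Fn ηH) g
      = ∫ x, ((η x ^ (2 * s + 1) : ℝ) : ℂ) * (g x : ℂ) := by
    -- The roles of `η` and `g` are exchanged: `g` becomes the `H¹` element, and the weak profile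
    -- equation is tested on it.
    obtain ⟨gH, hg1, hg2⟩ := (hm.decayC1.ofReal_mul 1).exists_h1
    have e1 : dirichlet ηH g = dirichlet gH η := by
      refine Finset.sum_congr rfl fun i _ => ?_
      simp only [wpair]
      refine integral_congr_ae ?_
      filter_upwards [hηG i, hg2 i] with x h1 h2
      rw [h1, h2, partialDeriv_ofReal_mul hm.decayC1.differentiable]
      ring
    have e2 : wpair (h1Fn ηH) g = wpair (h1Fn gH) η := by
      simp only [wpair]
      refine integral_congr_ae ?_
      filter_upwards [hηH, hg1] with x h1 h2
      rw [h1, h2]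
      ring
    rw [e1, e2, hη.dirichlet_gauge gH, wpair]
    refine integral_congr_ae ?_
    filter_upwards [hg1] with x h1
    rw [h1, hη.rpow_two_s_add_one]
    ring
  have hdir : dirichlet u g = dirichlet ηH g + dirichlet w g := by
    simp only [dirichlet]
    rw [← Finset.sum_add_distrib]
    exact Finset.sum_congr rfl fun i _ => wadd (hu2 i) (memLp_h1Grad ηH i) (memLp_h1Grad w i)
      (hm.decayC1.decayC0_partialDeriv i)
  have hlhs : (∑ i, ∫ x, h1Grad u i x * conj (partialDeriv i (fun x => c * (g x : ℂ)) x))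
      = conj c * dirichlet u g := by
    rw [dirichlet, Finset.mul_sum]
    refine Finset.sum_congr rfl fun i _ => ?_
    simp only [partialDeriv_ofReal_mul hm.decayC1.differentiable]
    exact integral_mul_conj_ofReal _ _ _
  have hsplit : wpair (h1Fn u) g = wpair (h1Fn ηH) g + wpair (h1Fn w) g :=
    wadd (by rw [hu]; exact h1Fn_add ηH w) hη2 (memLp_h1Fn w) hg0
  have hgs : DecayC0 (fun x => η x ^ (2 * s) * g x) := hη.decayC0_rpow_mul hg0
  have hweak := hm.weak w
  rw [wpair_add (memLp_h1Fn w) (hgs.const_mul κ) hm.decayC0, wpair_const_mul] at hweak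
  -- splitting of the nonlinearity
  have i1 : Integrable (fun x => ((η x ^ (2 * s + 1) : ℝ) : ℂ) * conj (c * (g x : ℂ))) := by
    have h1 := hη.decayC1_rpow (p := 2 * s + 1) (by positivity)
    have h2 : MemLp (fun x => ((η x ^ (2 * s + 1) : ℝ) : ℂ)) 2 volume :=
      (h1.decay.memLp_two h1.continuous.aestronglyMeasurable).ofReal
    exact integrable_L2_mul_conj h2 (hm.decayC1.ofReal_mul c).decay
      (hm.decayC1.ofReal_mul c).continuous.aestronglyMeasurable
  have i2 : Integrable (fun x => ((η x ^ (2 * s) : ℝ) : ℂ) * powLin s (h1Fn w x)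
      * conj (c * (g x : ℂ))) := by
    have h1 : MemLp (fun x => powLin s (h1Fn w x)) 2 volume :=
      MemLp.of_le_mul (memLp_h1Fn w)
        ((continuous_powLin s).comp_aestronglyMeasurable (memLp_h1Fn w).1)
        (Eventually.of_forall fun x => norm_powLin_le hs.le _)
    refine ((hgs.integrable_mul h1).const_mul (conj c)).congr (Eventually.of_forall fun x => ?_)
    simp only [map_mul, Complex.conj_ofReal]
    push_cast
    ring
  have hN : ∫ x, powNL s (h1Fn u x) * conj (c * (g x : ℂ))
      = (∫ x, (powNL s (η x + h1Fn w x) - ((η x ^ (2 * s + 1) : ℝ) : ℂ)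
        - ((η x ^ (2 * s) : ℝ) : ℂ) * powLin s (h1Fn w x)) * conj (c * (g x : ℂ)))
        + (∫ x, ((η x ^ (2 * s + 1) : ℝ) : ℂ) * conj (c * (g x : ℂ)))
        + ∫ x, ((η x ^ (2 * s) : ℝ) : ℂ) * powLin s (h1Fn w x) * conj (c * (g x : ℂ)) := by
    rw [← integral_add hR i1, ← integral_add (integrable_fun_add hR i1) i2]
    refine integral_congr_ae ?_
    filter_upwards [hu1] with x hx
    rw [hx]
    ring
  have hlin : (∫ x, ((η x ^ (2 * s) : ℝ) : ℂ) * powLin s (h1Fn w x) * conj (c * (g x : ℂ))).re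
      = κ * (conj c * wpair (h1Fn w) (fun x => η x ^ (2 * s) * g x)).re := by
    have i3 := (hgs.integrable_mul (memLp_h1Fn w)).const_mul (conj c)
    rw [wpair, ← integral_const_mul, ← RCLike.re_eq_complex_re, ← integral_re i2, ← integral_re i3,
      ← integral_const_mul]
    refine integral_congr_ae (Eventually.of_forall fun x => ?_)
    have h1 := hm.re_powLin (h1Fn w x)
    have e1 : ((η x ^ (2 * s) : ℝ) : ℂ) * powLin s (h1Fn w x) * conj (c * (g x : ℂ))
        = ((η x ^ (2 * s) * g x : ℝ) : ℂ) * (powLin s (h1Fn w x) * conj c) := by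
      rw [map_mul, Complex.conj_ofReal]
      push_cast
      ring
    have e2 : conj c * (((η x ^ (2 * s) * g x : ℝ) : ℂ) * h1Fn w x)
        = ((η x ^ (2 * s) * g x : ℝ) : ℂ) * (h1Fn w x * conj c) := by ring
    simp only [RCLike.re_eq_complex_re]
    rw [e1, e2, Complex.re_ofReal_mul, Complex.re_ofReal_mul, h1]
    ring
  -- The factor `i` in the tangent vector `c i Y` turns the vanishing imaginary part into a
  -- vanishing real part.
  have hY' : (conj c * wpair (h1Fn w) Y).re = 0 := by
    have h1 : ∫ x, h1Fn w x * conj (c * Complex.I * (Y x : ℂ))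
        = conj (c * Complex.I) * wpair (h1Fn w) Y := integral_mul_conj_ofReal _ _ _
    rw [symp, h1, map_mul, Complex.conj_I] at hY
    have h2 : (conj c * -Complex.I * wpair (h1Fn w) Y).im = -(conj c * wpair (h1Fn w) Y).re := by
      rw [show conj c * -Complex.I * wpair (h1Fn w) Y
        = -(Complex.I * (conj c * wpair (h1Fn w) Y)) by ring, Complex.neg_im, Complex.I_mul_im]
    rw [h2] at hY
    linarith
  have hp2 : conj c * (dirichlet ηH g + wpair (h1Fn ηH) g)
      = ∫ x, ((η x ^ (2 * s + 1) : ℝ) : ℂ) * conj (c * (g x : ℂ)) := by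
    rw [hprof, ← integral_const_mul]
    refine integral_congr_ae (Eventually.of_forall fun x => ?_)
    simp only [map_mul, Complex.conj_ofReal]
    ring
  have htot : (∑ i, ∫ x, h1Grad u i x * conj (partialDeriv i (fun x => c * (g x : ℂ)) x))
        + (∫ x, h1Fn u x * conj (c * (g x : ℂ)))
        - ∫ x, powNL s (h1Fn u x) * conj (c * (g x : ℂ))
      = (κ : ℂ) * (conj c * wpair (h1Fn w) (fun x => η x ^ (2 * s) * g x))
        + conj c * wpair (h1Fn w) Y
        - (∫ x, (powNL s (η x + h1Fn w x) - ((η x ^ (2 * s + 1) : ℝ) : ℂ)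
          - ((η x ^ (2 * s) : ℝ) : ℂ) * powLin s (h1Fn w x)) * conj (c * (g x : ℂ)))
        - ∫ x, ((η x ^ (2 * s) : ℝ) : ℂ) * powLin s (h1Fn w x) * conj (c * (g x : ℂ)) := by
    rw [hlhs, integral_mul_conj_ofReal, hN, hdir, hsplit, ← hp2]
    linear_combination conj c * hweak
  rw [htot, Complex.sub_re, Complex.sub_re, Complex.add_re, hY', hlin, Complex.re_ofReal_mul]
  ring

/-- Exact modulation equation of a mode. -/
lemma SolitonMode.modulation_identity (hm : SolitonMode s η c κ g Y) (hη : DecayProfile s η)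
    {s' ε T : ℝ} {lam : Space N → ℝ} {ψ : ℝ → H1 N}
    (hψ : IsNLSSolution s s' ε lam T ψ) (hT : 0 < T) {t : ℝ} (ht : t ∈ Icc 0 T) {σ : ℝ → Param N}
    {w : ℝ → H1 N} (hμ0 : ∀ τ ∈ Icc 0 T, 0 < (σ τ).μ)
    (hsk : ∀ τ ∈ Icc 0 T, IsSkewDecomp s η (ψ τ) (σ τ) (w τ))
    {a' v' : Space N} {γ' μ' : ℝ}
    (ha : HasDerivWithinAt (fun τ => (σ τ).a) a' (Icc 0 T) t)
    (hv : HasDerivWithinAt (fun τ => (σ τ).v) v' (Icc 0 T) t)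
    (hγ : HasDerivWithinAt (fun τ => (σ τ).γ) γ' (Icc 0 T) t)
    (hμ : HasDerivWithinAt (fun τ => (σ τ).μ) μ' (Icc 0 T) t)
    {A B : Space N} {Γ M : ℝ} (hA : A = Real.sqrt (σ t).μ • (a' - (σ t).v))
    (hB : B = (1 / (2 * Real.sqrt (σ t).μ)) • v')
    (hΓ : Γ = γ' - inner ℝ (σ t).v a' / 2 + ‖(σ t).v‖ ^ 2 / 4 - (σ t).μ) (hM : M = μ' / (σ t).μ)
    (hR : Integrable (fun x => (powNL s (η x + h1Fn (w t) x) - ((η x ^ (2 * s + 1) : ℝ) : ℂ)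
        - ((η x ^ (2 * s) : ℝ) : ℂ) * powLin s (h1Fn (w t) x)) * conj (c * (g x : ℂ)))) :
    symp (fun x => (η x : ℂ)) (modGen s A B Γ M (fun x => c * (g x : ℂ)))
      + symp (h1Fn (w t)) (modGen s A B Γ M (fun x => c * (g x : ℂ)))
      + (σ t).μ * (∫ x, (powNL s (η x + h1Fn (w t) x) - ((η x ^ (2 * s + 1) : ℝ) : ℂ)
        - ((η x ^ (2 * s) : ℝ) : ℂ) * powLin s (h1Fn (w t) x)) * conj (c * (g x : ℂ))).re
      - ε * (σ t).μ ^ (s' / s) * (∫ x, (lam ((σ t).a + (Real.sqrt (σ t).μ)⁻¹ • x) : ℂ)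
        * powNL s' (η x + h1Fn (w t) x) * conj (c * (g x : ℂ))).re
      = (1 / s - N / 2) * M * symp (fun x => (η x : ℂ)) (fun x => c * (g x : ℂ)) := by
  have hs := hη.s_pos
  have hmt := hμ0 t ht
  have hηC : DecayC1 (fun x => (η x : ℂ)) := by simpa using hη.decayC1.ofReal_mul 1
  have hη2 : MemLp (fun x => (η x : ℂ)) 2 volume :=
    hηC.decay.memLp_two hηC.continuous.aestronglyMeasurable
  have hZ := hm.decayC1.ofReal_mul c
  have hZ2 : MemLp (fun x => c * (g x : ℂ)) 2 volume :=
    hZ.decay.memLp_two hZ.continuous.aestronglyMeasurable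
  obtain ⟨ηH, hηH, hηG⟩ := hηC.exists_h1
  have hηG' : ∀ i, h1Grad ηH i =ᵐ[volume] fun x => ((partialDeriv i η x : ℝ) : ℂ) := fun i =>
    (hηG i).trans (Eventually.of_forall fun x => partialDeriv_ofReal (hη.differentiable x) i)
  have hu1 : h1Fn (ηH + w t) =ᵐ[volume] fun x => (η x : ℂ) + h1Fn (w t) x := by
    filter_upwards [h1Fn_add ηH (w t), hηH] with x h1 h2
    rw [h1, h2]
  have hu : h1Fn (ψ t) =ᵐ[volume] transf s (σ t) (h1Fn (ηH + w t)) :=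
    (hsk t ht).1.trans (transf_ae_eq (σ t) hmt hu1.symm)
  have key := hasDerivWithinAt_pairing hs hψ ht ha hv hγ hμ hμ0 hu hZ
  rw [← hA, ← hB, ← hΓ, ← hM] at key
  have key2 := (Complex.imCLM.hasFDerivAt.comp_hasDerivWithinAt t key)
  have hpow : HasDerivWithinAt (fun τ => (σ τ).μ ^ (1 / s - N / 2)
      * symp (fun x => (η x : ℂ)) (fun x => c * (g x : ℂ)))
      (μ' * (1 / s - N / 2) * (σ t).μ ^ (1 / s - N / 2 - 1)
        * symp (fun x => (η x : ℂ)) (fun x => c * (g x : ℂ))) (Icc 0 T) t :=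
    (hμ.rpow_const (Or.inl hmt.ne')).mul_const _
  have hcongr : ∀ τ ∈ Icc 0 T, (σ τ).μ ^ (1 / s - N / 2)
      * symp (fun x => (η x : ℂ)) (fun x => c * (g x : ℂ))
      = Complex.imCLM (∫ x, h1Fn (ψ τ) x * conj (transf s (σ τ) (fun x => c * (g x : ℂ)) x)) :=
    fun τ hτ => ((hsk τ hτ).symp_eq (hμ0 τ hτ) hη2 hZ2 (hm.tangent (σ τ) (hμ0 τ hτ))).symm
  -- The same function of time has been differentiated twice, once by the equation and once by
  -- skew-orthogonality; `T > 0` makes the one-sided derivatives at the endpoints unique.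
  have heq := (uniqueDiffOn_Icc hT t ht).eq_deriv _ key2
    (hpow.congr (fun τ hτ => (hcongr τ hτ).symm) (hcongr t ht).symm)
  simp only [Complex.imCLM_apply, Complex.im_ofReal_mul] at heq
  -- Both derivatives carry this common scaling factor, which is divided out.
  have hα : 0 < (σ t).μ ^ (1 / s - N / 2) := Real.rpow_pos_of_pos hmt _
  have heq2 := mul_left_cancel₀ hα.ne' (heq.trans (show _ = (σ t).μ ^ (1 / s - N / 2) *
      ((1 / s - N / 2) * M * symp (fun x => (η x : ℂ)) (fun x => c * (g x : ℂ))) by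
    rw [hM, Real.rpow_sub_one hmt.ne']
    ring))
  have hen := hm.energy_identity hη hηH hηG' rfl
    ((hsk t ht).symp_eq_zero hmt (hm.tangent' (σ t) hmt)) hR
  have hforce : ∫ x, (lam ((σ t).a + (Real.sqrt (σ t).μ)⁻¹ • x) : ℂ)
        * powNL s' (h1Fn (ηH + w t) x) * conj (c * (g x : ℂ))
      = ∫ x, (lam ((σ t).a + (Real.sqrt (σ t).μ)⁻¹ • x) : ℂ)
        * powNL s' (η x + h1Fn (w t) x) * conj (c * (g x : ℂ)) := by
    refine integral_congr_ae ?_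
    filter_upwards [hu1] with x hx
    rw [hx]
  have hG := expDecay_modGen (s := s) A B Γ M hZ
  have hGc := (continuous_modGen (s := s) A B Γ M hZ).aestronglyMeasurable
    (μ := (volume : Measure (Space N)))
  have hsum : (∫ x, h1Fn (ηH + w t) x * conj (modGen s A B Γ M (fun x => c * (g x : ℂ)) x)).im
      = symp (fun x => (η x : ℂ)) (modGen s A B Γ M (fun x => c * (g x : ℂ)))
      + symp (h1Fn (w t)) (modGen s A B Γ M (fun x => c * (g x : ℂ))) := by
    rw [symp, symp, ← Complex.add_im, ← integral_add (integrable_L2_mul_conj hη2 hG hGc)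
      (integrable_L2_mul_conj (memLp_h1Fn (w t)) hG hGc)]
    congr 1
    refine integral_congr_ae ?_
    filter_upwards [hu1] with x hx
    rw [hx]
    ring
  rw [hforce, Complex.add_im, hsum, show ∀ z : ℂ, (-Complex.I * z).im = -z.re from fun z => by simp,
    Complex.add_re, Complex.re_ofReal_mul, hen, ← Complex.ofReal_mul, Complex.re_ofReal_mul] at heq2
  rw [← heq2]
  ring

/-- Linear bound for the pairing of the remainder with the infinitesimal modulation. -/
lemma exists_symp_modGen_bound (hs : 0 < s) {Z : Space N → ℂ} (hZ : DecayC1 Z) :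
    ∃ C, 0 ≤ C ∧ ∀ (w : H1 N) (A B : Space N) (Γ M : ℝ),
      |symp (h1Fn w) (modGen s A B Γ M Z)| ≤ C * ((‖A‖ + ‖B‖ + |Γ| + |M|) * ‖w‖) := by
  -- One envelope dominates all the generators at once, so the constant does not depend on `A`, `B`,
  -- `Γ`, `M`.
  set H : Space N → ℝ := fun y => (1 + ‖y‖) * ‖fderiv ℝ Z y‖
    + (1 + 1 / (2 * s)) * ((1 + ‖y‖) * ‖Z y‖) with hH
  have hHd : ExpDecay H := by
    refine (hZ.decay_fderiv.poly 1 1 fun y => ?_).add (hZ.decay.poly (1 + 1 / (2 * s)) 1 fun y => ?_)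
    · rw [Real.norm_of_nonneg (by positivity), pow_one, one_mul]
    · rw [Real.norm_of_nonneg (by positivity), pow_one, mul_assoc]
  have hHc : Continuous H := by
    have h1 := hZ.continuous
    have h2 := hZ.continuous_fderiv
    fun_prop
  have hH2 := hHd.memLp_two (hHc.aestronglyMeasurable (μ := (volume : Measure (Space N))))
  refine ⟨(eLpNorm H 2 volume).toReal, ENNReal.toReal_nonneg, fun w A B Γ M => ?_⟩
  set X := ‖A‖ + ‖B‖ + |Γ| + |M| with hX
  have hX0 : 0 ≤ X := by positivity
  have hpt : ∀ y, ‖modGen s A B Γ M Z y‖ ≤ X * ‖H y‖ := fun y => by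
    have hHy : 0 ≤ H y := by positivity
    rw [Real.norm_of_nonneg hHy, modGen]
    refine norm_add₃_le.trans ?_
    have n1 : ‖-fderiv ℝ Z y A‖ ≤ ‖fderiv ℝ Z y‖ * ‖A‖ := by
      rw [norm_neg]; exact (fderiv ℝ Z y).le_opNorm A
    have n2 : ‖Complex.I * ((inner ℝ B y + Γ : ℝ) : ℂ) * Z y‖ ≤ (‖B‖ * ‖y‖ + |Γ|) * ‖Z y‖ := by
      rw [norm_mul, norm_mul, Complex.norm_I, one_mul, Complex.norm_real, Real.norm_eq_abs]
      gcongr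
      exact (abs_add_le _ _).trans (by gcongr; exact abs_real_inner_le_norm B y)
    have n3 : ‖(M : ℂ) * (((1 / (2 * s) : ℝ) : ℂ) * Z y + (1 / 2 : ℂ) * fderiv ℝ Z y y)‖
        ≤ |M| * (1 / (2 * s) * ‖Z y‖ + ‖fderiv ℝ Z y‖ * ‖y‖) := by
      rw [norm_mul, Complex.norm_real, Real.norm_eq_abs]
      gcongr
      refine (norm_add_le _ _).trans ?_
      rw [norm_mul, norm_mul, Complex.norm_real, Real.norm_of_nonneg (by positivity : 0 ≤ 1 / (2 * s))]
      have h1 := (fderiv ℝ Z y).le_opNorm y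
      have h2 : ‖(1 / 2 : ℂ)‖ = 1 / 2 := by norm_num
      have h3 := norm_nonneg (fderiv ℝ Z y y)
      rw [h2]
      linarith
    refine (add_le_add (add_le_add n1 n2) n3).trans ?_
    have p0 : 0 ≤ 1 / (2 * s) := by positivity
    set r := 1 / (2 * s)
    set p := ‖fderiv ℝ Z y‖
    set q := ‖Z y‖
    set z := ‖y‖
    have hp : 0 ≤ p := norm_nonneg _
    have hq : 0 ≤ q := norm_nonneg _
    have hz : 0 ≤ z := norm_nonneg _
    have k1 : p * ‖A‖ ≤ ‖A‖ * H y := by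
      rw [mul_comm]
      gcongr
      simp only [hH]
      have : 0 ≤ z * p := by positivity
      have : 0 ≤ (1 + r) * ((1 + z) * q) := by positivity
      change p ≤ (1 + z) * p + (1 + r) * ((1 + z) * q)
      linarith
    have hq1 : (1 + z) * q ≤ H y := by
      change (1 + z) * q ≤ (1 + z) * p + (1 + r) * ((1 + z) * q)
      have : 0 ≤ (1 + z) * p := by positivity
      have : 0 ≤ r * ((1 + z) * q) := by positivity
      linarith
    have hq2 : r * q + p * z ≤ H y := by
      change r * q + p * z ≤ (1 + z) * p + (1 + r) * ((1 + z) * q)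
      have : 0 ≤ r * q * z := by positivity
      have : 0 ≤ (1 + z) * q := by positivity
      nlinarith
    have k2 : (‖B‖ * z + |Γ|) * q ≤ (‖B‖ + |Γ|) * H y := by
      calc (‖B‖ * z + |Γ|) * q ≤ (‖B‖ + |Γ|) * ((1 + z) * q) := by
            have h1 : 0 ≤ ‖B‖ * q := by positivity
            have h2 : 0 ≤ |Γ| * z * q := by positivity
            nlinarith
        _ ≤ _ := by gcongr
    have k3 : |M| * (r * q + p * z) ≤ |M| * H y := by gcongr
    rw [hX]
    linarith
  have hG : MemLp (modGen s A B Γ M Z) 2 volume :=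
    (expDecay_modGen A B Γ M hZ).memLp_two (continuous_modGen A B Γ M hZ).aestronglyMeasurable
  have hle : (eLpNorm (fun y => conj (modGen s A B Γ M Z y)) 2 volume).toReal
      ≤ X * (eLpNorm H 2 volume).toReal := by
    have h1 : eLpNorm (fun y => conj (modGen s A B Γ M Z y)) 2 volume
        ≤ ENNReal.ofReal X * eLpNorm H 2 volume :=
      eLpNorm_le_mul_eLpNorm_of_ae_le_mul (Eventually.of_forall fun y => by
        rw [RCLike.norm_conj]; exact hpt y) 2
    have h2 := ENNReal.toReal_mono (ENNReal.mul_ne_top ENNReal.ofReal_ne_top hH2.2.ne) h1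
    rwa [ENNReal.toReal_mul, ENNReal.toReal_ofReal hX0] at h2
  calc |symp (h1Fn w) (modGen s A B Γ M Z)| ≤ ‖∫ x, h1Fn w x * conj (modGen s A B Γ M Z x)‖ :=
        Complex.abs_im_le_norm _
    _ ≤ ‖w‖ * (X * (eLpNorm H 2 volume).toReal) :=
        (norm_integral_mul_le (memLp_h1Fn w) (memLp_conj hG)).trans
          (mul_le_mul (toReal_eLpNorm_h1Fn_le w) hle ENNReal.toReal_nonneg (norm_nonneg _))
    _ = _ := by ring

end ModeIdentity

/-! ### Uniform estimates of the modulation equation of a mode. -/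

section ModeEstimate

variable {N : ℕ} {s : ℝ} {η : Space N → ℝ} {c : ℂ} {κ : ℝ} {g Y : Space N → ℝ}

/-- Modulation equation of a mode up to quadratic errors, with uniform constants. -/
lemma SolitonMode.exists_estimate (hm : SolitonMode s η c κ g Y) (hη : DecayProfile s η)
    (hN : 1 ≤ N) (hs : s < 2 / (N : ℝ)) {s' : ℝ} (hs'0 : 0 ≤ s')
    (hs'1 : 3 ≤ N → s' < 2 / ((N : ℝ) - 2)) {lam : Space N → ℝ} (hlam : MemLp lam ⊤ volume)
    {μ₁ : ℝ} (hμ₁ : 0 < μ₁) :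
    ∃ C, 0 ≤ C ∧ ∀ ε ∈ Ico (0 : ℝ) 1, ∀ T > (0 : ℝ), ∀ ψ : ℝ → H1 N,
      IsNLSSolution s s' ε lam T ψ → ∀ (σ : ℝ → Param N) (w : ℝ → H1 N),
      (∀ τ ∈ Icc 0 T, 0 < (σ τ).μ ∧ (σ τ).μ ≤ μ₁) →
      (∀ τ ∈ Icc 0 T, IsSkewDecomp s η (ψ τ) (σ τ) (w τ)) →
      ∀ t ∈ Icc 0 T, ∀ (a' v' : Space N) (γ' μ' : ℝ),
      HasDerivWithinAt (fun τ => (σ τ).a) a' (Icc 0 T) t →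
      HasDerivWithinAt (fun τ => (σ τ).v) v' (Icc 0 T) t →
      HasDerivWithinAt (fun τ => (σ τ).γ) γ' (Icc 0 T) t →
      HasDerivWithinAt (fun τ => (σ τ).μ) μ' (Icc 0 T) t →
      ‖w t‖ ≤ 1 → ∀ (A B : Space N) (Γ M : ℝ), A = Real.sqrt (σ t).μ • (a' - (σ t).v) →
      B = (1 / (2 * Real.sqrt (σ t).μ)) • v' →
      Γ = γ' - inner ℝ (σ t).v a' / 2 + ‖(σ t).v‖ ^ 2 / 4 - (σ t).μ → M = μ' / (σ t).μ →
      |symp (fun x => (η x : ℂ)) (modGen s A B Γ M (fun x => c * (g x : ℂ)))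
          - (1 / s - N / 2) * M * symp (fun x => (η x : ℂ)) (fun x => c * (g x : ℂ))
          - ε * (σ t).μ ^ (s' / s) * (∫ x, (lam ((σ t).a + (Real.sqrt (σ t).μ)⁻¹ • x) : ℂ)
            * ((η x ^ (2 * s' + 1) : ℝ) : ℂ) * conj (c * (g x : ℂ))).re|
        ≤ C * ((‖A‖ + ‖B‖ + |Γ| + |M|) * ‖w t‖ + ‖w t‖ ^ 2 + ε * ‖w t‖) ∧
      |ε * (σ t).μ ^ (s' / s) * (∫ x, (lam ((σ t).a + (Real.sqrt (σ t).μ)⁻¹ • x) : ℂ)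
            * ((η x ^ (2 * s' + 1) : ℝ) : ℂ) * conj (c * (g x : ℂ))).re| ≤ C * ε := by
  have hs0 := hη.s_pos
  have hN0 : (0 : ℝ) < N := by exact_mod_cast hN
  have hsN : s * N < 2 := (lt_div_iff₀ hN0).1 hs
  -- The mass-subcritical bound `s < 2/N` implies that the exponent `2s + 1` lies below the Sobolev
  -- exponent `2N/(N-2)`.
  have hcond : 3 ≤ N → (2 * s + 1) * ((N : ℝ) - 2) < 2 * N := fun h3 => by
    have : (3 : ℝ) ≤ N := by exact_mod_cast h3
    nlinarith
  have hcond' : 3 ≤ N → (2 * s' + 1) * ((N : ℝ) - 2) < 2 * N := fun h3 => by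
    have h4 : (3 : ℝ) ≤ N := by exact_mod_cast h3
    have h5 := (lt_div_iff₀ (by linarith)).1 (hs'1 h3)
    nlinarith
  have hZ := hm.decayC1.ofReal_mul c
  obtain ⟨K, hK, hb⟩ := hm.bound
  have hZb : ∀ x, ‖c * (g x : ℂ)‖ ≤ K * (1 + ‖x‖) * η x := fun x => by
    rw [norm_mul, hm.norm_c, one_mul, Complex.norm_real]
    exact hb x
  obtain ⟨C₁, hC₁, h1⟩ := exists_symp_modGen_bound hs0 hZ
  obtain ⟨C₂, hC₂, h2⟩ := hη.exists_remainder_bound hN hcond hZ.continuous hK hZb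
  obtain ⟨C₃, hC₃, h3⟩ := hη.exists_force_bound hN hs'0 hcond' hZ.continuous hK hZb
    (L := (eLpNorm lam ⊤ volume).toReal) ENNReal.toReal_nonneg
  set Q := μ₁ ^ (s' / s) with hQ
  have hQ0 : 0 ≤ Q := Real.rpow_nonneg hμ₁.le _
  -- The three summands belong to the pairing of `w` with `modGen`, the quadratic remainder of the
  -- energy, and the force; `Q` bounds `μ^(s'/s)`.
  refine ⟨C₁ + μ₁ * C₂ + Q * C₃, by positivity, ?_⟩
  intro ε hε T hT ψ hψ σ w hμ hsk t ht a' v' γ' μ' ha hv hγ hμ' hw A B Γ M hA hB hΓ hM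
  obtain ⟨hR, hRb⟩ := h2 (w t) hw
  have hid := hm.modulation_identity hη hψ hT ht (fun τ hτ => (hμ τ hτ).1) hsk ha hv hγ hμ' hA hB hΓ
    hM hR
  have hmt := (hμ t ht).1
  have hq0 : Real.sqrt (σ t).μ ≠ 0 := (Real.sqrt_pos.2 hmt).ne'
  have hl : (fun x => lam ((σ t).a + (Real.sqrt (σ t).μ)⁻¹ • x))
      = fun x => lam ((Real.sqrt (σ t).μ)⁻¹ • (x - -(Real.sqrt (σ t).μ • (σ t).a))) := by
    funext x
    rw [sub_neg_eq_add, smul_add, smul_smul, inv_mul_cancel₀ hq0, one_smul, add_comm]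
  obtain ⟨f1, f2⟩ := h3 (w t) (fun x => lam ((σ t).a + (Real.sqrt (σ t).μ)⁻¹ • x)) hw
    (by rw [hl]; exact aestronglyMeasurable_comp_affine hlam (inv_ne_zero hq0) _)
    (by
      have := ae_norm_comp_affine_le hlam (inv_ne_zero hq0) (-(Real.sqrt (σ t).μ • (σ t).a))
      have e : ∀ x, lam ((σ t).a + (Real.sqrt (σ t).μ)⁻¹ • x) = _ := fun x => congrFun hl x
      simpa only [e] using this)
  set F₁ := ∫ x, (lam ((σ t).a + (Real.sqrt (σ t).μ)⁻¹ • x) : ℂ)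
        * powNL s' (η x + h1Fn (w t) x) * conj (c * (g x : ℂ))
  set F₀ := ∫ x, (lam ((σ t).a + (Real.sqrt (σ t).μ)⁻¹ • x) : ℂ)
            * ((η x ^ (2 * s' + 1) : ℝ) : ℂ) * conj (c * (g x : ℂ))
  set R := ∫ x, (powNL s (η x + h1Fn (w t) x) - ((η x ^ (2 * s + 1) : ℝ) : ℂ)
        - ((η x ^ (2 * s) : ℝ) : ℂ) * powLin s (h1Fn (w t) x)) * conj (c * (g x : ℂ))
  have hP : (σ t).μ ^ (s' / s) ≤ Q :=
    Real.rpow_le_rpow hmt.le (hμ t ht).2 (by positivity)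
  have hP0 : 0 ≤ (σ t).μ ^ (s' / s) := Real.rpow_nonneg hmt.le _
  have hw0 := norm_nonneg (w t)
  have hε0 := hε.1
  set X := ‖A‖ + ‖B‖ + |Γ| + |M| with hX
  have hX0 : 0 ≤ X := by positivity
  have b1 := h1 (w t) A B Γ M
  have b2 : |(σ t).μ * R.re| ≤ μ₁ * (C₂ * ‖w t‖ ^ 2) := by
    rw [abs_mul, abs_of_pos hmt]
    exact mul_le_mul (hμ t ht).2 ((Complex.abs_re_le_norm R).trans hRb) (abs_nonneg _) hμ₁.le
  have b3 : |ε * (σ t).μ ^ (s' / s) * (F₁ - F₀).re| ≤ ε * Q * (C₃ * ‖w t‖) := by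
    rw [abs_mul, abs_of_nonneg (by positivity)]
    exact mul_le_mul (by gcongr) ((Complex.abs_re_le_norm _).trans f1) (abs_nonneg _) (by positivity)
  constructor
  · have e : symp (fun x => (η x : ℂ)) (modGen s A B Γ M (fun x => c * (g x : ℂ)))
          - (1 / s - N / 2) * M * symp (fun x => (η x : ℂ)) (fun x => c * (g x : ℂ))
          - ε * (σ t).μ ^ (s' / s) * F₀.re
        = -symp (h1Fn (w t)) (modGen s A B Γ M (fun x => c * (g x : ℂ)))
          - (σ t).μ * R.re + ε * (σ t).μ ^ (s' / s) * (F₁ - F₀).re := by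
      rw [Complex.sub_re, ← hid]
      ring
    rw [e]
    refine (abs_add_le _ _).trans ((add_le_add ((abs_sub _ _).trans
      (add_le_add ((abs_neg _).le.trans b1) b2)) b3).trans ?_)
    have p1 : 0 ≤ X * ‖w t‖ := by positivity
    have p2 : 0 ≤ ‖w t‖ ^ 2 := by positivity
    have p3 : 0 ≤ ε * ‖w t‖ := by positivity
    have q1 : C₁ * (X * ‖w t‖) ≤ C₁ * (X * ‖w t‖ + ‖w t‖ ^ 2 + ε * ‖w t‖) := by gcongr; linarith
    have q2 : μ₁ * (C₂ * ‖w t‖ ^ 2) ≤ μ₁ * (C₂ * (X * ‖w t‖ + ‖w t‖ ^ 2 + ε * ‖w t‖)) := by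
      gcongr; linarith
    have q3 : Q * (C₃ * (ε * ‖w t‖)) ≤ Q * (C₃ * (X * ‖w t‖ + ‖w t‖ ^ 2 + ε * ‖w t‖)) := by
      gcongr; linarith
    linarith
  · rw [abs_mul, abs_of_nonneg (by positivity)]
    calc ε * (σ t).μ ^ (s' / s) * |F₀.re| ≤ ε * Q * C₃ :=
          mul_le_mul (by gcongr) ((Complex.abs_re_le_norm _).trans f2) (abs_nonneg _) (by positivity)
      _ = Q * C₃ * ε := by ring
      _ ≤ _ := by
          gcongr
          have : 0 ≤ μ₁ * C₂ := by positivity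
          linarith

end ModeEstimate

/-! ### The symplectic matrix on the tangent space at the profile. -/

section ProfileIntegrals

variable {N : ℕ} {s : ℝ} {η : Space N → ℝ}

lemma integral_eq_zero_of_odd {f : Space N → ℝ} (hf : ∀ x, f (-x) = -f x) : ∫ x, f x = 0 := by
  have h := integral_neg_eq_self f (volume : Measure (Space N))
  simp only [hf, integral_neg] at h
  linarith

/-- Since `η` and `g` are real, only the imaginary directions of the modulation, boost and gauge,
contribute to the imaginary part. -/
lemma symp_modGen_real (hη : DecayC1 η) (A B : Space N) (Γ M : ℝ) {g : Space N → ℝ}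
    (hg : DecayC1 g) :
    symp (fun x => (η x : ℂ)) (modGen s A B Γ M (fun x => 1 * (g x : ℂ)))
      = -∫ x, η x * ((inner ℝ B x + Γ) * g x) := by
  have hZ := hg.ofReal_mul 1
  have hηC : DecayC1 (fun x => (η x : ℂ)) := by simpa using hη.ofReal_mul 1
  have hi := integrable_L2_mul_conj (hηC.decay.memLp_two hηC.continuous.aestronglyMeasurable)
    (expDecay_modGen (s := s) A B Γ M hZ) (continuous_modGen A B Γ M hZ).aestronglyMeasurable
  rw [symp, ← RCLike.im_eq_complex_im, ← integral_im hi, ← integral_neg]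
  refine integral_congr_ae (Eventually.of_forall fun x => ?_)
  have hd : ∀ h, fderiv ℝ (fun x => 1 * (g x : ℂ)) x h = ((fderiv ℝ g x h : ℝ) : ℂ) := fun h => by
    simp only [one_mul]
    have : HasFDerivAt (fun x => (g x : ℂ)) (Complex.ofRealCLM.comp (fderiv ℝ g x)) x :=
      Complex.ofRealCLM.hasFDerivAt.comp x (hg.differentiable x).hasFDerivAt
    rw [this.fderiv]
    rfl
  simp only [RCLike.im_eq_complex_im, modGen, hd]
  have e : (1 / 2 : ℂ) = ((1 / 2 : ℝ) : ℂ) := by norm_num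
  rw [e]
  simp [-one_div, -Complex.ofReal_div, -Complex.ofReal_mul, -mul_eq_mul_left_iff]

/-- Complementary to the real case: an imaginary mode sees only translations and dilations. -/
lemma symp_modGen_imag (hη : DecayC1 η) (A B : Space N) (Γ M : ℝ) {g : Space N → ℝ}
    (hg : DecayC1 g) :
    symp (fun x => (η x : ℂ)) (modGen s A B Γ M (fun x => Complex.I * (g x : ℂ)))
      = ∫ x, η x * (fderiv ℝ g x A - M * (1 / (2 * s) * g x + 1 / 2 * fderiv ℝ g x x)) := by
  have hZ := hg.ofReal_mul Complex.I
  have hηC : DecayC1 (fun x => (η x : ℂ)) := by simpa using hη.ofReal_mul 1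
  have hi := integrable_L2_mul_conj (hηC.decay.memLp_two hηC.continuous.aestronglyMeasurable)
    (expDecay_modGen (s := s) A B Γ M hZ) (continuous_modGen A B Γ M hZ).aestronglyMeasurable
  rw [symp, ← RCLike.im_eq_complex_im, ← integral_im hi]
  refine integral_congr_ae (Eventually.of_forall fun x => ?_)
  have hd : ∀ h, fderiv ℝ (fun x => Complex.I * (g x : ℂ)) x h
      = Complex.I * ((fderiv ℝ g x h : ℝ) : ℂ) := fun h => by
    have : HasFDerivAt (fun x => Complex.I * (g x : ℂ))
        ((((ContinuousLinearMap.mul ℝ ℂ) Complex.I).comp Complex.ofRealCLM).comp (fderiv ℝ g x)) x :=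
      (((ContinuousLinearMap.mul ℝ ℂ) Complex.I).comp Complex.ofRealCLM).hasFDerivAt.comp x
        (hg.differentiable x).hasFDerivAt
    rw [this.fderiv]
    rfl
  simp only [RCLike.im_eq_complex_im, modGen, hd]
  have e : (1 / 2 : ℂ) = ((1 / 2 : ℝ) : ℂ) := by norm_num
  rw [e]
  simp [-one_div, -Complex.ofReal_div, -Complex.ofReal_mul, -mul_eq_mul_left_iff]
  ring

lemma symp_ofReal_real (f g : Space N → ℝ) :
    symp (fun x => (f x : ℂ)) (fun x => 1 * (g x : ℂ)) = 0 := by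
  simp only [symp, one_mul, Complex.conj_ofReal, ← Complex.ofReal_mul]
  rw [integral_complex_ofReal, Complex.ofReal_im]

lemma symp_ofReal_imag (f g : Space N → ℝ) :
    symp (fun x => (f x : ℂ)) (fun x => Complex.I * (g x : ℂ)) = -∫ x, f x * g x := by
  have e : ∀ x, (f x : ℂ) * conj (Complex.I * (g x : ℂ)) = -Complex.I * ((f x * g x : ℝ) : ℂ) :=
    fun x => by
      simp only [map_mul, Complex.conj_I, Complex.conj_ofReal]
      push_cast
      ring
  simp only [symp, e]
  rw [integral_const_mul, integral_complex_ofReal]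
  simp

lemma integral_mul_self_eq_mass : ∫ x, η x * η x = 2 * profileMass η := by
  simp only [profileMass, sq]
  ring

namespace DecayProfile

variable (hη : DecayProfile s η)

include hη

lemma integrable_mul_of_decay {f : Space N → ℝ} (hf : ExpDecay f) (hc : Continuous f) :
    Integrable (fun x => η x * f x) := by
  obtain ⟨C, hC, hb⟩ := hη.decay.bounded
  refine ExpDecay.integrable (hf.mono C fun x => ?_)
    (hη.decayC1.continuous.mul hc).aestronglyMeasurable
  rw [norm_mul]
  gcongr
  exact hb x

lemma even (x : Space N) : η (-x) = η x := hη.radial _ _ (norm_neg x)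

lemma fderiv_neg_apply (x h : Space N) : fderiv ℝ η (-x) h = -fderiv ℝ η x h := by
  have h1 : HasFDerivAt (fun y => η (-y)) ((fderiv ℝ η (-x)).comp (-ContinuousLinearMap.id ℝ _)) x :=
    (hη.differentiable (-x)).hasFDerivAt.comp x (hasFDerivAt_id x).neg
  rw [funext hη.even] at h1
  rw [h1.fderiv]
  simp

lemma mass_pos : 0 < profileMass η := by
  have hi : Integrable (fun x => η x ^ 2) := by
    simpa only [sq] using hη.integrable_mul_of_decay hη.decay hη.decayC1.continuous
  have h : 0 < ∫ x, η x ^ 2 := by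
    rw [integral_pos_iff_support_of_nonneg (fun x => sq_nonneg _) hi]
    have e : Function.support (fun x => η x ^ 2) = univ :=
      Set.eq_univ_of_forall fun x => (pow_pos (hη.pos x) 2).ne'
    rw [e]
    exact Measure.measure_univ_pos.2 (NeZero.ne _)
  rw [profileMass]
  linarith

lemma integral_mul_partialDeriv (j : Fin N) : ∫ x, η x * partialDeriv j η x = 0 := by
  refine integral_eq_zero_of_odd fun x => ?_
  rw [partialDeriv, partialDeriv, hη.fderiv_neg_apply, hη.even]
  ring

/-- Integration by parts reproduces the same integral with the opposite sign, plus `∫ η²` when `j =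
k`. -/
lemma integral_mul_coord_mul_partialDeriv (k j : Fin N) :
    ∫ x, η x * (x k * partialDeriv j η x) = if j = k then -profileMass η else 0 := by
  have hd := hη.decayC1
  have hp := hη.decayC1.decayC0_partialDeriv j
  have hk := hη.decayC1.coord_mul k
  have i1 : Integrable (fun x => partialDeriv j (fun x => x k * η x) x * η x) := by
    simpa only [mul_comm] using
      hη.integrable_mul_of_decay (hk.decay_partialDeriv j) (hk.continuous_partialDeriv j)
  have i2 : Integrable (fun x => η x * (x k * partialDeriv j η x)) :=
    hη.integrable_mul_of_decay (hp.coord_mul k).decay (hp.coord_mul k).continuous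
  have i3 : Integrable (fun x => x k * η x * η x) := by
    simpa only [mul_comm] using hη.integrable_mul_of_decay hk.decay hk.continuous
  have i4 : Integrable (fun x => η x * η x) := hη.integrable_mul_of_decay hη.decay hd.continuous
  have i2' : Integrable (fun x => x k * η x * partialDeriv j η x) :=
    i2.congr (Eventually.of_forall fun x => by ring)
  have h := integral_mul_fderiv_eq_neg_fderiv_mul_of_integrable (μ := (volume : Measure (Space N)))
    (v := stdVec j) i1 i2' i3 (fun x _ => hk.differentiable x) (fun x _ => hη.differentiable x)
  change ∫ x, x k * η x * partialDeriv j η x = -∫ x, partialDeriv j (fun x => x k * η x) x * η x at h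
  have e1 : ∫ x, x k * η x * partialDeriv j η x = ∫ x, η x * (x k * partialDeriv j η x) := by
    congr 1; funext x; ring
  have e2 : ∫ x, partialDeriv j (fun x => x k * η x) x * η x
      = (∫ x, η x * (x k * partialDeriv j η x)) + if j = k then 2 * profileMass η else 0 := by
    by_cases hjk : j = k
    · rw [if_pos hjk, ← integral_mul_self_eq_mass, ← integral_add i2 i4]
      congr 1; funext x
      rw [partialDeriv_coord_mul j k hη.differentiable, if_pos hjk]
      ring
    · rw [if_neg hjk, add_zero]
      congr 1; funext x
      rw [partialDeriv_coord_mul j k hη.differentiable, if_neg hjk]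
      ring
  rw [e1, e2] at h
  split_ifs at h ⊢ <;> linarith

lemma integral_mul_inner_mul_partialDeriv (B : Space N) (j : Fin N) :
    ∫ x, η x * (inner ℝ B x * partialDeriv j η x) = -(profileMass η * B j) := by
  have e : ∀ x : Space N, η x * (inner ℝ B x * partialDeriv j η x)
      = ∑ k, B k * (η x * (x k * partialDeriv j η x)) := fun x => by
    rw [PiLp.inner_apply, Finset.sum_mul, Finset.mul_sum]
    refine Finset.sum_congr rfl fun k _ => ?_
    simp only [RCLike.inner_apply, conj_trivial]
    ring
  have hp := hη.decayC1.decayC0_partialDeriv j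
  simp only [e]
  rw [integral_finsetSum _ fun k _ => (hη.integrable_mul_of_decay (hp.coord_mul k).decay
    (hp.coord_mul k).continuous).const_mul (B k)]
  simp only [integral_const_mul, hη.integral_mul_coord_mul_partialDeriv]
  simp
  ring

lemma integral_mul_radial : ∫ x, η x * fderiv ℝ η x x = -(N * profileMass η) := by
  have e : ∀ x : Space N, η x * fderiv ℝ η x x = ∑ k, η x * (x k * partialDeriv k η x) := fun x => by
    rw [fderiv_apply_eq_sum, Finset.mul_sum]
    rfl
  simp only [e]
  rw [integral_finsetSum _ fun k _ => hη.integrable_mul_of_decay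
    ((hη.decayC1.decayC0_partialDeriv k).coord_mul k).decay
    ((hη.decayC1.decayC0_partialDeriv k).coord_mul k).continuous]
  simp [hη.integral_mul_coord_mul_partialDeriv]

/-- This is half the derivative of `∫ η²` under dilations. It is positive exactly when `s < 2/N`,
which is the nondegeneracy needed to solve for the gauge and scaling velocities. -/
lemma integral_mul_scaling :
    ∫ x, η x * (1 / (2 * s) * η x + 1 / 2 * fderiv ℝ η x x) = (1 / s - N / 2) * profileMass η := by
  have i1 := hη.integrable_mul_of_decay hη.decay hη.decayC1.continuous
  have i2 := hη.integrable_mul_of_decay hη.decayC1_radial.decay hη.decayC1_radial.continuous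
  have e : ∀ x : Space N, η x * (1 / (2 * s) * η x + 1 / 2 * fderiv ℝ η x x)
      = 1 / (2 * s) * (η x * η x) + 1 / 2 * (η x * fderiv ℝ η x x) := fun x => by ring
  simp only [e]
  rw [integral_add (i1.const_mul _) (i2.const_mul _), integral_const_mul, integral_const_mul,
    integral_mul_self_eq_mass, hη.integral_mul_radial]
  have := hη.s_pos
  field_simp
  ring

/-- Each mode isolates one velocity, by parity and integration by parts. Here the generator gives
`-M` and the factor `μ^(1/s - N/2)` contributes `+2M`, so the total keeps a positive coefficient. -/
lemma symp_gauge (A B : Space N) (Γ M : ℝ) :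
    symp (fun x => (η x : ℂ)) (modGen s A B Γ M (fun x => Complex.I * (η x : ℂ)))
      - (1 / s - N / 2) * M * symp (fun x => (η x : ℂ)) (fun x => Complex.I * (η x : ℂ))
      = (1 / s - N / 2) * profileMass η * M := by
  rw [symp_modGen_imag hη.decayC1 A B Γ M hη.decayC1, symp_ofReal_imag, integral_mul_self_eq_mass]
  have i1 := hη.integrable_mul_of_decay (f := fun x => fderiv ℝ η x A)
    (hη.decayC1.decay_fderiv.mono ‖A‖ fun x => by
      rw [mul_comm]; exact (fderiv ℝ η x).le_opNorm A)
    (hη.decayC1.continuous_fderiv.clm_apply continuous_const)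
  have i2 := hη.integrable_mul_of_decay hη.decayC1_scaling.decay hη.decayC1_scaling.continuous
  have h0 : ∫ x, η x * fderiv ℝ η x A = 0 := integral_eq_zero_of_odd fun x => by
    rw [hη.fderiv_neg_apply, hη.even]; ring
  have e : ∀ x : Space N, η x * (fderiv ℝ η x A - M * (1 / (2 * s) * η x + 1 / 2 * fderiv ℝ η x x))
      = η x * fderiv ℝ η x A - M * (η x * (1 / (2 * s) * η x + 1 / 2 * fderiv ℝ η x x)) :=
    fun x => by ring
  simp only [e]
  rw [integral_sub i1 (i2.const_mul _), integral_const_mul, h0, hη.integral_mul_scaling]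
  ring

lemma symp_translation (A B : Space N) (Γ M : ℝ) (j : Fin N) :
    symp (fun x => (η x : ℂ)) (modGen s A B Γ M (fun x => 1 * ((partialDeriv j η x : ℝ) : ℂ)))
      - (1 / s - N / 2) * M
        * symp (fun x => (η x : ℂ)) (fun x => 1 * ((partialDeriv j η x : ℝ) : ℂ))
      = profileMass η * B j := by
  rw [symp_modGen_real hη.decayC1 A B Γ M (hη.decayC1_partialDeriv j), symp_ofReal_real]
  have hp := hη.decayC1.decayC0_partialDeriv j
  have i0 : Integrable (fun x => η x * (inner ℝ B x * partialDeriv j η x)) :=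
    hη.integrable_mul_of_decay (hp.decay.poly ‖B‖ 1 fun x => by
      rw [norm_mul, pow_one]
      have := abs_real_inner_le_norm B x
      have := norm_nonneg B
      gcongr
      rw [Real.norm_eq_abs]
      linarith) (by have := hp.continuous; fun_prop)
  have i1 := hη.integrable_mul_of_decay hp.decay hp.continuous
  have e : ∀ x : Space N, η x * ((inner ℝ B x + Γ) * partialDeriv j η x)
      = η x * (inner ℝ B x * partialDeriv j η x) + Γ * (η x * partialDeriv j η x) := fun x => by ring
  simp only [e]
  rw [integral_add i0 (i1.const_mul _), integral_const_mul, hη.integral_mul_partialDeriv,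
    hη.integral_mul_inner_mul_partialDeriv]
  ring

lemma symp_scaling (A B : Space N) (Γ M : ℝ) :
    symp (fun x => (η x : ℂ)) (modGen s A B Γ M
        (fun x => 1 * ((1 / (2 * s) * η x + 1 / 2 * fderiv ℝ η x x : ℝ) : ℂ)))
      - (1 / s - N / 2) * M * symp (fun x => (η x : ℂ))
        (fun x => 1 * ((1 / (2 * s) * η x + 1 / 2 * fderiv ℝ η x x : ℝ) : ℂ))
      = -((1 / s - N / 2) * profileMass η * Γ) := by
  rw [symp_modGen_real hη.decayC1 A B Γ M hη.decayC1_scaling, symp_ofReal_real]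
  have hp := hη.decayC1_scaling.decayC0
  have i0 : Integrable (fun x => η x * (inner ℝ B x * (1 / (2 * s) * η x + 1 / 2 * fderiv ℝ η x x))) :=
    hη.integrable_mul_of_decay (hp.decay.poly ‖B‖ 1 fun x => by
      rw [norm_mul, pow_one]
      have := abs_real_inner_le_norm B x
      have := norm_nonneg B
      gcongr
      rw [Real.norm_eq_abs]
      linarith) ((by fun_prop : Continuous fun x : Space N => (inner ℝ B x : ℝ)).mul hp.continuous)
  have i1 := hη.integrable_mul_of_decay hp.decay hp.continuous
  have h0 : ∫ x, η x * (inner ℝ B x * (1 / (2 * s) * η x + 1 / 2 * fderiv ℝ η x x)) = 0 :=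
    integral_eq_zero_of_odd fun x => by
      rw [map_neg, hη.fderiv_neg_apply, hη.even, inner_neg_right]; ring
  have e : ∀ x : Space N, η x * ((inner ℝ B x + Γ) * (1 / (2 * s) * η x + 1 / 2 * fderiv ℝ η x x))
      = η x * (inner ℝ B x * (1 / (2 * s) * η x + 1 / 2 * fderiv ℝ η x x))
        + Γ * (η x * (1 / (2 * s) * η x + 1 / 2 * fderiv ℝ η x x)) := fun x => by ring
  simp only [e]
  rw [integral_add i0 (i1.const_mul _), integral_const_mul, hη.integral_mul_scaling, h0]
  ring

lemma fderiv_coord_mul_apply (j : Fin N) (x h : Space N) :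
    fderiv ℝ (fun x => x j * η x) x h = x j * fderiv ℝ η x h + h j * η x := by
  have h1 : HasFDerivAt (fun x : Space N => x j) (EuclideanSpace.proj (𝕜 := ℝ) j) x :=
    (EuclideanSpace.proj (𝕜 := ℝ) j : Space N →L[ℝ] ℝ).hasFDerivAt
  have h2 : HasFDerivAt (fun x : Space N => x j * η x) _ x :=
    h1.mul (hη.differentiable x).hasFDerivAt
  rw [h2.fderiv]
  simp [mul_comm]

lemma symp_boost (A B : Space N) (Γ M : ℝ) (j : Fin N) :
    symp (fun x => (η x : ℂ)) (modGen s A B Γ M (fun x => Complex.I * ((x j * η x : ℝ) : ℂ)))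
      - (1 / s - N / 2) * M
        * symp (fun x => (η x : ℂ)) (fun x => Complex.I * ((x j * η x : ℝ) : ℂ))
      = profileMass η * A j := by
  have hk := hη.decayC1.coord_mul j
  rw [symp_modGen_imag hη.decayC1 A B Γ M hk, symp_ofReal_imag]
  have h0 : ∫ x, η x * (x j * η x) = 0 := integral_eq_zero_of_odd fun x => by
    rw [hη.even, PiLp.neg_apply]; ring
  have h1 : ∫ x, η x * (M * (1 / (2 * s) * (x j * η x)
      + 1 / 2 * fderiv ℝ (fun x => x j * η x) x x)) = 0 := integral_eq_zero_of_odd fun x => by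
    rw [hη.fderiv_coord_mul_apply, hη.fderiv_coord_mul_apply, map_neg, hη.fderiv_neg_apply, hη.even,
      PiLp.neg_apply]
    ring
  have hA : ∀ x, fderiv ℝ (fun x => x j * η x) x A
      = (∑ i, A i * (x j * partialDeriv i η x)) + A j * η x := fun x => by
    rw [hη.fderiv_coord_mul_apply, fderiv_apply_eq_sum, Finset.mul_sum]
    congr 1
    refine Finset.sum_congr rfl fun i _ => ?_
    rw [smul_eq_mul]
    ring
  have i1 : ∀ i, Integrable (fun x => η x * (x j * partialDeriv i η x)) := fun i =>
    hη.integrable_mul_of_decay ((hη.decayC1.decayC0_partialDeriv i).coord_mul j).decay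
      ((hη.decayC1.decayC0_partialDeriv i).coord_mul j).continuous
  have i2 := hη.integrable_mul_of_decay hη.decay hη.decayC1.continuous
  have h2 : ∫ x, η x * fderiv ℝ (fun x => x j * η x) x A = profileMass η * A j := by
    have e : ∀ x, η x * fderiv ℝ (fun x => x j * η x) x A
        = (∑ i, A i * (η x * (x j * partialDeriv i η x))) + A j * (η x * η x) := fun x => by
      rw [hA, mul_add, Finset.mul_sum]
      congr 1
      · exact Finset.sum_congr rfl fun i _ => by ring
      · ring
    simp only [e]
    rw [integral_add (integrable_finsetSum _ fun i _ => (i1 i).const_mul _) (i2.const_mul _),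
      integral_finsetSum _ fun i _ => (i1 i).const_mul _]
    simp only [integral_const_mul, hη.integral_mul_coord_mul_partialDeriv, integral_mul_self_eq_mass]
    simp
    ring
  have j1 : Integrable (fun x => η x * fderiv ℝ (fun x => x j * η x) x A) :=
    hη.integrable_mul_of_decay (hk.decay_fderiv.mono ‖A‖ fun x => by
      rw [mul_comm]; exact (fderiv ℝ _ x).le_opNorm A)
      (hk.continuous_fderiv.clm_apply continuous_const)
  have hrad : DecayC0 (fun x => fderiv ℝ (fun x => x j * η x) x x) := by
    refine ⟨hk.decay_fderiv.poly 1 1 fun x => ((fderiv ℝ _ x).le_opNorm x).trans ?_,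
      hk.continuous_fderiv.clm_apply continuous_id⟩
    rw [mul_comm, pow_one, one_mul]
    gcongr
    linarith
  have hsc := ((hk.decayC0.const_mul (1 / (2 * s))).add (hrad.const_mul (1 / 2))).const_mul M
  have j2 := hη.integrable_mul_of_decay hsc.decay hsc.continuous
  simp only [mul_sub]
  rw [integral_sub j1 j2, h0, h1, h2]
  ring

end DecayProfile

end ProfileIntegrals

/-! ### The force of the potential on the modes. -/

section Forces

variable {N : ℕ} {s s' : ℝ} {η lam : Space N → ℝ}

/-- Gauge and boost modes are imaginary while the leading force is real. Hence the equations of `μ`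
and `a` have no term of order `ε` independent of `w`. -/
lemma re_integral_mul_conj_I_mul (l r g : Space N → ℝ) :
    (∫ x, (l x : ℂ) * (r x : ℂ) * conj (Complex.I * (g x : ℂ))).re = 0 := by
  have e : ∀ x, (l x : ℂ) * (r x : ℂ) * conj (Complex.I * (g x : ℂ))
      = -Complex.I * ((l x * (r x * g x) : ℝ) : ℂ) := fun x => by
    simp only [map_mul, Complex.conj_I, Complex.conj_ofReal]
    push_cast
    ring
  simp only [e]
  rw [integral_const_mul, integral_complex_ofReal]
  simp

lemma re_integral_mul_conj_ofReal (l r g : Space N → ℝ) :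
    (∫ x, (l x : ℂ) * (r x : ℂ) * conj (1 * (g x : ℂ))).re = ∫ x, l x * (r x * g x) := by
  have e : ∀ x, (l x : ℂ) * (r x : ℂ) * conj (1 * (g x : ℂ))
      = ((l x * (r x * g x) : ℝ) : ℂ) := fun x => by
    simp only [one_mul, Complex.conj_ofReal]
    push_cast
    ring
  simp only [e]
  rw [integral_complex_ofReal, Complex.ofReal_re]

lemma shift_sqrt_smul {μ : ℝ} (hμ : 0 < μ) (a x : Space N) :
    (Real.sqrt μ)⁻¹ • (Real.sqrt μ • a + x) = a + (Real.sqrt μ)⁻¹ • x := by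
  rw [smul_add, smul_smul, inv_mul_cancel₀ (Real.sqrt_pos.2 hμ).ne', one_smul]

/-- The gradient of the effective potential already has its derivative on `η`; the normalization by
`(2 + 2s') m` leaves the factor `m`. -/
lemma DecayProfile.translation_force (hη : DecayProfile s η) (hs' : 0 ≤ s')
    (hlam : MemLp lam ⊤ volume) (ε : ℝ) {μ : ℝ} (hμ : 0 < μ) (a : Space N) (j : Fin N) :
    ε * μ ^ (s' / s) * ∫ x, lam (a + (Real.sqrt μ)⁻¹ • x)
        * (η x ^ (2 * s' + 1) * partialDeriv j η x)
      = -(profileMass η * gradient (Veff s s' ε lam η μ) (Real.sqrt μ • a) j) := by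
  rw [hη.gradient_Veff hs' hlam ε hμ, effPrefactor]
  simp only [shift_sqrt_smul hμ]
  have := hη.mass_pos.ne'
  have : 2 + 2 * s' ≠ 0 := by positivity
  field_simp
  ring

/-- The scaling profile produces the integrals of `λ η^(2s'+2)` and `λ η^(2s'+1) x·∂_xη`. The second
is eliminated through the divergence of the vector field, which brings in `Beff` and shifts the
coefficient of `Veff` by `-N/2`. -/
lemma DecayProfile.scaling_force (hη : DecayProfile s η) (hs' : 0 ≤ s')
    (hlam : MemLp lam ⊤ volume) (ε : ℝ) {μ : ℝ} (hμ : 0 < μ) (a : Space N) :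
    ε * μ ^ (s' / s) * ∫ x, lam (a + (Real.sqrt μ)⁻¹ • x)
        * (η x ^ (2 * s' + 1) * (1 / (2 * s) * η x + 1 / 2 * fderiv ℝ η x x))
      = profileMass η * ((2 + 2 * s' - N * s) / (2 * s)
          * Veff s s' ε lam η μ (Real.sqrt μ • a)
        - Beff s s' ε lam η μ (Real.sqrt μ • a) / 2) := by
  have hν : (Real.sqrt μ)⁻¹ ≠ 0 := inv_ne_zero (Real.sqrt_pos.2 hμ).ne'
  have hρ := hη.decayC1_rpow (p := 2 * s' + 2) (by positivity)
  have hP : ∀ x, η x ^ (2 * s' + 1) * η x = η x ^ (2 * s' + 2) := fun x => by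
    rw [show 2 * s' + 2 = 2 * s' + 1 + 1 by ring,
      Real.rpow_add_one (hη.pos x).ne' (2 * s' + 1)]
  have iJ : Integrable (fun x => lam ((Real.sqrt μ)⁻¹ • (Real.sqrt μ • a + x))
      * η x ^ (2 * s' + 2)) :=
    integrable_shift_smul hlam hν (Real.sqrt μ • a) hρ.decay hρ.continuous.aestronglyMeasurable
  have hrad : DecayC0 (fun x => fderiv ℝ (fun x => η x ^ (2 * s' + 2)) x x) := by
    refine ⟨hρ.decay_fderiv.poly 1 1 fun x => ((fderiv ℝ _ x).le_opNorm x).trans ?_,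
      hρ.continuous_fderiv.clm_apply continuous_id⟩
    rw [mul_comm, pow_one, one_mul]
    gcongr
    linarith
  have h2 : 2 * s' + 2 ≠ 0 := by positivity
  have iK : Integrable (fun x => lam ((Real.sqrt μ)⁻¹ • (Real.sqrt μ • a + x))
      * (η x ^ (2 * s' + 1) * fderiv ℝ η x x)) := by
    have := (integrable_shift_smul hlam hν (Real.sqrt μ • a) hrad.decay
      hrad.continuous.aestronglyMeasurable).const_mul (2 * s' + 2)⁻¹
    refine this.congr (Eventually.of_forall fun x => ?_)
    simp only [hη.fderiv_rpow_apply, smul_eq_mul]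
    field_simp
  have e1 : ∀ x : Space N, lam ((Real.sqrt μ)⁻¹ • (Real.sqrt μ • a + x))
        * (η x ^ (2 * s' + 1) * (1 / (2 * s) * η x + 1 / 2 * fderiv ℝ η x x))
      = 1 / (2 * s) * (lam ((Real.sqrt μ)⁻¹ • (Real.sqrt μ • a + x)) * η x ^ (2 * s' + 2))
        + 1 / 2 * (lam ((Real.sqrt μ)⁻¹ • (Real.sqrt μ • a + x))
          * (η x ^ (2 * s' + 1) * fderiv ℝ η x x)) := fun x => by
    rw [← hP]; ring
  have e2 : ∀ x : Space N, lam ((Real.sqrt μ)⁻¹ • (Real.sqrt μ • a + x))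
        * (N * η x ^ (2 * s' + 2) + (2 * s' + 2) * (η x ^ (2 * s' + 1) * fderiv ℝ η x x))
      = N * (lam ((Real.sqrt μ)⁻¹ • (Real.sqrt μ • a + x)) * η x ^ (2 * s' + 2))
        + (2 * s' + 2) * (lam ((Real.sqrt μ)⁻¹ • (Real.sqrt μ • a + x))
          * (η x ^ (2 * s' + 1) * fderiv ℝ η x x)) := fun x => by
    ring
  rw [Beff, hη.divergenceAt_effField hs' hlam hμ, Veff, effPrefactor]
  simp only [← shift_sqrt_smul hμ, e1, e2]
  rw [integral_add (iJ.const_mul _) (iK.const_mul _), integral_add (iJ.const_mul _) (iK.const_mul _)]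
  simp only [integral_const_mul]
  have := hη.mass_pos.ne'
  have := hη.s_pos.ne'
  have : 2 + 2 * s' ≠ 0 := by positivity
  field_simp
  ring

end Forces

/-! ### Solving the modulation system. -/

section Modulation

variable {N : ℕ} {s s' : ℝ} {η lam : Space N → ℝ}

/-- The modulation equations in the moving frame, up to errors which are quadratic in the remainder
and the parameter velocities. -/
lemma DecayProfile.exists_modulation_estimates (hη : DecayProfile s η)
    (hN : 1 ≤ N) (hs : s < 2 / (N : ℝ)) (hs'0 : 0 ≤ s')
    (hs'1 : 3 ≤ N → s' < 2 / ((N : ℝ) - 2)) (hlam : MemLp lam ⊤ volume)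
    {μ₁ : ℝ} (hμ₁ : 0 < μ₁) :
    ∃ C, 0 ≤ C ∧ ∀ ε ∈ Ico (0 : ℝ) 1, ∀ T > (0 : ℝ), ∀ ψ : ℝ → H1 N,
      IsNLSSolution s s' ε lam T ψ → ∀ (σ : ℝ → Param N) (w : ℝ → H1 N),
      (∀ τ ∈ Icc 0 T, 0 < (σ τ).μ ∧ (σ τ).μ ≤ μ₁) →
      (∀ τ ∈ Icc 0 T, IsSkewDecomp s η (ψ τ) (σ τ) (w τ)) →
      ∀ t ∈ Icc 0 T, ∀ (a' v' : Space N) (γ' μ' : ℝ),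
      HasDerivWithinAt (fun τ => (σ τ).a) a' (Icc 0 T) t →
      HasDerivWithinAt (fun τ => (σ τ).v) v' (Icc 0 T) t →
      HasDerivWithinAt (fun τ => (σ τ).γ) γ' (Icc 0 T) t →
      HasDerivWithinAt (fun τ => (σ τ).μ) μ' (Icc 0 T) t →
      ‖w t‖ ≤ 1 → ∀ (A B G : Space N) (Γ M f D : ℝ), A = Real.sqrt (σ t).μ • (a' - (σ t).v) →
      B = (1 / (2 * Real.sqrt (σ t).μ)) • v' →
      Γ = γ' - inner ℝ (σ t).v a' / 2 + ‖(σ t).v‖ ^ 2 / 4 - (σ t).μ → M = μ' / (σ t).μ →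
      G = gradient (Veff s s' ε lam η (σ t).μ) (Real.sqrt (σ t).μ • (σ t).a) →
      f = (2 + 2 * s' - N * s) / (2 * s) * Veff s s' ε lam η (σ t).μ (Real.sqrt (σ t).μ • (σ t).a)
        - Beff s s' ε lam η (σ t).μ (Real.sqrt (σ t).μ • (σ t).a) / 2 →
      D = (‖A‖ + ‖B‖ + |Γ| + |M|) * ‖w t‖ + ‖w t‖ ^ 2 + ε * ‖w t‖ →
      (∀ j, |profileMass η * A j| ≤ C * D) ∧
      (∀ j, |profileMass η * (B + G) j| ≤ C * D ∧ |profileMass η * G j| ≤ C * ε) ∧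
      (|profileMass η * ((1 / s - N / 2) * Γ + f)| ≤ C * D ∧ |profileMass η * f| ≤ C * ε) ∧
      |profileMass η * ((1 / s - N / 2) * M)| ≤ C * D := by
  obtain ⟨C₁, hC₁, h1⟩ := hη.gaugeMode.exists_estimate hη hN hs hs'0 hs'1 hlam hμ₁
  choose C₂ hC₂ h2 using fun j => (hη.boostMode j).exists_estimate hη hN hs hs'0 hs'1 hlam hμ₁
  choose C₃ hC₃ h3 using fun j => (hη.translationMode j).exists_estimate hη hN hs hs'0 hs'1 hlam hμ₁
  obtain ⟨C₄, hC₄, h4⟩ := hη.scalingMode.exists_estimate hη hN hs hs'0 hs'1 hlam hμ₁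
  have hS₂ : 0 ≤ ∑ j, C₂ j := Finset.sum_nonneg fun j _ => hC₂ j
  have hS₃ : 0 ≤ ∑ j, C₃ j := Finset.sum_nonneg fun j _ => hC₃ j
  have hle₂ : ∀ j, C₂ j ≤ ∑ j, C₂ j := fun j =>
    Finset.single_le_sum (fun j _ => hC₂ j) (Finset.mem_univ j)
  have hle₃ : ∀ j, C₃ j ≤ ∑ j, C₃ j := fun j =>
    Finset.single_le_sum (fun j _ => hC₃ j) (Finset.mem_univ j)
  refine ⟨C₁ + ∑ j, C₂ j + ∑ j, C₃ j + C₄, by positivity, ?_⟩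
  intro ε hε T hT ψ hψ σ w hμ hsk t ht a' v' γ' μ' ha hv hγ hμ' hw A B G Γ M f D hA hB hΓ hM hG hf hD
  have hε0 := hε.1
  have hD0 : 0 ≤ D := by rw [hD]; positivity
  have hmt := (hμ t ht).1
  have k1 := (h1 ε hε T hT ψ hψ σ w hμ hsk t ht a' v' γ' μ' ha hv hγ hμ' hw A B Γ M hA hB hΓ hM).1
  have k2 := fun j =>
    (h2 j ε hε T hT ψ hψ σ w hμ hsk t ht a' v' γ' μ' ha hv hγ hμ' hw A B Γ M hA hB hΓ hM).1
  have k3 := fun j =>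
    h3 j ε hε T hT ψ hψ σ w hμ hsk t ht a' v' γ' μ' ha hv hγ hμ' hw A B Γ M hA hB hΓ hM
  have k4 := h4 ε hε T hT ψ hψ σ w hμ hsk t ht a' v' γ' μ' ha hv hγ hμ' hw A B Γ M hA hB hΓ hM
  rw [← hD, hη.symp_gauge, re_integral_mul_conj_I_mul, mul_zero, sub_zero] at k1
  simp only [← hD, hη.symp_boost, re_integral_mul_conj_I_mul, mul_zero, sub_zero] at k2
  simp only [← hD, hη.symp_translation, re_integral_mul_conj_ofReal,
    hη.translation_force hs'0 hlam ε hmt, ← hG, abs_neg, sub_neg_eq_add] at k3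
  rw [← hD, hη.symp_scaling, re_integral_mul_conj_ofReal, hη.scaling_force hs'0 hlam ε hmt,
    ← hf] at k4
  refine ⟨fun j => (k2 j).trans ?_, fun j => ⟨?_, (k3 j).2.trans ?_⟩, ⟨?_, k4.2.trans ?_⟩, ?_⟩
  · gcongr
    linarith [hle₂ j]
  · rw [PiLp.add_apply, mul_add]
    refine (k3 j).1.trans ?_
    gcongr
    linarith [hle₃ j]
  · gcongr
    linarith [hle₃ j]
  -- The scaling pairing carries `Γ` with a negative sign, opposite to that of the other velocities.
  · rw [← abs_neg]
    refine (le_of_eq (congrArg _ ?_)).trans (k4.1.trans ?_)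
    · ring
    · gcongr
      linarith
  · gcongr
    linarith
  · refine (le_of_eq (congrArg _ ?_)).trans (k1.trans ?_)
    · ring
    · gcongr
      linarith

lemma norm_le_card_mul {r : ℝ} {A : Space N} (h : ∀ j, |A j| ≤ r) : ‖A‖ ≤ N * r := by
  have e := (EuclideanSpace.basisFun (Fin N) ℝ).sum_repr A
  calc ‖A‖ = ‖∑ i, A i • EuclideanSpace.basisFun (Fin N) ℝ i‖ := congrArg _ e.symm
    _ ≤ ∑ i : Fin N, r := (norm_sum_le _ _).trans (Finset.sum_le_sum fun i _ => by
        rw [norm_smul, OrthonormalBasis.norm_eq_one, mul_one]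
        exact h i)
    _ = N * r := by simp

/-- Absorption of the parameter velocities `X` on the right-hand side. -/
lemma le_of_absorption {K X w ε : ℝ} (hK : 0 ≤ K) (hX : 0 ≤ X) (hw : 0 ≤ w)
    (hwK : w * (2 * K + 1) ≤ 1) (hε : 0 ≤ ε) (h : X ≤ K * (X * w + w ^ 2 + ε * w + ε)) :
    X * w + w ^ 2 + ε * w ≤ (4 * K + 1) * (ε * w + w ^ 2) := by
  have hw1 : w ≤ 1 := by nlinarith
  -- Smallness of `w` lets half of `X` absorb the term `K X w` on the right.
  have hKw : K * w ≤ 1 / 2 := by linarith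
  have h1 : K * (X * w) ≤ X / 2 := by nlinarith
  have h2 : K * (ε * w) ≤ K * ε := by gcongr; nlinarith
  have h3 : X ≤ 2 * K * (w ^ 2 + 2 * ε) := by linarith
  have h4 : X * w ≤ 2 * K * (w ^ 2 + 2 * ε) * w := by gcongr
  have h5 : K * (w ^ 2 * w) ≤ K * (w ^ 2 * 1) := by gcongr
  have h6 : 0 ≤ K * w ^ 2 := by positivity
  linarith

/-- Closing the modulation estimates for a small remainder. -/
lemma modulation_bounds {m α C w ε : ℝ} (hm : 0 < m) (hα : 0 < α) (hC : 0 ≤ C) (hw : 0 ≤ w)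
    (hε : 0 ≤ ε) {A B G : Space N} {Γ M f D : ℝ}
    (hD : D = (‖A‖ + ‖B‖ + |Γ| + |M|) * w + w ^ 2 + ε * w)
    (hA : ∀ j, |m * A j| ≤ C * D)
    (hB : ∀ j, |m * (B + G) j| ≤ C * D ∧ |m * G j| ≤ C * ε)
    (hΓ : |m * (α * Γ + f)| ≤ C * D ∧ |m * f| ≤ C * ε) (hM : |m * (α * M)| ≤ C * D)
    {K : ℝ} (hK : K = 2 * N * (C / m) + 2 * (C / (m * α))) (hwK : w * (2 * K + 1) ≤ 1) :
    ‖A‖ ≤ N * (C / m * D) ∧ ‖B + G‖ ≤ N * (C / m * D) ∧ |Γ + f / α| ≤ C / (m * α) * D ∧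
      |M| ≤ C / (m * α) * D ∧ D ≤ (4 * K + 1) * (ε * w + w ^ 2) := by
  have hdiv : ∀ x y : ℝ, |m * x| ≤ C * y → |x| ≤ C / m * y := fun x y h => by
    rw [abs_mul, abs_of_pos hm] at h
    rw [div_mul_eq_mul_div, le_div_iff₀ hm]
    linarith
  have hdivα : ∀ x y : ℝ, |m * (α * x)| ≤ C * y → |x| ≤ C / (m * α) * y := fun x y h => by
    rw [← mul_assoc, abs_mul, abs_of_pos (mul_pos hm hα)] at h
    rw [div_mul_eq_mul_div, le_div_iff₀ (mul_pos hm hα)]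
    linarith
  have bA : ‖A‖ ≤ N * (C / m * D) := norm_le_card_mul fun j => hdiv _ _ (hA j)
  have bBG : ‖B + G‖ ≤ N * (C / m * D) := norm_le_card_mul fun j => hdiv _ _ (hB j).1
  have bG : ‖G‖ ≤ N * (C / m * ε) := norm_le_card_mul fun j => hdiv _ _ (hB j).2
  have bΓ : |Γ + f / α| ≤ C / (m * α) * D :=
    hdivα _ _ (by rw [mul_add, mul_div_cancel₀ _ hα.ne']; exact hΓ.1)
  have bf : |f / α| ≤ C / (m * α) * ε := hdivα _ _ (by rw [mul_div_cancel₀ _ hα.ne']; exact hΓ.2)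
  have bM : |M| ≤ C / (m * α) * D := hdivα _ _ hM
  refine ⟨bA, bBG, bΓ, bM, ?_⟩
  have bB : ‖B‖ ≤ ‖B + G‖ + ‖G‖ := by simpa using norm_sub_le (B + G) G
  have bΓ' : |Γ| ≤ |Γ + f / α| + |f / α| := by simpa using abs_sub (Γ + f / α) (f / α)
  have hP : 0 ≤ C / m := by positivity
  have hQ : 0 ≤ C / (m * α) := by positivity
  have hK0 : 0 ≤ K := by rw [hK]; positivity
  -- Only `B + G` and `Γ + f/α` are bounded by `D`; the forces `G` and `f/α` are of order `ε`, which
  -- accounts for the extra `ε` and for the factors two in `K`.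
  have hXK : ‖A‖ + ‖B‖ + |Γ| + |M| ≤ K * (D + ε) := by
    have h1 : 0 ≤ N * (C / m * ε) := by positivity
    have h2 : 0 ≤ C / (m * α) * ε := by positivity
    rw [hK]
    linarith
  rw [hD] at hXK ⊢
  exact le_of_absorption hK0 (by positivity) hw hwK hε hXK

/-- The modulation equations in the original variables. -/
lemma modulation_equations {s s' μ₀ μ₁ μ P Q L D E γ' μ' V W α Γ M f : ℝ} {a' v v' A B G : Space N}
    (hs : 0 < s) (hsN : s * N < 2) (hμ₀ : 0 < μ₀) (hμ : μ₀ ≤ μ ∧ μ ≤ μ₁) (hP : 0 ≤ P) (hQ : 0 ≤ Q)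
    (hD : 0 ≤ D) (hDE : D ≤ L * E) (hα : α = 1 / s - N / 2)
    (hA : A = Real.sqrt μ • (a' - v)) (hB : B = (1 / (2 * Real.sqrt μ)) • v')
    (hΓ : Γ = γ' - inner ℝ v a' / 2 + ‖v‖ ^ 2 / 4 - μ) (hM : M = μ' / μ)
    (hf : f = (2 + 2 * s' - N * s) / (2 * s) * V - W / 2)
    (bA : ‖A‖ ≤ N * (P * D)) (bB : ‖B + G‖ ≤ N * (P * D)) (bΓ : |Γ + f / α| ≤ Q * D)
    (bM : |M| ≤ Q * D) {C : ℝ}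
    (hC : ((Real.sqrt μ₀)⁻¹ * (N * P) + 2 * Real.sqrt μ₁ * (N * P) + Q + μ₁ * Q) * (L * E) ≤ C) :
    ‖a' - v‖ ≤ C ∧ ‖v' - (-(2 * Real.sqrt μ)) • G‖ ≤ C ∧
      |γ' - (μ + inner ℝ a' v / 2 - ‖v‖ ^ 2 / 4 - (2 - N * s + 2 * s') / (2 - N * s) * V
        + s / (2 - N * s) * W)| ≤ C ∧ |μ'| ≤ C := by
  have hμ0 : 0 < μ := hμ₀.trans_le hμ.1
  have hμ₁ : 0 < μ₁ := hμ0.trans_le hμ.2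
  have hq := Real.sqrt_pos.2 hμ0
  have hq₀ := Real.sqrt_pos.2 hμ₀
  have h1 : 0 ≤ (Real.sqrt μ₀)⁻¹ * (N * P) := by positivity
  have h2 : 0 ≤ 2 * Real.sqrt μ₁ * (N * P) := by positivity
  have h4 : 0 ≤ μ₁ * Q := by positivity
  have hfin : ∀ x k : ℝ, k ≤ (Real.sqrt μ₀)⁻¹ * (N * P) + 2 * Real.sqrt μ₁ * (N * P) + Q + μ₁ * Q →
      x ≤ k * D → x ≤ C := fun x k hk hx =>
    (hx.trans (mul_le_mul hk hDE hD (by positivity))).trans hC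
  refine ⟨hfin _ ((Real.sqrt μ₀)⁻¹ * (N * P)) (by linarith) ?_,
    hfin _ (2 * Real.sqrt μ₁ * (N * P)) (by linarith) ?_, hfin _ Q (by linarith) ?_,
    hfin _ (μ₁ * Q) (by linarith) ?_⟩
  · have h : a' - v = (Real.sqrt μ)⁻¹ • A := by
      rw [hA, smul_smul, inv_mul_cancel₀ hq.ne', one_smul]
    rw [h, norm_smul, Real.norm_of_nonneg (by positivity), mul_assoc, mul_assoc]
    gcongr
    exact hμ.1
  · have h : v' - (-(2 * Real.sqrt μ)) • G = (2 * Real.sqrt μ) • (B + G) := by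
      rw [hB, smul_add, smul_smul, mul_one_div_cancel (by positivity), one_smul, neg_smul,
        sub_neg_eq_add]
    rw [h, norm_smul, Real.norm_of_nonneg (by positivity), mul_assoc _ _ D, mul_assoc _ P D]
    gcongr
    exact hμ.2
  · refine (le_of_eq (congrArg _ ?_)).trans bΓ
    have h2 : (2 - N * s : ℝ) ≠ 0 := by linarith
    -- Dividing `f` by this quantity produces the coefficients `(2 - Ns + 2s')/(2 - Ns)` of `Veff`
    -- and `s/(2 - Ns)` of `Beff`.
    have hαe : α = (2 - N * s) / (2 * s) := by
      rw [hα]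
      field_simp
    rw [hΓ, hf, hαe, real_inner_comm]
    field_simp
    ring
  · have h : μ' = μ * M := by
      rw [hM, mul_div_cancel₀ _ hμ0.ne']
    rw [h, abs_mul, abs_of_pos hμ0, mul_assoc]
    gcongr
    exact hμ.2

/-- Positive upper and lower bounds of a bounded set with closure in the positive half-line. -/
lemma exists_pos_bounds {I : Set ℝ} (hIb : Bornology.IsBounded I) (hI : closure I ⊆ Ioi 0) :
    ∃ μ₀ μ₁ : ℝ, 0 < μ₀ ∧ 0 < μ₁ ∧ ∀ μ ∈ I, μ₀ ≤ μ ∧ μ ≤ μ₁ := by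
  have hc : IsCompact (closure I) := hIb.isCompact_closure
  rcases (closure I).eq_empty_or_nonempty with h | h
  · exact ⟨1, 1, one_pos, one_pos, fun μ hμ => by
      have := subset_closure hμ
      simp [h] at this⟩
  · obtain ⟨p, hp, hp'⟩ := hc.exists_isLeast h
    obtain ⟨q, hq, hq'⟩ := hc.exists_isGreatest h
    exact ⟨p, q, hI hp, hI hq, fun μ hμ => ⟨hp' (subset_closure hμ), hq' (subset_closure hμ)⟩⟩

end Modulation

/-! ### The modulation theorem. -/

theorem corollary3p2 (N : ℕ) (hN : 1 ≤ N) (s s' : ℝ) (hs : s ∈ Ioo 0 (2 / (N : ℝ)))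
    (hs'0 : 0 ≤ s') (hs'1 : 3 ≤ N → s' < 2 / ((N : ℝ) - 2))
    (lam : Space N → ℝ) (hlam : MemLp lam ⊤ volume)
    (η : Space N → ℝ) (hη : IsSolitonProfile s η)
    (I I₀ : Set ℝ) (hIb : Bornology.IsBounded I) (hIpos : closure I ⊆ Ioi 0)
    (hI₀ : I₀ ⊆ interior I) :
    (∀ ε μ : ℝ, 0 < μ →
      Differentiable ℝ (Veff s s' ε lam η μ) ∧ Differentiable ℝ (effField s' lam η μ)) ∧
    ∃ c ∈ Ioo (0 : ℝ) 1, ∃ C > (0 : ℝ), ∀ ε ∈ Ico (0 : ℝ) 1, ∀ T > (0 : ℝ), ∀ δ > (0 : ℝ),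
      ∀ ψ : ℝ → H1 N, IsNLSSolution s s' ε lam T ψ →
      (∀ t ∈ Icc 0 T, ψ t ∈ tube s η I₀ δ) →
      ∀ (σ : ℝ → Param N) (w : ℝ → H1 N),
      (∀ t ∈ Icc 0 T, (σ t).μ ∈ I ∧ IsSkewDecomp s η (ψ t) (σ t) (w t)) →
      ∀ (a' v' : ℝ → Space N) (γ' μ' : ℝ → ℝ),
      (∀ t ∈ Icc 0 T,
        HasDerivWithinAt (fun τ => (σ τ).a) (a' t) (Icc 0 T) t ∧
        HasDerivWithinAt (fun τ => (σ τ).v) (v' t) (Icc 0 T) t ∧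
        HasDerivWithinAt (fun τ => (σ τ).γ) (γ' t) (Icc 0 T) t ∧
        HasDerivWithinAt (fun τ => (σ τ).μ) (μ' t) (Icc 0 T) t) →
      ∀ t ∈ Icc 0 T, ‖w t‖ < c →
        ‖a' t - (σ t).v‖ ≤ C * (ε * ‖w t‖ + ‖w t‖ ^ 2) ∧
        ‖v' t - (-(2 * Real.sqrt (σ t).μ)) •
            gradient (Veff s s' ε lam η (σ t).μ) (Real.sqrt (σ t).μ • (σ t).a)‖
          ≤ C * (ε * ‖w t‖ + ‖w t‖ ^ 2) ∧
        |γ' t - ((σ t).μ + inner ℝ (a' t) (σ t).v / 2 - ‖(σ t).v‖ ^ 2 / 4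
            - (2 - N * s + 2 * s') / (2 - N * s)
              * Veff s s' ε lam η (σ t).μ (Real.sqrt (σ t).μ • (σ t).a)
            + s / (2 - N * s)
              * Beff s s' ε lam η (σ t).μ (Real.sqrt (σ t).μ • (σ t).a))|
          ≤ C * (ε * ‖w t‖ + ‖w t‖ ^ 2) ∧
        |μ' t| ≤ C * (ε * ‖w t‖ + ‖w t‖ ^ 2) := by
  have hη' := hη.decayProfile hN hs.1
  have hs0 := hs.1
  refine ⟨fun ε μ hμ => ⟨fun b => (hη'.hasFDerivAt_Veff hs'0 hlam ε hμ b).differentiableAt,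
    fun b => (hη'.hasFDerivAt_effField hs'0 hlam hμ b).differentiableAt⟩, ?_⟩
  obtain ⟨μ₀, μ₁, hμ₀, hμ₁, hI⟩ := exists_pos_bounds hIb hIpos
  obtain ⟨C, hC, hest⟩ := hη'.exists_modulation_estimates hN hs.2 hs'0 hs'1 hlam hμ₁
  have hN0 : (0 : ℝ) < N := by exact_mod_cast hN
  have hsN : s * N < 2 := (lt_div_iff₀ hN0).1 hs.2
  have hm := hη'.mass_pos
  -- Mass subcriticality `s < 2/N` is what makes the gauge–scaling block invertible with positive
  -- entry.
  have hα0 : 0 < 1 / s - N / 2 := by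
    rw [sub_pos, div_lt_div_iff₀ two_pos hs0]
    linarith
  have hP : 0 ≤ C / profileMass η := by positivity
  have hQ : 0 ≤ C / (profileMass η * (1 / s - N / 2)) := by positivity
  obtain ⟨K, hK⟩ : ∃ K, K = 2 * N * (C / profileMass η)
    + 2 * (C / (profileMass η * (1 / s - N / 2))) := ⟨_, rfl⟩
  obtain ⟨S, hS⟩ : ∃ S, S = (Real.sqrt μ₀)⁻¹ * (N * (C / profileMass η))
    + 2 * Real.sqrt μ₁ * (N * (C / profileMass η)) + C / (profileMass η * (1 / s - N / 2))
    + μ₁ * (C / (profileMass η * (1 / s - N / 2))) := ⟨_, rfl⟩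
  have hK0 : 0 ≤ K := by rw [hK]; positivity
  have hS0 : 0 ≤ S := by rw [hS]; positivity
  -- Below this threshold `‖w‖ (2K + 1) ≤ 1`, the condition for absorption. The summand `1` in the
  -- second constant only ensures strict positivity.
  refine ⟨1 / (2 * K + 2), ⟨by positivity, (div_lt_one (by positivity)).2 (by linarith)⟩,
    S * (4 * K + 1) + 1, by positivity, ?_⟩
  intro ε hε T hT δ _ ψ hψ _ σ w hσ a' v' γ' μ' hder t ht hw
  have hw0 := norm_nonneg (w t)
  have hwK : ‖w t‖ * (2 * K + 1) ≤ 1 := by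
    have := (lt_div_iff₀ (by positivity)).1 hw
    linarith
  have hw1 : ‖w t‖ ≤ 1 := (le_mul_of_one_le_right hw0 (by linarith)).trans hwK
  obtain ⟨ha, hv, hγ, hμ'⟩ := hder t ht
  obtain ⟨e1, e2, e3, e4⟩ := hest ε hε T hT ψ hψ σ w
    (fun τ hτ => ⟨hμ₀.trans_le (hI _ (hσ τ hτ).1).1, (hI _ (hσ τ hτ).1).2⟩)
    (fun τ hτ => (hσ τ hτ).2) t ht (a' t) (v' t) (γ' t) (μ' t) ha hv hγ hμ' hw1 _ _ _ _ _ _ _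
    rfl rfl rfl rfl rfl rfl rfl
  obtain ⟨bA, bB, bΓ, bM, hDE⟩ := modulation_bounds hm hα0 hC hw0 hε.1 rfl e1 e2 e3 e4 hK hwK
  have hE : 0 ≤ ε * ‖w t‖ + ‖w t‖ ^ 2 := add_nonneg (mul_nonneg hε.1 hw0) (sq_nonneg _)
  have hD : ∀ X : ℝ, 0 ≤ X → 0 ≤ X * ‖w t‖ + ‖w t‖ ^ 2 + ε * ‖w t‖ := fun X hX =>
    add_nonneg (add_nonneg (mul_nonneg hX hw0) (sq_nonneg _)) (mul_nonneg hε.1 hw0)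
  refine modulation_equations hs0 hsN hμ₀ (hI _ (hσ t ht).1) hP hQ (hD _ (by positivity)) hDE rfl
    rfl rfl rfl rfl rfl bA bB bΓ bM ?_
  rw [← hS]
  linarith
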